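/- **Conventions.** Let $V=\mathbb R^{1,3}$ be Minkowski space with basis $e_0,\dots,e_3$, coordinates $x^\mu$ and $\square=\partial_0^2-\partial_1^2-\partial_2^2-\partial_3^2$. The spinor module $S^*=\{(s,\bar s)\}\subset S_+^*\oplus S_-^*$, $S_+^*=\mathbb C^2$, carries the standard action of $SL(2,\mathbb C)$ (and $S_-^*$ the conjugate one); $SL(2,\mathbb{C})$ acts on $V$ so that the symmetric real bilinear map $\Gamma(s,t)=2\,\mathrm{Re}(\Gamma^{ab}s_a\bar t_b)$, with $\Gamma^{11}=e_0+e_1$, $\Gamma^{12}=e_2-ie_3$, $\Gamma^{21}=e_2+ie_3$, $\Gamma^{22}=e_0-e_1$, is equivariant. Put $\varepsilon^{12}=\varepsilon_{12}=1=-\varepsilon^{21}=-\varepsilon_{21}$ and $\Gamma^\mu_{ab}=\varepsilon_{ac}\varepsilon_{bd}(\Gamma^{cd})^\mu$. The super Poincaré group has underlying group $V\rtimes SL(2,\mathbb C)$ and odd part $S^*$ of its Lie superalgebra, with $[s,t]=-2\Gamma(s,t)\in V$. A unitary representation of it is a super Hilbert space with a strongly continuous even unitary representation $\rho$ of $V\rtimes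 SL(2,\mathbb C)$ and odd operators $\eta(s)$, $s\in S^*$, on the space of $\rho$-smooth vectors, real-linear in $s$, such that $e^{-i\pi/4}\eta(s)$ is symmetric, $\eta$ is $SL(2,\mathbb C)$-equivariant and translation-invariant, and $\eta(s)\eta(t)+\eta(t)\eta(s)=d\rho([s,t])$. Superfunctions are the elements of $C^\infty(V,\bigwedge S_{\mathbb C}^*)$, $S^*_{\mathbb C}=S_+^*\oplus S_-^*$, with generators $\theta^a,\bar\theta^a$ ($a=1,2$); $f\mapsto\bar f$ is the antilinear algebra automorphism which conjugates functions on $V$ and exchanges $\theta^a$ and $\bar\theta^a$. Put $$D_a=\partial_{\theta^a}-\Gamma^\mu_{ab}\bar\theta^b\partial_\mu,\quad \overline D_b=\partial_{\bar\theta^b}-\Gamma^\mu_{ab}\theta^a\partial_\mu,\quad Q_a=\partial_{\theta^a}+\Gamma^\mu_{ab}\bar\theta^b\partial_\mu,\quad \overline Q_b=\partial_{\bar\theta^b}+\Gamma^\mu_{ab}\theta^a\partial_\mu,\quad D^2=\tfrac14\varepsilon^{ab}D_aD_b .$$ The super Poincaré group acts on superfunctions by $((v,A)f)(x)=A\,f(A^{-1}(x-v))$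 and by $s\mapsto z^aQ_a+\bar z^a\overline Q_a$, $z^a=\varepsilon^{ab}s_b$. For $m>0$ let $\mathcal O_m=\{p\in V^*: p^2=m^2,\ p_0>0\}$ with its invariant measure $d\beta(p)=d^3p/(2p_0)$. The representation $\mathcal H_{(m,0)}$ of mass $m$ and superspin $0$ is the induced representation on the Hilbert space of square-integrable $w:\mathcal O_m\to\bigwedge S_+^*$, $w=a+\chi_c\tau^c+b\,\tau^1\tau^2$, with fibre norm $|a|^2+p(\Gamma(\chi,\chi))+4m^2|b|^2$, grading that of $\bigwedge S_+^*$, and $$(\rho(v,A)w)(p)=e^{-ip(v)}\,A\,w(A^{-1}p),\qquad (\eta(s)w)(p)= i\,s\wedge w(p)+2\,p(\Gamma^{cd})\,\bar s_d\,\partial_{\tau^c}w(p).$$ **Theorem.** Let $m>0$ and let $E_m\subset C^\infty(V,\bigwedge S^*_{\mathbb C})$ be the set of superfunctions $f$ satisfying $$\overline D_1f=0,\qquad \overline D_2f=0,\qquad D^2f=-m\bar f .$$ 1. $E_m$ is a graded real-linear subspace, invariant under the super Poincaré group. 2. In components $f=\varphi+e^{i\pi/4}\psi_a\theta^a+(\text{other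 monomials})$, the map $f\mapsto(\varphi,\psi)$ is a bijection of $E_m$ onto the set of pairs $(\varphi,\psi)\in C^\infty(V,\mathbb C)\times C^\infty(V,S_+^*)$ of ordinary (commuting) fields with $$(\square+m^2)\varphi=0,\qquad i\,\Gamma^\mu_{ab}\partial_\mu\bar\psi^b+m\psi_a=0\qquad(\bar\psi^b=\varepsilon^{bc}\overline{\psi_c}).$$ 3. $\mathcal H_{(m,0)}$ exists, is an irreducible unitary representation of the super Poincaré group, and is realized in $E_m$: there is an injective real-linear map $T$ from its space of smooth vectors into the superfunctions, preserving parity and equivariant for $V\rtimes SL(2,\mathbb C)$ and for $S^*$, whose image is the set of those $f\in E_m$ which, together with all their derivatives, decrease rapidly in space, locally uniformly in time. It is a super Fourier transform: $T(w)=u-m^{-1}\,\overline{D^2u}$, where $u$ is the superfunction with $\overline D_1u=\overline D_2u=0$ whose components along $1,\ \theta^a,\ \theta^1\theta^2$ at $x$ are $$\int_{\mathcal O_m}e^{ip(x)}b(p)\,d\beta(p),\qquad -i\int_{\mathcal O_m}e^{ip(x)}\chi_a(p)\,d\beta(p),\qquad \int_{\mathcal O_m}e^{ip(x)}a(p)\,d\beta(p).$$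 -/

import Mathlib

open scoped ContDiff

noncomputable section

namespace SuperPoincare

/-! ### Minkowski spacetime, spinors and the Poincare group -/

/-- Minkowski spacetime with an origin chosen, i.e. the Lorentzian vector space `V` of
signature `(1,3)`; `v μ` is the coordinate along `e_μ`. -/
abbrev Spacetime : Type := Fin 4 → ℝ

/-- The dual space of `Spacetime`; the pairing of `p` with `x` is `p ⬝ᵥ x`. -/
abbrev Covector : Type := Fin 4 → ℝ

/-- The basis vector `e_μ`. -/
def basisVec (μ : Fin 4) : Spacetime := Pi.single μ 1

/-- `SL(2,ℂ)`, the spin group of `Spacetime`. -/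
abbrev SL2 : Type := Matrix.SpecialLinearGroup (Fin 2) ℂ

/-- The real spinor module `S^*`. Its elements are the pairs `(s, conj s)` in
`S_+^* ⊕ S_-^*`, and are recorded by `s` in `S_+^* = ℂ²`. The group `SL(2,ℂ)` acts on `S_+^*` by
the standard representation, and on `S_-^*` by the conjugate one. -/
abbrev Spinor : Type := Fin 2 → ℂ

/-- The invariant symplectic form, `ε 0 1 = 1`. -/
def eps (a b : Fin 2) : ℂ := !![0, 1; -1, 0] a b

/-- The components of `Γ^{ab} = Γ_ℂ(f^a, conj f^b)`:
`Γ^{11} = e_0 + e_1`, `Γ^{12} = e_2 - i e_3`, `Γ^{21} = e_2 + i e_3`, `Γ^{22} = e_0 - e_1`. -/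
def gammaUp (μ : Fin 4) : Matrix (Fin 2) (Fin 2) ℂ :=
  ![!![1, 0; 0, 1], !![1, 0; 0, -1], !![0, 1; 1, 0], !![0, -Complex.I; Complex.I, 0]] μ

/-- `Γ_{ab}`, obtained from `Γ^{ab}` by lowering both spinor indices with `eps`. -/
def gammaLow (μ : Fin 4) (a b : Fin 2) : ℂ :=
  ∑ c, ∑ d, eps a c * eps b d * gammaUp μ c d

/-- The symmetric real bilinear map `Γ : S^* × S^* → V`. -/
def gamma (s t : Spinor) : Spacetime := fun μ =>
  2 * (∑ a, ∑ b, gammaUp μ a b * s a * starRingEnd ℂ (t b)).re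

/-- The identification of `Spacetime` with the Hermitian matrices for which `Γ(s, s)`
corresponds to `4 s s†`. -/
def toHerm (v : Spacetime) : Matrix (Fin 2) (Fin 2) ℂ :=
  !![(v 0 : ℂ) + v 1, (v 2 : ℂ) + Complex.I * v 3; (v 2 : ℂ) - Complex.I * v 3, (v 0 : ℂ) - v 1]

/-- The inverse of `toHerm` on Hermitian matrices. -/
def ofHerm (N : Matrix (Fin 2) (Fin 2) ℂ) : Spacetime :=
  ![((N 0 0).re + (N 1 1).re) / 2, ((N 0 0).re - (N 1 1).re) / 2, (N 0 1).re, (N 0 1).im]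

/-- The Lorentz transformation of `Spacetime` defined by an element of `SL(2,ℂ)`. -/
def lorentz (A : SL2) (v : Spacetime) : Spacetime :=
  ofHerm ((A : Matrix (Fin 2) (Fin 2) ℂ) * toHerm v * (A : Matrix (Fin 2) (Fin 2) ℂ).conjTranspose)

theorem ofHerm_toHerm (v : Spacetime) : ofHerm (toHerm v) = v := by
  ext i; fin_cases i <;> simp [ofHerm, toHerm]

theorem toHerm_ofHerm {N : Matrix (Fin 2) (Fin 2) ℂ} (h : N.conjTranspose = N) :
    toHerm (ofHerm N) = N := by
  have h00 := congrFun (congrFun h 0) 0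
  have h01 := congrFun (congrFun h 1) 0
  have h11 := congrFun (congrFun h 1) 1
  simp only [Matrix.conjTranspose_apply, Complex.ext_iff, Complex.star_def, Complex.conj_re,
    Complex.conj_im] at h00 h01 h11
  ext i j
  fin_cases i <;> fin_cases j <;> apply Complex.ext <;> simp [ofHerm, toHerm] <;> linarith

theorem toHerm_conjTranspose (v : Spacetime) : (toHerm v).conjTranspose = toHerm v := by
  ext i j
  fin_cases i <;> fin_cases j <;> apply Complex.ext <;> simp [toHerm]

theorem toHerm_lorentz (A : SL2) (v : Spacetime) :
    toHerm (lorentz A v) = (A : Matrix (Fin 2) (Fin 2) ℂ) * toHerm v *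
      (A : Matrix (Fin 2) (Fin 2) ℂ).conjTranspose := by
  apply toHerm_ofHerm
  simp [Matrix.conjTranspose_mul, toHerm_conjTranspose, Matrix.mul_assoc]

theorem lorentz_mul (A B : SL2) (v : Spacetime) :
    lorentz (A * B) v = lorentz A (lorentz B v) := by
  conv_rhs => rw [lorentz, toHerm_lorentz]
  simp [lorentz, Matrix.conjTranspose_mul, Matrix.mul_assoc]

theorem lorentz_one (v : Spacetime) : lorentz 1 v = v := by
  simp [lorentz, ofHerm_toHerm]

theorem lorentz_add (A : SL2) (v w : Spacetime) :
    lorentz A (v + w) = lorentz A v + lorentz A w := by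
  have h : toHerm (v + w) = toHerm v + toHerm w := by
    ext i j; fin_cases i <;> fin_cases j <;> simp [toHerm] <;> ring
  rw [lorentz, h, Matrix.mul_add, Matrix.add_mul]
  ext i; fin_cases i <;> simp [lorentz, ofHerm] <;> ring

theorem lorentz_zero (A : SL2) : lorentz A 0 = 0 := by
  simpa using lorentz_add A 0 0

/-- The Poincare group `V ⋊ SL(2,ℂ)`; its elements act on spacetime by
`x ↦ lorentz lin x + trans`. -/
@[ext] structure Poincare where
  trans : Spacetime
  lin : SL2

instance : Mul Poincare := ⟨fun g h => ⟨g.trans + lorentz g.lin h.trans, g.lin * h.lin⟩⟩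

instance : One Poincare := ⟨⟨0, 1⟩⟩

instance : Inv Poincare := ⟨fun g => ⟨lorentz g.lin⁻¹ (-g.trans), g.lin⁻¹⟩⟩

instance : Group Poincare :=
  Group.ofLeftAxioms
    (fun g h k => by
      apply Poincare.ext
      · change (g.trans + lorentz g.lin h.trans) + lorentz (g.lin * h.lin) k.trans =
          g.trans + lorentz g.lin (h.trans + lorentz h.lin k.trans)
        rw [lorentz_add, lorentz_mul, add_assoc]
      · exact mul_assoc g.lin h.lin k.lin)
    (fun g => by
      apply Poincare.ext
      · change (0 : Spacetime) + lorentz 1 g.trans = g.trans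
        rw [lorentz_one, zero_add]
      · exact one_mul g.lin)
    (fun g => by
      apply Poincare.ext
      · change lorentz g.lin⁻¹ (-g.trans) + lorentz g.lin⁻¹ g.trans = 0
        rw [← lorentz_add, neg_add_cancel, lorentz_zero]
      · exact inv_mul_cancel g.lin)

/-! ### The exterior algebras of `S_+^*` and of `S_+^* ⊕ S_-^*` -/

/-- `⋀ S_+^*`: the value at `I` is the coefficient of the ordered monomial `τ^I`. -/
abbrev Fock : Type := Finset (Fin 2) → ℂ

/-- `⋀ S_ℂ^* = ⋀ S_+^* ⊗ ⋀ S_-^*`: the value at `(I, J)` is the coefficient of the ordered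
monomial `θ^I θbar^J`. -/
abbrev Fock2 : Type := Finset (Fin 2) × Finset (Fin 2) → ℂ

/-- The sign `(-1)^k`, with `k` the number of elements of `I` before `a`. -/
def koszul (a : Fin 2) (I : Finset (Fin 2)) : ℂ := (-1) ^ (I.filter (· < a)).card

/-- Left exterior multiplication by `τ^a`. -/
def ext (a : Fin 2) (w : Fock) : Fock := fun I =>
  if a ∈ I then koszul a I * w (I.erase a) else 0

/-- The left derivative `∂/∂τ^a`. -/
def contr (a : Fin 2) (w : Fock) : Fock := fun I =>
  if a ∈ I then 0 else koszul a I * w (insert a I)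

/-- The matrix coefficients of the algebra endomorphism of `⋀ ℂ²` which extends a `2 × 2` matrix
(the minors of the matrix). -/
def minor (A : Matrix (Fin 2) (Fin 2) ℂ) (I J : Finset (Fin 2)) : ℂ :=
  if h : I.card = J.card then
    (A.submatrix (I.orderEmbOfFin rfl) (J.orderEmbOfFin h.symm)).det
  else 0

/-- The action of `SL(2,ℂ)` on `⋀ S_+^*`. -/
def spinFock (A : SL2) (w : Fock) : Fock := fun I =>
  ∑ J, minor (A : Matrix (Fin 2) (Fin 2) ℂ) I J * w J

/-- The action of `SL(2,ℂ)` on `⋀ S_+^* ⊗ ⋀ S_-^*`. -/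
def spinFock2 (A : SL2) (w : Fock2) : Fock2 := fun I =>
  ∑ J : Finset (Fin 2) × Finset (Fin 2),
    minor (A : Matrix (Fin 2) (Fin 2) ℂ) I.1 J.1 *
      starRingEnd ℂ (minor (A : Matrix (Fin 2) (Fin 2) ℂ) I.2 J.2) * w J

/-! ### Superfunctions on Minkowski superspacetime and their differential operators -/

/-- Functions on spacetime with values in `⋀ S_ℂ^*`. The superfunctions are the smooth ones. -/
abbrev Superfield : Type := Spacetime → Fock2

/-- `f` belongs to `C^∞(M, ⋀ S_ℂ^*)`. -/
def IsSuperfunction (f : Superfield) : Prop := ContDiff ℝ ∞ f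

/-- `∂/∂x^μ`, applied to functions with values in a normed space. -/
def partialX {F : Type} [NormedAddCommGroup F] [NormedSpace ℝ F] (μ : Fin 4)
    (f : Spacetime → F) : Spacetime → F := fun x => fderiv ℝ f x (basisVec μ)

/-- Left multiplication by `θ^a`. -/
def mulTheta (a : Fin 2) (f : Superfield) : Superfield := fun x I =>
  if a ∈ I.1 then koszul a I.1 * f x (I.1.erase a, I.2) else 0

/-- Left multiplication by `θbar^a`. -/
def mulThetaBar (a : Fin 2) (f : Superfield) : Superfield := fun x I =>
  if a ∈ I.2 then (-1) ^ I.1.card * koszul a I.2 * f x (I.1, I.2.erase a) else 0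

/-- The left derivative `∂/∂θ^a`. -/
def partialTheta (a : Fin 2) (f : Superfield) : Superfield := fun x I =>
  if a ∈ I.1 then 0 else koszul a I.1 * f x (insert a I.1, I.2)

/-- The left derivative `∂/∂θbar^a`. -/
def partialThetaBar (a : Fin 2) (f : Superfield) : Superfield := fun x I =>
  if a ∈ I.2 then 0 else (-1) ^ I.1.card * koszul a I.2 * f x (I.1, insert a I.2)

/-- `Γ_{ab}^μ ∂/∂x^μ`. -/
def gammaPartial (a b : Fin 2) (f : Superfield) : Superfield :=
  ∑ μ, gammaLow μ a b • partialX μ f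

/-- `Q_a = ∂/∂θ^a + Γ_{ab}^μ θbar^b ∂_μ`. -/
def Q (a : Fin 2) (f : Superfield) : Superfield :=
  partialTheta a f + ∑ b, mulThetaBar b (gammaPartial a b f)

/-- `Qbar_b = ∂/∂θbar^b + Γ_{ab}^μ θ^a ∂_μ`. -/
def QBar (b : Fin 2) (f : Superfield) : Superfield :=
  partialThetaBar b f + ∑ a, mulTheta a (gammaPartial a b f)

/-- `D_a = ∂/∂θ^a - Γ_{ab}^μ θbar^b ∂_μ`. -/
def D (a : Fin 2) (f : Superfield) : Superfield :=
  partialTheta a f - ∑ b, mulThetaBar b (gammaPartial a b f)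

/-- `Dbar_b = ∂/∂θbar^b - Γ_{ab}^μ θ^a ∂_μ`. -/
def DBar (b : Fin 2) (f : Superfield) : Superfield :=
  partialThetaBar b f - ∑ a, mulTheta a (gammaPartial a b f)

/-- `D² = (1/4) ε^{ab} D_a D_b`. -/
def DSq (f : Superfield) : Superfield :=
  (1 / 4 : ℂ) • ∑ a, ∑ b, eps a b • D a (D b f)

/-- The conjugation of superfunctions: the antilinear algebra automorphism which conjugates
functions on spacetime and exchanges `θ^a` with `θbar^a`. The sign reorders
`θbar^J θ^I` into `θ^I θbar^J`. -/
def conjS (f : Superfield) : Superfield := fun x I =>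
  (-1) ^ (I.1.card * I.2.card) * starRingEnd ℂ (f x (I.2, I.1))

/-- The parity automorphism of superfunctions: `+1` on even and `-1` on odd ones. -/
def parityS (f : Superfield) : Superfield := fun x I =>
  (-1) ^ (I.1.card + I.2.card) * f x I

/-- The action of the Poincare group on superfunctions. -/
def act (g : Poincare) (f : Superfield) : Superfield := fun x =>
  spinFock2 g.lin (f (lorentz g.lin⁻¹ (x - g.trans)))

/-- The action of `s` in `S^*` on superfunctions: the odd vector field
`z^a Q_a + conj(z^a) Qbar_a`, where `z^a = ε^{ab} s_b`. -/
def superAct (s : Spinor) (f : Superfield) : Superfield :=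
  ∑ a, ((∑ b, eps a b * s b) • Q a f + starRingEnd ℂ (∑ b, eps a b * s b) • QBar a f)

/-- The superfunctions with `Dbar_1 f = Dbar_2 f = 0` and `D² f = -m conj f`. -/
def solutions (m : ℝ) : Set Superfield :=
  {f | IsSuperfunction f ∧ DBar 0 f = 0 ∧ DBar 1 f = 0 ∧ DSq f = -(m : ℂ) • conjS f}

/-- `f` and all its derivatives decrease rapidly in space, locally uniformly in time. -/
def RapidlyDecreasing (f : Superfield) : Prop :=
  ∀ (k n : ℕ) (r : ℝ), ∃ C : ℝ, ∀ x : Spacetime, |x 0| ≤ r →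
    ‖x‖ ^ k * ‖iteratedFDeriv ℝ n f x‖ ≤ C

/-! ### Ordinary component fields -/

/-- The wave operator of signature `(1,3)`. -/
def box (φ : Spacetime → ℂ) : Spacetime → ℂ :=
  partialX 0 (partialX 0 φ) - partialX 1 (partialX 1 φ) - partialX 2 (partialX 2 φ)
    - partialX 3 (partialX 3 φ)

/-- `ψbar^b = ε^{bc} conj(ψ_c)`. -/
def spinorBarUp (ψ : Spacetime → Spinor) (b : Fin 2) : Spacetime → ℂ := fun x =>
  ∑ c, eps b c * starRingEnd ℂ (ψ x c)

/-- The pairs `(φ, ψ)` of smooth fields which satisfy the Klein-Gordon and Dirac equations. -/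
def componentSolutions (m : ℝ) : Set ((Spacetime → ℂ) × (Spacetime → Spinor)) :=
  {P | ContDiff ℝ ∞ P.1 ∧ ContDiff ℝ ∞ P.2 ∧
    (∀ x, box P.1 x + (m : ℂ) ^ 2 * P.1 x = 0) ∧
    ∀ x a, Complex.I * (∑ b, ∑ μ, gammaLow μ a b * partialX μ (spinorBarUp P.2 b) x)
      + (m : ℂ) * P.2 x a = 0}

/-- The component fields `(φ, ψ)` of a superfunction
`f = φ + exp(iπ/4) ψ_a θ^a + (other monomials)`. -/
def components (f : Superfield) : (Spacetime → ℂ) × (Spacetime → Spinor) :=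
  (fun x => f x (∅, ∅),
    fun x a => Complex.exp (-(Complex.I * (Real.pi / 4 : ℝ))) * f x ({a}, ∅))

/-! ### Unitary representations of the super Poincare group -/

/-- Elements of `SL(2,ℂ)` in the local coordinates `w` around the identity (at `w = 0`). -/
def slChart (w : Fin 3 → ℂ) : SL2 :=
  ⟨!![Complex.exp (w 0), w 1; w 2, Complex.exp (-(w 0)) * (1 + w 1 * w 2)], by
    have h : Complex.exp (w 0) * Complex.exp (-(w 0)) = 1 := by
      rw [← Complex.exp_add, add_neg_cancel, Complex.exp_zero]
    rw [Matrix.det_fin_two_of, ← mul_assoc, h]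
    ring⟩

section Representations

variable {H : Type*} [NormedAddCommGroup H] [InnerProductSpace ℂ H]

/-- The smooth vectors of a unitary representation of the Poincare group. The map
`(v, w) ↦ (v, slChart w)` is a local diffeomorphism around the origin, and smoothness of
`g ↦ ρ g Ψ` near the identity is equivalent to its smoothness everywhere. -/
def smoothVectors (ρ : Poincare →* (H ≃ₗᵢ[ℂ] H)) : Submodule ℂ H where
  carrier := {Ψ | ContDiff ℝ ∞ (fun y : Spacetime × (Fin 3 → ℂ) => ρ ⟨y.1, slChart y.2⟩ Ψ)}
  add_mem' := fun {a b} ha hb => by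
    simp only [Set.mem_ofPred_eq, map_add] at ha hb ⊢
    exact ha.add hb
  zero_mem' := by
    simp only [Set.mem_ofPred_eq, map_zero]
    exact contDiff_const
  smul_mem' := fun c a ha => by
    simp only [Set.mem_ofPred_eq, map_smul] at ha ⊢
    exact ha.const_smul c

/-- The action of a translation `v` of the Lie algebra on a (smooth) vector. -/
def translationDeriv (ρ : Poincare →* (H ≃ₗᵢ[ℂ] H)) (v : Spacetime) (Ψ : H) : H :=
  deriv (fun t : ℝ => ρ ⟨t • v, 1⟩ Ψ) 0

/-- The Lie superalgebra bracket of `S^*` with itself: `[s, t] = -2 Γ(s, t)`. -/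
def bracket (s t : Spinor) : Spacetime := -(2 : ℝ) • gamma s t

variable (H) in
/-- A unitary representation of the super Poincare group `(V ⋊ SL(2,ℂ), (spin(V) ⊕ V) ⊕ S^*)` on a
super Hilbert space. The grading of `H` is given by `parity`, and `charge s`
is the odd symmetric operator `exp(-iπ/4) η(s)` on smooth vectors. -/
structure SuperUnitaryRep where
  parity : H ≃ₗᵢ[ℂ] H
  parity_parity : ∀ Ψ, parity (parity Ψ) = Ψ
  ρ : Poincare →* (H ≃ₗᵢ[ℂ] H)
  continuous_ρ : ∀ Ψ, Continuous (fun y : Spacetime × SL2 => ρ ⟨y.1, y.2⟩ Ψ)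
  even_ρ : ∀ g Ψ, ρ g (parity Ψ) = parity (ρ g Ψ)
  charge : Spinor →ₗ[ℝ] (smoothVectors ρ →ₗ[ℂ] smoothVectors ρ)
  odd_charge : ∀ (s : Spinor) (Ψ Ω : smoothVectors ρ), (Ω : H) = parity Ψ →
    (charge s Ω : H) = -parity (charge s Ψ)
  symm_charge : ∀ (s : Spinor) (Ψ Ω : smoothVectors ρ),
    inner ℂ (charge s Ψ : H) (Ω : H) = inner ℂ (Ψ : H) (charge s Ω : H)
  anticomm_charge : ∀ (s t : Spinor) (Ψ : smoothVectors ρ),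
    (charge s (charge t Ψ) : H) + charge t (charge s Ψ) =
      -Complex.I • translationDeriv ρ (bracket s t) Ψ
  equivariant_charge : ∀ (g : Poincare) (s : Spinor) (Ψ Ω : smoothVectors ρ), (Ω : H) = ρ g Ψ →
    (charge ((g.lin : Matrix (Fin 2) (Fin 2) ℂ).mulVec s) Ω : H) = ρ g (charge s Ψ)

/-- The representation is nonzero and has no proper nonzero closed graded invariant subspace. -/
def SuperUnitaryRep.IsIrreducible (R : SuperUnitaryRep H) : Prop :=
  Nontrivial H ∧ ∀ K : Submodule ℂ H, IsClosed (K : Set H) →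
    (∀ Ψ ∈ K, R.parity Ψ ∈ K) → (∀ g, ∀ Ψ ∈ K, R.ρ g Ψ ∈ K) →
    (∀ s, ∀ Ψ : smoothVectors R.ρ, (Ψ : H) ∈ K → (R.charge s Ψ : H) ∈ K) →
    K = ⊥ ∨ K = ⊤

/-! ### The representation of mass `m` and superspin `0` -/

/-- The `SL(2,ℂ)`-invariant measure of the orbit `p² = m²`, `p_0 > 0`, as a measure on the dual of
spacetime: the image of `dk / (2 √(m² + |k|²))` under `k ↦ (√(m² + |k|²), k)`. -/
def massShell (m : ℝ) : MeasureTheory.Measure Covector :=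
  MeasureTheory.Measure.map
    (fun k : Fin 3 → ℝ => ![√(m ^ 2 + ∑ i, k i ^ 2), k 0, k 1, k 2])
    (MeasureTheory.volume.withDensity
      (fun k : Fin 3 → ℝ => ENNReal.ofReal (1 / (2 * √(m ^ 2 + ∑ i, k i ^ 2)))))

/-- The covector `A⁻¹ p = p ∘ lorentz A`. -/
def pullback (A : SL2) (p : Covector) : Covector := fun μ => p ⬝ᵥ lorentz A (basisVec μ)

/-- The squared norm of `w = a + χ_a τ^a + b τ^1 τ^2` in the fibre `⋀ S_+^*` over `p`:
`|a|² + p(Γ(χ, χ)) + 4 m² |b|²`. -/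
def fibreNormSq (m : ℝ) (p : Covector) (w : Fock) : ℝ :=
  ‖w ∅‖ ^ 2 + p ⬝ᵥ gamma (fun a => w {a}) (fun a => w {a}) + 4 * m ^ 2 * ‖w Finset.univ‖ ^ 2

/-- The Clifford action `η(s)` of `S^*` on the fibre `⋀ S_+^*` over `p`: `s_+ = s` creates, while
`s_- = conj s` annihilates through the pairing `p(Γ_ℂ(τ^c, s_-))`. The square of this operator
is `i p(Γ(s, s))`. -/
def clifford (p : Covector) (s : Spinor) (w : Fock) : Fock :=
  Complex.I • (∑ a, s a • ext a w) +
    (2 : ℂ) • ∑ c, (∑ d, ∑ μ, (p μ : ℂ) * gammaUp μ c d * starRingEnd ℂ (s d)) • contr c w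

/-- `R` is the representation of mass `m` and superspin `0`, i.e. the one induced from the
representation `⋀ S_+^*` of the stabilizer of a point of the orbit `p² = m²`, `p_0 > 0`:
`Φ` identifies the Hilbert space with the square-integrable sections, read in
the `SL(2,ℂ)`-equivariant trivialization of the Hermitian bundle over the orbit with fibre
`⋀ S_+^*`. -/
structure IsInduced (m : ℝ) (R : SuperUnitaryRep H)
    (Φ : H →ₗ[ℂ] MeasureTheory.AEEqFun Covector Fock (massShell m)) : Prop where
  norm_sq : ∀ Ψ, ENNReal.ofReal (‖Ψ‖ ^ 2) =
    ∫⁻ p, ENNReal.ofReal (fibreNormSq m p (Φ Ψ p)) ∂(massShell m)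
  surj : ∀ w : MeasureTheory.AEEqFun Covector Fock (massShell m),
    ∫⁻ p, ENNReal.ofReal (fibreNormSq m p (w p)) ∂(massShell m) < ⊤ → ∃ Ψ, Φ Ψ = w
  parity : ∀ Ψ, ∀ᵐ p ∂(massShell m), ∀ I, Φ (R.parity Ψ) p I = (-1) ^ I.card * Φ Ψ p I
  poincare : ∀ (g : Poincare) (Ψ : H), ∀ᵐ p ∂(massShell m),
    Φ (R.ρ g Ψ) p = Complex.exp (-(Complex.I * (p ⬝ᵥ g.trans : ℝ))) •
      spinFock g.lin (Φ Ψ (pullback g.lin p))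
  charge : ∀ (s : Spinor) (Ψ : smoothVectors R.ρ), ∀ᵐ p ∂(massShell m),
    Complex.exp (Complex.I * (Real.pi / 4 : ℝ)) • Φ (R.charge s Ψ) p = clifford p s (Φ Ψ p)

/-- `f` is obtained from the momentum space wave function `w` by Fourier transform:
`f = u - m⁻¹ conj(D² u)`, where `u` is the chiral superfunction whose components along
`1`, `θ^a`, `θ^1 θ^2` are the Fourier integrals of the purely odd Fourier transform (Hodge dual)
of `w`. -/
def IsFourierTransform (m : ℝ) (w : Covector → Fock) (f : Superfield) : Prop :=
  MeasureTheory.Integrable w (massShell m) ∧ ∃ u : Superfield,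
    IsSuperfunction u ∧ DBar 0 u = 0 ∧ DBar 1 u = 0 ∧
    (∀ x, u x (∅, ∅) =
      ∫ p, Complex.exp (Complex.I * (p ⬝ᵥ x : ℝ)) * w p Finset.univ ∂(massShell m)) ∧
    (∀ x a, u x ({a}, ∅) =
      -Complex.I * ∫ p, Complex.exp (Complex.I * (p ⬝ᵥ x : ℝ)) * w p {a} ∂(massShell m)) ∧
    (∀ x, u x (Finset.univ, ∅) =
      ∫ p, Complex.exp (Complex.I * (p ⬝ᵥ x : ℝ)) * w p ∅ ∂(massShell m)) ∧
    f = u - (m : ℂ)⁻¹ • conjS (DSq u)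

end Representations

end SuperPoincare

end

open scoped ContDiff ComplexConjugate

noncomputable section

namespace SuperPoincare

/-! ### Partial derivatives -/

section PartialDerivatives

variable {F G : Type} [NormedAddCommGroup F] [NormedSpace ℝ F] [NormedAddCommGroup G]
  [NormedSpace ℝ G]

theorem contDiff_partialX {f : Spacetime → F} (hf : ContDiff ℝ ∞ f) (μ : Fin 4) :
    ContDiff ℝ ∞ (partialX μ f) := by
  unfold partialX
  exact (hf.fderiv_right (m := ∞) (by simp)).clm_apply contDiff_const

theorem partialX_add {f g : Spacetime → F} {x : Spacetime} (hf : DifferentiableAt ℝ f x)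
    (hg : DifferentiableAt ℝ g x) (μ : Fin 4) :
    partialX μ (fun y => f y + g y) x = partialX μ f x + partialX μ g x := by
  simp only [partialX]
  rw [fderiv_fun_add hf hg]; rfl

theorem partialX_clm (L : F →L[ℝ] G) {f : Spacetime → F} {x : Spacetime}
    (hf : DifferentiableAt ℝ f x) (μ : Fin 4) :
    partialX μ (fun y => L (f y)) x = L (partialX μ f x) := by
  simp only [partialX]
  have := (L.hasFDerivAt.comp x hf.hasFDerivAt).fderiv
  rw [show (fun y => L (f y)) = L ∘ f from rfl, this]; rfl

theorem partialX_linear [FiniteDimensional ℝ F] (L : F →ₗ[ℝ] G) {f : Spacetime → F}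
    {x : Spacetime} (hf : DifferentiableAt ℝ f x) (μ : Fin 4) :
    partialX μ (fun y => L (f y)) x = L (partialX μ f x) :=
  partialX_clm (LinearMap.toContinuousLinearMap L) hf μ

theorem partialX_comm {f : Spacetime → F} (hf : ContDiff ℝ ∞ f) (μ ν : Fin 4) (x : Spacetime) :
    partialX μ (partialX ν f) x = partialX ν (partialX μ f) x := by
  have h2 : ContDiffAt ℝ 2 f x := (contDiff_infty.1 hf 2).contDiffAt
  have hs := h2.isSymmSndFDerivAt (by simp)
  have hd : DifferentiableAt ℝ (fderiv ℝ f) x :=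
    ((hf.fderiv_right (m := ∞) (by simp)).differentiable (by simp)).differentiableAt
  have key : ∀ μ ν : Fin 4, partialX μ (partialX ν f) x =
      fderiv ℝ (fderiv ℝ f) x (basisVec μ) (basisVec ν) := by
    intro μ ν
    change fderiv ℝ (fun y => fderiv ℝ f y (basisVec ν)) x (basisVec μ) = _
    rw [fderiv_clm_apply hd (differentiableAt_const _)]
    simp
  rw [key, key]
  exact hs.eq _ _

theorem contDiff_linear_comp [FiniteDimensional ℝ F] (L : F →ₗ[ℝ] G) {f : Spacetime → F}
    (hf : ContDiff ℝ ∞ f) : ContDiff ℝ ∞ (fun y => L (f y)) :=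
  (LinearMap.toContinuousLinearMap L).contDiff.comp hf

theorem partialX_const_smul {f : Spacetime → ℂ} {x : Spacetime} (c : ℂ)
    (hf : DifferentiableAt ℝ f x) (μ : Fin 4) :
    partialX μ (fun y => c * f y) x = c * partialX μ f x := by
  simp only [partialX]
  rw [fderiv_const_mul hf]; rfl

theorem partialX_conj (f : Spacetime → ℂ) (μ : Fin 4) (x : Spacetime) :
    partialX μ (fun y => conj (f y)) x = conj (partialX μ f x) := by
  have h : (fun y => conj (f y)) = Complex.conjCLE ∘ f := rfl
  simp only [partialX]
  rw [h, Complex.conjCLE.comp_fderiv]; rfl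

theorem partialX_apply {ι : Type} [Fintype ι] {f : Spacetime → ι → ℂ} {x : Spacetime}
    (hf : DifferentiableAt ℝ f x) (μ : Fin 4) (i : ι) :
    partialX μ f x i = partialX μ (fun y => f y i) x := by
  simp only [partialX]
  rw [fderiv_apply hf]; rfl

end PartialDerivatives

/-! ### First order operators with constant coefficients -/

theorem finset_fin_two_cases (I : Finset (Fin 2)) :
    I = ∅ ∨ I = {0} ∨ I = {1} ∨ I = Finset.univ := by
  revert I; decide

/-- Left multiplication by `θ^a` on the fibre. -/
def thetaL (a : Fin 2) : Fock2 →ₗ[ℂ] Fock2 where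
  toFun w := fun I => if a ∈ I.1 then koszul a I.1 * w (I.1.erase a, I.2) else 0
  map_add' v w := by ext I; simp only [Pi.add_apply]; split_ifs <;> ring
  map_smul' c w := by
    ext I; simp only [Pi.smul_apply, smul_eq_mul, RingHom.id_apply]; split_ifs <;> ring

/-- Left multiplication by `θbar^a` on the fibre. -/
def thetaBarL (a : Fin 2) : Fock2 →ₗ[ℂ] Fock2 where
  toFun w := fun I => if a ∈ I.2 then (-1) ^ I.1.card * koszul a I.2 * w (I.1, I.2.erase a) else 0
  map_add' v w := by ext I; simp only [Pi.add_apply]; split_ifs <;> ring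
  map_smul' c w := by
    ext I; simp only [Pi.smul_apply, smul_eq_mul, RingHom.id_apply]; split_ifs <;> ring

/-- The left derivative `∂/∂θ^a` on the fibre. -/
def dThetaL (a : Fin 2) : Fock2 →ₗ[ℂ] Fock2 where
  toFun w := fun I => if a ∈ I.1 then 0 else koszul a I.1 * w (insert a I.1, I.2)
  map_add' v w := by ext I; simp only [Pi.add_apply]; split_ifs <;> ring
  map_smul' c w := by
    ext I; simp only [Pi.smul_apply, smul_eq_mul, RingHom.id_apply]; split_ifs <;> ring

/-- The left derivative `∂/∂θbar^a` on the fibre. -/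
def dThetaBarL (a : Fin 2) : Fock2 →ₗ[ℂ] Fock2 where
  toFun w := fun I =>
    if a ∈ I.2 then 0 else (-1) ^ I.1.card * koszul a I.2 * w (I.1, insert a I.2)
  map_add' v w := by ext I; simp only [Pi.add_apply]; split_ifs <;> ring
  map_smul' c w := by
    ext I; simp only [Pi.smul_apply, smul_eq_mul, RingHom.id_apply]; split_ifs <;> ring

/-- The operator `f ↦ M f + N^μ ∂_μ f`. -/
def fieldOp (M : Fock2 →ₗ[ℂ] Fock2) (N : Fin 4 → Fock2 →ₗ[ℂ] Fock2) (f : Superfield) :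
    Superfield := fun x => M (f x) + ∑ μ, N μ (partialX μ f x)

theorem partialX_linearC (L : Fock2 →ₗ[ℂ] Fock2) {f : Superfield} {x : Spacetime}
    (hf : DifferentiableAt ℝ f x) (μ : Fin 4) :
    partialX μ (fun y => L (f y)) x = L (partialX μ f x) :=
  partialX_linear (L.restrictScalars ℝ) hf μ

theorem contDiff_linearC (L : Fock2 →ₗ[ℂ] Fock2) {f : Superfield}
    (hf : ContDiff ℝ ∞ f) : ContDiff ℝ ∞ (fun y => L (f y)) :=
  contDiff_linear_comp (L.restrictScalars ℝ) hf

theorem IsSuperfunction.fieldOp {f : Superfield} (hf : IsSuperfunction f)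
    (M : Fock2 →ₗ[ℂ] Fock2) (N : Fin 4 → Fock2 →ₗ[ℂ] Fock2) :
    IsSuperfunction (fieldOp M N f) :=
  (contDiff_linearC M hf).add (ContDiff.sum fun μ _ => contDiff_linearC (N μ)
    (contDiff_partialX hf μ))

theorem IsSuperfunction.differentiableAt {f : Superfield} (hf : IsSuperfunction f)
    (x : Spacetime) : DifferentiableAt ℝ f x :=
  (ContDiff.differentiable hf (by simp)).differentiableAt

theorem IsSuperfunction.partialX {f : Superfield} (hf : IsSuperfunction f) (μ : Fin 4) :
    IsSuperfunction (partialX μ f) := contDiff_partialX hf μ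

theorem partialX_fieldOp {f : Superfield} (hf : IsSuperfunction f)
    (M : Fock2 →ₗ[ℂ] Fock2) (N : Fin 4 → Fock2 →ₗ[ℂ] Fock2) (μ : Fin 4) :
    partialX μ (fieldOp M N f) = fieldOp M N (partialX μ f) := by
  ext1 x
  have h1 : DifferentiableAt ℝ (fun y => M (f y)) x :=
    ((contDiff_linearC M hf).differentiable (by simp)).differentiableAt
  have h2 : ∀ ν, DifferentiableAt ℝ (fun y => N ν (SuperPoincare.partialX ν f y)) x := fun ν =>
    ((contDiff_linearC (N ν) (contDiff_partialX hf ν)).differentiable (by simp)).differentiableAt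
  have h3 : SuperPoincare.partialX μ (fun y => ∑ ν, N ν (SuperPoincare.partialX ν f y)) x =
      ∑ ν, SuperPoincare.partialX μ (fun y => N ν (SuperPoincare.partialX ν f y)) x := by
    simp only [SuperPoincare.partialX] at h2 ⊢
    rw [fderiv_fun_sum (fun ν _ => h2 ν)]
    simp
  change SuperPoincare.partialX μ
    (fun y => M (f y) + ∑ ν, N ν (SuperPoincare.partialX ν f y)) x = _
  rw [partialX_add h1 (DifferentiableAt.fun_sum fun ν _ => h2 ν), h3,
    partialX_linearC M (hf.differentiableAt x)]
  simp only [SuperPoincare.fieldOp]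
  congr 1
  refine Finset.sum_congr rfl fun ν _ => ?_
  rw [partialX_linearC (N ν) ((hf.partialX ν).differentiableAt x), partialX_comm hf]

theorem fieldOp_fieldOp {f : Superfield} (hf : IsSuperfunction f)
    (M M' : Fock2 →ₗ[ℂ] Fock2) (N N' : Fin 4 → Fock2 →ₗ[ℂ] Fock2) (x : Spacetime) :
    fieldOp M N (fieldOp M' N' f) x = (M * M') (f x) +
      ∑ μ, (M * N' μ + N μ * M') (partialX μ f x) +
      ∑ μ, ∑ ν, (N μ * N' ν) (partialX ν (partialX μ f) x) := by
  rw [fieldOp]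
  simp only [partialX_fieldOp hf]
  simp only [fieldOp, map_add, map_sum, LinearMap.add_apply, Module.End.mul_apply,
    Finset.sum_add_distrib]
  abel

theorem fieldOp_anticomm {f : Superfield} (hf : IsSuperfunction f)
    {M M' : Fock2 →ₗ[ℂ] Fock2} {N N' : Fin 4 → Fock2 →ₗ[ℂ] Fock2}
    (hM : M * M' + M' * M = 0) (hMN : ∀ μ, (M * N' μ + N' μ * M) + (N μ * M' + M' * N μ) = 0)
    (hN : ∀ μ ν, N μ * N' ν + N' ν * N μ = 0) :
    fieldOp M N (fieldOp M' N' f) = -fieldOp M' N' (fieldOp M N f) := by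
  ext1 x
  refine eq_neg_of_add_eq_zero_left ?_
  rw [fieldOp_fieldOp hf, fieldOp_fieldOp hf]
  have e1 : (M * M') (f x) + (M' * M) (f x) = 0 := by
    rw [← LinearMap.add_apply, hM]; rfl
  have e2 : ∑ μ, (M * N' μ + N μ * M') (partialX μ f x) +
      ∑ μ, (M' * N μ + N' μ * M) (partialX μ f x) = 0 := by
    rw [← Finset.sum_add_distrib]
    refine Finset.sum_eq_zero fun μ _ => ?_
    rw [← LinearMap.add_apply, show M * N' μ + N μ * M' + (M' * N μ + N' μ * M) = 0 by
      rw [← hMN μ]; abel]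
    rfl
  have e3 : ∑ μ, ∑ ν, (N μ * N' ν) (partialX ν (partialX μ f) x) +
      ∑ μ, ∑ ν, (N' μ * N ν) (partialX ν (partialX μ f) x) = 0 := by
    rw [Finset.sum_comm (f := fun μ ν => (N' μ * N ν) (partialX ν (partialX μ f) x)),
      ← Finset.sum_add_distrib]
    refine Finset.sum_eq_zero fun μ _ => ?_
    rw [← Finset.sum_add_distrib]
    refine Finset.sum_eq_zero fun ν _ => ?_
    rw [partialX_comm hf μ ν, ← LinearMap.add_apply, hN]
    rfl
  calc _ = ((M * M') (f x) + (M' * M) (f x)) + (∑ μ, (M * N' μ + N μ * M') (partialX μ f x) +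
      ∑ μ, (M' * N μ + N' μ * M) (partialX μ f x)) +
      (∑ μ, ∑ ν, (N μ * N' ν) (partialX ν (partialX μ f) x) +
      ∑ μ, ∑ ν, (N' μ * N ν) (partialX ν (partialX μ f) x)) := by abel
    _ = 0 := by rw [e1, e2, e3]; simp

theorem fieldOp_add {f g : Superfield} (hf : IsSuperfunction f) (hg : IsSuperfunction g)
    (M : Fock2 →ₗ[ℂ] Fock2) (N : Fin 4 → Fock2 →ₗ[ℂ] Fock2) :
    fieldOp M N (f + g) = fieldOp M N f + fieldOp M N g := by
  ext1 x
  have : ∀ μ, partialX μ (f + g) x = partialX μ f x + partialX μ g x := fun μ =>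
    partialX_add (hf.differentiableAt x) (hg.differentiableAt x) μ
  simp only [fieldOp, Pi.add_apply, this, map_add, Finset.sum_add_distrib]
  abel

theorem fieldOp_smul {f : Superfield} (hf : IsSuperfunction f) (c : ℂ)
    (M : Fock2 →ₗ[ℂ] Fock2) (N : Fin 4 → Fock2 →ₗ[ℂ] Fock2) :
    fieldOp M N (c • f) = c • fieldOp M N f := by
  ext1 x
  have : ∀ μ, partialX μ (c • f) x = c • partialX μ f x := fun μ =>
    partialX_linearC (c • LinearMap.id) (hf.differentiableAt x) μ
  simp only [fieldOp, Pi.smul_apply, this, map_smul, Finset.smul_sum, smul_add]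

/-- The symbols `∓ Γ_{ab}^μ θbar^b` of the terms with derivatives. -/
def symbolBar (a : Fin 2) (μ : Fin 4) : Fock2 →ₗ[ℂ] Fock2 := ∑ b, gammaLow μ a b • thetaBarL b

/-- The symbols `Γ_{ab}^μ θ^a`. -/
def symbolHol (b : Fin 2) (μ : Fin 4) : Fock2 →ₗ[ℂ] Fock2 := ∑ a, gammaLow μ a b • thetaL a

theorem sum_mulThetaBar_gammaPartial (a : Fin 2) (f : Superfield) :
    ∑ b, mulThetaBar b (gammaPartial a b f) = fun x => ∑ μ, symbolBar a μ (partialX μ f x) := by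
  ext1 x
  have h : ∀ b, mulThetaBar b (gammaPartial a b f) x = thetaBarL b (gammaPartial a b f x) :=
    fun b => rfl
  simp only [Finset.sum_apply, h]
  simp only [gammaPartial, symbolBar, Finset.sum_apply, map_sum, LinearMap.sum_apply,
    Pi.smul_apply, map_smul, LinearMap.smul_apply]
  rw [Finset.sum_comm]

theorem sum_mulTheta_gammaPartial (b : Fin 2) (f : Superfield) :
    ∑ a, mulTheta a (gammaPartial a b f) = fun x => ∑ μ, symbolHol b μ (partialX μ f x) := by
  ext1 x
  have h : ∀ a, mulTheta a (gammaPartial a b f) x = thetaL a (gammaPartial a b f x) :=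
    fun b => rfl
  simp only [Finset.sum_apply, h]
  simp only [gammaPartial, symbolHol, Finset.sum_apply, map_sum, LinearMap.sum_apply,
    Pi.smul_apply, map_smul, LinearMap.smul_apply]
  rw [Finset.sum_comm]

theorem Q_eq_fieldOp (a : Fin 2) : Q a = fieldOp (dThetaL a) (symbolBar a) := by
  ext1 f
  rw [Q, sum_mulThetaBar_gammaPartial]; rfl

theorem D_eq_fieldOp (a : Fin 2) : D a = fieldOp (dThetaL a) (fun μ => -symbolBar a μ) := by
  ext1 f
  rw [D, sum_mulThetaBar_gammaPartial]; ext1 x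
  simp only [fieldOp, LinearMap.neg_apply, Finset.sum_neg_distrib, ← sub_eq_add_neg]; rfl

theorem QBar_eq_fieldOp (b : Fin 2) : QBar b = fieldOp (dThetaBarL b) (symbolHol b) := by
  ext1 f
  rw [QBar, sum_mulTheta_gammaPartial]; rfl

theorem DBar_eq_fieldOp (b : Fin 2) :
    DBar b = fieldOp (dThetaBarL b) (fun μ => -symbolHol b μ) := by
  ext1 f
  rw [DBar, sum_mulTheta_gammaPartial]; ext1 x
  simp only [fieldOp, LinearMap.neg_apply, Finset.sum_neg_distrib, ← sub_eq_add_neg]; rfl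

/-! ### Canonical anticommutation relations -/

theorem fock2_end_ext {M N : Fock2 →ₗ[ℂ] Fock2}
    (h : ∀ (w : Fock2) (I J : Finset (Fin 2)), M w (I, J) = N w (I, J)) : M = N :=
  LinearMap.ext fun w => funext fun I => h w I.1 I.2

theorem koszul_zero (I : Finset (Fin 2)) : koszul 0 I = 1 := by
  have : I.filter (· < 0) = ∅ := by ext a; simp
  simp [koszul]

theorem koszul_one (I : Finset (Fin 2)) : koszul 1 I = if 0 ∈ I then -1 else 1 := by
  rcases finset_fin_two_cases I with rfl | rfl | rfl | rfl
  · simp [koszul]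
  · rw [koszul, show Finset.filter (· < 1) ({0} : Finset (Fin 2)) = {0} by decide]; simp
  · rw [koszul, show Finset.filter (· < 1) ({1} : Finset (Fin 2)) = ∅ by decide]; simp
  · rw [koszul, show Finset.filter (· < 1) (Finset.univ : Finset (Fin 2)) = {0} by decide]; simp

theorem erase_univ_zero : (Finset.univ : Finset (Fin 2)).erase 0 = {1} := by decide
theorem erase_univ_one : (Finset.univ : Finset (Fin 2)).erase 1 = {0} := by decide
theorem insert_zero_one : (insert 0 {1} : Finset (Fin 2)) = Finset.univ := by decide
theorem insert_one_zero : (insert 1 {0} : Finset (Fin 2)) = Finset.univ := by decide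

theorem thetaL_anticomm (a b : Fin 2) : thetaL a * thetaL b + thetaL b * thetaL a = 0 := by
  refine fock2_end_ext fun w I J => ?_
  rcases finset_fin_two_cases I with rfl | rfl | rfl | rfl <;> fin_cases a <;> fin_cases b <;>
    simp [thetaL, koszul_zero, koszul_one, erase_univ_zero, erase_univ_one]

theorem dThetaL_anticomm (a b : Fin 2) :
    dThetaL a * dThetaL b + dThetaL b * dThetaL a = 0 := by
  refine fock2_end_ext fun w I J => ?_
  rcases finset_fin_two_cases I with rfl | rfl | rfl | rfl <;> fin_cases a <;> fin_cases b <;>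
    simp [dThetaL, koszul_zero, koszul_one, insert_zero_one, insert_one_zero]

theorem thetaBarL_anticomm (a b : Fin 2) :
    thetaBarL a * thetaBarL b + thetaBarL b * thetaBarL a = 0 := by
  refine fock2_end_ext fun w I J => ?_
  rcases finset_fin_two_cases J with rfl | rfl | rfl | rfl <;> fin_cases a <;> fin_cases b <;>
    simp [thetaBarL, koszul_zero, koszul_one, erase_univ_zero, erase_univ_one]

theorem dThetaBarL_anticomm (a b : Fin 2) :
    dThetaBarL a * dThetaBarL b + dThetaBarL b * dThetaBarL a = 0 := by
  refine fock2_end_ext fun w I J => ?_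
  rcases finset_fin_two_cases J with rfl | rfl | rfl | rfl <;> fin_cases a <;> fin_cases b <;>
    simp [dThetaBarL, koszul_zero, koszul_one, insert_zero_one, insert_one_zero]

theorem dThetaL_thetaL (a b : Fin 2) :
    dThetaL a * thetaL b + thetaL b * dThetaL a = if a = b then 1 else 0 := by
  refine fock2_end_ext fun w I J => ?_
  rcases finset_fin_two_cases I with rfl | rfl | rfl | rfl <;> fin_cases a <;> fin_cases b <;>
    simp [thetaL, dThetaL, koszul_zero, koszul_one, erase_univ_zero, erase_univ_one,
      insert_zero_one, insert_one_zero]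

theorem dThetaBarL_thetaBarL (a b : Fin 2) :
    dThetaBarL a * thetaBarL b + thetaBarL b * dThetaBarL a = if a = b then 1 else 0 := by
  have h : ∀ n : ℕ, ((-1 : ℂ) ^ n) * (-1) ^ n = 1 := fun n => by
    rw [← pow_add, ← two_mul, pow_mul]; simp
  refine fock2_end_ext fun w I J => ?_
  rcases finset_fin_two_cases J with rfl | rfl | rfl | rfl <;> fin_cases a <;> fin_cases b <;>
    simp [thetaBarL, dThetaBarL, koszul_zero, koszul_one, erase_univ_zero, erase_univ_one,
      insert_zero_one, insert_one_zero, ← mul_assoc, h]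

theorem neg_one_pow_card_erase {a : Fin 2} {I : Finset (Fin 2)} (h : a ∈ I) :
    (-1 : ℂ) ^ (I.erase a).card = -(-1) ^ I.card := by
  rw [← Finset.card_erase_add_one h, pow_succ]; ring

theorem thetaL_thetaBarL (a b : Fin 2) :
    thetaL a * thetaBarL b + thetaBarL b * thetaL a = 0 := by
  refine fock2_end_ext fun w I J => ?_
  by_cases h : a ∈ I <;> by_cases h' : b ∈ J <;>
    simp [thetaL, thetaBarL, h, h', neg_one_pow_card_erase, -Finset.card_erase_of_mem]
  ring

theorem dThetaL_thetaBarL (a b : Fin 2) :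
    dThetaL a * thetaBarL b + thetaBarL b * dThetaL a = 0 := by
  refine fock2_end_ext fun w I J => ?_
  by_cases h : a ∈ I <;> by_cases h' : b ∈ J <;>
    simp [dThetaL, thetaBarL, h, h']
  ring

theorem dThetaBarL_thetaL (a b : Fin 2) :
    dThetaBarL a * thetaL b + thetaL b * dThetaBarL a = 0 := by
  refine fock2_end_ext fun w I J => ?_
  by_cases h : b ∈ I <;> by_cases h' : a ∈ J <;>
    simp [thetaL, dThetaBarL, h, h', neg_one_pow_card_erase, -Finset.card_erase_of_mem]
  ring

theorem dThetaL_dThetaBarL (a b : Fin 2) :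
    dThetaL a * dThetaBarL b + dThetaBarL b * dThetaL a = 0 := by
  refine fock2_end_ext fun w I J => ?_
  by_cases h : a ∈ I <;> by_cases h' : b ∈ J <;>
    simp [dThetaL, dThetaBarL, h, h']
  ring

end SuperPoincare

namespace SuperPoincare

/-! ### Supersymmetry: (anti)commutation of the vector fields -/

theorem anticomm_sum_smul {ι : Type} [Fintype ι] {X : Fock2 →ₗ[ℂ] Fock2}
    {Y : ι → Fock2 →ₗ[ℂ] Fock2} {c d : ι → ℂ}
    (h : ∀ i, X * Y i + Y i * X = d i • 1) :
    X * (∑ i, c i • Y i) + (∑ i, c i • Y i) * X = (∑ i, c i * d i) • 1 := by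
  rw [Finset.mul_sum, Finset.sum_mul, ← Finset.sum_add_distrib, Finset.sum_smul]
  refine Finset.sum_congr rfl fun i _ => ?_
  rw [mul_smul_comm, smul_mul_assoc, ← smul_add, h, smul_smul]

theorem anticomm_neg_right {R : Type} [Ring R] {x y z : R} (h : x * y + y * x = z) :
    x * -y + -y * x = -z := by
  rw [← h]; noncomm_ring

theorem anticomm_neg_left {R : Type} [Ring R] {x y z : R} (h : x * y + y * x = z) :
    -x * y + y * -x = -z := by
  rw [← h]; noncomm_ring

theorem anticomm_comm {R : Type} [Ring R] {x y z : R} (h : x * y + y * x = z) :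
    y * x + x * y = z := by
  rw [← h, add_comm]

theorem dThetaL_symbolBar (a b : Fin 2) (μ : Fin 4) :
    dThetaL a * symbolBar b μ + symbolBar b μ * dThetaL a = 0 := by
  rw [symbolBar, anticomm_sum_smul (d := fun _ => 0)]
  · simp
  · intro c; rw [dThetaL_thetaBarL]; simp

theorem dThetaBarL_symbolHol (a b : Fin 2) (μ : Fin 4) :
    dThetaBarL a * symbolHol b μ + symbolHol b μ * dThetaBarL a = 0 := by
  rw [symbolHol, anticomm_sum_smul (d := fun _ => 0)]
  · simp
  · intro c; rw [dThetaBarL_thetaL]; simp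

theorem dThetaL_symbolHol (a b : Fin 2) (μ : Fin 4) :
    dThetaL a * symbolHol b μ + symbolHol b μ * dThetaL a = gammaLow μ a b • 1 := by
  rw [symbolHol, anticomm_sum_smul (d := fun c => if a = c then 1 else 0)]
  · simp
  · intro c; rw [dThetaL_thetaL]; split_ifs <;> simp

theorem dThetaBarL_symbolBar (a b : Fin 2) (μ : Fin 4) :
    dThetaBarL a * symbolBar b μ + symbolBar b μ * dThetaBarL a = gammaLow μ b a • 1 := by
  rw [symbolBar, anticomm_sum_smul (d := fun c => if a = c then 1 else 0)]
  · simp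
  · intro c; rw [dThetaBarL_thetaBarL]; split_ifs <;> simp

theorem symbolBar_symbolBar (a b : Fin 2) (μ ν : Fin 4) :
    symbolBar a μ * symbolBar b ν + symbolBar b ν * symbolBar a μ = 0 := by
  rw [symbolBar.eq_1 b, anticomm_sum_smul (d := fun _ => 0)]
  · simp
  · intro c; rw [add_comm, symbolBar, anticomm_sum_smul (d := fun _ => 0)]
    · simp
    · intro c; rw [thetaBarL_anticomm]; simp

theorem symbolHol_symbolHol (a b : Fin 2) (μ ν : Fin 4) :
    symbolHol a μ * symbolHol b ν + symbolHol b ν * symbolHol a μ = 0 := by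
  rw [symbolHol.eq_1 b, anticomm_sum_smul (d := fun _ => 0)]
  · simp
  · intro c; rw [add_comm, symbolHol, anticomm_sum_smul (d := fun _ => 0)]
    · simp
    · intro c; rw [thetaL_anticomm]; simp

theorem symbolHol_symbolBar (a b : Fin 2) (μ ν : Fin 4) :
    symbolHol a μ * symbolBar b ν + symbolBar b ν * symbolHol a μ = 0 := by
  rw [symbolBar.eq_1 b, anticomm_sum_smul (d := fun _ => 0)]
  · simp
  · intro c; rw [add_comm, symbolHol, anticomm_sum_smul (d := fun _ => 0)]
    · simp
    · intro c; rw [add_comm, thetaL_thetaBarL]; simp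

theorem symbolBar_symbolHol (a b : Fin 2) (μ ν : Fin 4) :
    symbolBar a μ * symbolHol b ν + symbolHol b ν * symbolBar a μ = 0 := by
  rw [add_comm, symbolHol_symbolBar]

variable {f : Superfield}

theorem D_D (hf : IsSuperfunction f) (a b : Fin 2) : D a (D b f) = -D b (D a f) := by
  rw [D_eq_fieldOp, D_eq_fieldOp]
  apply fieldOp_anticomm hf (dThetaL_anticomm a b)
  · intro μ
    rw [anticomm_neg_right (dThetaL_symbolBar a b μ),
      anticomm_comm (anticomm_neg_right (dThetaL_symbolBar b a μ))]; simp
  · intro μ ν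
    rw [anticomm_neg_left (anticomm_neg_right (symbolBar_symbolBar a b μ ν))]; simp

theorem D_Q (hf : IsSuperfunction f) (a b : Fin 2) : D a (Q b f) = -Q b (D a f) := by
  rw [D_eq_fieldOp, Q_eq_fieldOp]
  apply fieldOp_anticomm hf (dThetaL_anticomm a b)
  · intro μ
    rw [dThetaL_symbolBar a b μ, anticomm_comm (anticomm_neg_right (dThetaL_symbolBar b a μ))]
    simp
  · intro μ ν
    rw [anticomm_neg_left (symbolBar_symbolBar a b μ ν)]; simp

theorem DBar_QBar (hf : IsSuperfunction f) (a b : Fin 2) :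
    DBar a (QBar b f) = -QBar b (DBar a f) := by
  rw [DBar_eq_fieldOp, QBar_eq_fieldOp]
  apply fieldOp_anticomm hf (dThetaBarL_anticomm a b)
  · intro μ
    rw [dThetaBarL_symbolHol a b μ,
      anticomm_comm (anticomm_neg_right (dThetaBarL_symbolHol b a μ))]
    simp
  · intro μ ν
    rw [anticomm_neg_left (symbolHol_symbolHol a b μ ν)]; simp

theorem D_QBar (hf : IsSuperfunction f) (a b : Fin 2) : D a (QBar b f) = -QBar b (D a f) := by
  rw [D_eq_fieldOp, QBar_eq_fieldOp]
  apply fieldOp_anticomm hf (dThetaL_dThetaBarL a b)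
  · intro μ
    rw [dThetaL_symbolHol a b μ,
      anticomm_comm (anticomm_neg_right (dThetaBarL_symbolBar b a μ)), add_neg_cancel]
  · intro μ ν
    rw [anticomm_neg_left (symbolBar_symbolHol a b μ ν)]; simp

theorem DBar_Q (hf : IsSuperfunction f) (a b : Fin 2) : DBar a (Q b f) = -Q b (DBar a f) := by
  rw [DBar_eq_fieldOp, Q_eq_fieldOp]
  apply fieldOp_anticomm hf (by rw [add_comm, dThetaL_dThetaBarL])
  · intro μ
    rw [dThetaBarL_symbolBar a b μ,
      anticomm_comm (anticomm_neg_right (dThetaL_symbolHol b a μ)), add_neg_cancel]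
  · intro μ ν
    rw [anticomm_neg_left (symbolHol_symbolBar a b μ ν)]; simp

theorem IsSuperfunction.D (hf : IsSuperfunction f) (a : Fin 2) : IsSuperfunction (D a f) := by
  rw [D_eq_fieldOp]; exact hf.fieldOp _ _

theorem IsSuperfunction.Q (hf : IsSuperfunction f) (a : Fin 2) : IsSuperfunction (Q a f) := by
  rw [Q_eq_fieldOp]; exact hf.fieldOp _ _

theorem IsSuperfunction.QBar (hf : IsSuperfunction f) (a : Fin 2) :
    IsSuperfunction (QBar a f) := by
  rw [QBar_eq_fieldOp]; exact hf.fieldOp _ _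

theorem IsSuperfunction.add {g : Superfield} (hf : IsSuperfunction f) (hg : IsSuperfunction g) :
    IsSuperfunction (f + g) := ContDiff.add hf hg

theorem IsSuperfunction.smul (hf : IsSuperfunction f) (c : ℂ) : IsSuperfunction (c • f) :=
  ContDiff.const_smul c hf

theorem IsSuperfunction.zero : IsSuperfunction (0 : Superfield) := contDiff_const

theorem D_add {g : Superfield} (hf : IsSuperfunction f) (hg : IsSuperfunction g) (a : Fin 2) :
    D a (f + g) = D a f + D a g := by
  rw [D_eq_fieldOp, fieldOp_add hf hg]

theorem D_smul (hf : IsSuperfunction f) (c : ℂ) (a : Fin 2) : D a (c • f) = c • D a f := by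
  rw [D_eq_fieldOp, fieldOp_smul hf]

theorem DBar_add {g : Superfield} (hf : IsSuperfunction f) (hg : IsSuperfunction g) (a : Fin 2) :
    DBar a (f + g) = DBar a f + DBar a g := by
  rw [DBar_eq_fieldOp, fieldOp_add hf hg]

theorem DBar_smul (hf : IsSuperfunction f) (c : ℂ) (a : Fin 2) :
    DBar a (c • f) = c • DBar a f := by
  rw [DBar_eq_fieldOp, fieldOp_smul hf]

theorem Q_add {g : Superfield} (hf : IsSuperfunction f) (hg : IsSuperfunction g) (a : Fin 2) :
    Q a (f + g) = Q a f + Q a g := by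
  rw [Q_eq_fieldOp, fieldOp_add hf hg]

theorem Q_smul (hf : IsSuperfunction f) (c : ℂ) (a : Fin 2) : Q a (c • f) = c • Q a f := by
  rw [Q_eq_fieldOp, fieldOp_smul hf]

theorem QBar_add {g : Superfield} (hf : IsSuperfunction f) (hg : IsSuperfunction g) (a : Fin 2) :
    QBar a (f + g) = QBar a f + QBar a g := by
  rw [QBar_eq_fieldOp, fieldOp_add hf hg]

theorem QBar_smul (hf : IsSuperfunction f) (c : ℂ) (a : Fin 2) :
    QBar a (c • f) = c • QBar a f := by
  rw [QBar_eq_fieldOp, fieldOp_smul hf]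

theorem D_zero (a : Fin 2) : D a 0 = 0 := by simpa using D_smul IsSuperfunction.zero 0 a
theorem DBar_zero (a : Fin 2) : DBar a 0 = 0 := by
  simpa using DBar_smul IsSuperfunction.zero 0 a

theorem DSq_eq (hf : IsSuperfunction f) : DSq f = (1 / 2 : ℂ) • D 0 (D 1 f) := by
  simp only [DSq, Fin.sum_univ_two, eps]
  rw [D_D hf 1 0]
  simp
  module

theorem IsSuperfunction.DSq (hf : IsSuperfunction f) : IsSuperfunction (DSq f) := by
  rw [DSq_eq hf]; exact ((hf.D 1).D 0).smul _

theorem DSq_add {g : Superfield} (hf : IsSuperfunction f) (hg : IsSuperfunction g) :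
    DSq (f + g) = DSq f + DSq g := by
  rw [DSq_eq (hf.add hg), DSq_eq hf, DSq_eq hg, D_add hf hg, D_add (hf.D 1) (hg.D 1), smul_add]

theorem DSq_smul (hf : IsSuperfunction f) (c : ℂ) : DSq (c • f) = c • DSq f := by
  rw [DSq_eq (hf.smul c), DSq_eq hf, D_smul hf, D_smul (hf.D 1), smul_comm]

theorem D_DSq (hf : IsSuperfunction f) (a : Fin 2) : D a (DSq f) = 0 := by
  have h0 : ∀ (b : Fin 2) {g : Superfield}, IsSuperfunction g → D b (D b g) = 0 := by
    intro b g hg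
    have h := D_D hg b b
    exact self_eq_neg.1 h
  rw [DSq_eq hf, D_smul ((hf.D 1).D 0)]
  fin_cases a
  · simp [h0 0 (hf.D 1)]
  · simp only [Fin.mk_one]
    rw [D_D (hf.D 1), h0 1 hf, D_zero]; simp

/-! ### Conjugation and parity -/

/-- The conjugation of the fibre. -/
def conjL : Fock2 →ₗ[ℝ] Fock2 where
  toFun w := fun I => (-1) ^ (I.1.card * I.2.card) * conj (w (I.2, I.1))
  map_add' v w := by ext I; simp only [Pi.add_apply, map_add]; ring
  map_smul' c w := by
    ext I; simp only [Pi.smul_apply, Complex.real_smul, map_mul, Complex.conj_ofReal,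
      RingHom.id_apply]; ring

theorem conjS_apply (f : Superfield) (x : Spacetime) : conjS f x = conjL (f x) := rfl

theorem conjL_conjL (w : Fock2) : conjL (conjL w) = w := by
  ext ⟨I, J⟩
  simp only [conjL, LinearMap.coe_mk, AddHom.coe_mk, map_mul, map_pow, map_neg, map_one,
    Complex.conj_conj]
  rw [← mul_assoc, mul_comm J.card, ← mul_pow]; simp

theorem conjL_smul (c : ℂ) (w : Fock2) : conjL (c • w) = conj c • conjL w := by
  ext I; simp only [conjL, LinearMap.coe_mk, AddHom.coe_mk, Pi.smul_apply, smul_eq_mul, map_mul]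
  ring

theorem neg_one_pow_card_erase_mul {a : Fin 2} {I : Finset (Fin 2)} (h : a ∈ I) (n : ℕ) :
    (-1 : ℂ) ^ (n * (I.erase a).card) = (-1) ^ n * (-1) ^ (n * I.card) := by
  rw [← Finset.card_erase_add_one h, mul_add, pow_add, mul_one, mul_left_comm, ← mul_pow]
  simp

theorem conj_koszul (a : Fin 2) (I : Finset (Fin 2)) :
    conj (koszul a I) = koszul a I := by simp [koszul]

theorem conjL_thetaL (a : Fin 2) (w : Fock2) : conjL (thetaL a w) = thetaBarL a (conjL w) := by
  ext ⟨I, J⟩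
  simp only [conjL, thetaL, thetaBarL, LinearMap.coe_mk, AddHom.coe_mk]
  by_cases h : a ∈ J
  · simp only [h, if_true, map_mul, conj_koszul, neg_one_pow_card_erase_mul h]
    have : ((-1 : ℂ) ^ I.card) * (-1) ^ I.card = 1 := by rw [← mul_pow]; simp
    linear_combination (-1) ^ (I.card * J.card) * (koszul a J) * 
      (conj (w (J.erase a, I))) * (-this)
  · simp [h]

theorem conjL_thetaBarL (a : Fin 2) (w : Fock2) :
    conjL (thetaBarL a w) = thetaL a (conjL w) := by
  rw [← conjL_conjL (thetaL a (conjL w)), conjL_thetaL, conjL_conjL]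

theorem conjL_dThetaL (a : Fin 2) (w : Fock2) :
    conjL (dThetaL a w) = dThetaBarL a (conjL w) := by
  ext ⟨I, J⟩
  simp only [conjL, dThetaL, dThetaBarL, LinearMap.coe_mk, AddHom.coe_mk]
  by_cases h : a ∈ J
  · simp [h]
  · have h2 := neg_one_pow_card_erase_mul (Finset.mem_insert_self a J) I.card
    rw [Finset.erase_insert h] at h2
    simp only [h, if_false, map_mul, conj_koszul, h2]
    ring

theorem conjL_dThetaBarL (a : Fin 2) (w : Fock2) :
    conjL (dThetaBarL a w) = dThetaL a (conjL w) := by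
  rw [← conjL_conjL (dThetaL a (conjL w)), conjL_dThetaL, conjL_conjL]

theorem partialX_conjS (hf : IsSuperfunction f) (μ : Fin 4) :
    partialX μ (conjS f) = conjS (partialX μ f) :=
  funext fun x => partialX_linear conjL (hf.differentiableAt x) μ

theorem IsSuperfunction.conjS (hf : IsSuperfunction f) : IsSuperfunction (conjS f) :=
  contDiff_linear_comp conjL hf

theorem conj_gammaLow (μ : Fin 4) (a b : Fin 2) :
    conj (gammaLow μ a b) = gammaLow μ b a := by
  fin_cases μ <;> fin_cases a <;> fin_cases b <;> simp [gammaLow, gammaUp, eps]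

theorem conjL_symbolBar (a : Fin 2) (μ : Fin 4) (w : Fock2) :
    conjL (symbolBar a μ w) = symbolHol a μ (conjL w) := by
  simp only [symbolBar, symbolHol, LinearMap.sum_apply, map_sum, LinearMap.smul_apply,
    conjL_smul, conj_gammaLow, conjL_thetaBarL]

theorem conjL_symbolHol (a : Fin 2) (μ : Fin 4) (w : Fock2) :
    conjL (symbolHol a μ w) = symbolBar a μ (conjL w) := by
  rw [← conjL_conjL (symbolBar a μ (conjL w)), conjL_symbolBar, conjL_conjL]

theorem conjS_fieldOp {M M' : Fock2 →ₗ[ℂ] Fock2} {N N' : Fin 4 → Fock2 →ₗ[ℂ] Fock2}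
    (hM : ∀ w, conjL (M w) = M' (conjL w)) (hN : ∀ μ w, conjL (N μ w) = N' μ (conjL w))
    (hf : IsSuperfunction f) : conjS (fieldOp M N f) = fieldOp M' N' (conjS f) := by
  ext1 x
  simp only [conjS_apply, fieldOp, map_add, map_sum, hM, hN, partialX_conjS hf]

theorem conjS_D (hf : IsSuperfunction f) (a : Fin 2) : conjS (D a f) = DBar a (conjS f) := by
  rw [D_eq_fieldOp, DBar_eq_fieldOp]
  exact conjS_fieldOp (conjL_dThetaL a) (fun μ w => by simp [conjL_symbolBar]) hf

theorem conjS_Q (hf : IsSuperfunction f) (a : Fin 2) : conjS (Q a f) = QBar a (conjS f) := by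
  rw [Q_eq_fieldOp, QBar_eq_fieldOp]
  exact conjS_fieldOp (conjL_dThetaL a) (fun μ w => by simp [conjL_symbolBar]) hf

theorem conjS_QBar (hf : IsSuperfunction f) (a : Fin 2) : conjS (QBar a f) = Q a (conjS f) := by
  rw [Q_eq_fieldOp, QBar_eq_fieldOp]
  exact conjS_fieldOp (conjL_dThetaBarL a) (fun μ w => by simp [conjL_symbolHol]) hf

theorem conjS_conjS (f : Superfield) : conjS (conjS f) = f := funext fun x => conjL_conjL (f x)

theorem conjS_add (f g : Superfield) : conjS (f + g) = conjS f + conjS g :=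
  funext fun x => map_add conjL (f x) (g x)

theorem conjS_smul (c : ℂ) (f : Superfield) : conjS (c • f) = conj c • conjS f :=
  funext fun x => conjL_smul c (f x)

theorem conjS_zero : conjS 0 = 0 := funext fun _ => map_zero conjL

/-- The parity automorphism of the fibre. -/
def parityL : Fock2 →ₗ[ℂ] Fock2 where
  toFun w := fun I => (-1) ^ (I.1.card + I.2.card) * w I
  map_add' v w := by ext I; simp only [Pi.add_apply]; ring
  map_smul' c w := by ext I; simp only [Pi.smul_apply, smul_eq_mul, RingHom.id_apply]; ring

theorem parityS_apply (f : Superfield) (x : Spacetime) : parityS f x = parityL (f x) := rfl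

theorem parityL_thetaL (a : Fin 2) (w : Fock2) : parityL (thetaL a w) = -thetaL a (parityL w) := by
  ext ⟨I, J⟩
  by_cases h : a ∈ I <;> simp [parityL, thetaL, h, pow_add, neg_one_pow_card_erase,
    -Finset.card_erase_of_mem]
  ring

theorem parityL_thetaBarL (a : Fin 2) (w : Fock2) :
    parityL (thetaBarL a w) = -thetaBarL a (parityL w) := by
  ext ⟨I, J⟩
  by_cases h : a ∈ J <;> simp [parityL, thetaBarL, h, pow_add, neg_one_pow_card_erase,
    -Finset.card_erase_of_mem]
  ring

theorem parityL_dThetaL (a : Fin 2) (w : Fock2) :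
    parityL (dThetaL a w) = -dThetaL a (parityL w) := by
  ext ⟨I, J⟩
  by_cases h : a ∈ I <;> simp [parityL, dThetaL, h, pow_add]
  ring

theorem parityL_dThetaBarL (a : Fin 2) (w : Fock2) :
    parityL (dThetaBarL a w) = -dThetaBarL a (parityL w) := by
  ext ⟨I, J⟩
  by_cases h : a ∈ J <;> simp [parityL, dThetaBarL, h, pow_add]
  ring

theorem parityL_symbolBar (a : Fin 2) (μ : Fin 4) (w : Fock2) :
    parityL (symbolBar a μ w) = -symbolBar a μ (parityL w) := by
  simp [symbolBar, parityL_thetaBarL, add_comm]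

theorem parityL_symbolHol (a : Fin 2) (μ : Fin 4) (w : Fock2) :
    parityL (symbolHol a μ w) = -symbolHol a μ (parityL w) := by
  simp [symbolHol, parityL_thetaL, add_comm]

theorem IsSuperfunction.parityS (hf : IsSuperfunction f) : IsSuperfunction (parityS f) :=
  contDiff_linearC parityL hf

theorem parityS_fieldOp {M : Fock2 →ₗ[ℂ] Fock2} {N : Fin 4 → Fock2 →ₗ[ℂ] Fock2}
    (hM : ∀ w, parityL (M w) = -M (parityL w)) (hN : ∀ μ w, parityL (N μ w) = -N μ (parityL w))
    (hf : IsSuperfunction f) : fieldOp M N (parityS f) = -parityS (fieldOp M N f) := by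
  ext1 x
  have : ∀ μ, partialX μ (parityS f) x = parityL (partialX μ f x) := fun μ =>
    partialX_linearC parityL (hf.differentiableAt x) μ
  simp only [Pi.neg_apply, parityS_apply, fieldOp, map_add, map_sum, hM, hN, this, neg_add,
    Finset.sum_neg_distrib, neg_neg]

theorem DBar_parityS (hf : IsSuperfunction f) (a : Fin 2) :
    DBar a (parityS f) = -parityS (DBar a f) := by
  rw [DBar_eq_fieldOp]
  exact parityS_fieldOp (parityL_dThetaBarL a) (fun μ w => by simp [parityL_symbolHol]) hf

theorem D_parityS (hf : IsSuperfunction f) (a : Fin 2) :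
    D a (parityS f) = -parityS (D a f) := by
  rw [D_eq_fieldOp]
  exact parityS_fieldOp (parityL_dThetaL a) (fun μ w => by simp [parityL_symbolBar]) hf

theorem DSq_parityS (hf : IsSuperfunction f) : DSq (parityS f) = parityS (DSq f) := by
  rw [DSq_eq hf.parityS, DSq_eq hf, D_parityS hf]
  have h1 : -parityS (D 1 f) = (-1 : ℂ) • parityS (D 1 f) := by module
  rw [h1, D_smul (hf.D 1).parityS, D_parityS (hf.D 1)]
  ext1 x
  simp [parityS_apply]

theorem conjS_parityS (f : Superfield) : conjS (parityS f) = parityS (conjS f) := by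
  ext x I
  simp only [conjS, parityS, map_mul, map_pow, map_neg, map_one]
  rw [add_comm]; ring

/-! ### The solution space is a graded representation of the supercharges -/

theorem superAct_eq (s : Spinor) (f : Superfield) : superAct s f =
    s 1 • Q 0 f + conj (s 1) • QBar 0 f + (-s 0) • Q 1 f +
      conj (-s 0) • QBar 1 f := by
  simp only [superAct, Fin.sum_univ_two, eps]
  simp [add_assoc]

theorem IsSuperfunction.superAct (hf : IsSuperfunction f) (s : Spinor) :
    IsSuperfunction (superAct s f) := by
  rw [superAct_eq]
  exact ((((hf.Q 0).smul _).add ((hf.QBar 0).smul _)).add ((hf.Q 1).smul _)).add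
    ((hf.QBar 1).smul _)

theorem superAct_smul (hf : IsSuperfunction f) (c : ℂ) (s : Spinor) :
    superAct s (c • f) = c • superAct s f := by
  simp only [superAct_eq, Q_smul hf, QBar_smul hf]
  module

theorem superAct_zero (s : Spinor) : superAct s 0 = 0 := by
  simpa using superAct_smul IsSuperfunction.zero 0 s

theorem D_superAct (hf : IsSuperfunction f) (s : Spinor) (a : Fin 2) :
    D a (superAct s f) = -superAct s (D a f) := by
  have q0 := (hf.Q 0).smul (s 1)
  have q1 := (hf.QBar 0).smul (conj (s 1))
  have q2 := (hf.Q 1).smul (-s 0)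
  have q3 := (hf.QBar 1).smul (conj (-s 0))
  rw [superAct_eq, superAct_eq, D_add ((q0.add q1).add q2) q3, D_add (q0.add q1) q2,
    D_add q0 q1, D_smul (hf.Q 0), D_smul (hf.QBar 0),
    D_smul (hf.Q 1), D_smul (hf.QBar 1), D_Q hf, D_Q hf, D_QBar hf, D_QBar hf]
  simp only [smul_neg, neg_add]

theorem DBar_superAct (hf : IsSuperfunction f) (s : Spinor) (a : Fin 2) :
    DBar a (superAct s f) = -superAct s (DBar a f) := by
  have q0 := (hf.Q 0).smul (s 1)
  have q1 := (hf.QBar 0).smul (conj (s 1))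
  have q2 := (hf.Q 1).smul (-s 0)
  have q3 := (hf.QBar 1).smul (conj (-s 0))
  rw [superAct_eq, superAct_eq, DBar_add ((q0.add q1).add q2) q3, DBar_add (q0.add q1) q2,
    DBar_add q0 q1, DBar_smul (hf.Q 0), DBar_smul (hf.QBar 0),
    DBar_smul (hf.Q 1), DBar_smul (hf.QBar 1), DBar_Q hf, DBar_Q hf, DBar_QBar hf, DBar_QBar hf]
  simp only [smul_neg, neg_add]

theorem conjS_superAct (hf : IsSuperfunction f) (s : Spinor) :
    conjS (superAct s f) = superAct s (conjS f) := by
  simp only [superAct_eq, conjS_add, conjS_smul, conjS_Q hf, conjS_QBar hf, Complex.conj_conj]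
  abel

theorem DSq_superAct (hf : IsSuperfunction f) (s : Spinor) :
    DSq (superAct s f) = superAct s (DSq f) := by
  rw [DSq_eq (hf.superAct s), DSq_eq hf, D_superAct hf, superAct_smul ((hf.D 1).D 0)]
  have h1 : -superAct s (D 1 f) = (-1 : ℂ) • superAct s (D 1 f) := by module
  rw [h1, D_smul ((hf.D 1).superAct s), D_superAct (hf.D 1)]
  module

theorem solutions_superAct {m : ℝ} (s : Spinor) (hf : f ∈ solutions m) :
    superAct s f ∈ solutions m := by
  obtain ⟨h, h0, h1, h2⟩ := hf
  refine ⟨h.superAct s, ?_, ?_, ?_⟩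
  · rw [DBar_superAct h, h0, superAct_zero, neg_zero]
  · rw [DBar_superAct h, h1, superAct_zero, neg_zero]
  · rw [DSq_superAct h, h2, superAct_smul h.conjS, conjS_superAct h]

theorem solutions_zero (m : ℝ) : (0 : Superfield) ∈ solutions m := by
  refine ⟨IsSuperfunction.zero, DBar_zero 0, DBar_zero 1, ?_⟩
  rw [conjS_zero, DSq_eq IsSuperfunction.zero, D_zero, D_zero]; simp

theorem solutions_add {m : ℝ} {g : Superfield} (hf : f ∈ solutions m) (hg : g ∈ solutions m) :
    f + g ∈ solutions m := by
  obtain ⟨h, h0, h1, h2⟩ := hf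
  obtain ⟨k, k0, k1, k2⟩ := hg
  refine ⟨h.add k, ?_, ?_, ?_⟩
  · rw [DBar_add h k, h0, k0, add_zero]
  · rw [DBar_add h k, h1, k1, add_zero]
  · rw [DSq_add h k, h2, k2, conjS_add, smul_add]

theorem solutions_smul {m : ℝ} (r : ℝ) (hf : f ∈ solutions m) : r • f ∈ solutions m := by
  obtain ⟨h, h0, h1, h2⟩ := hf
  have hr : r • f = (r : ℂ) • f := by ext x I; simp
  rw [hr]
  refine ⟨h.smul r, ?_, ?_, ?_⟩
  · rw [DBar_smul h, h0, smul_zero]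
  · rw [DBar_smul h, h1, smul_zero]
  · rw [DSq_smul h, h2, conjS_smul, Complex.conj_ofReal, smul_comm]

theorem solutions_parityS {m : ℝ} (hf : f ∈ solutions m) : parityS f ∈ solutions m := by
  obtain ⟨h, h0, h1, h2⟩ := hf
  have hz : parityS 0 = 0 := funext fun _ => map_zero parityL
  refine ⟨h.parityS, ?_, ?_, ?_⟩
  · rw [DBar_parityS h, h0, hz, neg_zero]
  · rw [DBar_parityS h, h1, hz, neg_zero]
  · rw [DSq_parityS h, h2, conjS_parityS]
    exact funext fun x => map_smul parityL _ _

end SuperPoincare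

namespace SuperPoincare

/-! ### The action of `SL(2,ℂ)` on the exterior algebras -/

theorem sum_finset_fin_two {M : Type*} [AddCommMonoid M] (g : Finset (Fin 2) → M) :
    ∑ I, g I = g ∅ + g {0} + g {1} + g Finset.univ := by
  rw [show (Finset.univ : Finset (Finset (Fin 2))) = {∅, {0}, {1}, Finset.univ} by decide]
  rw [Finset.sum_insert (by decide), Finset.sum_insert (by decide),
    Finset.sum_insert (by decide), Finset.sum_singleton]
  abel

theorem minor_of_card_eq (A : Matrix (Fin 2) (Fin 2) ℂ) {I J : Finset (Fin 2)} {n : ℕ}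
    (hI : I.card = n) (hJ : J.card = n) :
    minor A I J = (A.submatrix (I.orderEmbOfFin hI) (J.orderEmbOfFin hJ)).det := by
  subst hI
  exact dif_pos hJ.symm

theorem minor_empty (A : Matrix (Fin 2) (Fin 2) ℂ) : minor A ∅ ∅ = 1 := by
  rw [minor_of_card_eq A (n := 0) rfl rfl]
  exact Matrix.det_isEmpty

theorem minor_singleton (A : Matrix (Fin 2) (Fin 2) ℂ) (a b : Fin 2) :
    minor A {a} {b} = A a b := by
  rw [minor_of_card_eq A (Finset.card_singleton a) (Finset.card_singleton b), Matrix.det_fin_one]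
  simp

theorem minor_univ (A : Matrix (Fin 2) (Fin 2) ℂ) :
    minor A Finset.univ Finset.univ = A.det := by
  have hid : ((Finset.univ : Finset (Fin 2)).orderEmbOfFin (k := 2) rfl : Fin 2 → Fin 2) = id :=
    (Finset.orderEmbOfFin_unique _ (fun _ => Finset.mem_univ _) strictMono_id).symm
  rw [minor_of_card_eq A (n := 2) rfl rfl, hid]; rfl

theorem minor_of_card_ne (A : Matrix (Fin 2) (Fin 2) ℂ) {I J : Finset (Fin 2)}
    (h : I.card ≠ J.card) : minor A I J = 0 := dif_neg h

/-- The coercion of `SL(2,ℂ)` to matrices. -/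
abbrev mat (A : SL2) : Matrix (Fin 2) (Fin 2) ℂ := (A : Matrix (Fin 2) (Fin 2) ℂ)

theorem mat_det (A : SL2) : mat A 0 0 * mat A 1 1 - mat A 0 1 * mat A 1 0 = 1 := by
  have := A.det_coe
  rwa [Matrix.det_fin_two] at this

theorem spinFock_empty (A : SL2) (w : Fock) : spinFock A w ∅ = w ∅ := by
  rw [spinFock, sum_finset_fin_two, minor_empty, minor_of_card_ne _ (by decide),
    minor_of_card_ne _ (by decide), minor_of_card_ne _ (by decide)]
  ring

theorem spinFock_singleton (A : SL2) (w : Fock) (a : Fin 2) :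
    spinFock A w {a} = mat A a 0 * w {0} + mat A a 1 * w {1} := by
  rw [spinFock, sum_finset_fin_two, minor_singleton, minor_singleton,
    minor_of_card_ne _ (by simp), minor_of_card_ne _ (by simp)]
  ring

theorem spinFock_univ (A : SL2) (w : Fock) : spinFock A w Finset.univ = w Finset.univ := by
  rw [spinFock, sum_finset_fin_two, minor_univ, minor_of_card_ne _ (by decide),
    minor_of_card_ne _ (by decide), minor_of_card_ne _ (by decide), A.det_coe]
  ring

theorem fock_ext {v w : Fock} (h0 : v ∅ = w ∅) (h1 : ∀ a, v {a} = w {a})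
    (h2 : v Finset.univ = w Finset.univ) : v = w := by
  ext I
  rcases finset_fin_two_cases I with rfl | rfl | rfl | rfl
  · exact h0
  · exact h1 0
  · exact h1 1
  · exact h2

theorem spinFock_add (A : SL2) (v w : Fock) :
    spinFock A (v + w) = spinFock A v + spinFock A w := by
  ext I; simp [spinFock, mul_add, Finset.sum_add_distrib]

theorem spinFock_smul (A : SL2) (c : ℂ) (w : Fock) : spinFock A (c • w) = c • spinFock A w := by
  ext I; simp only [spinFock, Pi.smul_apply, smul_eq_mul, Finset.mul_sum]
  exact Finset.sum_congr rfl fun J _ => by ring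

/-- The action of `SL(2,ℂ)` on `⋀ S_+^*` as a linear map. -/
def spinFockL (A : SL2) : Fock →ₗ[ℂ] Fock where
  toFun := spinFock A
  map_add' := spinFock_add A
  map_smul' := spinFock_smul A

theorem spinFock_ext (A : SL2) (c : Fin 2) (w : Fock) :
    spinFock A (ext c w) = ∑ b, mat A b c • ext b (spinFock A w) := by
  have hd := mat_det A
  rw [Fin.sum_univ_two]
  apply fock_ext
  · simp [spinFock_empty, ext]
  · intro a
    simp only [spinFock_singleton, Pi.add_apply, Pi.smul_apply, ext, smul_eq_mul]
    fin_cases c <;> fin_cases a <;>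
      simp [koszul_zero, koszul_one, spinFock_empty]
  · simp only [spinFock_univ, Pi.add_apply, Pi.smul_apply, ext, smul_eq_mul, Finset.mem_univ,
      if_true, koszul_zero, koszul_one, erase_univ_zero, erase_univ_one, spinFock_singleton]
    fin_cases c
    · simp only [Fin.zero_eta, erase_univ_zero, koszul_zero]
      linear_combination (-w {1}) * hd
    · simp only [Fin.mk_one, erase_univ_one, koszul_one, Finset.mem_univ, if_true]
      linear_combination (w {0}) * hd

theorem contr_spinFock (A : SL2) (a : Fin 2) (w : Fock) :
    contr a (spinFock A w) = ∑ b, mat A a b • spinFock A (contr b w) := by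
  have hd := mat_det A
  rw [Fin.sum_univ_two]
  apply fock_ext
  · simp only [Pi.add_apply, Pi.smul_apply, spinFock_empty, contr, smul_eq_mul]
    fin_cases a <;>
      simp [koszul_zero, koszul_one, spinFock_singleton]
  · intro c
    simp only [spinFock_singleton, Pi.add_apply, Pi.smul_apply, contr, smul_eq_mul]
    fin_cases c <;> fin_cases a <;>
      simp [koszul_zero, koszul_one, spinFock_univ, insert_zero_one, insert_one_zero]
    · ring
    · linear_combination (w Finset.univ) * hd
    · linear_combination (-w Finset.univ) * hd
    · ring
  · simp only [spinFock_univ, Pi.add_apply, Pi.smul_apply, contr, smul_eq_mul, Finset.mem_univ,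
      if_true]
    ring

theorem spinFock2_apply (A : SL2) (w : Fock2) (I J : Finset (Fin 2)) :
    spinFock2 A w (I, J) =
      ∑ L, conj (minor (mat A) J L) * spinFock A (fun K => w (K, L)) I := by
  rw [spinFock2, Fintype.sum_prod_type, Finset.sum_comm]
  refine Finset.sum_congr rfl fun L _ => ?_
  rw [spinFock, Finset.mul_sum]
  exact Finset.sum_congr rfl fun K _ => by ring

theorem spinFock2_add (A : SL2) (v w : Fock2) :
    spinFock2 A (v + w) = spinFock2 A v + spinFock2 A w := by
  ext I; simp [spinFock2, mul_add, Finset.sum_add_distrib]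

theorem spinFock2_smul (A : SL2) (c : ℂ) (w : Fock2) :
    spinFock2 A (c • w) = c • spinFock2 A w := by
  ext I; simp only [spinFock2, Pi.smul_apply, smul_eq_mul, Finset.mul_sum]
  exact Finset.sum_congr rfl fun J _ => by ring

/-- The action of `SL(2,ℂ)` on `⋀ S_ℂ^*` as a linear map. -/
def spinFock2L (A : SL2) : Fock2 →ₗ[ℂ] Fock2 where
  toFun := spinFock2 A
  map_add' := spinFock2_add A
  map_smul' := spinFock2_smul A

theorem spinFock2L_apply (A : SL2) (w : Fock2) : spinFock2L A w = spinFock2 A w := rfl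

theorem spinFock2_thetaL (A : SL2) (c : Fin 2) (w : Fock2) :
    spinFock2 A (thetaL c w) = ∑ b, mat A b c • thetaL b (spinFock2 A w) := by
  ext ⟨I, J⟩
  have h1 : ∀ L, (fun K => thetaL c w (K, L)) = ext c (fun K => w (K, L)) := fun L => rfl
  have h2 : ∀ b, thetaL b (spinFock2 A w) (I, J) = ∑ L, conj (minor (mat A) J L) *
      ext b (spinFock A (fun K => w (K, L))) I := by
    intro b
    change (if b ∈ I then koszul b I * spinFock2 A w (I.erase b, J) else 0) = _
    simp only [ext]
    split_ifs with h
    · rw [spinFock2_apply, Finset.mul_sum]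
      exact Finset.sum_congr rfl fun L _ => by ring
    · simp
  simp only [spinFock2_apply, h1, spinFock_ext, Finset.sum_apply, Pi.smul_apply, h2, smul_eq_mul,
    Finset.mul_sum]
  rw [Finset.sum_comm]
  exact Finset.sum_congr rfl fun b _ => Finset.sum_congr rfl fun L _ => by ring

theorem dThetaL_spinFock2 (A : SL2) (a : Fin 2) (w : Fock2) :
    dThetaL a (spinFock2 A w) = ∑ b, mat A a b • spinFock2 A (dThetaL b w) := by
  ext ⟨I, J⟩
  have h1 : ∀ b L, (fun K => dThetaL b w (K, L)) = contr b (fun K => w (K, L)) := fun b L => rfl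
  have h2 : dThetaL a (spinFock2 A w) (I, J) = ∑ L, conj (minor (mat A) J L) *
      contr a (spinFock A (fun K => w (K, L))) I := by
    change (if a ∈ I then 0 else koszul a I * spinFock2 A w (insert a I, J)) = _
    simp only [contr]
    split_ifs with h
    · simp
    · rw [spinFock2_apply, Finset.mul_sum]
      exact Finset.sum_congr rfl fun L _ => by ring
  rw [h2]
  simp only [contr_spinFock, Finset.sum_apply, Pi.smul_apply, smul_eq_mul, Finset.mul_sum,
    spinFock2_apply, h1]
  rw [Finset.sum_comm]
  exact Finset.sum_congr rfl fun b _ => Finset.sum_congr rfl fun L _ => by ring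

theorem conjL_spinFock2 (A : SL2) (w : Fock2) :
    conjL (spinFock2 A w) = spinFock2 A (conjL w) := by
  ext ⟨I, J⟩
  simp only [conjL, LinearMap.coe_mk, AddHom.coe_mk, spinFock2, map_sum, map_mul,
    Complex.conj_conj, Fintype.sum_prod_type, Finset.mul_sum]
  rw [Finset.sum_comm]
  refine Finset.sum_congr rfl fun K _ => Finset.sum_congr rfl fun L _ => ?_
  by_cases h1 : J.card = L.card
  · by_cases h2 : I.card = K.card
    · rw [h1, h2]; ring
    · rw [minor_of_card_ne _ h2]; simp
  · rw [minor_of_card_ne _ h1]; simp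

theorem spinFock2_thetaBarL (A : SL2) (c : Fin 2) (w : Fock2) :
    spinFock2 A (thetaBarL c w) = ∑ b, conj (mat A b c) • thetaBarL b (spinFock2 A w) := by
  rw [← conjL_conjL (spinFock2 A (thetaBarL c w)), conjL_spinFock2, conjL_thetaBarL,
    spinFock2_thetaL, map_sum]
  simp only [conjL_smul, conjL_thetaL, ← conjL_spinFock2, conjL_conjL]

/-! ### Lorentz transformations -/

theorem lorentz_smul (A : SL2) (c : ℝ) (v : Spacetime) : lorentz A (c • v) = c • lorentz A v := by
  have h : toHerm (c • v) = (c : ℂ) • toHerm v := by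
    ext i j; fin_cases i <;> fin_cases j <;> simp [toHerm] <;> ring
  rw [lorentz, h, Matrix.mul_smul, Matrix.smul_mul]
  ext i; fin_cases i <;> simp [lorentz, ofHerm] <;> ring

/-- The Lorentz transformation as a continuous linear map. -/
def lorentzL (A : SL2) : Spacetime →L[ℝ] Spacetime :=
  LinearMap.toContinuousLinearMap
    { toFun := lorentz A
      map_add' := lorentz_add A
      map_smul' := lorentz_smul A }

theorem lorentzL_apply (A : SL2) (v : Spacetime) : lorentzL A v = lorentz A v := rfl

theorem sum_smul_basisVec (v : Spacetime) : ∑ μ, v μ • basisVec μ = v := by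
  ext ν; simp [basisVec, Pi.single_apply]

theorem lorentz_lorentz_inv (A : SL2) (v : Spacetime) : lorentz A (lorentz A⁻¹ v) = v := by
  rw [← lorentz_mul, mul_inv_cancel, lorentz_one]

theorem lorentz_inv_lorentz (A : SL2) (v : Spacetime) : lorentz A⁻¹ (lorentz A v) = v := by
  rw [← lorentz_mul, inv_mul_cancel, lorentz_one]

theorem mat_inv (A : SL2) : mat A⁻¹ = !![mat A 1 1, -mat A 0 1; -mat A 1 0, mat A 0 0] := by
  rw [mat, Matrix.SpecialLinearGroup.coe_inv, Matrix.adjugate_fin_two]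

set_option maxHeartbeats 4000000 in
theorem gammaLow_lorentz_inv (A : SL2) (a b : Fin 2) (ν : Fin 4) :
    ∑ μ, gammaLow μ a b * (lorentz A⁻¹ (basisVec μ) ν : ℂ) =
      ∑ c, ∑ d, mat A a c * conj (mat A b d) * gammaLow ν c d := by
  have hinv := mat_inv A
  simp only [lorentz]
  rw [← mat, hinv]
  generalize mat A = M
  simp only [Fin.sum_univ_four, Fin.sum_univ_two, gammaLow, eps, gammaUp]
  fin_cases ν <;> fin_cases a <;> fin_cases b <;> apply Complex.ext <;>
    simp [ofHerm, toHerm, basisVec, Matrix.mul_apply, Fin.sum_univ_two,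
      Matrix.conjTranspose_apply] <;> ring

/-! ### The action of the Poincare group on superfunctions -/

variable {f : Superfield}

theorem IsSuperfunction.act (hf : IsSuperfunction f) (g : Poincare) :
    IsSuperfunction (act g f) := by
  have h1 : ContDiff ℝ ∞ (fun x : Spacetime => f (lorentzL g.lin⁻¹ (x - g.trans))) :=
    ContDiff.comp hf ((lorentzL g.lin⁻¹).contDiff.comp (contDiff_id.sub contDiff_const))
  exact contDiff_linearC (spinFock2L g.lin) h1

theorem partialX_comp_poincare {F : Type} [NormedAddCommGroup F] [NormedSpace ℝ F]
    {f : Spacetime → F} (hf : Differentiable ℝ f) (g : Poincare) (μ : Fin 4) (x : Spacetime) :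
    partialX μ (fun x => f (lorentz g.lin⁻¹ (x - g.trans))) x =
      ∑ ν, lorentz g.lin⁻¹ (basisVec μ) ν • partialX ν f (lorentz g.lin⁻¹ (x - g.trans)) := by
  have h1 : HasFDerivAt (fun x : Spacetime => lorentz g.lin⁻¹ (x - g.trans))
      ((lorentzL g.lin⁻¹).comp (ContinuousLinearMap.id ℝ Spacetime)) x :=
    HasFDerivAt.comp x (g := lorentzL g.lin⁻¹) (f := fun x : Spacetime => x - g.trans)
      (lorentzL g.lin⁻¹).hasFDerivAt ((hasFDerivAt_id x).sub_const g.trans)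
  have h2 := ((hf _).hasFDerivAt.comp x h1).fderiv
  rw [partialX, show (fun x => f (lorentz g.lin⁻¹ (x - g.trans))) =
    f ∘ (fun x : Spacetime => lorentz g.lin⁻¹ (x - g.trans)) from rfl, h2,
    ContinuousLinearMap.comp_apply, ContinuousLinearMap.comp_apply,
    ContinuousLinearMap.id_apply, lorentzL_apply]
  conv_lhs => rw [← sum_smul_basisVec (lorentz g.lin⁻¹ (basisVec μ)), map_sum]
  simp only [map_smul]; rfl

theorem partialX_act (hf : IsSuperfunction f) (g : Poincare) (μ : Fin 4) (x : Spacetime) :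
    partialX μ (act g f) x = ∑ ν, (lorentz g.lin⁻¹ (basisVec μ) ν : ℂ) •
      spinFock2 g.lin (partialX ν f (lorentz g.lin⁻¹ (x - g.trans))) := by
  have hd : Differentiable ℝ f := ContDiff.differentiable hf (by simp)
  have h1 : DifferentiableAt ℝ (fun x => f (lorentz g.lin⁻¹ (x - g.trans))) x :=
    (hd _).comp x ((lorentzL g.lin⁻¹).differentiableAt.comp x
      (differentiableAt_id.sub_const g.trans))
  have h2 := partialX_linearC (spinFock2L g.lin) h1 μ
  rw [partialX_comp_poincare hd, map_sum] at h2
  refine h2.trans (Finset.sum_congr rfl fun ν _ => ?_)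
  rw [← spinFock2L_apply, ← map_smul]
  congr 1

theorem D_act (hf : IsSuperfunction f) (g : Poincare) (a : Fin 2) :
    D a (act g f) = ∑ c, mat g.lin a c • act g (D c f) := by
  ext1 x
  rw [D_eq_fieldOp]
  simp only [D_eq_fieldOp, fieldOp, partialX_act hf, LinearMap.neg_apply, Finset.sum_neg_distrib,
    Finset.sum_apply, Pi.smul_apply, act, dThetaL_spinFock2, map_sum, map_smul]
  simp only [← spinFock2L_apply, map_add, map_neg, map_sum, smul_add, Finset.sum_add_distrib]
  congr 1
  simp only [smul_neg, Finset.sum_neg_distrib, neg_inj, symbolBar, LinearMap.sum_apply,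
    LinearMap.smul_apply, map_sum, map_smul]
  simp only [spinFock2L_apply, spinFock2_thetaBarL]
  simp only [Finset.smul_sum, smul_smul]
  generalize lorentz g.lin⁻¹ (x - g.trans) = y
  have key := gammaLow_lorentz_inv g.lin a
  calc _ = ∑ b, ∑ ν, (∑ μ, gammaLow μ a b * (lorentz g.lin⁻¹ (basisVec μ) ν : ℂ)) •
        thetaBarL b (spinFock2 g.lin (partialX ν f y)) := by
        simp only [Finset.sum_smul]
        rw [Finset.sum_comm, Finset.sum_congr rfl fun ν _ => Finset.sum_comm, Finset.sum_comm]
        refine Finset.sum_congr rfl fun b _ => Finset.sum_congr rfl fun ν _ =>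
          Finset.sum_congr rfl fun μ _ => ?_
        rw [mul_comm]
    _ = _ := by
        simp only [key, Finset.sum_smul]
        rw [Finset.sum_comm]
        have : ∀ ν : Fin 4, ∑ b, ∑ c, ∑ d, (mat g.lin a c * conj (mat g.lin b d) *
            gammaLow ν c d) • thetaBarL b (spinFock2 g.lin (partialX ν f y)) =
            ∑ c, ∑ d, ∑ b, (mat g.lin a c * conj (mat g.lin b d) *
            gammaLow ν c d) • thetaBarL b (spinFock2 g.lin (partialX ν f y)) := by
          intro ν
          rw [Finset.sum_comm]
          exact Finset.sum_congr rfl fun c _ => Finset.sum_comm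
        rw [Finset.sum_congr rfl fun ν _ => this ν, Finset.sum_comm]
        refine Finset.sum_congr rfl fun c _ => Finset.sum_congr rfl fun ν _ =>
          Finset.sum_congr rfl fun d _ => Finset.sum_congr rfl fun b _ => ?_
        congr 1; ring

theorem conjS_act (g : Poincare) (f : Superfield) : conjS (act g f) = act g (conjS f) :=
  funext fun _ => conjL_spinFock2 g.lin _

theorem DBar_act (hf : IsSuperfunction f) (g : Poincare) (a : Fin 2) :
    DBar a (act g f) = ∑ c, conj (mat g.lin a c) • act g (DBar c f) := by
  have h := congrArg conjS (D_act hf.conjS g a)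
  rw [conjS_D (hf.conjS.act g), conjS_act, conjS_conjS] at h
  rw [h]
  have hsum : ∀ F : Fin 2 → Superfield, conjS (∑ c, F c) = ∑ c, conjS (F c) := fun F => by
    simp only [Fin.sum_univ_two, conjS_add]
  rw [hsum]
  refine Finset.sum_congr rfl fun c _ => ?_
  rw [conjS_smul, conjS_act, conjS_D hf.conjS, conjS_conjS]

theorem act_smul (g : Poincare) (c : ℂ) (f : Superfield) : act g (c • f) = c • act g f :=
  funext fun _ => spinFock2_smul g.lin c _

theorem act_add (g : Poincare) (f h : Superfield) : act g (f + h) = act g f + act g h :=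
  funext fun _ => spinFock2_add g.lin _ _

theorem act_zero (g : Poincare) : act g 0 = 0 := by
  simpa using act_smul g 0 0

theorem DSq_act (hf : IsSuperfunction f) (g : Poincare) : DSq (act g f) = act g (DSq f) := by
  have hd := mat_det g.lin
  have hDD : ∀ a, D a (D a f) = 0 := fun a => self_eq_neg.1 (D_D hf a a)
  rw [DSq_eq (hf.act g), DSq_eq hf, D_act hf, Fin.sum_univ_two,
    D_add (((hf.D 0).act g).smul _) (((hf.D 1).act g).smul _), D_smul ((hf.D 0).act g),
    D_smul ((hf.D 1).act g), D_act (hf.D 0), D_act (hf.D 1), Fin.sum_univ_two, Fin.sum_univ_two,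
    hDD, hDD, D_D hf 1 0, act_smul, act_zero]
  have : act g (-D 0 (D 1 f)) = -act g (D 0 (D 1 f)) := by
    simpa using act_smul g (-1) (D 0 (D 1 f))
  rw [this]
  congr 1
  have h1 : act g (D 0 (D 1 f)) =
      (mat g.lin 0 0 * mat g.lin 1 1 - mat g.lin 0 1 * mat g.lin 1 0) • act g (D 0 (D 1 f)) := by
    rw [hd, one_smul]
  conv_rhs => rw [h1]
  module

theorem solutions_act {m : ℝ} (g : Poincare) (hf : f ∈ solutions m) : act g f ∈ solutions m := by
  obtain ⟨h, h0, h1, h2⟩ := hf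
  refine ⟨h.act g, ?_, ?_, ?_⟩
  · rw [DBar_act h, Fin.sum_univ_two, h0, h1, act_zero]; simp
  · rw [DBar_act h, Fin.sum_univ_two, h0, h1, act_zero]; simp
  · rw [DSq_act h, h2, act_smul, conjS_act]

end SuperPoincare

namespace SuperPoincare

/-! ### Components of chiral superfunctions -/

/-- The scalar operator `Γ_{ab}^μ ∂_μ`. -/
def dslash (a b : Fin 2) (φ : Spacetime → ℂ) : Spacetime → ℂ := fun x =>
  ∑ μ, gammaLow μ a b * partialX μ φ x

theorem contDiff_dslash {φ : Spacetime → ℂ} (hφ : ContDiff ℝ ∞ φ) (a b : Fin 2) :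
    ContDiff ℝ ∞ (dslash a b φ) :=
  ContDiff.sum fun μ _ => contDiff_const.mul (contDiff_partialX hφ μ)

theorem ContDiff.differentiableAt_top {F G : Type} [NormedAddCommGroup F] [NormedSpace ℝ F]
    [NormedAddCommGroup G] [NormedSpace ℝ G] {φ : F → G} (hφ : ContDiff ℝ ∞ φ) (x : F) :
    DifferentiableAt ℝ φ x := (hφ.differentiable (by simp)).differentiableAt

theorem dslash_add {φ ψ : Spacetime → ℂ} (hφ : ContDiff ℝ ∞ φ) (hψ : ContDiff ℝ ∞ ψ)
    (a b : Fin 2) (x : Spacetime) :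
    dslash a b (fun y => φ y + ψ y) x = dslash a b φ x + dslash a b ψ x := by
  simp only [dslash, partialX_add (ContDiff.differentiableAt_top hφ x)
    (ContDiff.differentiableAt_top hψ x), mul_add, Finset.sum_add_distrib]

theorem dslash_const_mul {φ : Spacetime → ℂ} (hφ : ContDiff ℝ ∞ φ) (c : ℂ)
    (a b : Fin 2) (x : Spacetime) :
    dslash a b (fun y => c * φ y) x = c * dslash a b φ x := by
  simp only [dslash, partialX_const_smul c (ContDiff.differentiableAt_top hφ x), Finset.mul_sum]
  exact Finset.sum_congr rfl fun μ _ => by ring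

theorem dslash_neg {φ : Spacetime → ℂ} (hφ : ContDiff ℝ ∞ φ) (a b : Fin 2) (x : Spacetime) :
    dslash a b (fun y => -φ y) x = -dslash a b φ x := by
  simpa using dslash_const_mul hφ (-1) a b x

theorem dslash_zero (a b : Fin 2) (x : Spacetime) : dslash a b (fun _ => 0) x = 0 := by
  simp [dslash, partialX]

theorem dslash_conj (φ : Spacetime → ℂ) (a b : Fin 2) (x : Spacetime) :
    dslash a b (fun y => conj (φ y)) x = conj (dslash b a φ x) := by
  simp only [dslash, partialX_conj, map_sum, map_mul, conj_gammaLow]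

theorem dslash_dslash {φ : Spacetime → ℂ} (hφ : ContDiff ℝ ∞ φ) (a b c d : Fin 2)
    (x : Spacetime) : dslash a b (dslash c d φ) x =
      ∑ μ, ∑ ν, gammaLow μ a b * gammaLow ν c d * partialX μ (partialX ν φ) x := by
  have h : ∀ μ, partialX μ (dslash c d φ) x =
      ∑ ν, gammaLow ν c d * partialX μ (partialX ν φ) x := by
    intro μ
    have h1 : ∀ ν, DifferentiableAt ℝ (fun y => gammaLow ν c d * partialX ν φ y) x := fun ν =>
      ContDiff.differentiableAt_top (contDiff_const.mul (contDiff_partialX hφ ν)) x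
    have h2 : partialX μ (dslash c d φ) x =
        ∑ ν, partialX μ (fun y => gammaLow ν c d * partialX ν φ y) x := by
      simp only [partialX] at h1 ⊢
      rw [show dslash c d φ = fun y => ∑ ν, gammaLow ν c d * fderiv ℝ φ y (basisVec ν) from rfl,
        fderiv_fun_sum (fun ν _ => h1 ν)]
      simp
    rw [h2]
    exact Finset.sum_congr rfl fun ν _ => partialX_const_smul _
      (ContDiff.differentiableAt_top (contDiff_partialX hφ ν) x) μ
  simp only [dslash.eq_1 a b, h, Finset.mul_sum, mul_assoc]

theorem box_eq_dslash {φ : Spacetime → ℂ} (hφ : ContDiff ℝ ∞ φ) (x : Spacetime) :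
    box φ x = dslash 0 0 (dslash 1 1 φ) x - dslash 1 0 (dslash 0 1 φ) x := by
  rw [dslash_dslash hφ, dslash_dslash hφ]
  simp [Fin.sum_univ_four, gammaLow, Fin.sum_univ_two, eps, gammaUp, box]
  rw [partialX_comm hφ 1 0, partialX_comm hφ 3 2]
  ring

theorem box_eq_dslash' {φ : Spacetime → ℂ} (hφ : ContDiff ℝ ∞ φ) (x : Spacetime) :
    box φ x = dslash 1 1 (dslash 0 0 φ) x - dslash 0 1 (dslash 1 0 φ) x := by
  rw [dslash_dslash hφ, dslash_dslash hφ]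
  simp [Fin.sum_univ_four, gammaLow, Fin.sum_univ_two, eps, gammaUp, box]
  rw [partialX_comm hφ 1 0, partialX_comm hφ 3 2]
  ring

theorem dslash_comm {φ : Spacetime → ℂ} (hφ : ContDiff ℝ ∞ φ) (a b c d : Fin 2) (x : Spacetime) :
    dslash a b (dslash c d φ) x = dslash c d (dslash a b φ) x := by
  rw [dslash_dslash hφ, dslash_dslash hφ, Finset.sum_comm]
  refine Finset.sum_congr rfl fun ν _ => Finset.sum_congr rfl fun μ _ => ?_
  rw [partialX_comm hφ]; ring

variable {f : Superfield}

theorem IsSuperfunction.component (hf : IsSuperfunction f) (I : Finset (Fin 2) × Finset (Fin 2)) :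
    ContDiff ℝ ∞ (fun x => f x I) := (contDiff_pi.1 hf) I

theorem gammaPartial_apply (hf : IsSuperfunction f) (a b : Fin 2) (x : Spacetime)
    (I : Finset (Fin 2) × Finset (Fin 2)) :
    gammaPartial a b f x I = dslash a b (fun y => f y I) x := by
  simp only [gammaPartial, Finset.sum_apply, Pi.smul_apply, dslash, smul_eq_mul,
    partialX_apply (hf.differentiableAt x)]

theorem DBar_apply (hf : IsSuperfunction f) (b : Fin 2) (x : Spacetime) (I J : Finset (Fin 2)) :
    DBar b f x (I, J) =
      (if b ∈ J then 0 else (-1) ^ I.card * koszul b J * f x (I, insert b J)) -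
      ∑ a, if a ∈ I then koszul a I * dslash a b (fun y => f y (I.erase a, J)) x else 0 := by
  simp only [DBar, Pi.sub_apply, Finset.sum_apply, partialThetaBar, mulTheta,
    gammaPartial_apply hf]

theorem D_apply (hf : IsSuperfunction f) (a : Fin 2) (x : Spacetime) (I J : Finset (Fin 2)) :
    D a f x (I, J) = (if a ∈ I then 0 else koszul a I * f x (insert a I, J)) -
      ∑ b, if b ∈ J then (-1) ^ I.card * koszul b J *
        dslash a b (fun y => f y (I, J.erase b)) x else 0 := by
  simp only [D, Pi.sub_apply, Finset.sum_apply, partialTheta, mulThetaBar,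
    gammaPartial_apply hf]

/-- `f` is a chiral superfunction. -/
structure IsChiral (f : Superfield) : Prop where
  smooth : IsSuperfunction f
  dbar : ∀ b, DBar b f = 0

theorem IsChiral.of_dbar (hf : IsSuperfunction f) (h0 : DBar 0 f = 0) (h1 : DBar 1 f = 0) :
    IsChiral f := ⟨hf, fun b => by fin_cases b <;> assumption⟩

theorem IsChiral.insert_eq (hf : IsChiral f) {b : Fin 2} {J : Finset (Fin 2)} (hb : b ∉ J)
    (x : Spacetime) (I : Finset (Fin 2)) :
    (-1) ^ I.card * koszul b J * f x (I, insert b J) =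
      ∑ a, if a ∈ I then koszul a I * dslash a b (fun y => f y (I.erase a, J)) x else 0 := by
  have h := congrFun (congrFun (hf.dbar b) x) (I, J)
  rw [DBar_apply hf.smooth, if_neg hb] at h
  exact sub_eq_zero.1 h

theorem koszul_empty (a : Fin 2) : koszul a ∅ = 1 := by simp [koszul]

theorem koszul_singleton (a : Fin 2) : koszul a {a} = 1 := by
  fin_cases a <;> simp [koszul_zero, koszul_one]

theorem IsChiral.empty_singleton (hf : IsChiral f) (x : Spacetime) (b : Fin 2) :
    f x (∅, {b}) = 0 := by
  have h := hf.insert_eq (Finset.notMem_empty b) x ∅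
  simpa [koszul_empty] using h

theorem IsChiral.singleton_singleton (hf : IsChiral f) (x : Spacetime) (a b : Fin 2) :
    f x ({a}, {b}) = -dslash a b (fun y => f y (∅, ∅)) x := by
  have h := hf.insert_eq (Finset.notMem_empty b) x {a}
  simp [koszul_empty, koszul_singleton] at h
  rw [← h, neg_neg]

theorem IsChiral.univ_singleton (hf : IsChiral f) (x : Spacetime) (b : Fin 2) :
    f x (Finset.univ, {b}) = dslash 0 b (fun y => f y ({1}, ∅)) x -
      dslash 1 b (fun y => f y ({0}, ∅)) x := by
  have h := hf.insert_eq (Finset.notMem_empty b) x Finset.univ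
  simp [koszul_empty, koszul_zero, koszul_one, erase_univ_zero, erase_univ_one] at h
  rw [h]; ring

theorem IsChiral.empty_univ (hf : IsChiral f) (x : Spacetime) : f x (∅, Finset.univ) = 0 := by
  have h := hf.insert_eq (b := 0) (J := {1}) (by decide) x ∅
  simpa [koszul_zero, insert_zero_one] using h

theorem IsChiral.singleton_univ (hf : IsChiral f) (x : Spacetime) (a : Fin 2) :
    f x ({a}, Finset.univ) = 0 := by
  have h := hf.insert_eq (b := 0) (J := {1}) (by decide) x {a}
  simpa [koszul_zero, insert_zero_one, koszul_singleton, hf.empty_singleton, dslash_zero] using h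

theorem IsChiral.univ_univ (hf : IsChiral f) (x : Spacetime) :
    f x (Finset.univ, Finset.univ) = -box (fun y => f y (∅, ∅)) x := by
  have h := hf.insert_eq (b := 0) (J := {1}) (by decide) x Finset.univ
  have h2 := hf.smooth.component (∅, ∅)
  simp [koszul_zero, koszul_one, insert_zero_one, hf.singleton_singleton, erase_univ_zero,
    erase_univ_one] at h
  rw [dslash_neg (contDiff_dslash h2 1 1), dslash_neg (contDiff_dslash h2 0 1)] at h
  rw [h, box_eq_dslash h2]; ring

theorem IsChiral.ext {g : Superfield} (hf : IsChiral f) (hg : IsChiral g)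
    (h : ∀ x I, f x (I, ∅) = g x (I, ∅)) : f = g := by
  have h' : ∀ I, (fun y => f y (I, ∅)) = fun y => g y (I, ∅) := fun I => funext fun y => h y I
  ext x ⟨I, J⟩
  rcases finset_fin_two_cases J with rfl | rfl | rfl | rfl
  · exact h x I
  · rcases finset_fin_two_cases I with rfl | rfl | rfl | rfl <;>
      simp only [hf.empty_singleton, hg.empty_singleton, hf.singleton_singleton,
        hg.singleton_singleton, hf.univ_singleton, hg.univ_singleton, h']
  · rcases finset_fin_two_cases I with rfl | rfl | rfl | rfl <;>
      simp only [hf.empty_singleton, hg.empty_singleton, hf.singleton_singleton,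
        hg.singleton_singleton, hf.univ_singleton, hg.univ_singleton, h']
  · rcases finset_fin_two_cases I with rfl | rfl | rfl | rfl <;>
      simp only [hf.empty_univ, hg.empty_univ, hf.singleton_univ,
        hg.singleton_univ, hf.univ_univ, hg.univ_univ, h']

theorem IsChiral.add {g : Superfield} (hf : IsChiral f) (hg : IsChiral g) : IsChiral (f + g) :=
  ⟨hf.smooth.add hg.smooth, fun b => by
    rw [DBar_add hf.smooth hg.smooth, hf.dbar, hg.dbar, add_zero]⟩

theorem IsChiral.smul (hf : IsChiral f) (c : ℂ) : IsChiral (c • f) :=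
  ⟨hf.smooth.smul c, fun b => by rw [DBar_smul hf.smooth, hf.dbar, smul_zero]⟩

theorem IsChiral.conjS_DSq (hf : IsSuperfunction f) : IsChiral (conjS (DSq f)) :=
  ⟨hf.DSq.conjS, fun b => by rw [← conjS_D hf.DSq, D_DSq hf, conjS_zero]⟩

/-- The chiral superfunction with given components along the monomials in `θ`. -/
def chiralLift (c : Spacetime → Fock) : Superfield := fun x I =>
  let low : Fin 2 → ℂ := fun b =>
    if I.1 = Finset.univ then
      dslash 0 b (fun y => c y {1}) x - dslash 1 b (fun y => c y {0}) x
    else if I.1 = {0} then -dslash 0 b (fun y => c y ∅) x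
    else if I.1 = {1} then -dslash 1 b (fun y => c y ∅) x else 0
  if I.2 = ∅ then c x I.1 else if I.2 = {0} then low 0 else if I.2 = {1} then low 1
  else if I.1 = Finset.univ then -box (fun y => c y ∅) x else 0

theorem chiralLift_empty (c : Spacetime → Fock) (x : Spacetime) (I : Finset (Fin 2)) :
    chiralLift c x (I, ∅) = c x I := by simp [chiralLift]

theorem contDiff_box {φ : Spacetime → ℂ} (hφ : ContDiff ℝ ∞ φ) : ContDiff ℝ ∞ (box φ) := by
  unfold box
  have h := fun μ => contDiff_partialX (contDiff_partialX hφ μ) μ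
  exact (((h 0).sub (h 1)).sub (h 2)).sub (h 3)

theorem isSuperfunction_chiralLift {c : Spacetime → Fock} (hc : ContDiff ℝ ∞ c) :
    IsSuperfunction (chiralLift c) := by
  have hc' : ∀ I, ContDiff ℝ ∞ (fun y => c y I) := fun I => (contDiff_pi.1 hc) I
  have hd : ∀ a b I, ContDiff ℝ ∞ (dslash a b (fun y => c y I)) := fun a b I =>
    contDiff_dslash (hc' I) a b
  refine contDiff_pi.2 fun I => ?_
  simp only [chiralLift]
  split_ifs
  all_goals first
    | exact hc' _
    | exact (hd _ _ _).sub (hd _ _ _)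
    | exact (hd _ _ _).neg
    | exact (contDiff_box (hc' _)).neg
    | exact contDiff_const

theorem isChiral_chiralLift {c : Spacetime → Fock} (hc : ContDiff ℝ ∞ c) :
    IsChiral (chiralLift c) := by
  have hs := isSuperfunction_chiralLift hc
  have hc0 : ContDiff ℝ ∞ (fun y => c y ∅) := (contDiff_pi.1 hc) ∅
  have e1 : ({0} : Finset (Fin 2)) ≠ Finset.univ := by decide
  have e2 : ({1} : Finset (Fin 2)) ≠ Finset.univ := by decide
  have e3 : (∅ : Finset (Fin 2)) ≠ Finset.univ := by decide
  have e4 : (Finset.univ : Finset (Fin 2)) ≠ {0} := by decide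
  have e5 : (Finset.univ : Finset (Fin 2)) ≠ {1} := by decide
  have e6 : (∅ : Finset (Fin 2)) ≠ {0} := by decide
  have e7 : (∅ : Finset (Fin 2)) ≠ {1} := by decide
  have e8 : (Finset.univ : Finset (Fin 2)) ≠ ∅ := by decide
  refine ⟨hs, fun b => ?_⟩
  ext x ⟨I, J⟩
  have c1 := dslash_comm hc0 1 0 0 0 x
  have c2 := dslash_comm hc0 1 1 0 0 x
  have c3 := dslash_comm hc0 0 1 1 0 x
  have c4 := dslash_comm hc0 1 1 0 1 x
  rw [DBar_apply hs, Fin.sum_univ_two]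
  rcases finset_fin_two_cases J with rfl | rfl | rfl | rfl <;>
  rcases finset_fin_two_cases I with rfl | rfl | rfl | rfl <;> fin_cases b <;>
  simp [chiralLift, koszul_zero, koszul_one, erase_univ_zero, erase_univ_one, insert_zero_one,
    insert_one_zero, e1, e2, e3, e4, e5, e6, e7, e8, dslash_zero,
    dslash_neg (contDiff_dslash hc0 _ _), box_eq_dslash hc0, c1, c2, c3, c4] <;> ring

/-! ### The component equations -/

theorem sum_ite_singleton {M : Type*} [AddCommMonoid M] (b : Fin 2) (g : Fin 2 → M) :
    (∑ a, if a ∈ ({b} : Finset (Fin 2)) then g a else 0) = g b := by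
  simp

theorem IsChiral.DSq_empty (hf : IsChiral f) (x : Spacetime) :
    DSq f x (∅, ∅) = -(1 / 2) * f x (Finset.univ, ∅) := by
  rw [DSq_eq hf.smooth, Pi.smul_apply, Pi.smul_apply, D_apply (hf.smooth.D 1)]
  simp [koszul_zero, D_apply hf.smooth, koszul_one, insert_one_zero]

theorem IsChiral.DSq_singleton (hf : IsChiral f) (x : Spacetime) (b : Fin 2) :
    DSq f x (∅, {b}) = -(dslash 0 b (fun y => f y ({1}, ∅)) x -
      dslash 1 b (fun y => f y ({0}, ∅)) x) := by
  rw [DSq_eq hf.smooth, Pi.smul_apply, Pi.smul_apply, D_apply (hf.smooth.D 1)]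
  simp [koszul_zero, D_apply hf.smooth, koszul_one, insert_one_zero, koszul_singleton,
    hf.univ_singleton]
  ring

theorem IsChiral.DSq_univ (hf : IsChiral f) (x : Spacetime) :
    DSq f x (∅, Finset.univ) = 2 * box (fun y => f y (∅, ∅)) x := by
  have h2 := hf.smooth.component (∅, ∅)
  rw [DSq_eq hf.smooth, Pi.smul_apply, Pi.smul_apply, D_apply (hf.smooth.D 1)]
  have e1 : ∀ b, (fun y => D 1 f y (∅, {b})) =
      fun y => (-2 : ℂ) * dslash 1 b (fun y => f y (∅, ∅)) y := by
    intro b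
    ext y
    rw [D_apply hf.smooth, sum_ite_singleton]
    simp [koszul_one, koszul_singleton, hf.singleton_singleton]
    ring
  simp only [Fin.sum_univ_two, Finset.mem_univ, if_true, erase_univ_zero, erase_univ_one, e1,
    dslash_const_mul (contDiff_dslash h2 _ _)]
  rw [D_apply hf.smooth]
  simp [koszul_zero, koszul_one, insert_one_zero, erase_univ_zero, erase_univ_one,
    hf.univ_univ, hf.singleton_singleton, dslash_neg (contDiff_dslash h2 _ _)]
  rw [dslash_comm h2 1 0 0 1, dslash_comm h2 1 1 0 0,  box_eq_dslash h2,
    dslash_comm h2 1 0 0 1]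
  ring

theorem conjS_empty (f : Superfield) (x : Spacetime) (I : Finset (Fin 2)) :
    conjS f x (I, ∅) = conj (f x (∅, I)) := by simp [conjS]

theorem conjS_empty' (f : Superfield) (x : Spacetime) (J : Finset (Fin 2)) :
    conjS f x (∅, J) = conj (f x (J, ∅)) := by simp [conjS]

theorem mem_solutions_iff {m : ℝ} : f ∈ solutions m ↔ IsChiral f ∧
    (∀ x, f x (Finset.univ, ∅) = 2 * m * conj (f x (∅, ∅))) ∧
    (∀ x b, m * conj (f x ({b}, ∅)) = dslash 0 b (fun y => f y ({1}, ∅)) x -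
      dslash 1 b (fun y => f y ({0}, ∅)) x) ∧
    (∀ x, 2 * box (fun y => f y (∅, ∅)) x =
      -m * conj (f x (Finset.univ, ∅))) := by
  constructor
  · rintro ⟨hs, h0, h1, h2⟩
    have hc := IsChiral.of_dbar hs h0 h1
    refine ⟨hc, fun x => ?_, fun x b => ?_, fun x => ?_⟩
    · have h := congrFun (congrFun h2 x) (∅, ∅)
      rw [hc.DSq_empty, Pi.smul_apply, Pi.smul_apply, conjS_empty, smul_eq_mul] at h
      linear_combination (-2) * h
    · have h := congrFun (congrFun h2 x) (∅, {b})
      rw [hc.DSq_singleton, Pi.smul_apply, Pi.smul_apply, conjS_empty', smul_eq_mul] at h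
      linear_combination h
    · have h := congrFun (congrFun h2 x) (∅, Finset.univ)
      rw [hc.DSq_univ, Pi.smul_apply, Pi.smul_apply, conjS_empty', smul_eq_mul] at h
      exact h
  · rintro ⟨hc, h0, h1, h2⟩
    refine ⟨hc.smooth, hc.dbar 0, hc.dbar 1, ?_⟩
    have key : conjS (DSq f) = (-(m : ℂ)) • f := by
      refine (IsChiral.conjS_DSq hc.smooth).ext (hc.smul _) fun x I => ?_
      rw [conjS_empty, Pi.smul_apply, Pi.smul_apply, smul_eq_mul]
      have hm : conj (m : ℂ) = m := Complex.conj_ofReal m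
      have hsing : ∀ b : Fin 2, conj (DSq f x (∅, {b})) = -(m : ℂ) * f x ({b}, ∅) := by
        intro b
        rw [hc.DSq_singleton, ← h1]
        simp
      rcases finset_fin_two_cases I with rfl | rfl | rfl | rfl
      · rw [hc.DSq_empty, h0]
        simp [Complex.conj_ofNat]
        ring
      · exact hsing 0
      · exact hsing 1
      · rw [hc.DSq_univ, h2]
        simp
    have := congrArg conjS key
    rwa [conjS_conjS, conjS_smul, map_neg, Complex.conj_ofReal] at this

theorem dirac_iff {ψ : Spacetime → Spinor} {ξ : Spacetime → Fin 2 → ℂ} (m : ℝ)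
    (hξ : ∀ x a, ψ x a = Complex.exp (-(Complex.I * (Real.pi / 4 : ℝ))) * ξ x a)
    (hs : ∀ a, ContDiff ℝ ∞ fun x => ξ x a) (x : Spacetime) (a : Fin 2) :
    Complex.I * (∑ b, ∑ μ, gammaLow μ a b * partialX μ (spinorBarUp ψ b) x) + m * ψ x a = 0 ↔
      m * conj (ξ x a) = dslash 0 a (fun y => ξ y 1) x - dslash 1 a (fun y => ξ y 0) x := by
  set ζ := Complex.exp (-(Complex.I * (Real.pi / 4 : ℝ))) with hζ
  have hζ0 : ζ ≠ 0 := Complex.exp_ne_zero _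
  have hconj : conj ζ = Complex.I * ζ := by
    rw [hζ, ← Complex.exp_conj]
    have : Complex.I = Complex.exp (Real.pi / 2 * Complex.I) := Complex.exp_pi_div_two_mul_I.symm
    conv_rhs => rw [this]
    rw [← Complex.exp_add]
    congr 1
    simp [Complex.conj_ofNat]
    ring
  have hbar : ∀ b, (∑ μ, gammaLow μ a b * partialX μ (spinorBarUp ψ b) x) =
      conj (∑ c, eps b c * ζ * dslash b a (fun y => ξ y c) x) := by
    intro b
    have h1 : spinorBarUp ψ b = fun y => conj (∑ c, eps b c * ζ * ξ y c) := by
      ext y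
      simp only [spinorBarUp, hξ, map_sum, map_mul]
      have : ∀ c, conj (eps b c) = eps b c := fun c => by
        fin_cases b <;> fin_cases c <;> simp [eps]
      exact Finset.sum_congr rfl fun c _ => by rw [this]; ring
    have h2 := dslash_conj (fun y => ∑ c, eps b c * ζ * ξ y c) a b x
    rw [h1]
    refine h2.trans (congrArg _ ?_)
    simp only [Fin.sum_univ_two]
    rw [dslash_add (contDiff_const.mul (hs 0)) (contDiff_const.mul (hs 1)),
      dslash_const_mul (hs 0), dslash_const_mul (hs 1)]
  rw [Fin.sum_univ_two, hbar, hbar, hξ]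
  simp only [Fin.sum_univ_two, eps, map_add, map_mul, hconj]
  have hI := Complex.I_sq
  constructor
  · intro h
    have h' : ζ * (conj (m * conj (ξ x a)) -
        conj (dslash 0 a (fun y => ξ y 1) x - dslash 1 a (fun y => ξ y 0) x)) = 0 := by
      simp [-mul_eq_zero] at h ⊢
      linear_combination h - (ζ * (conj (dslash 0 a (fun y => ξ y 1) x) -
        conj (dslash 1 a (fun y => ξ y 0) x))) * hI
    have h3 := (mul_eq_zero.1 h').resolve_left hζ0
    exact (conj).injective (sub_eq_zero.1 h3)
  · intro h
    have h' := congrArg conj h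
    simp at h' ⊢
    linear_combination ζ * h' + (ζ * (conj (dslash 0 a (fun y => ξ y 1) x) -
        conj (dslash 1 a (fun y => ξ y 0) x))) * hI

theorem mem_componentSolutions_iff {m : ℝ} (hf : IsSuperfunction f) :
    components f ∈ componentSolutions m ↔
    (∀ x, box (fun y => f y (∅, ∅)) x + (m : ℂ) ^ 2 * f x (∅, ∅) = 0) ∧
    (∀ x b, m * conj (f x ({b}, ∅)) = dslash 0 b (fun y => f y ({1}, ∅)) x -
      dslash 1 b (fun y => f y ({0}, ∅)) x) := by
  have hd := dirac_iff (ψ := (components f).2) (ξ := fun x a => f x ({a}, ∅)) m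
    (fun x a => rfl) (fun a => hf.component _)
  constructor
  · rintro ⟨-, -, h1, h2⟩
    exact ⟨h1, fun x b => (hd x b).1 (h2 x b)⟩
  · rintro ⟨h1, h2⟩
    exact ⟨hf.component _, contDiff_pi.2 fun a => contDiff_const.mul (hf.component _), h1,
      fun x b => (hd x b).2 (h2 x b)⟩

theorem mem_solutions_iff_components {m : ℝ} : f ∈ solutions m ↔ IsChiral f ∧
    (∀ x, f x (Finset.univ, ∅) = 2 * m * conj (f x (∅, ∅))) ∧
    components f ∈ componentSolutions m := by
  rw [mem_solutions_iff]
  constructor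
  · rintro ⟨hc, h0, h1, h2⟩
    refine ⟨hc, h0, (mem_componentSolutions_iff hc.smooth).2 ⟨fun x => ?_, h1⟩⟩
    have h := h2 x
    rw [h0] at h
    simp [Complex.conj_ofNat] at h
    linear_combination h / 2
  · rintro ⟨hc, h0, h⟩
    obtain ⟨h2, h1⟩ := (mem_componentSolutions_iff hc.smooth).1 h
    refine ⟨hc, h0, h1, fun x => ?_⟩
    rw [h0]
    simp [Complex.conj_ofNat]
    linear_combination 2 * h2 x

theorem solutions_ext {m : ℝ} {g : Superfield} (hf : f ∈ solutions m)
    (hg : g ∈ solutions m) (h0 : ∀ x, f x (∅, ∅) = g x (∅, ∅))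
    (h1 : ∀ x a, f x ({a}, ∅) = g x ({a}, ∅)) : f = g := by
  rw [mem_solutions_iff_components] at hf hg
  refine hf.1.ext hg.1 fun x I => ?_
  rcases finset_fin_two_cases I with rfl | rfl | rfl | rfl
  · exact h0 x
  · exact h1 x 0
  · exact h1 x 1
  · rw [hf.2.1, hg.2.1, h0]

theorem bijOn_components (m : ℝ) :
    Set.BijOn components (solutions m) (componentSolutions m) := by
  have hζ0 : Complex.exp (-(Complex.I * (Real.pi / 4 : ℝ))) ≠ 0 := Complex.exp_ne_zero _
  refine ⟨fun f hf => (mem_solutions_iff_components.1 hf).2.2, fun f hf g hg h => ?_, ?_⟩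
  · refine solutions_ext hf hg (fun x => congrFun (congrArg Prod.fst h) x) fun x a => ?_
    exact mul_left_cancel₀ hζ0 (congrFun (congrFun (congrArg Prod.snd h) x) a)
  · rintro ⟨φ, ψ⟩ hP
    set ζ := Complex.exp (-(Complex.I * (Real.pi / 4 : ℝ))) with hζ
    have hφ : ContDiff ℝ ∞ φ := hP.1
    have hψ : ContDiff ℝ ∞ ψ := hP.2.1
    let c : Spacetime → Fock := fun x I => if I = ∅ then φ x else
      if I = {0} then ζ⁻¹ * ψ x 0 else if I = {1} then ζ⁻¹ * ψ x 1 else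
      2 * m * conj (φ x)
    have hc : ContDiff ℝ ∞ c := by
      refine contDiff_pi.2 fun I => ?_
      have hbar : ContDiff ℝ ∞ (fun x => conj (φ x)) :=
        Complex.conjCLE.contDiff.comp hφ
      simp only [c]
      split_ifs
      · exact hφ
      · exact contDiff_const.mul ((contDiff_pi.1 hψ) 0)
      · exact contDiff_const.mul ((contDiff_pi.1 hψ) 1)
      · exact contDiff_const.mul hbar
    have e : (Finset.univ : Finset (Fin 2)) ≠ ∅ := by decide
    have e1 : (Finset.univ : Finset (Fin 2)) ≠ {0} := by decide
    have e2 : (Finset.univ : Finset (Fin 2)) ≠ {1} := by decide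
    have hcomp : components (chiralLift c) = (φ, ψ) := by
      simp only [components, chiralLift_empty]
      ext x a
      · simp [c]
      · rw [← hζ]
        fin_cases a <;> simp [c, hζ0]
    refine ⟨chiralLift c, mem_solutions_iff_components.2
      ⟨isChiral_chiralLift hc, fun x => ?_, hcomp ▸ hP⟩, hcomp⟩
    simp [chiralLift_empty, c, e, e1, e2]

end SuperPoincare

namespace SuperPoincare

/-! ### Solutions from chiral superfunctions -/

variable {f : Superfield}

theorem box_eq_conj {φ : Spacetime → ℂ} (x : Spacetime) :
    box (fun y => conj (φ y)) x = conj (box φ x) := by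
  have h : ∀ μ, partialX μ (fun y => conj (φ y)) =
      fun y => conj (partialX μ φ y) := fun μ => funext fun y => partialX_conj φ μ y
  simp only [box, h, Pi.sub_apply, partialX_conj, map_sub]

theorem box_add {φ ψ : Spacetime → ℂ} (hφ : ContDiff ℝ ∞ φ) (hψ : ContDiff ℝ ∞ ψ)
    (x : Spacetime) : box (fun y => φ y + ψ y) x = box φ x + box ψ x := by
  have h : ∀ μ, partialX μ (fun y => φ y + ψ y) =
      fun y => partialX μ φ y + partialX μ ψ y := fun μ => funext fun y =>
    partialX_add (ContDiff.differentiableAt_top hφ y) (ContDiff.differentiableAt_top hψ y) μ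
  have h2 : ∀ μ, partialX μ (fun y => partialX μ φ y + partialX μ ψ y) x =
      partialX μ (partialX μ φ) x + partialX μ (partialX μ ψ) x := fun μ =>
    partialX_add (ContDiff.differentiableAt_top (contDiff_partialX hφ μ) x)
      (ContDiff.differentiableAt_top (contDiff_partialX hψ μ) x) μ
  simp only [box, h, Pi.sub_apply, h2]
  ring

theorem box_const_mul {φ : Spacetime → ℂ} (hφ : ContDiff ℝ ∞ φ) (c : ℂ)
    (x : Spacetime) : box (fun y => c * φ y) x = c * box φ x := by
  have h : ∀ μ, partialX μ (fun y => c * φ y) = fun y => c * partialX μ φ y := fun μ =>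
    funext fun y => partialX_const_smul c (ContDiff.differentiableAt_top hφ y) μ
  have h2 : ∀ μ, partialX μ (fun y => c * partialX μ φ y) x =
      c * partialX μ (partialX μ φ) x := fun μ =>
    partialX_const_smul c (ContDiff.differentiableAt_top (contDiff_partialX hφ μ) x) μ
  simp only [box, h, Pi.sub_apply, h2]
  ring

/-- The superfunction `u - m⁻¹ conj(D² u)`. -/
def realify (m : ℝ) (u : Superfield) : Superfield := u - (m : ℂ)⁻¹ • conjS (DSq u)

theorem IsChiral.realify_empty (hf : IsChiral f) (m : ℝ) (x : Spacetime) :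
    realify m f x (∅, ∅) =
      f x (∅, ∅) + (m : ℂ)⁻¹ / 2 * conj (f x (Finset.univ, ∅)) := by
  rw [realify, Pi.sub_apply, Pi.sub_apply, Pi.smul_apply, Pi.smul_apply, conjS_empty,
    hf.DSq_empty]
  simp [Complex.conj_ofNat]
  ring

theorem IsChiral.realify_singleton (hf : IsChiral f) (m : ℝ) (x : Spacetime) (b : Fin 2) :
    realify m f x ({b}, ∅) = f x ({b}, ∅) + (m : ℂ)⁻¹ * conj
      (dslash 0 b (fun y => f y ({1}, ∅)) x - dslash 1 b (fun y => f y ({0}, ∅)) x) := by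
  rw [realify, Pi.sub_apply, Pi.sub_apply, Pi.smul_apply, Pi.smul_apply, conjS_empty,
    hf.DSq_singleton, map_neg, smul_eq_mul]
  ring

theorem IsChiral.realify_univ (hf : IsChiral f) (m : ℝ) (x : Spacetime) :
    realify m f x (Finset.univ, ∅) = f x (Finset.univ, ∅) -
      (m : ℂ)⁻¹ * (2 * conj (box (fun y => f y (∅, ∅)) x)) := by
  rw [realify, Pi.sub_apply, Pi.sub_apply, Pi.smul_apply, Pi.smul_apply, conjS_empty,
    hf.DSq_univ]
  simp [Complex.conj_ofNat]

theorem IsChiral.realify (hf : IsChiral f) (m : ℝ) : IsChiral (realify m f) := by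
  have := hf.add ((IsChiral.conjS_DSq hf.smooth).smul (-(m : ℂ)⁻¹))
  rwa [neg_smul, ← sub_eq_add_neg] at this

theorem IsChiral.realify_mem_solutions (hf : IsChiral f) {m : ℝ} (hm : m ≠ 0)
    (hKG : ∀ I x, box (fun y => f y (I, ∅)) x = -(m : ℂ) ^ 2 * f x (I, ∅)) :
    SuperPoincare.realify m f ∈ solutions m := by
  have hm' : (m : ℂ) ≠ 0 := by exact_mod_cast hm
  have hs := fun I => hf.smooth.component (I, ∅)
  have hbar : ∀ I, ContDiff ℝ ∞ fun y => conj (f y (I, ∅)) := fun I =>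
    Complex.conjCLE.contDiff.comp (hs I)
  rw [mem_solutions_iff]
  refine ⟨hf.realify m, fun x => ?_, fun x b => ?_, fun x => ?_⟩
  · rw [hf.realify_univ, hf.realify_empty, hKG]
    simp [Complex.conj_ofNat]
    field_simp
    ring
  · have h1 : ∀ c, (fun y => SuperPoincare.realify m f y ({c}, ∅)) = fun y => f y ({c}, ∅) +
        (m : ℂ)⁻¹ * conj (dslash 0 c (fun y => f y ({1}, ∅)) y +
          -1 * dslash 1 c (fun y => f y ({0}, ∅)) y) := fun c => funext fun y => by
      rw [hf.realify_singleton]; ring_nf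
    have hd : ∀ a b c, ContDiff ℝ ∞ (dslash a b fun y => f y ({c}, ∅)) := fun a b c =>
      contDiff_dslash (hs {c}) a b
    have h2 : ∀ c, ContDiff ℝ ∞ (fun y => (dslash 0 c (fun y => f y ({1}, ∅)) y +
          -1 * dslash 1 c (fun y => f y ({0}, ∅)) y)) := fun c =>
      (hd 0 c 1).add (contDiff_const.mul (hd 1 c 0))
    have h2' : ∀ c, ContDiff ℝ ∞ (fun y => conj (dslash 0 c (fun y => f y ({1}, ∅)) y +
          -1 * dslash 1 c (fun y => f y ({0}, ∅)) y)) := fun c =>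
      Complex.conjCLE.contDiff.comp (h2 c)
    rw [hf.realify_singleton]
    simp only [h1, dslash_add (hs _) (contDiff_const.mul (h2' _)), dslash_const_mul (h2' _),
      dslash_conj]
    have h3 : ∀ a b c, dslash a b (fun y => (dslash 0 c (fun y => f y ({1}, ∅)) y +
          -1 * dslash 1 c (fun y => f y ({0}, ∅)) y)) x =
          dslash a b (dslash 0 c (fun y => f y ({1}, ∅))) x -
          dslash a b (dslash 1 c (fun y => f y ({0}, ∅))) x := by
      intro a b c
      rw [dslash_add (hd 0 c 1) (contDiff_const.mul (hd 1 c 0)), dslash_const_mul (hd 1 c 0)]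
      ring
    simp only [h3]
    have k0 := box_eq_dslash' (hs {0}) x
    have k1 := box_eq_dslash' (hs {1}) x
    rw [hKG] at k0 k1
    have key : conj (dslash b 0 (dslash 0 1 fun y => f y ({1}, ∅)) x -
        dslash b 0 (dslash 1 1 fun y => f y ({0}, ∅)) x) -
        conj (dslash b 1 (dslash 0 0 fun y => f y ({1}, ∅)) x -
        dslash b 1 (dslash 1 0 fun y => f y ({0}, ∅)) x) =
        (m : ℂ) ^ 2 * conj (f x ({b}, ∅)) := by
      rw [← map_sub]
      have : (m : ℂ) ^ 2 * conj (f x ({b}, ∅)) =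
        conj ((m : ℂ) ^ 2 * f x ({b}, ∅)) := by simp
      rw [this]
      congr 1
      fin_cases b
      · simp only [Fin.zero_eta]
        rw [dslash_comm (hs {1}) 0 0 0 1, dslash_comm (hs {0}) 0 0 1 1]
        linear_combination k0
      · simp only [Fin.mk_one]
        rw [dslash_comm (hs {1}) 1 0 0 1, dslash_comm (hs {0}) 1 0 1 1]
        linear_combination k1
    simp only [map_add, map_mul, map_inv₀, Complex.conj_ofReal, Complex.conj_conj]
    field_simp
    linear_combination -key
  · have h1 : (fun y => SuperPoincare.realify m f y (∅, ∅)) = fun y => f y (∅, ∅) +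
        (m : ℂ)⁻¹ / 2 * conj (f y (Finset.univ, ∅)) := funext fun y =>
      hf.realify_empty m y
    rw [h1, box_add (hs ∅) (contDiff_const.mul (hbar Finset.univ)),
      box_const_mul (hbar Finset.univ), box_eq_conj, hKG, hKG, hf.realify_univ, hKG]
    simp [Complex.conj_ofNat]
    field_simp
    ring

end SuperPoincare

namespace SuperPoincare
open Complex (I exp)

/-! ### Geometry of the mass shell -/

/-- Spatial momenta. -/
abbrev Mom : Type := EuclideanSpace ℝ (Fin 3)

/-- The spatial part of a covector. -/
def spatial : Covector →L[ℝ] Mom :=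
  LinearMap.toContinuousLinearMap
    { toFun := fun p => WithLp.toLp 2 (fun i : Fin 3 => p i.succ)
      map_add' := fun p q => by ext i; simp
      map_smul' := fun c p => by ext i; simp }

theorem spatial_apply (p : Covector) (i : Fin 3) : spatial p i = p i.succ := rfl

/-- The energy of a particle of mass `m` and momentum `k`. -/
def energy (m : ℝ) (k : Mom) : ℝ := √(m ^ 2 + ∑ i, k i ^ 2)

/-- The point of the mass shell over the momentum `k`. -/
def shellPt (m : ℝ) (k : Mom) : Covector := ![energy m k, k 0, k 1, k 2]

/-- `p² = m²` and `p_0 ≥ 0`. -/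
def OnShell (m : ℝ) (p : Covector) : Prop := p 0 = energy m (spatial p)

variable {m : ℝ}

theorem energy_sq (m : ℝ) (k : Mom) : energy m k ^ 2 = m ^ 2 + ∑ i, k i ^ 2 :=
  Real.sq_sqrt (by positivity)

theorem energy_spatial_sq (m : ℝ) (p : Covector) :
    energy m (spatial p) ^ 2 = m ^ 2 + p 1 ^ 2 + p 2 ^ 2 + p 3 ^ 2 := by
  rw [energy_sq, Fin.sum_univ_three]
  simp only [spatial_apply]
  rw [show (Fin.succ 0 : Fin 4) = 1 from rfl, show (Fin.succ 1 : Fin 4) = 2 from rfl,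
    show (Fin.succ 2 : Fin 4) = 3 from rfl]
  ring

theorem energy_pos (hm : 0 < m) (k : Mom) : 0 < energy m k :=
  Real.sqrt_pos.2 (by positivity)

theorem le_energy (m : ℝ) (k : Mom) : m ≤ energy m k :=
  Real.le_sqrt_of_sq_le (by linarith [show 0 ≤ ∑ i, k i ^ 2 by positivity])

theorem spatial_shellPt (m : ℝ) (k : Mom) : spatial (shellPt m k) = k := by
  ext i; rw [spatial_apply]; fin_cases i <;> rfl

theorem onShell_shellPt (m : ℝ) (k : Mom) : OnShell m (shellPt m k) := by
  rw [OnShell, spatial_shellPt]; rfl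

theorem OnShell.shellPt_spatial {p : Covector} (h : OnShell m p) : shellPt m (spatial p) = p := by
  ext i
  fin_cases i
  · exact h.symm
  all_goals rfl

theorem OnShell.sq {p : Covector} (h : OnShell m p) :
    p 0 ^ 2 = m ^ 2 + p 1 ^ 2 + p 2 ^ 2 + p 3 ^ 2 := by
  rw [h, energy_spatial_sq]

theorem OnShell.pos (hm : 0 < m) {p : Covector} (h : OnShell m p) : 0 < p 0 := by
  rw [h]; exact energy_pos hm _

theorem OnShell.of_sq {p : Covector} (h0 : 0 ≤ p 0)
    (h : p 0 ^ 2 = m ^ 2 + p 1 ^ 2 + p 2 ^ 2 + p 3 ^ 2) : OnShell m p := by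
  rw [← energy_spatial_sq] at h
  exact (pow_left_inj₀ h0 (Real.sqrt_nonneg _) two_ne_zero).1 h

theorem energy_add_pos (hm : 0 < m) (k : Mom) : 0 < energy m k + k 0 := by
  have h1 := energy_sq m k
  have h2 := energy_pos hm k
  rw [Fin.sum_univ_three] at h1
  nlinarith [sq_nonneg (k 1), sq_nonneg (k 2), sq_nonneg (energy m k - k 0), pow_pos hm 2]

/-! ### Equivariance of `Γ` -/

theorem toHerm_injective : Function.Injective toHerm := fun v w h => by
  rw [← ofHerm_toHerm v, h, ofHerm_toHerm]

theorem toHerm_gamma (s t : Spinor) : toHerm (gamma s t) =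
    (2 : ℂ) • (Matrix.vecMulVec s (star t) + Matrix.vecMulVec t (star s)) := by
  ext i j
  fin_cases i <;> fin_cases j <;> apply Complex.ext <;>
    simp [toHerm, gamma, Fin.sum_univ_two, gammaUp, Matrix.vecMulVec_apply] <;> ring

theorem gamma_mulVec (A : SL2) (s t : Spinor) :
    gamma ((mat A).mulVec s) ((mat A).mulVec t) = lorentz A (gamma s t) := by
  apply toHerm_injective
  rw [toHerm_lorentz, toHerm_gamma, toHerm_gamma, Matrix.mul_smul, Matrix.smul_mul,
    Matrix.mul_add, Matrix.add_mul]
  simp only [Matrix.star_mulVec, Matrix.mul_vecMulVec, Matrix.vecMulVec_mul]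

theorem pullback_dotProduct (A : SL2) (p : Covector) (v : Spacetime) :
    pullback A p ⬝ᵥ v = p ⬝ᵥ lorentz A v := by
  conv_rhs => rw [← sum_smul_basisVec v, ← lorentzL_apply, map_sum]
  simp only [map_smul, lorentzL_apply, dotProduct_sum, dotProduct_smul, smul_eq_mul]
  simp only [pullback, dotProduct, mul_comm]

theorem pullback_mul (A B : SL2) (p : Covector) :
    pullback (A * B) p = pullback B (pullback A p) := by
  ext μ
  rw [pullback, lorentz_mul, ← pullback_dotProduct]; rfl

theorem pullback_one (p : Covector) : pullback 1 p = p := by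
  ext μ
  rw [pullback, lorentz_one]
  simp [basisVec]

theorem pullback_pullback_inv (A : SL2) (p : Covector) : pullback A (pullback A⁻¹ p) = p := by
  rw [← pullback_mul, inv_mul_cancel, pullback_one]

theorem pullback_inv_pullback (A : SL2) (p : Covector) : pullback A⁻¹ (pullback A p) = p := by
  rw [← pullback_mul, mul_inv_cancel, pullback_one]

theorem pullback_add (A : SL2) (p q : Covector) :
    pullback A (p + q) = pullback A p + pullback A q := by
  ext μ; simp [pullback, add_dotProduct]

theorem pullback_smul (A : SL2) (c : ℝ) (p : Covector) :
    pullback A (c • p) = c • pullback A p := by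
  ext μ; simp [pullback, smul_dotProduct]

/-- The pullback of covectors as a continuous linear map. -/
def pullbackL (A : SL2) : Covector →L[ℝ] Covector :=
  LinearMap.toContinuousLinearMap
    { toFun := pullback A
      map_add' := pullback_add A
      map_smul' := pullback_smul A }

/-- The matrix `p(Γ^{ab})`. -/
def slashUp (p : Covector) (a b : Fin 2) : ℂ := ∑ μ, (p μ : ℂ) * gammaUp μ a b

theorem slashUp_00 (p : Covector) : slashUp p 0 0 = p 0 + p 1 := by
  simp [slashUp, Fin.sum_univ_four, gammaUp]
theorem slashUp_11 (p : Covector) : slashUp p 1 1 = p 0 - p 1 := by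
  simp [slashUp, Fin.sum_univ_four, gammaUp]; ring
theorem slashUp_01 (p : Covector) : slashUp p 0 1 = p 2 - p 3 * I := by
  simp [slashUp, Fin.sum_univ_four, gammaUp]; ring
theorem slashUp_10 (p : Covector) : slashUp p 1 0 = p 2 + p 3 * I := by
  simp [slashUp, Fin.sum_univ_four, gammaUp]

theorem dotProduct_gamma (p : Covector) (s t : Spinor) :
    p ⬝ᵥ gamma s t = 2 * (∑ a, ∑ b, slashUp p a b * s a * conj (t b)).re := by
  simp only [Fin.sum_univ_two, slashUp_00, slashUp_01, slashUp_10, slashUp_11, dotProduct,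
    Fin.sum_univ_four, gamma, gammaUp]
  simp
  ring

theorem slashUp_pullback (A : SL2) (p : Covector) (a b : Fin 2) :
    slashUp (pullback A p) a b =
      ∑ c, ∑ d, mat A c a * slashUp p c d * conj (mat A d b) := by
  have h : ∀ ν, (pullback A p) ν = ∑ μ, p μ * lorentz A (basisVec ν) μ := fun ν => rfl
  simp only [slashUp, Fin.sum_univ_four, h, Fin.sum_univ_two, lorentz]
  rw [← mat]
  generalize mat A = M
  fin_cases a <;> fin_cases b <;> apply Complex.ext <;>
    simp [ofHerm, toHerm, basisVec, Matrix.mul_apply, Fin.sum_univ_two, gammaUp,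
      Matrix.conjTranspose_apply] <;> ring

theorem det_slashUp (p : Covector) :
    slashUp p 0 0 * slashUp p 1 1 - slashUp p 0 1 * slashUp p 1 0 =
      ((p 0 ^ 2 - p 1 ^ 2 - p 2 ^ 2 - p 3 ^ 2 : ℝ) : ℂ) := by
  rw [slashUp_00, slashUp_01, slashUp_10, slashUp_11]
  push_cast
  linear_combination (p 3 : ℂ) ^ 2 * Complex.I_sq

theorem pullback_sq (A : SL2) (p : Covector) :
    pullback A p 0 ^ 2 - pullback A p 1 ^ 2 - pullback A p 2 ^ 2 - pullback A p 3 ^ 2 =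
      p 0 ^ 2 - p 1 ^ 2 - p 2 ^ 2 - p 3 ^ 2 := by
  have h := det_slashUp (pullback A p)
  have h2 := det_slashUp p
  have h3 := mat_det A
  have h4 := congrArg conj h3
  simp only [map_sub, map_mul, map_one] at h4
  rw [slashUp_pullback, slashUp_pullback, slashUp_pullback, slashUp_pullback] at h
  simp only [Fin.sum_univ_two] at h
  have h5 : ((p 0 ^ 2 - p 1 ^ 2 - p 2 ^ 2 - p 3 ^ 2 : ℝ) : ℂ) =
      ((pullback A p 0 ^ 2 - pullback A p 1 ^ 2 - pullback A p 2 ^ 2 - pullback A p 3 ^ 2 : ℝ) : ℂ)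
      := by
    rw [← h, ← h2]
    linear_combination (-(slashUp p 0 0 * slashUp p 1 1 - slashUp p 0 1 * slashUp p 1 0)) *
      (h3 * (conj (mat A 0 0) * conj (mat A 1 1) -
        conj (mat A 0 1) * conj (mat A 1 0)) + h4)
  exact_mod_cast h5.symm

/-- Completing the square in the quadratic form `p(Γ(χ, χ))`. -/
theorem dotProduct_gamma_self {p : Covector} (hp : p 0 + p 1 ≠ 0) (χ : Spinor) :
    p ⬝ᵥ gamma χ χ = 2 * ((p 0 + p 1) *
      ‖χ 0 + ((p 2 : ℂ) + p 3 * I) / ((p 0 : ℂ) + p 1) * χ 1‖ ^ 2 +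
      (p 0 ^ 2 - p 1 ^ 2 - p 2 ^ 2 - p 3 ^ 2) / (p 0 + p 1) * ‖χ 1‖ ^ 2) := by
  obtain ⟨u, hu⟩ : ∃ u, p 2 = u * (p 0 + p 1) := ⟨p 2 / (p 0 + p 1), by field_simp⟩
  obtain ⟨v, hv⟩ : ∃ v, p 3 = v * (p 0 + p 1) := ⟨p 3 / (p 0 + p 1), by field_simp⟩
  have hp' : (p 0 : ℂ) + p 1 ≠ 0 := by exact_mod_cast hp
  have e : ((p 2 : ℂ) + p 3 * I) / ((p 0 : ℂ) + p 1) = (u : ℂ) + (v : ℂ) * I := by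
    rw [hu, hv]; push_cast; field_simp
  rw [dotProduct_gamma, e]
  simp only [Fin.sum_univ_two, slashUp_00, slashUp_01, slashUp_10, slashUp_11,
    ← Complex.normSq_eq_norm_sq, Complex.normSq_apply]
  simp
  rw [hu, hv]
  field_simp
  ring

theorem OnShell.add_pos (hm : 0 < m) {p : Covector} (h : OnShell m p) : 0 < p 0 + p 1 := by
  have := energy_add_pos hm (spatial p)
  rwa [← h] at this

theorem OnShell.gamma_nonneg (hm : 0 < m) {p : Covector} (h : OnShell m p) (χ : Spinor) :
    0 ≤ p ⬝ᵥ gamma χ χ := by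
  have h1 := h.add_pos hm
  rw [dotProduct_gamma_self h1.ne']
  have h2 : p 0 ^ 2 - p 1 ^ 2 - p 2 ^ 2 - p 3 ^ 2 = m ^ 2 := by linarith [h.sq]
  rw [h2]
  positivity

theorem gamma_single_add : gamma (Pi.single 0 1) (Pi.single 0 1) +
    gamma (Pi.single 1 1) (Pi.single 1 1) = (4 : ℝ) • basisVec 0 := by
  ext μ
  fin_cases μ <;> simp [gamma, Fin.sum_univ_two, gammaUp, basisVec]
  norm_num

theorem OnShell.pullback (hm : 0 < m) {p : Covector} (h : OnShell m p) (A : SL2) :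
    OnShell m (pullback A p) := by
  apply OnShell.of_sq
  · have h1 : SuperPoincare.pullback A p ⬝ᵥ ((4 : ℝ) • basisVec 0) =
        4 * SuperPoincare.pullback A p 0 := by
      simp [basisVec]
    rw [← gamma_single_add, dotProduct_add, pullback_dotProduct, pullback_dotProduct,
      ← gamma_mulVec, ← gamma_mulVec] at h1
    have h2 := h.gamma_nonneg hm ((mat A).mulVec (Pi.single 0 1))
    have h3 := h.gamma_nonneg hm ((mat A).mulVec (Pi.single 1 1))
    linarith
  · have := pullback_sq A p
    have := h.sq
    linarith

/-! ### The Hermitian form on the fibres -/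

theorem spinFock_singletons (A : SL2) (w : Fock) :
    (fun a : Fin 2 => spinFock A w {a}) = (mat A).mulVec (fun a => w {a}) := by
  ext a
  rw [spinFock_singleton, Matrix.mulVec, dotProduct, Fin.sum_univ_two]

theorem fibreNormSq_spinFock (A : SL2) (p : Covector) (w : Fock) :
    fibreNormSq m p (spinFock A w) = fibreNormSq m (pullback A p) w := by
  rw [fibreNormSq, fibreNormSq, spinFock_empty, spinFock_univ, spinFock_singletons, gamma_mulVec,
    pullback_dotProduct]

/-- The fibre of the trivialized bundle. -/
abbrev FibreE : Type := EuclideanSpace ℂ (Finset (Fin 2))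

/-- `p_+ = p_0 + p_1` as a function of the spatial momentum. -/
def plus (m : ℝ) (p : Covector) : ℝ := energy m (spatial p) + p 1

theorem plus_pos (hm : 0 < m) (p : Covector) : 0 < plus m p := energy_add_pos hm (spatial p)

theorem OnShell.plus_eq {p : Covector} (h : OnShell m p) : plus m p = p 0 + p 1 := by
  rw [plus, h]

/-- The triangular trivialization of the Hermitian bundle over the mass shell. -/
def triv (m : ℝ) (p : Covector) (w : Fock) : FibreE := WithLp.toLp 2 fun I =>
  if I = ∅ then w ∅ else
  if I = {0} then (√2 * √(plus m p) : ℝ) * w {0} +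
    ((p 2 : ℂ) + p 3 * Complex.I) * (√2 / √(plus m p) : ℝ) * w {1} else
  if I = {1} then (√2 * m / √(plus m p) : ℝ) * w {1} else (2 * m : ℝ) * w Finset.univ

/-- The inverse of `triv`. -/
def trivInv (m : ℝ) (p : Covector) (e : FibreE) : Fock := fun I =>
  if I = ∅ then e ∅ else
  if I = {0} then ((√2 * √(plus m p))⁻¹ : ℝ) * e {0} -
    ((p 2 : ℂ) + p 3 * Complex.I) * ((√2 * m * √(plus m p))⁻¹ : ℝ) * e {1} else
  if I = {1} then (√(plus m p) / (√2 * m) : ℝ) * e {1} else ((2 * m)⁻¹ : ℝ) * e Finset.univ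

theorem univ_ne_empty' : (Finset.univ : Finset (Fin 2)) ≠ ∅ := by decide
theorem univ_ne_zero' : (Finset.univ : Finset (Fin 2)) ≠ {0} := by decide
theorem univ_ne_one' : (Finset.univ : Finset (Fin 2)) ≠ {1} := by decide

theorem triv_empty (p : Covector) (w : Fock) : triv m p w ∅ = w ∅ := by simp [triv]
theorem triv_zero (p : Covector) (w : Fock) : triv m p w {0} =
    (√2 * √(plus m p) : ℝ) * w {0} +
    ((p 2 : ℂ) + p 3 * I) * (√2 / √(plus m p) : ℝ) * w {1} := by simp [triv]
theorem triv_one (p : Covector) (w : Fock) : triv m p w {1} =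
    (√2 * m / √(plus m p) : ℝ) * w {1} := by simp [triv]
theorem triv_univ (p : Covector) (w : Fock) : triv m p w Finset.univ =
    (2 * m : ℝ) * w Finset.univ := by
  simp [triv, univ_ne_empty', univ_ne_zero', univ_ne_one']

theorem trivInv_empty (p : Covector) (e : FibreE) : trivInv m p e ∅ = e ∅ := by simp [trivInv]
theorem trivInv_zero (p : Covector) (e : FibreE) : trivInv m p e {0} =
    ((√2 * √(plus m p))⁻¹ : ℝ) * e {0} -
    ((p 2 : ℂ) + p 3 * I) * ((√2 * m * √(plus m p))⁻¹ : ℝ) * e {1} := by simp [trivInv]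
theorem trivInv_one (p : Covector) (e : FibreE) : trivInv m p e {1} =
    (√(plus m p) / (√2 * m) : ℝ) * e {1} := by simp [trivInv]
theorem trivInv_univ (p : Covector) (e : FibreE) : trivInv m p e Finset.univ =
    ((2 * m)⁻¹ : ℝ) * e Finset.univ := by
  simp [trivInv, univ_ne_empty', univ_ne_zero', univ_ne_one']

theorem fibreE_ext {v w : FibreE} (h0 : v ∅ = w ∅) (h1 : v {0} = w {0}) (h2 : v {1} = w {1})
    (h3 : v Finset.univ = w Finset.univ) : v = w := by
  ext I
  rcases finset_fin_two_cases I with rfl | rfl | rfl | rfl <;> assumption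

theorem trivInv_triv (hm : 0 < m) (p : Covector) (w : Fock) : trivInv m p (triv m p w) = w := by
  have hq : ((√(plus m p) : ℝ) : ℂ) ≠ 0 := by
    exact_mod_cast (Real.sqrt_pos.2 (plus_pos hm p)).ne'
  have h2 : ((√2 : ℝ) : ℂ) ≠ 0 := by exact_mod_cast (Real.sqrt_pos.2 zero_lt_two).ne'
  have hm' : (m : ℂ) ≠ 0 := by exact_mod_cast hm.ne'
  apply fock_ext
  · rw [trivInv_empty, triv_empty]
  · intro a
    fin_cases a
    · simp only [Fin.zero_eta, trivInv_zero, triv_zero, triv_one]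
      push_cast
      field_simp
      ring
    · simp only [Fin.mk_one, trivInv_one, triv_one]
      push_cast
      field_simp
  · rw [trivInv_univ, triv_univ]
    push_cast
    field_simp

theorem triv_trivInv (hm : 0 < m) (p : Covector) (e : FibreE) : triv m p (trivInv m p e) = e := by
  have hq : ((√(plus m p) : ℝ) : ℂ) ≠ 0 := by
    exact_mod_cast (Real.sqrt_pos.2 (plus_pos hm p)).ne'
  have h2 : ((√2 : ℝ) : ℂ) ≠ 0 := by exact_mod_cast (Real.sqrt_pos.2 zero_lt_two).ne'
  have hm' : (m : ℂ) ≠ 0 := by exact_mod_cast hm.ne'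
  apply fibreE_ext
  · rw [triv_empty, trivInv_empty]
  · simp only [trivInv_zero, triv_zero, trivInv_one]
    push_cast
    field_simp
    ring
  · simp only [trivInv_one, triv_one]
    push_cast
    field_simp
  · rw [triv_univ, trivInv_univ]
    push_cast
    field_simp

theorem triv_add (p : Covector) (v w : Fock) : triv m p (v + w) = triv m p v + triv m p w := by
  apply fibreE_ext <;> simp only [PiLp.add_apply, triv_empty, triv_zero, triv_one, triv_univ,
    Pi.add_apply] <;> ring

theorem triv_smul (p : Covector) (c : ℂ) (w : Fock) : triv m p (c • w) = c • triv m p w := by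
  apply fibreE_ext <;> simp only [PiLp.smul_apply, triv_empty, triv_zero, triv_one, triv_univ,
    Pi.smul_apply, smul_eq_mul] <;> ring

/-- The Hermitian form on the fibre over `p`, antilinear in the first argument. -/
def fibreInner (m : ℝ) (p : Covector) (v w : Fock) : ℂ :=
  conj (v ∅) * w ∅ +
    2 * ∑ a, ∑ b, slashUp p a b * w {a} * conj (v {b}) +
    4 * m ^ 2 * (conj (v Finset.univ) * w Finset.univ)

theorem inner_triv (hm : 0 < m) {p : Covector} (h : OnShell m p) (v w : Fock) :
    inner ℂ (triv m p v) (triv m p w) = fibreInner m p v w := by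
  have hP := plus_pos hm p
  have hq : ((√(plus m p) : ℝ) : ℂ) ≠ 0 := by
    exact_mod_cast (Real.sqrt_pos.2 hP).ne'
  have hq2 : ((√(plus m p) : ℝ) : ℂ) ^ 2 = (p 0 : ℂ) + p 1 := by
    rw [← Complex.ofReal_pow, Real.sq_sqrt hP.le, h.plus_eq]; push_cast; ring
  have h2 : ((√2 : ℝ) : ℂ) ^ 2 = 2 := by
    rw [← Complex.ofReal_pow, Real.sq_sqrt zero_le_two]; norm_num
  have hsq : (p 0 : ℂ) ^ 2 = (m : ℂ) ^ 2 + (p 1 : ℂ) ^ 2 + (p 2 : ℂ) ^ 2 + (p 3 : ℂ) ^ 2 := by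
    exact_mod_cast h.sq
  rw [PiLp.inner_apply, sum_finset_fin_two]
  simp only [triv_empty, triv_zero, triv_one, triv_univ, fibreInner, Fin.sum_univ_two, slashUp_00,
    slashUp_01, slashUp_10, slashUp_11, RCLike.inner_apply, map_add, map_mul, Complex.conj_ofReal,
    Complex.conj_I]
  push_cast
  set q : ℂ := ((√(plus m p) : ℝ) : ℂ)
  set r : ℂ := ((√2 : ℝ) : ℂ)
  have hI := Complex.I_sq
  field_simp
  rw [h2, hq2]
  linear_combination (-2 * w {1} * conj (v {1})) * hsq -
    (2 * w {1} * conj (v {1}) * (p 3 : ℂ) ^ 2) * hI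

theorem fibreInner_self (p : Covector) (w : Fock) :
    (fibreInner m p w w).re = fibreNormSq m p w := by
  rw [fibreInner, fibreNormSq, dotProduct_gamma]
  simp only [← Complex.normSq_eq_norm_sq, Complex.normSq_apply]
  simp [Fin.sum_univ_two, ← Complex.ofReal_pow]

theorem norm_triv_sq (hm : 0 < m) {p : Covector} (h : OnShell m p) (w : Fock) :
    ‖triv m p w‖ ^ 2 = fibreNormSq m p w := by
  rw [← fibreInner_self, ← inner_triv hm h]
  exact norm_sq_eq_re_inner (𝕜 := ℂ) _

end SuperPoincare

namespace SuperPoincare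
open Complex (I exp)
open MeasureTheory

/-! ### The invariant measure of the mass shell -/

variable {m : ℝ}

theorem contDiff_coord (i : Fin 3) : ContDiff ℝ ∞ (fun k : Mom => k i) :=
  (EuclideanSpace.proj (𝕜 := ℝ) i).contDiff

theorem contDiff_energy (hm : 0 < m) : ContDiff ℝ ∞ (energy m) := by
  apply ContDiff.sqrt
  · exact contDiff_const.add (ContDiff.sum fun i _ => (contDiff_coord i).pow 2)
  · intro k; positivity

theorem contDiff_shellPt (hm : 0 < m) : ContDiff ℝ ∞ (shellPt m) := by
  rw [contDiff_pi]
  intro i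
  fin_cases i
  · exact contDiff_energy hm
  · exact contDiff_coord 0
  · exact contDiff_coord 1
  · exact contDiff_coord 2

theorem shellPt_injective : Function.Injective (shellPt m) := fun k l h => by
  rw [← spatial_shellPt m k, h, spatial_shellPt]

theorem continuous_energy (hm : 0 < m) : Continuous (energy m) := (contDiff_energy hm).continuous

theorem measurableEmbedding_shellPt (hm : 0 < m) : MeasurableEmbedding (shellPt m) :=
  (contDiff_shellPt hm).continuous.measurableEmbedding shellPt_injective

/-- The density of the invariant measure. -/
def shellDensity (m : ℝ) (k : Mom) : ENNReal := ENNReal.ofReal (1 / (2 * energy m k))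

theorem measurable_shellDensity (hm : 0 < m) : Measurable (shellDensity m) := by
  have := (continuous_energy hm).measurable
  unfold shellDensity
  fun_prop

theorem shellDensity_toReal (hm : 0 < m) (k : Mom) :
    (shellDensity m k).toReal = (2 * energy m k)⁻¹ := by
  have := energy_pos hm k
  rw [shellDensity, ENNReal.toReal_ofReal (by positivity), one_div]

theorem massShell_eq (hm : 0 < m) : massShell m =
    Measure.map (shellPt m) (volume.withDensity (shellDensity m)) := by
  have he : MeasurableEmbedding (fun k : Fin 3 → ℝ => WithLp.toLp 2 k : (Fin 3 → ℝ) → Mom) :=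
    (MeasurableEquiv.toLp 2 (Fin 3 → ℝ)).measurableEmbedding
  have hv := PiLp.volume_preserving_toLp (Fin 3)
  have h : (volume : Measure Mom).withDensity (shellDensity m) =
      Measure.map (WithLp.toLp 2) ((volume : Measure (Fin 3 → ℝ)).withDensity
        (fun k => shellDensity m (WithLp.toLp 2 k))) := by
    ext s hs
    rw [he.map_apply, withDensity_apply _ hs, withDensity_apply _ (he.measurable hs)]
    exact (hv.setLIntegral_comp_preimage_emb he _ _).symm
  rw [h, Measure.map_map (measurableEmbedding_shellPt hm).measurable he.measurable]
  rfl

theorem lintegral_massShell (hm : 0 < m) (f : Covector → ENNReal) :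
    ∫⁻ p, f p ∂(massShell m) = ∫⁻ k, shellDensity m k * f (shellPt m k) := by
  rw [massShell_eq hm, (measurableEmbedding_shellPt hm).lintegral_map,
    lintegral_withDensity_eq_lintegral_mul_non_measurable _ (measurable_shellDensity hm)
      (Filter.Eventually.of_forall fun k => ENNReal.ofReal_lt_top)]
  rfl

theorem integrable_massShell_iff (hm : 0 < m) {E : Type*} [NormedAddCommGroup E] [NormedSpace ℝ E]
    {f : Covector → E} : Integrable f (massShell m) ↔
      Integrable (fun k => (2 * energy m k)⁻¹ • f (shellPt m k)) := by
  rw [massShell_eq hm, (measurableEmbedding_shellPt hm).integrable_map_iff,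
    integrable_withDensity_iff_integrable_smul' (measurable_shellDensity hm)
      (Filter.Eventually.of_forall fun k => ENNReal.ofReal_lt_top)]
  simp only [shellDensity_toReal hm, Function.comp]

theorem integral_massShell (hm : 0 < m) {E : Type*} [NormedAddCommGroup E] [NormedSpace ℝ E]
    (f : Covector → E) : ∫ p, f p ∂(massShell m) =
      ∫ k, (2 * energy m k)⁻¹ • f (shellPt m k) := by
  rw [massShell_eq hm, (measurableEmbedding_shellPt hm).integral_map,
    integral_withDensity_eq_integral_toReal_smul (measurable_shellDensity hm)
      (Filter.Eventually.of_forall fun k => ENNReal.ofReal_lt_top)]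
  simp only [shellDensity_toReal hm]

theorem ae_massShell_iff (hm : 0 < m) {P : Covector → Prop} :
    (∀ᵐ p ∂(massShell m), P p) ↔ ∀ᵐ k : Mom, P (shellPt m k) := by
  rw [massShell_eq hm, (measurableEmbedding_shellPt hm).ae_map_iff,
    ae_withDensity_iff (measurable_shellDensity hm)]
  have : ∀ k, shellDensity m k ≠ 0 := fun k => by
    have := energy_pos hm k
    rw [shellDensity, ne_eq, ENNReal.ofReal_eq_zero, not_le]
    positivity
  simp only [this, not_false_eq_true, forall_const, ne_eq]

theorem ae_onShell (hm : 0 < m) : ∀ᵐ p ∂(massShell m), OnShell m p :=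
  (ae_massShell_iff hm).2 (Filter.Eventually.of_forall fun k => onShell_shellPt m k)

theorem integrable_massShell_of_bound (hm : 0 < m) {E : Type*} [NormedAddCommGroup E]
    [NormedSpace ℝ E] {f : Covector → E} (hf : AEStronglyMeasurable f (massShell m)) {C : ℝ}
    (hC : ∀ p, OnShell m p → ‖f p‖ ≤ C * (p 0 ^ 3)⁻¹) : Integrable f (massShell m) := by
  have h0 : Integrable (fun p : Covector => C * (p 0 ^ 3)⁻¹) (massShell m) := by
    apply Integrable.const_mul
    rw [integrable_massShell_iff hm]
    have h1 : Integrable (fun k : Mom => (1 + ‖k‖ ^ 2) ^ (-(4 : ℝ) / 2)) :=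
      integrable_rpow_neg_one_add_norm_sq (by simp; norm_num)
    have hE := continuous_energy hm
    refine Integrable.mono' (h1.const_mul (1 / (2 * (min m 1) ^ 4))) (Continuous.aestronglyMeasurable ?_)
      (Filter.Eventually.of_forall fun k => ?_)
    · have : ∀ k, energy m k ≠ 0 := fun k => (energy_pos hm k).ne'
      exact ((continuous_const.mul hE).inv₀ fun k => mul_ne_zero two_ne_zero (this k)).smul
        ((hE.pow 3).inv₀ fun k => pow_ne_zero _ (this k))
    · have hp := energy_pos hm k
      have hr : (1 + ‖k‖ ^ 2) ^ (-(4 : ℝ) / 2) = ((1 + ‖k‖ ^ 2) ^ 2)⁻¹ := by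
        rw [show (-(4 : ℝ) / 2) = -((2 : ℕ) : ℝ) by norm_num, Real.rpow_neg (by positivity),
          Real.rpow_natCast]
      have hn : (min m 1) ^ 2 * (1 + ‖k‖ ^ 2) ≤ energy m k ^ 2 := by
        rw [energy_sq, EuclideanSpace.norm_sq_eq]
        have h3 : min m 1 ^ 2 ≤ m ^ 2 := pow_le_pow_left₀ (by positivity) (min_le_left _ _) 2
        have h4 : min m 1 ^ 2 ≤ 1 := pow_le_one₀ (by positivity) (min_le_right _ _)
        simp only [Real.norm_eq_abs, sq_abs]
        nlinarith [show 0 ≤ ∑ i, k i ^ 2 by positivity]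
      have hM : 0 < min m 1 := by positivity
      have h5 : ((min m 1) ^ 2 * (1 + ‖k‖ ^ 2)) ^ 2 ≤ energy m k ^ 4 := by
        calc _ ≤ (energy m k ^ 2) ^ 2 := pow_le_pow_left₀ (by positivity) hn 2
          _ = _ := by ring
      rw [hr, smul_eq_mul, Real.norm_eq_abs, abs_of_nonneg (by positivity)]
      change (2 * energy m k)⁻¹ * (energy m k ^ 3)⁻¹ ≤ _
      rw [← mul_inv, one_div, ← mul_inv]
      apply inv_anti₀ (by positivity)
      nlinarith
  refine h0.mono' hf ?_
  filter_upwards [ae_onShell hm] with p hp using hC p hp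

/-! ### Light-cone coordinates -/

/-- Light-cone coordinates: the logarithm of `p_+` and the transverse momentum. -/
abbrev LightCone : Type := ℝ × (Fin 2 → ℝ)

/-- The transverse mass squared. -/
def transSq (m : ℝ) (z : Fin 2 → ℝ) : ℝ := m ^ 2 + z 0 ^ 2 + z 1 ^ 2

/-- The point of the mass shell with given light-cone coordinates. -/
def lightCone (m : ℝ) (y : LightCone) : Covector :=
  ![(Real.exp y.1 + transSq m y.2 * Real.exp (-y.1)) / 2,
    (Real.exp y.1 - transSq m y.2 * Real.exp (-y.1)) / 2, y.2 0, y.2 1]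

theorem continuous_lightCone : Continuous (lightCone m) := by
  unfold lightCone transSq
  rw [continuous_pi_iff]
  intro i
  fin_cases i <;> simp <;> fun_prop

theorem onShell_lightCone (y : LightCone) : OnShell m (lightCone m y) := by
  have h : 0 ≤ transSq m y.2 := by unfold transSq; positivity
  apply OnShell.of_sq
  · simp only [lightCone, Matrix.cons_val_zero]; positivity
  · have h2 : Real.exp y.1 * Real.exp (-y.1) = 1 := by
      rw [← Real.exp_add, add_neg_cancel, Real.exp_zero]
    simp only [lightCone, Matrix.cons_val]
    have : transSq m y.2 = m ^ 2 + y.2 0 ^ 2 + y.2 1 ^ 2 := rfl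
    linear_combination transSq m y.2 * h2 + this

theorem plus_lightCone (y : LightCone) : lightCone m y 0 + lightCone m y 1 = Real.exp y.1 := by
  simp [lightCone]; ring

theorem lightCone_log (hm : 0 < m) {p : Covector} (h : OnShell m p) :
    lightCone m (Real.log (p 0 + p 1), ![p 2, p 3]) = p := by
  have h1 := h.add_pos hm
  have h2 := h.sq
  ext i
  fin_cases i <;> simp [lightCone, transSq, Real.exp_neg, Real.exp_log h1] <;>
    field_simp <;> linarith

theorem lightCone_injective : Function.Injective (lightCone m) := fun x y h => by
  have h0 := plus_lightCone (m := m) x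
  rw [h, plus_lightCone] at h0
  have h2 := congrFun h 2
  have h3 := congrFun h 3
  simp only [lightCone, Matrix.cons_val] at h2 h3
  refine Prod.ext (Real.exp_injective h0.symm) ?_
  ext i
  fin_cases i
  · exact h2
  · exact h3

theorem massShell_eq_lightCone (hm : 0 < m) :
    massShell m = (2⁻¹ : ENNReal) • Measure.map (lightCone m) volume := by
  refine Measure.ext_of_lintegral _ fun f hf => ?_
  rw [lintegral_smul_measure, lintegral_map hf continuous_lightCone.measurable,
    lintegral_massShell hm]
  have hshell := (contDiff_shellPt hm).continuous.measurable
  have hm1 : Measurable fun k : Mom => shellDensity m k * f (shellPt m k) :=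
    (measurable_shellDensity hm).mul (hf.comp hshell)
  have hm2 : Measurable fun k : Fin 3 → ℝ =>
      shellDensity m (WithLp.toLp 2 k) * f (shellPt m (WithLp.toLp 2 k)) :=
    hm1.comp (WithLp.measurable_toLp 2 _)
  have hs : ∫⁻ k : Fin 3 → ℝ, shellDensity m (WithLp.toLp 2 k) * f (shellPt m (WithLp.toLp 2 k)) =
      ∫⁻ y : LightCone, shellDensity m (WithLp.toLp 2
        ((MeasurableEquiv.piFinSuccAbove (fun _ : Fin 3 => ℝ) 0).symm y)) *
        f (shellPt m (WithLp.toLp 2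
          ((MeasurableEquiv.piFinSuccAbove (fun _ : Fin 3 => ℝ) 0).symm y))) :=
    (((volume_preserving_piFinSuccAbove (fun _ : Fin 3 => ℝ) 0).symm).lintegral_comp hm2).symm
  have hm3 : Measurable fun y : LightCone => shellDensity m (WithLp.toLp 2
        ((MeasurableEquiv.piFinSuccAbove (fun _ : Fin 3 => ℝ) 0).symm y)) *
        f (shellPt m (WithLp.toLp 2
          ((MeasurableEquiv.piFinSuccAbove (fun _ : Fin 3 => ℝ) 0).symm y))) :=
    hm2.comp (MeasurableEquiv.measurable _)
  rw [← (PiLp.volume_preserving_toLp (Fin 3)).lintegral_comp hm1, hs, Measure.volume_eq_prod,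
    lintegral_prod_symm' _ hm3,
    lintegral_prod_symm' (fun y => f (lightCone m y)) (hf.comp continuous_lightCone.measurable),
    smul_eq_mul,
    ← lintegral_const_mul]
  · congr 1
    ext z
    set g : ℝ → ℝ := fun l => (Real.exp l - transSq m z * Real.exp (-l)) / 2
    set g' : ℝ → ℝ := fun l => (Real.exp l + transSq m z * Real.exp (-l)) / 2
    have hz : 0 < transSq m z := by unfold transSq; positivity
    have hg' : ∀ l, 0 < g' l := fun l => by positivity
    have hd : ∀ l, HasDerivAt g (g' l) l := fun l => by
      have := ((Real.hasDerivAt_exp l).sub (((Real.hasDerivAt_exp (-l)).comp l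
        (hasDerivAt_neg l)).const_mul (transSq m z))).div_const 2
      convert! this using 1
      simp only [g']; ring
    have hinj : Function.Injective g := (strictMono_of_hasDerivAt_pos hd hg').injective
    have hpt : ∀ l, shellPt m (WithLp.toLp 2 ((MeasurableEquiv.piFinSuccAbove (fun _ : Fin 3 => ℝ) 0).symm
        (g l, z))) = lightCone m (l, z) := fun l => by
      rw [← (onShell_lightCone (m := m) (l, z)).shellPt_spatial]
      congr 1
      ext i
      fin_cases i <;> rfl
    have hsurj : g '' Set.univ = Set.univ := by
      refine Set.eq_univ_of_forall fun x => ?_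
      set p := shellPt m (WithLp.toLp 2 ![x, z 0, z 1])
      have := lightCone_log hm (onShell_shellPt m (WithLp.toLp 2 ![x, z 0, z 1]))
      refine ⟨Real.log (p 0 + p 1), trivial, ?_⟩
      have h1 := congrFun this 1
      simp only [lightCone, Matrix.cons_val, p, g, shellPt, transSq] at h1 ⊢
      exact h1
    have key := lintegral_image_eq_lintegral_abs_deriv_mul (s := Set.univ) MeasurableSet.univ
      (fun l _ => (hd l).hasDerivWithinAt) hinj.injOn (fun x => shellDensity m (WithLp.toLp 2
        ((MeasurableEquiv.piFinSuccAbove (fun _ : Fin 3 => ℝ) 0).symm (x, z))) *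
        f (shellPt m (WithLp.toLp 2
          ((MeasurableEquiv.piFinSuccAbove (fun _ : Fin 3 => ℝ) 0).symm (x, z)))))
    rw [hsurj] at key
    simp only [Measure.restrict_univ] at key
    have hmz : Measurable fun x : ℝ => f (lightCone m (x, z)) :=
      hf.comp (continuous_lightCone.measurable.comp measurable_prodMk_right)
    rw [← lintegral_const_mul _ hmz]
    refine key.trans (lintegral_congr fun l => ?_)
    rw [hpt, ← mul_assoc]
    congr 1
    rw [abs_of_pos (hg' l), shellDensity]
    have he : energy m (WithLp.toLp 2 ((MeasurableEquiv.piFinSuccAbove (fun _ : Fin 3 => ℝ) 0).symm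
        (g l, z))) = g' l := congrFun (hpt l) 0
    rw [he, ← ENNReal.ofReal_mul (hg' l).le, show g' l * (1 / (2 * g' l)) = 2⁻¹ by
      have := (hg' l).ne'
      field_simp, ENNReal.ofReal_inv_of_pos zero_lt_two]
    norm_num
  · exact Measurable.lintegral_prod_left' (hf.comp continuous_lightCone.measurable)

theorem ae_massShell_iff_lightCone (hm : 0 < m) {P : Covector → Prop} :
    (∀ᵐ p ∂(massShell m), P p) ↔ ∀ᵐ y : LightCone, P (lightCone m y) := by
  rw [massShell_eq_lightCone hm, Measure.ae_ennreal_smul_measure_iff (by simp)]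
  exact (continuous_lightCone.measurableEmbedding lightCone_injective).ae_map_iff

/-! ### Invariance of the measure -/

theorem measurePreserving_shear (t : ℝ) (c : Fin 2 → ℝ) :
    MeasurePreserving (fun y : LightCone => (y.1 + t, y.2 + Real.exp y.1 • c)) := by
  refine MeasurePreserving.skew_product (g := fun a z => z + Real.exp a • c)
    (measurePreserving_add_right volume t) ?_ ?_
  · unfold Function.uncurry; fun_prop
  · exact Filter.Eventually.of_forall fun a => map_add_right_eq_self volume _

/-- The upper triangular matrices which act simply transitively on the mass shell. -/
def borel (t : ℝ) (c : Fin 2 → ℝ) : SL2 :=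
  ⟨!![(Real.exp (t / 2) : ℂ), Real.exp (-(t / 2)) * (c 0 + c 1 * I);
    0, (Real.exp (-(t / 2)) : ℂ)], by
    rw [Matrix.det_fin_two_of, ← Complex.ofReal_mul, ← Real.exp_add]; simp⟩

theorem borel_half_mul (t : ℝ) :
    (Real.exp (t / 2) : ℂ) * (Real.exp (-(t / 2)) : ℂ) = 1 := by
  rw [← Complex.ofReal_mul, ← Real.exp_add, add_neg_cancel, Real.exp_zero, Complex.ofReal_one]

theorem covector_ext_of_onShell {p q : Covector} (hm : 0 < m) (hp : OnShell m p) (hq : OnShell m q)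
    (h0 : slashUp p 0 0 = slashUp q 0 0) (h1 : slashUp p 1 0 = slashUp q 1 0) : p = q := by
  rw [slashUp_00, slashUp_00] at h0
  rw [slashUp_10, slashUp_10] at h1
  have a0 : p 0 + p 1 = q 0 + q 1 := by exact_mod_cast h0
  have a2 : p 2 = q 2 := by simpa using congrArg Complex.re h1
  have a3 : p 3 = q 3 := by simpa using congrArg Complex.im h1
  rw [← lightCone_log hm hp, ← lightCone_log hm hq, a0, a2, a3]

theorem pullback_borel (hm : 0 < m) (t : ℝ) (c : Fin 2 → ℝ) (y : LightCone) :
    pullback (borel t c) (lightCone m y) = lightCone m (y.1 + t, y.2 + Real.exp y.1 • c) := by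
  have hh := borel_half_mul t
  have he : (Real.exp (t / 2) : ℂ) * Real.exp (t / 2) = Real.exp t := by
    rw [← Complex.ofReal_mul, ← Real.exp_add, add_halves]
  have hpl : ∀ y : LightCone, (lightCone m y 0 : ℂ) + lightCone m y 1 = Real.exp y.1 := fun y => by
    rw [← plus_lightCone (m := m), Complex.ofReal_add]
  have e2 : ∀ y : LightCone, lightCone m y 2 = y.2 0 := fun y => rfl
  have e3 : ∀ y : LightCone, lightCone m y 3 = y.2 1 := fun y => rfl
  apply covector_ext_of_onShell hm ((onShell_lightCone y).pullback hm _) (onShell_lightCone _)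
  · rw [slashUp_pullback, slashUp_00, hpl]
    simp only [Fin.sum_univ_two, slashUp_00, hpl, borel, mat, Matrix.of_apply, Matrix.cons_val,
      map_zero, Complex.conj_ofReal, zero_mul, mul_zero, add_zero, Real.exp_add]
    push_cast at he ⊢
    linear_combination exp y.1 * he
  · rw [slashUp_pullback, slashUp_10, e2, e3]
    simp only [Fin.sum_univ_two, slashUp_00, slashUp_10, hpl, e2, e3, borel, mat, Matrix.of_apply,
      Matrix.cons_val, map_zero, Complex.conj_ofReal, mul_zero, add_zero, Pi.add_apply,
      Pi.smul_apply, smul_eq_mul]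
    push_cast at hh ⊢
    linear_combination (exp y.1 * (c 0 + c 1 * I) +
      (y.2 0 + y.2 1 * I)) * hh

/-- The pullback of covectors as a measurable equivalence. -/
def pullbackEquiv (A : SL2) : Covector ≃ᵐ Covector where
  toFun := pullback A
  invFun := pullback A⁻¹
  left_inv := pullback_inv_pullback A
  right_inv := pullback_pullback_inv A
  measurable_toFun := (pullbackL A).continuous.measurable
  measurable_invFun := (pullbackL A⁻¹).continuous.measurable

theorem measurePreserving_pullback_inv {A : SL2}
    (h : MeasurePreserving (pullback A) (massShell m) (massShell m)) :
    MeasurePreserving (pullback A⁻¹) (massShell m) (massShell m) :=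
  MeasurePreserving.symm (pullbackEquiv A) h

theorem measurePreserving_pullback_mul {A B : SL2}
    (hA : MeasurePreserving (pullback A) (massShell m) (massShell m))
    (hB : MeasurePreserving (pullback B) (massShell m) (massShell m)) :
    MeasurePreserving (pullback (A * B)) (massShell m) (massShell m) := by
  have : pullback (A * B) = pullback B ∘ pullback A := funext fun p => pullback_mul A B p
  rw [this]
  exact hB.comp hA

theorem measurePreserving_pullback_borel (hm : 0 < m) (t : ℝ) (c : Fin 2 → ℝ) :
    MeasurePreserving (pullback (borel t c)) (massShell m) (massShell m) := by
  have hP : Measurable (pullback (borel t c)) := (pullbackL _).continuous.measurable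
  refine ⟨hP, ?_⟩
  rw [massShell_eq_lightCone hm, Measure.map_smul, Measure.map_map hP continuous_lightCone.measurable]
  congr 1
  have : pullback (borel t c) ∘ lightCone m =
      lightCone m ∘ fun y : LightCone => (y.1 + t, y.2 + Real.exp y.1 • c) :=
    funext fun y => pullback_borel hm t c y
  rw [this, ← Measure.map_map continuous_lightCone.measurable (measurePreserving_shear t c).1,
    (measurePreserving_shear t c).map_eq]

/-- The Weyl element of `SL(2,ℂ)`. -/
def weyl : SL2 := ⟨!![0, 1; -1, 0], by simp [Matrix.det_fin_two_of]⟩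

/-- The rotation by `π` which the Weyl element induces on momenta. -/
def weylRot : Mom ≃ₗᵢ[ℝ] Mom :=
  LinearIsometryEquiv.piLpCongrRight 2 fun i : Fin 3 =>
    if i = 2 then LinearIsometryEquiv.refl ℝ ℝ else LinearIsometryEquiv.neg ℝ

theorem weylRot_apply (k : Mom) : weylRot k = WithLp.toLp 2 ![-k 0, -k 1, k 2] := by
  ext i
  fin_cases i <;> simp [weylRot]

theorem pullback_weyl_shellPt (k : Mom) : pullback weyl (shellPt m k) = shellPt m (weylRot k) := by
  have he : energy m (weylRot k) = energy m k := by
    simp [energy, weylRot_apply, Fin.sum_univ_three]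
  ext μ
  fin_cases μ <;> simp [pullback, lorentz, ofHerm, toHerm, weyl, basisVec, Matrix.mul_apply,
    shellPt, weylRot_apply, dotProduct, Fin.sum_univ_four, Matrix.conjTranspose_apply]
  · rw [← he, weylRot_apply]
  · ring

theorem measurePreserving_pullback_weyl (hm : 0 < m) :
    MeasurePreserving (pullback weyl) (massShell m) (massShell m) := by
  have hP : Measurable (pullback weyl) := (pullbackL _).continuous.measurable
  refine ⟨hP, Measure.ext_of_lintegral _ fun f hf => ?_⟩
  rw [lintegral_map hf hP, lintegral_massShell hm, lintegral_massShell hm]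
  have hm1 : Measurable fun k : Mom => shellDensity m k * f (shellPt m k) :=
    (measurable_shellDensity hm).mul (hf.comp (contDiff_shellPt hm).continuous.measurable)
  rw [← weylRot.measurePreserving.lintegral_comp hm1]
  refine lintegral_congr fun k => ?_
  rw [pullback_weyl_shellPt]
  congr 1
  simp [shellDensity, energy, weylRot_apply, Fin.sum_univ_three]

theorem measurePreserving_pullback (hm : 0 < m) (A : SL2) :
    MeasurePreserving (pullback A) (massShell m) (massShell m) := by
  have hup : ∀ c : ℂ, ∀ U : SL2, mat U = !![1, c; 0, 1] →
      MeasurePreserving (pullback U) (massShell m) (massShell m) := fun c U hU => by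
    have : U = borel 0 ![c.re, c.im] := by
      apply Subtype.ext
      change mat U = _
      rw [hU]
      simp [borel]
    rw [this]
    exact measurePreserving_pullback_borel hm _ _
  have hlow : ∀ c : ℂ, ∀ L : SL2, mat L = !![1, 0; c, 1] →
      MeasurePreserving (pullback L) (massShell m) (massShell m) := fun c L hL => by
    have hw := measurePreserving_pullback_weyl hm
    have : L = weyl * (weyl⁻¹ * L * weyl) * weyl⁻¹ := by group
    rw [this]
    refine measurePreserving_pullback_mul (measurePreserving_pullback_mul hw
      (hup (-c) _ ?_)) (measurePreserving_pullback_inv hw)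
    change (weyl⁻¹ : SL2).1 * L.1 * weyl.1 = _
    rw [show L.1 = _ from hL, Matrix.SpecialLinearGroup.coe_inv, weyl, Matrix.adjugate_fin_two_of]
    ext i j
    fin_cases i <;> fin_cases j <;> simp [Matrix.mul_apply]
  have hne : ∀ A : SL2, mat A 1 0 ≠ 0 →
      MeasurePreserving (pullback A) (massShell m) (massShell m) := fun A hA => by
    set a := mat A 0 0 with ha
    set b := mat A 0 1 with hb
    set c := mat A 1 0 with hc
    set d := mat A 1 1 with hd
    have hdet : a * d - b * c = 1 := mat_det A
    set U1 : SL2 := ⟨!![1, (a - 1) / c; 0, 1], by simp⟩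
    set L : SL2 := ⟨!![1, 0; c, 1], by simp⟩
    set U2 : SL2 := ⟨!![1, (d - 1) / c; 0, 1], by simp⟩
    have : A = U1 * L * U2 := by
      apply Subtype.ext
      change mat A = !![1, (a - 1) / c; 0, 1] * !![1, 0; c, 1] * !![1, (d - 1) / c; 0, 1]
      rw [Matrix.eta_fin_two (mat A)]
      ext i j
      fin_cases i <;> fin_cases j <;> simp [Matrix.mul_apply, Fin.sum_univ_two, ← ha, ← hb, ← hc, ← hd] <;>
        field_simp <;> first | ring1 | linear_combination hdet | linear_combination -hdet
    rw [this]
    exact measurePreserving_pullback_mul (measurePreserving_pullback_mul (hup _ U1 rfl)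
      (hlow _ L rfl)) (hup _ U2 rfl)
  by_cases hA : mat A 1 0 = 0
  · set L : SL2 := ⟨!![1, 0; 1, 1], by simp⟩
    have h1 : A = (A * L) * L⁻¹ := by group
    rw [h1]
    refine measurePreserving_pullback_mul (hne _ ?_) (measurePreserving_pullback_inv (hlow 1 L rfl))
    change (mat A * (!![1, 0; 1, 1] : Matrix (Fin 2) (Fin 2) ℂ)) 1 0 ≠ 0
    have hdet := mat_det A
    rw [hA] at hdet
    simp only [Matrix.mul_apply, Fin.sum_univ_two]
    simp
    intro h
    rw [show mat A 1 0 = 0 from hA, zero_add] at h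
    rw [h] at hdet
    simp at hdet
  · exact hne A hA

end SuperPoincare

namespace SuperPoincare
open Complex (I exp)
open MeasureTheory

/-! ### Hilbert spaces of square-integrable sections over the mass shell -/

variable {m : ℝ}

theorem continuous_plus (hm : 0 < m) : Continuous (plus m) :=
  ((continuous_energy hm).comp spatial.continuous).add (continuous_apply 1)

theorem continuous_triv (hm : 0 < m) : Continuous fun x : Covector × Fock => triv m x.1 x.2 := by
  have h1 : Continuous fun x : Covector × Fock => √(plus m x.1) :=
    ((continuous_plus hm).comp continuous_fst).sqrt
  have h0 : ∀ x : Covector × Fock, √(plus m x.1) ≠ 0 := fun x =>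
    (Real.sqrt_pos.2 (plus_pos hm x.1)).ne'
  refine (PiLp.continuous_toLp 2 _).comp (continuous_pi fun I => ?_)
  rcases finset_fin_two_cases I with rfl | rfl | rfl | rfl
  · simp; fun_prop
  · simp only [Finset.singleton_ne_empty, if_false, if_true]
    have := (continuous_const (y := √2)).div h1 h0
    fun_prop
  · simp only [Finset.singleton_ne_empty, Finset.singleton_inj, one_ne_zero, if_false, if_true]
    have := (continuous_const (y := √2 * m)).div h1 h0
    fun_prop
  · simp only [univ_ne_empty', univ_ne_zero', univ_ne_one', if_false]
    fun_prop

theorem continuous_trivInv (hm : 0 < m) :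
    Continuous fun x : Covector × FibreE => trivInv m x.1 x.2 := by
  have h1 : Continuous fun x : Covector × FibreE => √(plus m x.1) :=
    ((continuous_plus hm).comp continuous_fst).sqrt
  have h0 : ∀ x : Covector × FibreE, √(plus m x.1) ≠ 0 := fun x =>
    (Real.sqrt_pos.2 (plus_pos hm x.1)).ne'
  have h2 : √2 ≠ 0 := by positivity
  refine continuous_pi fun I => ?_
  have he : ∀ I, Continuous fun x : Covector × FibreE => x.2 I := fun I => by fun_prop
  rcases finset_fin_two_cases I with rfl | rfl | rfl | rfl
  · simp only [trivInv_empty]; exact he _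
  · simp only [trivInv_zero]
    have e1 : Continuous fun x : Covector × FibreE => (√2 * √(plus m x.1))⁻¹ :=
      (h1.const_mul √2).inv₀ fun x => mul_ne_zero h2 (h0 x)
    have e2 : Continuous fun x : Covector × FibreE => (√2 * m * √(plus m x.1))⁻¹ := (h1.const_mul (√2 * m)).inv₀ fun x => mul_ne_zero (mul_ne_zero h2 hm.ne') (h0 x)
    have := he {0}
    have := he {1}
    generalize hE1 : (fun x : Covector × FibreE => (√2 * √(plus m x.1))⁻¹) = E1 at e1
    generalize hE2 : (fun x : Covector × FibreE => (√2 * m * √(plus m x.1))⁻¹) = E2 at e2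
    change Continuous fun x : Covector × FibreE =>
      ((fun x : Covector × FibreE => (√2 * √(plus m x.1))⁻¹) x : ℝ) * x.2 {0} -
      ((x.1 2 : ℂ) + x.1 3 * Complex.I) *
        ((fun x : Covector × FibreE => (√2 * m * √(plus m x.1))⁻¹) x : ℝ) * x.2 {1}
    rw [hE1, hE2]
    fun_prop
  · simp only [trivInv_one]
    have := he {1}
    fun_prop
  · simp only [trivInv_univ]
    have := he Finset.univ
    fun_prop

theorem trivInv_add (hm : 0 < m) (p : Covector) (v w : FibreE) :
    trivInv m p (v + w) = trivInv m p v + trivInv m p w := by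
  rw [← trivInv_triv hm p (trivInv m p v + trivInv m p w), triv_add, triv_trivInv hm,
    triv_trivInv hm]

theorem trivInv_smul (hm : 0 < m) (p : Covector) (c : ℂ) (w : FibreE) :
    trivInv m p (c • w) = c • trivInv m p w := by
  rw [← trivInv_triv hm p (c • trivInv m p w), triv_smul, triv_trivInv hm]

theorem aestronglyMeasurable_triv (hm : 0 < m) {w : Covector → Fock}
    (hw : AEStronglyMeasurable w (massShell m)) :
    AEStronglyMeasurable (fun p => triv m p (w p)) (massShell m) := by
  have h : AEStronglyMeasurable (fun p => (p, w p)) (massShell m) :=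
    aestronglyMeasurable_id.prodMk hw
  have h2 := (continuous_triv hm).comp_aestronglyMeasurable h
  exact h2

theorem aestronglyMeasurable_trivInv (hm : 0 < m) {w : Covector → FibreE}
    (hw : AEStronglyMeasurable w (massShell m)) :
    AEStronglyMeasurable (fun p => trivInv m p (w p)) (massShell m) := by
  have h : AEStronglyMeasurable (fun p => (p, w p)) (massShell m) :=
    aestronglyMeasurable_id.prodMk hw
  have h2 := (continuous_trivInv hm).comp_aestronglyMeasurable h
  exact h2

theorem lintegral_fibreNormSq (hm : 0 < m) (w : Covector → Fock) :
    ∫⁻ p, ENNReal.ofReal (fibreNormSq m p (w p)) ∂(massShell m) =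
      ∫⁻ p, ‖triv m p (w p)‖ₑ ^ 2 ∂(massShell m) := by
  refine lintegral_congr_ae ?_
  filter_upwards [ae_onShell hm] with p hp
  rw [← norm_triv_sq hm hp, ENNReal.ofReal_pow (norm_nonneg _), ofReal_norm]

theorem eLpNorm_two_sq {α E : Type*} [MeasurableSpace α] {μ : Measure α} [NormedAddCommGroup E]
    (f : α → E) : eLpNorm f 2 μ ^ 2 = ∫⁻ x, ‖f x‖ₑ ^ 2 ∂μ := by
  have h := eLpNorm_nnreal_pow_eq_lintegral (f := f) (μ := μ) (p := 2) two_ne_zero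
  simpa using h

/-- The norm of `p_0⁻²` in the space of square-integrable functions on the mass shell. -/
def shellConst (m : ℝ) : ℝ := √(∫ p : Covector, ‖(p 0 ^ 2)⁻¹‖ ^ (2 : ℝ) ∂(massShell m))

variable {H : Type*} [NormedAddCommGroup H] [InnerProductSpace ℂ H]

/-- `Φ` identifies `H` with the Hilbert space of square-integrable sections over the mass shell,
with the induced action of the Poincare group. -/
structure PreInduced (m : ℝ) (ρ : Poincare →* (H ≃ₗᵢ[ℂ] H))
    (Φ : H →ₗ[ℂ] AEEqFun Covector Fock (massShell m)) : Prop where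
  norm_sq : ∀ Ψ, ENNReal.ofReal (‖Ψ‖ ^ 2) =
    ∫⁻ p, ENNReal.ofReal (fibreNormSq m p (Φ Ψ p)) ∂(massShell m)
  surj : ∀ w : AEEqFun Covector Fock (massShell m),
    ∫⁻ p, ENNReal.ofReal (fibreNormSq m p (w p)) ∂(massShell m) < ⊤ → ∃ Ψ, Φ Ψ = w
  poincare : ∀ (g : Poincare) (Ψ : H), ∀ᵐ p ∂(massShell m),
    Φ (ρ g Ψ) p = exp (-(I * (p ⬝ᵥ g.trans : ℝ))) •
      spinFock g.lin (Φ Ψ (pullback g.lin p))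

theorem IsInduced.preInduced {R : SuperUnitaryRep H}
    {Φ : H →ₗ[ℂ] AEEqFun Covector Fock (massShell m)} (h : IsInduced m R Φ) :
    PreInduced m R.ρ Φ := ⟨h.norm_sq, h.surj, h.poincare⟩

namespace PreInduced

variable {ρ : Poincare →* (H ≃ₗᵢ[ℂ] H)} {Φ : H →ₗ[ℂ] AEEqFun Covector Fock (massShell m)}

theorem coe_add (Φ : H →ₗ[ℂ] AEEqFun Covector Fock (massShell m)) (Ψ Ω : H) :
    ∀ᵐ p ∂(massShell m), Φ (Ψ + Ω) p = Φ Ψ p + Φ Ω p := by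
  rw [map_add]; exact AEEqFun.coeFn_add _ _

theorem coe_sub (Φ : H →ₗ[ℂ] AEEqFun Covector Fock (massShell m)) (Ψ Ω : H) :
    ∀ᵐ p ∂(massShell m), Φ (Ψ - Ω) p = Φ Ψ p - Φ Ω p := by
  rw [map_sub]; exact AEEqFun.coeFn_sub _ _

theorem coe_smul (Φ : H →ₗ[ℂ] AEEqFun Covector Fock (massShell m)) (c : ℂ) (Ψ : H) :
    ∀ᵐ p ∂(massShell m), Φ (c • Ψ) p = c • Φ Ψ p := by
  rw [map_smul]; exact AEEqFun.coeFn_smul _ _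

theorem coe_zero (Φ : H →ₗ[ℂ] AEEqFun Covector Fock (massShell m)) :
    ∀ᵐ p ∂(massShell m), Φ 0 p = 0 := by
  rw [map_zero]; exact AEEqFun.coeFn_zero

variable (h : PreInduced m ρ Φ) (hm : 0 < m)
include h hm

theorem enorm_sq (Ψ : H) : ‖Ψ‖ₑ ^ 2 = ∫⁻ p, ‖triv m p (Φ Ψ p)‖ₑ ^ 2 ∂(massShell m) := by
  rw [← lintegral_fibreNormSq hm, ← h.norm_sq, ENNReal.ofReal_pow (norm_nonneg _), ofReal_norm]

theorem eLpNorm_triv (Ψ : H) : eLpNorm (fun p => triv m p (Φ Ψ p)) 2 (massShell m) = ‖Ψ‖ₑ := by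
  have h2 := (h.enorm_sq hm Ψ).symm
  rw [← eLpNorm_two_sq] at h2
  exact (ENNReal.pow_right_strictMono two_ne_zero).injective h2

theorem memLp (Ψ : H) : MemLp (fun p => triv m p (Φ Ψ p)) 2 (massShell m) :=
  ⟨aestronglyMeasurable_triv hm (Φ Ψ).aestronglyMeasurable, by
    rw [h.eLpNorm_triv hm]; exact enorm_lt_top⟩

omit hm in
theorem eq_of_ae {Ψ Ω : H} (he : ∀ᵐ p ∂(massShell m), Φ Ψ p = Φ Ω p) : Ψ = Ω := by
  rw [← sub_eq_zero, ← norm_eq_zero, ← sq_eq_zero_iff]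
  have h1 := h.norm_sq (Ψ - Ω)
  rw [lintegral_congr_ae (g := fun _ => 0), lintegral_zero] at h1
  · exact le_antisymm (ENNReal.ofReal_eq_zero.1 h1) (sq_nonneg _)
  · filter_upwards [he, coe_sub Φ Ψ Ω] with p h2 h3
    rw [h3, h2, sub_self]
    simp [fibreNormSq, gamma, dotProduct]

theorem exists_of_memLp {g : Covector → FibreE} (hg : MemLp g 2 (massShell m)) :
    ∃ Ψ, ∀ᵐ p ∂(massShell m), Φ Ψ p = trivInv m p (g p) := by
  set w : AEEqFun Covector Fock (massShell m) :=
    AEEqFun.mk _ (aestronglyMeasurable_trivInv hm hg.1) with hw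
  have hc := AEEqFun.coeFn_mk _ (aestronglyMeasurable_trivInv hm hg.1)
  obtain ⟨Ψ, hΨ⟩ := h.surj w (by
    rw [lintegral_fibreNormSq hm, ← eLpNorm_two_sq]
    refine ENNReal.pow_lt_top ?_
    rw [eLpNorm_congr_ae (g := g)]
    · exact hg.2
    · filter_upwards [hc] with p hp
      rw [hw, hp, triv_trivInv hm])
  refine ⟨Ψ, ?_⟩
  rw [hΨ]
  exact hc

theorem exists_of_bound {g : Covector → Fock} (hg : AEStronglyMeasurable g (massShell m)) (Ψ : H)
    {C : ℝ} (hC : ∀ᵐ p ∂(massShell m), ‖triv m p (g p)‖ ≤ C * ‖triv m p (Φ Ψ p)‖) :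
    ∃ Ω, (∀ᵐ p ∂(massShell m), Φ Ω p = g p) ∧ ‖Ω‖ ≤ C * ‖Ψ‖ := by
  have hM : MemLp (fun p => triv m p (g p)) 2 (massShell m) :=
    MemLp.of_le_mul (h.memLp hm Ψ) (aestronglyMeasurable_triv hm hg) hC
  obtain ⟨Ω, hΩ⟩ := h.exists_of_memLp hm hM
  simp only [trivInv_triv hm] at hΩ
  refine ⟨Ω, hΩ, ?_⟩
  rcases eq_or_ne Ψ 0 with rfl | hΨ
  · have : Ω = 0 := h.eq_of_ae (by
      filter_upwards [hΩ, hC, coe_zero Φ] with p h1 h2 h3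
      rw [h1, h3]
      rw [h3, show triv m p 0 = 0 by simpa using triv_smul (m := m) p 0 0, norm_zero, mul_zero,
        norm_le_zero_iff] at h2
      rw [← trivInv_triv hm p (g p), h2]
      simpa using trivInv_smul hm p 0 0)
    rw [this]; simp
  have hC0 : 0 ≤ C := by
    by_contra hneg
    refine hΨ (h.eq_of_ae ?_)
    filter_upwards [hC, coe_zero Φ] with p h1 h3
    have h4 : ‖triv m p (Φ Ψ p)‖ = 0 := by
      have := norm_nonneg (triv m p (g p))
      have := norm_nonneg (triv m p (Φ Ψ p))
      nlinarith
    rw [norm_eq_zero] at h4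
    rw [h3, ← trivInv_triv hm p (Φ Ψ p), h4]
    simpa using trivInv_smul hm p 0 0
  have h1 : ‖Ω‖ₑ ≤ ENNReal.ofReal C * ‖Ψ‖ₑ := by
    rw [← h.eLpNorm_triv hm Ω, ← h.eLpNorm_triv hm Ψ]
    refine eLpNorm_le_mul_eLpNorm_of_ae_le_mul ?_ 2
    filter_upwards [hΩ, hC] with p h2 h3
    rwa [h2]
  rw [← ofReal_norm, ← ofReal_norm, ← ENNReal.ofReal_mul hC0] at h1
  exact (ENNReal.ofReal_le_ofReal_iff (by positivity)).1 h1

/-- Bounded operators which act fibrewise. -/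
theorem exists_fibre_op (N : Covector → Fock →ₗ[ℂ] Fock)
    (hN : Continuous fun x : Covector × Fock => N x.1 x.2) (C : ℝ)
    (hC : ∀ p, OnShell m p → ∀ w, ‖triv m p (N p w)‖ ≤ C * ‖triv m p w‖) :
    ∃ T : H →L[ℂ] H, ∀ Ψ, ∀ᵐ p ∂(massShell m), Φ (T Ψ) p = N p (Φ Ψ p) := by
  have hex : ∀ Ψ, ∃ Ω, (∀ᵐ p ∂(massShell m), Φ Ω p = N p (Φ Ψ p)) ∧ ‖Ω‖ ≤ C * ‖Ψ‖ := fun Ψ =>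
    h.exists_of_bound hm (hN.comp_aestronglyMeasurable
      (aestronglyMeasurable_id.prodMk (Φ Ψ).aestronglyMeasurable)) Ψ (by
      filter_upwards [ae_onShell hm] with p hp using hC p hp _)
  choose T hT hTC using hex
  refine ⟨LinearMap.mkContinuous { toFun := T, map_add' := ?_, map_smul' := ?_ } C hTC, hT⟩
  · intro Ψ Ω
    refine h.eq_of_ae ?_
    filter_upwards [hT (Ψ + Ω), hT Ψ, hT Ω, coe_add Φ Ψ Ω, coe_add Φ (T Ψ) (T Ω)]
      with p h1 h2 h3 h4 h5
    rw [h1, h4, h5, h2, h3, map_add]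
  · intro c Ψ
    refine h.eq_of_ae ?_
    filter_upwards [hT (c • Ψ), hT Ψ, coe_smul Φ c Ψ, coe_smul Φ c (T Ψ)]
      with p h1 h2 h4 h5
    rw [RingHom.id_apply, h1, h4, h5, h2, map_smul]

/-- The isometry onto the square-integrable functions given by the trivialization. -/
def toLp : H →ₗᵢ[ℂ] Lp FibreE 2 (massShell m) where
  toFun Ψ := (h.memLp hm Ψ).toLp _
  map_add' Ψ Ω := by
    rw [← MemLp.toLp_add]
    refine MemLp.toLp_congr _ _ ?_
    filter_upwards [coe_add Φ Ψ Ω] with p hp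
    rw [hp, triv_add]; rfl
  map_smul' c Ψ := by
    rw [RingHom.id_apply, ← MemLp.toLp_const_smul]
    refine MemLp.toLp_congr _ _ ?_
    filter_upwards [coe_smul Φ c Ψ] with p hp
    rw [hp, triv_smul]; rfl
  norm_map' Ψ := by
    change ‖(h.memLp hm Ψ).toLp _‖ = _
    rw [Lp.norm_toLp, h.eLpNorm_triv hm, toReal_enorm]

theorem coe_toLp (Ψ : H) : ∀ᵐ p ∂(massShell m), h.toLp hm Ψ p = triv m p (Φ Ψ p) :=
  (h.memLp hm Ψ).coeFn_toLp

theorem inner_eq (Ψ Ω : H) : inner ℂ Ψ Ω =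
    ∫ p, inner ℂ (triv m p (Φ Ψ p)) (triv m p (Φ Ω p)) ∂(massShell m) := by
  rw [← (h.toLp hm).inner_map_map, L2.inner_def]
  refine integral_congr_ae ?_
  filter_upwards [h.coe_toLp hm Ψ, h.coe_toLp hm Ω] with p h1 h2
  rw [h1, h2]

theorem integrable_inner (Ψ Ω : H) :
    Integrable (fun p => (inner ℂ (triv m p (Φ Ψ p)) (triv m p (Φ Ω p)) : ℂ)) (massShell m) := by
  refine (L2.integrable_inner (𝕜 := ℂ) (h.toLp hm Ψ) (h.toLp hm Ω)).congr ?_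
  filter_upwards [h.coe_toLp hm Ψ, h.coe_toLp hm Ω] with p h1 h2
  rw [h1, h2]

/-- Limits in `H` and limits almost everywhere agree. -/
theorem ae_eq_of_tendsto {Ψ : ℕ → H} {Ω : H} (hΨ : Filter.Tendsto Ψ Filter.atTop (nhds Ω))
    {g : Covector → Fock} (hg : ∀ᵐ p ∂(massShell m),
      Filter.Tendsto (fun n => Φ (Ψ n) p) Filter.atTop (nhds (g p))) :
    ∀ᵐ p ∂(massShell m), Φ Ω p = g p := by
  have h1 : Filter.Tendsto (fun n => h.toLp hm (Ψ n)) Filter.atTop (nhds (h.toLp hm Ω)) :=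
    ((h.toLp hm).continuous.tendsto _).comp hΨ
  obtain ⟨ns, hns, hlim⟩ := (tendstoInMeasure_of_tendsto_Lp h1).exists_seq_tendsto_ae
  have h2 : ∀ᵐ p ∂(massShell m), ∀ n, h.toLp hm (Ψ n) p = triv m p (Φ (Ψ n) p) :=
    ae_all_iff.2 fun n => h.coe_toLp hm (Ψ n)
  filter_upwards [hlim, hg, h2, h.coe_toLp hm Ω] with p h3 h4 h5 h6
  simp only [h5, h6] at h3
  have h7 := ((continuous_trivInv hm).comp (Continuous.prodMk_right p)).tendsto
    (triv m p (Φ Ω p)) |>.comp h3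
  simp only [Function.comp_def, trivInv_triv hm] at h7
  exact tendsto_nhds_unique h7 (h4.comp hns.tendsto_atTop)

/-- Bounded functionals given by integrals over the mass shell. -/
theorem integral_norm_fibre_le (N : Covector → Fock →ₗ[ℂ] Fock)
    (hN : Continuous fun x : Covector × Fock => N x.1 x.2) (C : ℝ)
    (hC : ∀ p, OnShell m p → ∀ w, ‖N p w‖ ≤ C * (p 0 ^ 2)⁻¹ * ‖triv m p w‖) (Ψ : H) :
    Integrable (fun p => N p (Φ Ψ p)) (massShell m) ∧
      ∫ p, ‖N p (Φ Ψ p)‖ ∂(massShell m) ≤ shellConst m * C * ‖Ψ‖ := by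
  have hbase : MemLp (fun p : Covector => (p 0 ^ 2)⁻¹) 2 (massShell m) := by
    have hmeas : AEStronglyMeasurable (fun p : Covector => (p 0 ^ 2)⁻¹) (massShell m) := by
      have : Measurable (fun p : Covector => (p 0 ^ 2)⁻¹) := by fun_prop
      exact this.aestronglyMeasurable
    rw [memLp_two_iff_integrable_sq hmeas]
    refine integrable_massShell_of_bound hm (hmeas.pow 2) (C := m⁻¹) fun p hp => ?_
    have h1 := hp.pos hm
    have h2 : m ≤ p 0 := by rw [hp]; exact le_energy _ _
    rw [Real.norm_eq_abs, abs_of_nonneg (by positivity), inv_pow, ← mul_inv]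
    exact inv_anti₀ (by positivity) (by
      calc m * p 0 ^ 3 ≤ p 0 * p 0 ^ 3 := by gcongr
        _ = _ := by ring)
  have hint : Integrable (fun p => (p 0 ^ 2)⁻¹ * ‖triv m p (Φ Ψ p)‖) (massShell m) :=
    hbase.integrable_mul (h.memLp hm Ψ).norm
  have hae : ∀ᵐ p ∂(massShell m), ‖N p (Φ Ψ p)‖ ≤ C * ((p 0 ^ 2)⁻¹ * ‖triv m p (Φ Ψ p)‖) := by
    filter_upwards [ae_onShell hm] with p hp
    rw [← mul_assoc]
    exact hC p hp _
  have hmeas : AEStronglyMeasurable (fun p => (p, Φ Ψ p)) (massShell m) :=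
    aestronglyMeasurable_id.prodMk (Φ Ψ).aestronglyMeasurable
  have hi : Integrable (fun p => N p (Φ Ψ p)) (massShell m) :=
    (hint.const_mul C).mono' (hN.comp_aestronglyMeasurable hmeas) hae
  refine ⟨hi, ?_⟩
  by_cases hC0 : 0 ≤ C
  · have h1 : ∫ p, ‖N p (Φ Ψ p)‖ ∂(massShell m) ≤
        ∫ p, C * ((p 0 ^ 2)⁻¹ * ‖triv m p (Φ Ψ p)‖) ∂(massShell m) :=
      integral_mono_ae hi.norm (hint.const_mul C) hae
    rw [integral_const_mul] at h1
    have h2 : ∫ p, (p 0 ^ 2)⁻¹ * ‖triv m p (Φ Ψ p)‖ ∂(massShell m) ≤ shellConst m * ‖Ψ‖ := by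
      have h3 := integral_mul_norm_le_Lp_mul_Lq (μ := massShell m) (p := 2) (q := 2)
        (f := fun p : Covector => (p 0 ^ 2)⁻¹) (g := fun p => ‖triv m p (Φ Ψ p)‖)
        (by norm_num [Real.holderConjugate_iff]) (by simpa using hbase)
        (by simpa using (h.memLp hm Ψ).norm)
      have h4 : ∫ p, ‖‖triv m p (Φ Ψ p)‖‖ ^ (2 : ℝ) ∂(massShell m) = ‖Ψ‖ ^ 2 := by
        have h5 := h.inner_eq hm Ψ Ψ
        simp only [inner_self_eq_norm_sq_to_K] at h5
        have h6 : ∀ p, ((‖triv m p (Φ Ψ p)‖ : ℂ)) ^ 2 =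
            ((‖‖triv m p (Φ Ψ p)‖‖ ^ (2 : ℝ) : ℝ) : ℂ) := fun p => by
          rw [norm_norm, Real.rpow_two, Complex.ofReal_pow]
        change (‖Ψ‖ : ℂ) ^ 2 = ∫ p, (‖triv m p (Φ Ψ p)‖ : ℂ) ^ 2 ∂(massShell m) at h5
        simp only [h6] at h5
        rw [integral_complex_ofReal] at h5
        exact_mod_cast h5.symm
      rw [h4, ← Real.sqrt_eq_rpow, ← Real.sqrt_eq_rpow, Real.sqrt_sq (norm_nonneg _)] at h3
      refine le_trans (le_of_eq (integral_congr_ae (Filter.Eventually.of_forall fun p => ?_))) h3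
      simp only [norm_norm]
      rw [Real.norm_of_nonneg (by positivity)]
    calc _ ≤ _ := h1
      _ ≤ _ := mul_le_mul_of_nonneg_left h2 hC0
      _ = _ := by ring
  · have hz : ∀ᵐ p ∂(massShell m), ‖N p (Φ Ψ p)‖ = 0 ∧ ‖triv m p (Φ Ψ p)‖ = 0 := by
      filter_upwards [hae, ae_onShell hm] with p h1 h2
      have h3 := h2.pos hm
      have h4 : 0 < (p 0 ^ 2)⁻¹ := by positivity
      have h5 := norm_nonneg (N p (Φ Ψ p))
      have h6 := norm_nonneg (triv m p (Φ Ψ p))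
      have h7 : 0 ≤ (p 0 ^ 2)⁻¹ * ‖triv m p (Φ Ψ p)‖ := by positivity
      have h8 : (p 0 ^ 2)⁻¹ * ‖triv m p (Φ Ψ p)‖ = 0 := by nlinarith [not_le.1 hC0]
      refine ⟨by nlinarith, (mul_eq_zero.1 h8).resolve_left h4.ne'⟩
    have hΨ : ‖Ψ‖ₑ = 0 := by
      rw [← h.eLpNorm_triv hm, eLpNorm_congr_ae (g := 0), eLpNorm_zero]
      filter_upwards [hz] with p hp using norm_eq_zero.1 hp.2
    rw [enorm_eq_zero] at hΨ
    rw [hΨ, norm_zero, mul_zero, ← hΨ, integral_congr_ae (g := fun _ => 0), integral_zero]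
    filter_upwards [hz] with p hp using hp.1

end PreInduced

end SuperPoincare

namespace SuperPoincare
open Complex (I exp)
open MeasureTheory

/-! ### Smooth vectors -/

theorem Poincare.mk_mul_mk (v w : Spacetime) (A B : SL2) :
    (⟨v, A⟩ * ⟨w, B⟩ : Poincare) = ⟨v + lorentz A w, A * B⟩ := rfl

/-- The local coordinates on `SL(2,ℂ)` inverse to `slChart`. -/
def slCoord (B : SL2) : Fin 3 → ℂ := ![Complex.log (mat B 0 0), mat B 0 1, mat B 1 0]

theorem slChart_slCoord {B : SL2} (h : mat B 0 0 ≠ 0) : slChart (slCoord B) = B := by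
  have hd := mat_det B
  apply Subtype.ext
  change _ = mat B
  have h11 : (mat B 0 0)⁻¹ * (1 + mat B 0 1 * mat B 1 0) = mat B 1 1 := by
    field_simp
    linear_combination -hd
  rw [Matrix.eta_fin_two (mat B)]
  simp only [slChart, slCoord, Matrix.cons_val, Complex.exp_log h, Complex.exp_neg, h11]

section Rep

variable {H : Type*} [NormedAddCommGroup H] [InnerProductSpace ℂ H]
  {ρ : Poincare →* (H ≃ₗᵢ[ℂ] H)} {E : Type*} [NormedAddCommGroup E] [NormedSpace ℝ E]

theorem rep_rep (ρ : Poincare →* (H ≃ₗᵢ[ℂ] H)) (g h : Poincare) (Ψ : H) :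
    ρ g (ρ h Ψ) = ρ (g * h) Ψ := by
  rw [map_mul]; rfl

theorem contDiff_lorentz {A : E → SL2} (hA : ∀ i j, ContDiff ℝ ∞ fun e => mat (A e) i j)
    {c : E → Spacetime} (hc : ContDiff ℝ ∞ c) : ContDiff ℝ ∞ fun e => lorentz (A e) (c e) := by
  have hre : ∀ f : E → ℂ, ContDiff ℝ ∞ f → ContDiff ℝ ∞ fun e => (f e).re := fun f hf =>
    Complex.reCLM.contDiff.comp hf
  have him : ∀ f : E → ℂ, ContDiff ℝ ∞ f → ContDiff ℝ ∞ fun e => (f e).im := fun f hf =>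
    Complex.imCLM.contDiff.comp hf
  have hc' : ∀ i, ContDiff ℝ ∞ fun e => ((c e i : ℝ) : ℂ) := fun i =>
    Complex.ofRealCLM.contDiff.comp (contDiff_pi.1 hc i)
  have hconj : ∀ i j, ContDiff ℝ ∞ fun e => conj (mat (A e) i j) := fun i j =>
    Complex.conjCLE.contDiff.comp (hA i j)
  have hN : ∀ i j, ContDiff ℝ ∞ fun e =>
      (mat (A e) * toHerm (c e) * (mat (A e)).conjTranspose) i j := by
    have ht : ∀ i j, ContDiff ℝ ∞ fun e => toHerm (c e) i j := by
      intro i j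
      fin_cases i <;> fin_cases j <;> simp [toHerm]
      · exact (hc' 0).add (hc' 1)
      · exact (hc' 2).add (contDiff_const.mul (hc' 3))
      · exact (hc' 2).sub (contDiff_const.mul (hc' 3))
      · exact (hc' 0).sub (hc' 1)
    intro i j
    simp only [Matrix.mul_apply, Matrix.conjTranspose_apply]
    exact ContDiff.sum fun k _ => (ContDiff.sum fun l _ => (hA i l).mul (ht l k)).mul (hconj j k)
  rw [contDiff_pi]
  intro i
  fin_cases i
  · exact ((hre _ (hN 0 0)).add (hre _ (hN 1 1))).div_const 2
  · exact ((hre _ (hN 0 0)).sub (hre _ (hN 1 1))).div_const 2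
  · exact hre _ (hN 0 1)
  · exact him _ (hN 0 1)

theorem rep_eq_chart (ρ : Poincare →* (H ≃ₗᵢ[ℂ] H)) (Ψ : H) (A₀ : SL2) {A : SL2} (c : Spacetime)
    (h : mat (A₀⁻¹ * A) 0 0 ≠ 0) : ρ ⟨c, A⟩ Ψ =
      ρ ⟨0, A₀⟩ (ρ ⟨lorentz A₀⁻¹ c, slChart (slCoord (A₀⁻¹ * A))⟩ Ψ) := by
  rw [slChart_slCoord h, rep_rep, Poincare.mk_mul_mk, zero_add,
    lorentz_lorentz_inv, mul_inv_cancel_left]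

theorem mat_mul_apply (A B : SL2) (i j : Fin 2) :
    mat (A * B) i j = mat A i 0 * mat B 0 j + mat A i 1 * mat B 1 j := by
  rw [mat, Matrix.SpecialLinearGroup.coe_mul, Matrix.mul_apply, Fin.sum_univ_two]

theorem contDiff_rep {Ψ : H} (hΨ : Ψ ∈ smoothVectors ρ) {c : E → Spacetime} {A : E → SL2}
    (hc : ContDiff ℝ ∞ c) (hA : ∀ i j, ContDiff ℝ ∞ fun e => mat (A e) i j) :
    ContDiff ℝ ∞ fun e => ρ ⟨c e, A e⟩ Ψ := by
  rw [contDiff_iff_contDiffAt]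
  intro e₀
  have hB : ∀ i j, ContDiff ℝ ∞ fun e => mat ((A e₀)⁻¹ * A e) i j := fun i j => by
    simp only [mat_mul_apply]
    exact (contDiff_const.mul (hA 0 j)).add (contDiff_const.mul (hA 1 j))
  have hB0 : mat ((A e₀)⁻¹ * A e₀) 0 0 = 1 := by
    rw [inv_mul_cancel, mat, Matrix.SpecialLinearGroup.coe_one, Matrix.one_apply_eq]
  have hev : ∀ᶠ e in nhds e₀, mat ((A e₀)⁻¹ * A e) 0 0 ≠ 0 :=
    (hB 0 0).continuous.continuousAt.eventually_ne (by rw [hB0]; exact one_ne_zero)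
  have hcoord : ContDiffAt ℝ ∞ (fun e => slCoord ((A e₀)⁻¹ * A e)) e₀ := by
    rw [contDiffAt_pi]
    intro i
    fin_cases i
    · refine ((Complex.contDiffAt_log ?_).restrict_scalars ℝ).comp e₀ (hB 0 0).contDiffAt
      rw [hB0]
      exact Complex.one_mem_slitPlane
    · exact (hB 0 1).contDiffAt
    · exact (hB 1 0).contDiffAt
  have hl : ContDiff ℝ ∞ fun e => lorentz (A e₀)⁻¹ (c e) :=
    contDiff_lorentz (fun i j => contDiff_const) hc
  have hs : ContDiff ℝ ∞ (fun y : Spacetime × (Fin 3 → ℂ) => ρ ⟨y.1, slChart y.2⟩ Ψ) := hΨ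
  have h1 : ContDiffAt ℝ ∞ (fun e => ρ ⟨0, A e₀⟩ (ρ ⟨lorentz (A e₀)⁻¹ (c e),
      slChart (slCoord ((A e₀)⁻¹ * A e))⟩ Ψ)) e₀ :=
    (((ρ ⟨0, A e₀⟩).toContinuousLinearEquiv.toContinuousLinearMap.restrictScalars
      ℝ).contDiff.contDiffAt).comp e₀
      (hs.contDiffAt.comp e₀ (hl.contDiffAt.prodMk hcoord))
  refine h1.congr_of_eventuallyEq ?_
  filter_upwards [hev] with e he using rep_eq_chart ρ Ψ (A e₀) (c e) he

theorem continuous_rep {Ψ : H} (hΨ : Ψ ∈ smoothVectors ρ) :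
    Continuous fun y : Spacetime × SL2 => ρ ⟨y.1, y.2⟩ Ψ := by
  rw [continuous_iff_continuousAt]
  intro e₀
  have hent : ∀ i j, Continuous fun y : Spacetime × SL2 => mat (e₀.2⁻¹ * y.2) i j := fun i j => by
    have : Continuous fun y : Spacetime × SL2 => mat (e₀.2⁻¹ * y.2) :=
      continuous_subtype_val.comp
        (Continuous.mul (f := fun _ => e₀.2⁻¹) (g := Prod.snd) continuous_const continuous_snd)
    exact (this.matrix_elem i j)
  have hB0 : mat (e₀.2⁻¹ * e₀.2) 0 0 = 1 := by
    rw [inv_mul_cancel, mat, Matrix.SpecialLinearGroup.coe_one, Matrix.one_apply_eq]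
  have hev : ∀ᶠ e : Spacetime × SL2 in nhds e₀, mat (e₀.2⁻¹ * e.2) 0 0 ≠ 0 :=
    (hent 0 0).continuousAt.eventually_ne (by rw [hB0]; exact one_ne_zero)
  have hcoord : ContinuousAt (fun e : Spacetime × SL2 => slCoord (e₀.2⁻¹ * e.2)) e₀ := by
    rw [continuousAt_pi]
    intro i
    fin_cases i
    · refine ContinuousAt.clog (hent 0 0).continuousAt ?_
      rw [hB0]
      exact Complex.one_mem_slitPlane
    · exact (hent 0 1).continuousAt
    · exact (hent 1 0).continuousAt
  have hl : Continuous fun e : Spacetime × SL2 => lorentz e₀.2⁻¹ e.1 :=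
    (lorentzL e₀.2⁻¹).continuous.comp continuous_fst
  have hs : ContDiff ℝ ∞ (fun y : Spacetime × (Fin 3 → ℂ) => ρ ⟨y.1, slChart y.2⟩ Ψ) := hΨ
  have h1 : ContinuousAt (fun e : Spacetime × SL2 => ρ ⟨0, e₀.2⟩ (ρ ⟨lorentz e₀.2⁻¹ e.1,
      slChart (slCoord (e₀.2⁻¹ * e.2))⟩ Ψ)) e₀ :=
    (ρ ⟨0, e₀.2⟩).continuous.continuousAt.comp
      (hs.continuous.continuousAt.comp (hl.continuousAt.prodMk hcoord))
  refine h1.congr ?_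
  filter_upwards [hev] with e he using (rep_eq_chart ρ Ψ e₀.2 e.1 he).symm

theorem contDiff_slChart (i j : Fin 2) {f : E → Fin 3 → ℂ} (hf : ContDiff ℝ ∞ f) :
    ContDiff ℝ ∞ fun e => mat (slChart (f e)) i j := by
  have hf' := contDiff_pi.1 hf
  have hexp : ContDiff ℝ ∞ exp := Complex.contDiff_exp
  fin_cases i <;> fin_cases j <;> simp [slChart, mat]
  · exact hexp.comp (hf' 0)
  · exact hf' 1
  · exact hf' 2
  · exact (hexp.comp (hf' 0).neg).mul (contDiff_const.add ((hf' 1).mul (hf' 2)))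

theorem mem_smoothVectors_of_contDiff {Ψ : H} (h : ∀ (c : (Spacetime × (Fin 3 → ℂ)) → Spacetime)
    (A : (Spacetime × (Fin 3 → ℂ)) → SL2), ContDiff ℝ ∞ c →
    (∀ i j, ContDiff ℝ ∞ fun e => mat (A e) i j) → ContDiff ℝ ∞ fun e => ρ ⟨c e, A e⟩ Ψ) :
    Ψ ∈ smoothVectors ρ :=
  h _ _ contDiff_fst fun i j => contDiff_slChart i j contDiff_snd

theorem rep_smooth_mem {Ψ : H} (hΨ : Ψ ∈ smoothVectors ρ) (g : Poincare) :
    ρ g Ψ ∈ smoothVectors ρ := by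
  refine mem_smoothVectors_of_contDiff fun c A hc hA => ?_
  have : ∀ e, ρ ⟨c e, A e⟩ (ρ g Ψ) = ρ ⟨c e + lorentz (A e) g.trans, A e * g.lin⟩ Ψ := fun e => by
    rw [rep_rep]; rfl
  simp only [this]
  refine contDiff_rep hΨ (hc.add (contDiff_lorentz hA contDiff_const)) fun i j => ?_
  simp only [mat_mul_apply]
  exact ((hA i 0).mul contDiff_const).add ((hA i 1).mul contDiff_const)

/-- Translates of a smooth vector. -/
theorem contDiff_translate {Ψ : H} (hΨ : Ψ ∈ smoothVectors ρ) :
    ContDiff ℝ ∞ fun x : Spacetime => ρ ⟨x, 1⟩ Ψ :=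
  contDiff_rep hΨ contDiff_id fun _ _ => contDiff_const

theorem hasDerivAt_translate {Ψ : H} (hΨ : Ψ ∈ smoothVectors ρ) (v : Spacetime) :
    HasDerivAt (fun t : ℝ => ρ ⟨t • v, 1⟩ Ψ) (translationDeriv ρ v Ψ) 0 := by
  have h : ContDiff ℝ ∞ fun t : ℝ => ρ ⟨t • v, 1⟩ Ψ :=
    (contDiff_translate hΨ).comp (contDiff_id.smul contDiff_const)
  exact (h.differentiable (by simp)).differentiableAt.hasDerivAt

theorem fderiv_translate {Ψ : H} (hΨ : Ψ ∈ smoothVectors ρ) (x v : Spacetime) :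
    fderiv ℝ (fun x : Spacetime => ρ ⟨x, 1⟩ Ψ) x v = ρ ⟨x, 1⟩ (translationDeriv ρ v Ψ) := by
  have h1 : HasFDerivAt (fun x : Spacetime => ρ ⟨x, 1⟩ Ψ) _ x :=
    ((contDiff_translate hΨ).differentiable (by simp)).differentiableAt.hasFDerivAt
  have hl : HasDerivAt (fun t : ℝ => x + t • v) v 0 := by
    simpa using ((hasDerivAt_id (0 : ℝ)).smul_const v).const_add x
  have h2 := (h1.congr_fderiv rfl).comp_hasDerivAt_of_eq 0 hl (by simp)
  have h3 : HasDerivAt (fun t : ℝ => ρ ⟨x, 1⟩ (ρ ⟨t • v, 1⟩ Ψ))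
      (ρ ⟨x, 1⟩ (translationDeriv ρ v Ψ)) 0 :=
    ((ρ ⟨x, 1⟩).toContinuousLinearEquiv.toContinuousLinearMap.restrictScalars
      ℝ).hasFDerivAt.comp_hasDerivAt 0 (hasDerivAt_translate hΨ v)
  have h4 : (fun t : ℝ => ρ ⟨x, 1⟩ (ρ ⟨t • v, 1⟩ Ψ)) =
      (fun x : Spacetime => ρ ⟨x, 1⟩ Ψ) ∘ fun t : ℝ => x + t • v := by
    funext t
    rw [rep_rep, Poincare.mk_mul_mk, lorentz_one, mul_one]
    rfl
  rw [h4] at h3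
  exact h2.unique h3

theorem rep_zero_one (ρ : Poincare →* (H ≃ₗᵢ[ℂ] H)) (Ψ : H) : ρ ⟨0, 1⟩ Ψ = Ψ := by
  change ρ 1 Ψ = Ψ
  rw [map_one]; rfl

theorem translationDeriv_eq {Ψ : H} (hΨ : Ψ ∈ smoothVectors ρ) (v : Spacetime) :
    translationDeriv ρ v Ψ = fderiv ℝ (fun x : Spacetime => ρ ⟨x, 1⟩ Ψ) 0 v := by
  rw [fderiv_translate hΨ, rep_zero_one]

theorem rep_translationDeriv {Ψ : H} (hΨ : Ψ ∈ smoothVectors ρ) (v : Spacetime) (g : Poincare) :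
    ρ g (translationDeriv ρ v Ψ) = translationDeriv ρ (lorentz g.lin v) (ρ g Ψ) := by
  have h3 : HasDerivAt (fun t : ℝ => ρ g (ρ ⟨t • v, 1⟩ Ψ))
      (ρ g (translationDeriv ρ v Ψ)) 0 :=
    ((ρ g).toContinuousLinearEquiv.toContinuousLinearMap.restrictScalars
      ℝ).hasFDerivAt.comp_hasDerivAt 0 (hasDerivAt_translate hΨ v)
  rw [← h3.deriv, translationDeriv]
  congr 1
  funext t
  rw [rep_rep, rep_rep]
  congr 2
  obtain ⟨w, A⟩ := g
  rw [Poincare.mk_mul_mk, Poincare.mk_mul_mk, lorentz_one, lorentz_smul, mul_one, one_mul, add_comm]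

theorem contDiff_rep_translationDeriv {Ψ : H} (hΨ : Ψ ∈ smoothVectors ρ) {c v : E → Spacetime}
    {A : E → SL2} (hc : ContDiff ℝ ∞ c) (hA : ∀ i j, ContDiff ℝ ∞ fun e => mat (A e) i j)
    (hv : ContDiff ℝ ∞ v) :
    ContDiff ℝ ∞ fun e => translationDeriv ρ (v e) (ρ ⟨c e, A e⟩ Ψ) := by
  have h1 : ContDiff ℝ ∞ (Function.uncurry fun (e : E) (x : Spacetime) =>
      ρ ⟨x, 1⟩ (ρ ⟨c e, A e⟩ Ψ)) := by
    have : ∀ y : E × Spacetime, Function.uncurry (fun (e : E) (x : Spacetime) =>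
        ρ ⟨x, 1⟩ (ρ ⟨c e, A e⟩ Ψ)) y = ρ ⟨y.2 + c y.1, A y.1⟩ Ψ := fun y => by
      rw [Function.uncurry, rep_rep, Poincare.mk_mul_mk,
        lorentz_one, one_mul]
    rw [funext this]
    exact contDiff_rep hΨ (contDiff_snd.add (hc.comp contDiff_fst))
      fun i j => (hA i j).comp contDiff_fst
  have h2 : ∀ e, translationDeriv ρ (v e) (ρ ⟨c e, A e⟩ Ψ) =
      fderiv ℝ (fun x : Spacetime => ρ ⟨x, 1⟩ (ρ ⟨c e, A e⟩ Ψ)) 0 (v e) := fun e =>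
    translationDeriv_eq (rep_smooth_mem hΨ _) _
  simp only [h2]
  exact (ContDiff.fderiv h1 contDiff_const (by simp)).clm_apply hv

theorem translationDeriv_mem {Ψ : H} (hΨ : Ψ ∈ smoothVectors ρ) (v : Spacetime) :
    translationDeriv ρ v Ψ ∈ smoothVectors ρ := by
  refine mem_smoothVectors_of_contDiff fun c A hc hA => ?_
  simp only [rep_translationDeriv hΨ]
  exact contDiff_rep_translationDeriv hΨ hc hA (contDiff_lorentz hA contDiff_const)

/-- The generator of the one-parameter group `t ↦ ρ (0, A t)`. -/
theorem hasDerivAt_rep_mem {Ψ : H} (hΨ : Ψ ∈ smoothVectors ρ) {A : ℝ → SL2}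
    (hA : ∀ i j, ContDiff ℝ ∞ fun t => mat (A t) i j) :
    ∃ Ω ∈ smoothVectors ρ, HasDerivAt (fun t => ρ ⟨0, A t⟩ Ψ) Ω 0 := by
  have hd : ∀ Θ ∈ smoothVectors ρ, HasDerivAt (fun t => ρ ⟨0, A t⟩ Θ)
      (deriv (fun t => ρ ⟨0, A t⟩ Θ) 0) 0 := fun Θ hΘ =>
    ((contDiff_rep hΘ contDiff_const hA).differentiable (by simp)).differentiableAt.hasDerivAt
  refine ⟨_, ?_, hd Ψ hΨ⟩
  refine mem_smoothVectors_of_contDiff fun c B hc hB => ?_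
  have h3 : ∀ e, ρ ⟨c e, B e⟩ (deriv (fun t => ρ ⟨0, A t⟩ Ψ) 0) =
      fderiv ℝ (fun t : ℝ => ρ ⟨c e, B e * A t⟩ Ψ) 0 1 := fun e => by
    have h4 : HasDerivAt (fun t : ℝ => ρ ⟨c e, B e⟩ (ρ ⟨0, A t⟩ Ψ)) _ 0 :=
      ((ρ ⟨c e, B e⟩).toContinuousLinearEquiv.toContinuousLinearMap.restrictScalars
        ℝ).hasFDerivAt.comp_hasDerivAt 0 (hd Ψ hΨ)
    have h5 : (fun t : ℝ => ρ ⟨c e, B e⟩ (ρ ⟨0, A t⟩ Ψ)) = fun t : ℝ => ρ ⟨c e, B e * A t⟩ Ψ := by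
      funext t
      rw [rep_rep, Poincare.mk_mul_mk, lorentz_zero, add_zero]
    rw [h5] at h4
    rw [fderiv_apply_one_eq_deriv, h4.deriv]
    rfl
  simp only [h3]
  refine (ContDiff.fderiv (f := fun (e : Spacetime × (Fin 3 → ℂ)) (t : ℝ) => ρ ⟨c e, B e * A t⟩ Ψ)
    (m := ∞) (n := ∞) ?_ contDiff_const (by simp)).clm_apply contDiff_const
  refine contDiff_rep hΨ (c := fun y : (Spacetime × (Fin 3 → ℂ)) × ℝ => c y.1)
    (A := fun y => B y.1 * A y.2) (hc.comp contDiff_fst) fun i j => ?_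
  simp only [mat_mul_apply]
  exact (((hB i 0).comp contDiff_fst).mul ((hA 0 j).comp contDiff_snd)).add
    (((hB i 1).comp contDiff_fst).mul ((hA 1 j).comp contDiff_snd))

end Rep

end SuperPoincare

namespace SuperPoincare
open Complex (I exp)
open MeasureTheory

/-! ### Families of functions closed under differentiation -/

section Family

variable {E H S J : Type*} [NormedAddCommGroup E] [NormedSpace ℝ E] [NormedAddCommGroup H]
  [NormedSpace ℂ H] [Fintype J]

/-- A family of functions whose derivatives are combinations, with smooth coefficients, of members
of the family consists of smooth functions. -/
theorem contDiff_of_closed_family {D : J → S → S} {a : J → E → E →L[ℝ] ℂ}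
    (ha : ∀ j, ContDiff ℝ ∞ (a j)) {F : S → E → H}
    (hF : ∀ W y, HasFDerivAt (F W) (∑ j, (a j y).smulRight (F (D j W) y)) y) (W : S) :
    ContDiff ℝ ∞ (F W) := by
  rw [contDiff_infty]
  intro n
  induction n generalizing W with
  | zero =>
    rw [Nat.cast_zero, contDiff_zero]
    exact continuous_iff_continuousAt.2 fun y => (hF W y).continuousAt
  | succ n ih =>
    have hd : fderiv ℝ (F W) = fun y => ∑ j, (a j y).smulRight (F (D j W) y) :=
      funext fun y => (hF W y).fderiv
    rw [Nat.cast_succ, contDiff_succ_iff_fderiv]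
    refine ⟨fun y => (hF W y).differentiableAt, by simp, ?_⟩
    rw [hd]
    have hb : IsBoundedBilinearMap ℝ fun q : (E →L[ℝ] ℂ) × H => q.1.smulRight q.2 :=
      { add_left := fun x y z => ContinuousLinearMap.ext fun e => add_smul (x e) (y e) z
        smul_left := fun c x z => ContinuousLinearMap.ext fun e => smul_assoc c (x e) z
        add_right := fun x y z => ContinuousLinearMap.ext fun e => smul_add (x e) y z
        smul_right := fun c x z => ContinuousLinearMap.ext fun e => smul_comm (x e) c z
        bound := ⟨1, one_pos, fun x y => by
          refine ContinuousLinearMap.opNorm_le_bound _ (by positivity) fun e => ?_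
          calc ‖x e • y‖ = ‖x e‖ * ‖y‖ := norm_smul _ _
            _ ≤ ‖x‖ * ‖e‖ * ‖y‖ := by gcongr; exact x.le_opNorm e
            _ = _ := by ring⟩ }
    exact ContDiff.sum fun j _ => hb.contDiff.comp
      (((ha j).of_le (by exact_mod_cast le_top)).prodMk (ih (D j W)))

/-- A uniform second-order Taylor estimate for such families of scalar functions which depend on a
parameter. -/
theorem taylor_of_closed_family {X : Type*} {D : J → S → S} {a : J → E → E →L[ℝ] ℂ}
    (ha : ∀ j, ContDiff ℝ ∞ (a j)) {f : S → E → X → ℂ} {P : X → Prop} {wt : X → ℝ}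
    (hwt : ∀ x, P x → 0 ≤ wt x)
    (hf : ∀ W x, P x → ∀ y, HasFDerivAt (fun y => f W y x) (∑ j, f (D j W) y x • a j y) y)
    (hb : ∀ W y₀, ∃ C, ∀ᶠ y in nhds y₀, ∀ x, P x → ‖f W y x‖ ≤ C * wt x) (W : S) (y₀ : E) :
    ∃ L, 0 ≤ L ∧ ∀ᶠ y in nhds y₀, ∀ x, P x →
      ‖f W y x - f W y₀ x - ∑ j, f (D j W) y₀ x • a j y₀ (y - y₀)‖ ≤ L * wt x * ‖y - y₀‖ ^ 2 := by
  have hb' : ∀ W, ∃ C, 0 ≤ C ∧ ∀ᶠ y in nhds y₀, ∀ x, P x → ‖f W y x‖ ≤ C * wt x := fun W => by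
    obtain ⟨C, hC⟩ := hb W y₀
    refine ⟨|C|, abs_nonneg C, hC.mono fun y hy x hx => (hy x hx).trans ?_⟩
    exact mul_le_mul_of_nonneg_right (le_abs_self C) (hwt x hx)
  choose C hC0 hC using hb'
  have hA : ∀ j, ∃ A, 0 ≤ A ∧ ∀ᶠ y in nhds y₀, ‖a j y‖ ≤ A := fun j => by
    refine ⟨‖a j y₀‖ + 1, by positivity, ?_⟩
    have := (ha j).continuous.norm.continuousAt (x := y₀)
    exact (this.eventually (gt_mem_nhds (lt_add_one _))).mono fun y hy => le_of_lt hy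
  choose A hA0 hA using hA
  have hK : ∀ j, ∃ K : NNReal, ∃ t ∈ nhds y₀, LipschitzOnWith K (a j) t := fun j =>
    ((ha j).contDiffAt.of_le (by simp)).exists_lipschitzOnWith
  choose K t ht hK using hK
  have hall : ∀ᶠ y in nhds y₀, (∀ j, ‖a j y‖ ≤ A j) ∧ (∀ j, y ∈ t j) ∧
      (∀ j x, P x → ‖f (D j W) y x‖ ≤ C (D j W) * wt x) ∧
      ∀ j k x, P x → ‖f (D k (D j W)) y x‖ ≤ C (D k (D j W)) * wt x := by
    refine ((Filter.eventually_all.2 hA).and ((Filter.eventually_all.2 ht).and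
      ((Filter.eventually_all.2 fun j => hC (D j W)).and (Filter.eventually_all.2 fun j =>
        Filter.eventually_all.2 fun k => hC (D k (D j W))))))
  obtain ⟨r, hr, hball⟩ := Metric.eventually_nhds_iff_ball.1 hall
  set M : J → ℝ := fun j => ∑ k, C (D k (D j W)) * A k
  have hM0 : ∀ j, 0 ≤ M j := fun j => Finset.sum_nonneg fun k _ => mul_nonneg (hC0 _) (hA0 k)
  set L : ℝ := ∑ j, (M j * A j + C (D j W) * K j)
  have hL0 : 0 ≤ L := Finset.sum_nonneg fun j _ => add_nonneg (mul_nonneg (hM0 j) (hA0 j))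
    (mul_nonneg (hC0 _) (K j).2)
  refine ⟨L, hL0, Metric.eventually_nhds_iff_ball.2 ⟨r, hr, fun y hy x hx => ?_⟩⟩
  have hy0 : y₀ ∈ Metric.ball y₀ r := Metric.mem_ball_self hr
  have hlip : ∀ j, ∀ z ∈ Metric.ball y₀ r,
      ‖f (D j W) z x - f (D j W) y₀ x‖ ≤ M j * wt x * ‖z - y₀‖ := fun j z hz => by
    refine (convex_ball y₀ r).norm_image_sub_le_of_norm_hasFDerivWithin_le
      (fun w _ => (hf (D j W) x hx w).hasFDerivWithinAt) (fun w hw => ?_) hy0 hz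
    refine (norm_sum_le _ _).trans ?_
    rw [Finset.sum_mul]
    refine Finset.sum_le_sum fun k _ => ?_
    rw [norm_smul]
    calc _ ≤ C (D k (D j W)) * wt x * A k :=
          mul_le_mul ((hball w hw).2.2.2 j k x hx) ((hball w hw).1 k) (norm_nonneg _)
            (mul_nonneg (hC0 _) (hwt x hx))
      _ = _ := by ring
  have hsub : Metric.closedBall y₀ ‖y - y₀‖ ⊆ Metric.ball y₀ r :=
    Metric.closedBall_subset_ball (by rwa [← dist_eq_norm])
  have key := (convex_closedBall y₀ ‖y - y₀‖).norm_image_sub_le_of_norm_hasFDerivWithin_le'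
    (f := fun y => f W y x) (φ := ∑ j, f (D j W) y₀ x • a j y₀) (C := L * wt x * ‖y - y₀‖)
    (fun w _ => (hf W x hx w).hasFDerivWithinAt) (fun z hz => ?_)
    (Metric.mem_closedBall_self (norm_nonneg _)) (y := y) (by rw [Metric.mem_closedBall, dist_eq_norm])
  · refine le_trans (le_of_eq ?_) (key.trans (le_of_eq (by ring)))
    congr 2
    simp
  · have hz' := hsub hz
    have hzn : ‖z - y₀‖ ≤ ‖y - y₀‖ := by rwa [Metric.mem_closedBall, dist_eq_norm] at hz
    rw [← Finset.sum_sub_distrib]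
    refine (norm_sum_le _ _).trans ?_
    rw [Finset.sum_mul, Finset.sum_mul]
    refine Finset.sum_le_sum fun j _ => ?_
    have e : f (D j W) z x • a j z - f (D j W) y₀ x • a j y₀ =
        (f (D j W) z x - f (D j W) y₀ x) • a j z + f (D j W) y₀ x • (a j z - a j y₀) := by
      refine ContinuousLinearMap.ext fun e => ?_
      change f (D j W) z x * a j z e - f (D j W) y₀ x * a j y₀ e =
        (f (D j W) z x - f (D j W) y₀ x) * a j z e + f (D j W) y₀ x * (a j z e - a j y₀ e)
      ring
    rw [e]
    refine (norm_add_le _ _).trans ?_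
    rw [norm_smul, norm_smul]
    have h1 : ‖f (D j W) z x - f (D j W) y₀ x‖ * ‖a j z‖ ≤ M j * wt x * ‖y - y₀‖ * A j :=
      mul_le_mul ((hlip j z hz').trans (mul_le_mul_of_nonneg_left hzn
        (mul_nonneg (hM0 j) (hwt x hx)))) ((hball z hz').1 j) (norm_nonneg _)
        (mul_nonneg (mul_nonneg (hM0 j) (hwt x hx)) (norm_nonneg _))
    have h2 : ‖f (D j W) y₀ x‖ * ‖a j z - a j y₀‖ ≤ C (D j W) * wt x * (K j * ‖y - y₀‖) := by
      refine mul_le_mul ((hball y₀ hy0).2.2.1 j x hx) ?_ (norm_nonneg _)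
        (mul_nonneg (hC0 _) (hwt x hx))
      have := (hK j).norm_sub_le ((hball z hz').2.1 j) ((hball y₀ hy0).2.1 j)
      exact this.trans (mul_le_mul_of_nonneg_left hzn (K j).2)
    calc _ ≤ _ := add_le_add h1 h2
      _ = _ := by ring

end Family

/-! ### Vectors with rapidly decreasing sections -/

section Vec

variable {m : ℝ} {H : Type*} [NormedAddCommGroup H] [InnerProductSpace ℂ H]
  {ρ : Poincare →* (H ≃ₗᵢ[ℂ] H)} {Φ : H →ₗ[ℂ] AEEqFun Covector Fock (massShell m)}

/-- The section with the scalar component `φ` along `τ^I`. -/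
def scalarSection (φ : Covector → ℂ) (I : Finset (Fin 2)) : Covector → Fock :=
  fun p => φ p • Pi.single I 1

theorem OnShell.le_zero {p : Covector} (h : OnShell m p) : m ≤ p 0 := by
  rw [h]; exact le_energy _ _

theorem OnShell.abs_le {p : Covector} (hm : 0 < m) (h : OnShell m p) (i : Fin 4) :
    |p i| ≤ p 0 := by
  have h0 := h.pos hm
  have h1 := h.sq
  apply abs_le_of_sq_le_sq _ h0.le
  fin_cases i <;> simp <;> nlinarith [sq_nonneg m, sq_nonneg (p 1), sq_nonneg (p 2), sq_nonneg (p 3)]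

theorem norm_triv_single_sq_le (hm : 0 < m) {p : Covector} (h : OnShell m p)
    (I : Finset (Fin 2)) :
    ‖triv m p (Pi.single I 1)‖ ^ 2 ≤ (m⁻¹ + 4 + 4 * m) * p 0 := by
  rw [norm_triv_sq hm h]
  have h0 := h.pos hm
  have h1 := h.le_zero
  have h2 := abs_le.1 (h.abs_le hm 1)
  have h3 : 1 ≤ m⁻¹ * p 0 := by rw [inv_mul_eq_div, one_le_div hm]; exact h1
  have h4 : 4 * m ^ 2 ≤ 4 * m * p 0 := by nlinarith
  rcases finset_fin_two_cases I with rfl | rfl | rfl | rfl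
  · simp [fibreNormSq, dotProduct_gamma, univ_ne_empty']
    nlinarith
  · simp [fibreNormSq, dotProduct_gamma, Fin.sum_univ_two, slashUp_00, univ_ne_zero']
    nlinarith
  · simp [fibreNormSq, dotProduct_gamma, Fin.sum_univ_two, slashUp_11, univ_ne_one']
    nlinarith
  · simp only [fibreNormSq, dotProduct_gamma, Fin.sum_univ_two]
    rw [Pi.single_eq_same, Pi.single_eq_of_ne univ_ne_empty'.symm,
      Pi.single_eq_of_ne univ_ne_zero'.symm, Pi.single_eq_of_ne univ_ne_one'.symm]
    simp
    nlinarith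

/-- The constant in the estimate of `exists_scalarSection`. -/
def vecConst (m : ℝ) : ℝ := √(∫ p : Covector, (m⁻¹ + 4 + 4 * m) * (p 0 ^ 3)⁻¹ ∂(massShell m))

namespace PreInduced

variable (h : PreInduced m ρ Φ) (hm : 0 < m)
include h hm

theorem norm_sq_eq_integral (Ψ : H) :
    ‖Ψ‖ ^ 2 = ∫ p, ‖triv m p (Φ Ψ p)‖ ^ 2 ∂(massShell m) := by
  have h5 := h.inner_eq hm Ψ Ψ
  simp only [inner_self_eq_norm_sq_to_K] at h5
  change (‖Ψ‖ : ℂ) ^ 2 = ∫ p, (‖triv m p (Φ Ψ p)‖ : ℂ) ^ 2 ∂(massShell m) at h5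
  simp only [← Complex.ofReal_pow] at h5
  rw [integral_complex_ofReal] at h5
  exact_mod_cast h5

theorem exists_scalarSection {φ : Covector → ℂ} (hφ : AEStronglyMeasurable φ (massShell m))
    (I : Finset (Fin 2)) {C : ℝ} (hC0 : 0 ≤ C) (hC : ∀ p, OnShell m p → ‖φ p‖ ≤ C * (p 0 ^ 2)⁻¹) :
    ∃ Ψ : H, (∀ᵐ p ∂(massShell m), Φ Ψ p = scalarSection φ I p) ∧ ‖Ψ‖ ≤ vecConst m * C := by
  have hmeas : AEStronglyMeasurable (scalarSection φ I) (massShell m) := hφ.smul_const _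
  have hint0 : Integrable (fun p : Covector => (m⁻¹ + 4 + 4 * m) * (p 0 ^ 3)⁻¹) (massShell m) := by
    have : Measurable (fun p : Covector => (m⁻¹ + 4 + 4 * m) * (p 0 ^ 3)⁻¹) := by fun_prop
    refine integrable_massShell_of_bound hm this.aestronglyMeasurable (C := m⁻¹ + 4 + 4 * m)
      fun p hp => ?_
    have := hp.pos hm
    rw [Real.norm_of_nonneg (by positivity)]
  have hsq : ∀ p, OnShell m p → ‖triv m p (scalarSection φ I p)‖ ^ 2 ≤
      C ^ 2 * ((m⁻¹ + 4 + 4 * m) * (p 0 ^ 3)⁻¹) := fun p hp => by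
    have h0 := hp.pos hm
    rw [scalarSection, triv_smul, norm_smul, mul_pow]
    calc _ ≤ (C * (p 0 ^ 2)⁻¹) ^ 2 * ((m⁻¹ + 4 + 4 * m) * p 0) :=
          mul_le_mul (pow_le_pow_left₀ (norm_nonneg _) (hC p hp) 2)
            (norm_triv_single_sq_le hm hp I) (sq_nonneg _) (sq_nonneg _)
      _ = _ := by field_simp
  have hM : MemLp (fun p => triv m p (scalarSection φ I p)) 2 (massShell m) := by
    rw [memLp_two_iff_integrable_sq_norm (aestronglyMeasurable_triv hm hmeas)]
    refine (hint0.const_mul (C ^ 2)).mono'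
      ((aestronglyMeasurable_triv hm hmeas).norm.pow 2) ?_
    filter_upwards [ae_onShell hm] with p hp
    rw [Real.norm_of_nonneg (sq_nonneg _)]
    exact hsq p hp
  obtain ⟨Ψ, hΨ⟩ := h.exists_of_memLp hm hM
  simp only [trivInv_triv hm] at hΨ
  refine ⟨Ψ, hΨ, ?_⟩
  have hle : ‖Ψ‖ ^ 2 ≤ (vecConst m * C) ^ 2 := by
    rw [h.norm_sq_eq_integral hm, mul_pow, vecConst, Real.sq_sqrt, mul_comm, ← integral_const_mul]
    · refine integral_mono_ae ?_ (hint0.const_mul (C ^ 2)) ?_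
      · exact (memLp_two_iff_integrable_sq_norm (h.memLp hm Ψ).1).1 (h.memLp hm Ψ)
      · filter_upwards [ae_onShell hm, hΨ] with p hp h2
        rw [h2]
        exact hsq p hp
    · refine integral_nonneg_of_ae ?_
      filter_upwards [ae_onShell hm] with p hp
      have := hp.pos hm
      simp only [Pi.zero_apply]
      positivity
  exact (pow_le_pow_iff_left₀ (norm_nonneg _) (mul_nonneg (Real.sqrt_nonneg _) hC0)
    two_ne_zero).1 hle

/-- Smooth dependence on parameters of vectors given by rapidly decreasing sections. -/
theorem contDiff_vec {E S J : Type*} [NormedAddCommGroup E] [NormedSpace ℝ E] [Fintype J]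
    {D : J → S → S} {a : J → E → E →L[ℝ] ℂ}
    (ha : ∀ j, ContDiff ℝ ∞ (a j)) {f : S → E → Covector → ℂ}
    (hmeas : ∀ W y, Continuous (f W y))
    (hf : ∀ W p, OnShell m p → ∀ y, HasFDerivAt (fun y => f W y p) (∑ j, f (D j W) y p • a j y) y)
    (hb : ∀ W y₀, ∃ C, ∀ᶠ y in nhds y₀, ∀ p, OnShell m p → ‖f W y p‖ ≤ C * (p 0 ^ 2)⁻¹)
    (I : Finset (Fin 2)) (F : S → E → H)
    (hF : ∀ W y, ∀ᵐ p ∂(massShell m), Φ (F W y) p = scalarSection (f W y) I p) (W : S) :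
    ContDiff ℝ ∞ (F W) := by
  refine contDiff_of_closed_family ha (D := D) (fun W y₀ => ?_) W
  obtain ⟨L, hL0, hL⟩ := taylor_of_closed_family (P := OnShell m) (wt := fun p => (p 0 ^ 2)⁻¹) ha
    (fun p hp => by positivity) hf hb W y₀
  set G : E →L[ℝ] H := ∑ j, (a j y₀).smulRight (F (D j W) y₀)
  have hbig : (fun y => F W y - F W y₀ - G (y - y₀)) =O[nhds y₀] fun y => ‖y - y₀‖ ^ 2 := by
    refine Asymptotics.IsBigO.of_bound (vecConst m * L) ?_
    filter_upwards [hL] with y hy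
    obtain ⟨Ψ, hΨ, hΨn⟩ := h.exists_scalarSection hm (I := I) (C := L * ‖y - y₀‖ ^ 2)
      (φ := fun p => f W y p - f W y₀ p - ∑ j, f (D j W) y₀ p • a j y₀ (y - y₀))
      (((hmeas W y).sub (hmeas W y₀)).sub (continuous_finsetSum _ fun j _ =>
        (hmeas (D j W) y₀).smul continuous_const)).aestronglyMeasurable (by positivity)
      (fun p hp => (hy p hp).trans (le_of_eq (by ring)))
    have he : F W y - F W y₀ - G (y - y₀) = Ψ := by
      refine h.eq_of_ae ?_
      have hG : ∀ᵐ p ∂(massShell m), Φ (G (y - y₀)) p =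
          ∑ j, a j y₀ (y - y₀) • Φ (F (D j W) y₀) p := by
        have e : Φ (G (y - y₀)) = ∑ j, a j y₀ (y - y₀) • Φ (F (D j W) y₀) := by
          simp [G, map_sum]
        rw [e]
        have h1 : ∀ᵐ p ∂(massShell m), ∀ j,
            (a j y₀ (y - y₀) • Φ (F (D j W) y₀) : AEEqFun Covector Fock (massShell m)) p =
              a j y₀ (y - y₀) • Φ (F (D j W) y₀) p :=
          ae_all_iff.2 fun j => AEEqFun.coeFn_smul _ _
        have h2 := AEEqFun.coeFn_finsetSum Finset.univ
          (fun j => (a j y₀ (y - y₀) • Φ (F (D j W) y₀) : AEEqFun Covector Fock (massShell m)))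
        filter_upwards [h1, h2] with p h3 h4
        rw [h4, Finset.sum_apply]
        exact Finset.sum_congr rfl fun j _ => h3 j
      have hall : ∀ᵐ p ∂(massShell m), ∀ j, Φ (F (D j W) y₀) p =
          scalarSection (f (D j W) y₀) I p := ae_all_iff.2 fun j => hF _ _
      filter_upwards [hΨ, hG, hall, hF W y, hF W y₀, coe_sub Φ (F W y) (F W y₀),
        coe_sub Φ (F W y - F W y₀) (G (y - y₀))] with p h1 h2 h3 h4 h5 h6 h7
      rw [h7, h6, h1, h2, h4, h5]
      simp only [h3, scalarSection, sub_smul, Finset.sum_smul, smul_smul, smul_eq_mul]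
      congr 1
      exact Finset.sum_congr rfl fun j _ => by rw [mul_comm]
    rw [he, Real.norm_of_nonneg (sq_nonneg _)]
    exact hΨn.trans (le_of_eq (by ring))
  have h1 := hbig.hasFDerivAt (𝕜 := ℝ) one_lt_two
  have h3 : HasFDerivAt (fun y => G (y - y₀)) G y₀ :=
    G.hasFDerivAt.comp y₀ ((hasFDerivAt_id y₀).sub_const y₀)
  have h2 := (h1.add h3).add_const (F W y₀)
  rw [zero_add] at h2
  refine h2.congr_of_eventuallyEq (Filter.Eventually.of_forall fun y => ?_)
  simp

end PreInduced

end Vec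

end SuperPoincare

namespace SuperPoincare
open Complex (I exp)
open MeasureTheory
open scoped SchwartzMap LineDeriv

/-! ### Schwartz sections are smooth vectors -/

section Symbols

variable {m : ℝ}

theorem temperate_energy (hm : 0 < m) : (energy m).HasTemperateGrowth := by
  have h1 := Function.hasTemperateGrowth_one_add_norm_sq_rpow Mom (1 / 2)
  have h2 : (fun k : Mom => m⁻¹ • k).HasTemperateGrowth :=
    (m⁻¹ • ContinuousLinearMap.id ℝ Mom).hasTemperateGrowth
  have h3 := (Function.HasTemperateGrowth.const (E := Mom) m).mul (h1.comp h2)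
  convert! h3 using 1
  funext k
  simp only [Pi.mul_apply, Function.comp, energy, ← Real.sqrt_eq_rpow]
  rw [← Real.sqrt_sq hm.le, ← Real.sqrt_mul (sq_nonneg m), Real.sqrt_sq hm.le]
  congr 1
  rw [norm_smul, mul_pow, EuclideanSpace.norm_sq_eq, Real.norm_of_nonneg (inv_nonneg.2 hm.le)]
  simp only [Real.norm_eq_abs, sq_abs]
  field_simp

theorem temperate_shell (hm : 0 < m) (κ : Fin 4) :
    (fun k : Mom => ((shellPt m k κ : ℝ) : ℂ)).HasTemperateGrowth := by
  refine Function.HasTemperateGrowth.comp (f := fun k : Mom => shellPt m k κ)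
    Complex.ofRealCLM.hasTemperateGrowth ?_
  have hc : ∀ i, (fun k : Mom => k i).HasTemperateGrowth := fun i =>
    (EuclideanSpace.proj (𝕜 := ℝ) i : Mom →L[ℝ] ℝ).hasTemperateGrowth
  fin_cases κ
  · exact temperate_energy hm
  · exact hc 0
  · exact hc 1
  · exact hc 2

/-- Multiplication of a Schwartz function on the mass shell by `p_κ`. -/
def mulP (m : ℝ) (κ : Fin 4) (V : 𝓢(Mom, ℂ)) : 𝓢(Mom, ℂ) :=
  SchwartzMap.smulLeftCLM ℂ (fun k : Mom => ((shellPt m k κ : ℝ) : ℂ)) V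

theorem mulP_apply (hm : 0 < m) (κ : Fin 4) (V : 𝓢(Mom, ℂ)) (k : Mom) :
    mulP m κ V k = shellPt m k κ * V k := by
  rw [mulP, SchwartzMap.smulLeftCLM_apply_apply (temperate_shell hm κ), smul_eq_mul]

theorem mulP_spatial (hm : 0 < m) (κ : Fin 4) (V : 𝓢(Mom, ℂ)) {q : Covector} (hq : OnShell m q) :
    mulP m κ V (spatial q) = q κ * V (spatial q) := by
  rw [mulP_apply hm, hq.shellPt_spatial]

theorem schwartz_bound (hm : 0 < m) (V : 𝓢(Mom, ℂ)) :
    ∃ C, 0 ≤ C ∧ ∀ q, OnShell m q → ‖V (spatial q)‖ ≤ C * (q 0 ^ 2)⁻¹ := by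
  obtain ⟨C, hC0, hC⟩ := (mulP m 0 (mulP m 0 V)).decay 0 0
  refine ⟨C, hC0.le, fun q hq => ?_⟩
  have h1 := hC (spatial q)
  have h0 := hq.pos hm
  rw [pow_zero, one_mul, norm_iteratedFDeriv_zero, mulP_spatial hm _ _ hq, mulP_spatial hm _ _ hq,
    norm_mul, norm_mul, Complex.norm_real, Real.norm_of_nonneg h0.le] at h1
  rw [← div_eq_mul_inv, le_div_iff₀ (by positivity)]
  linarith

/-- The elementary derivations of symbols: multiplication by a momentum after at most one
derivative. -/
def symbolOp (m : ℝ) (j : Option (Fin 3) × Fin 4) (V : 𝓢(Mom, ℂ)) : 𝓢(Mom, ℂ) :=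
  match j.1 with
  | none => mulP m j.2 V
  | some i => mulP m j.2 (∂_{(EuclideanSpace.single i 1 : Mom)} V)

variable {E : Type*} [NormedAddCommGroup E] [NormedSpace ℝ E]

/-- The transform of a scalar symbol under the Poincare group. -/
def symbolAct (c : E → Spacetime) (A : E → SL2) (V : 𝓢(Mom, ℂ)) (e : E) (p : Covector) : ℂ :=
  exp (-(I * (p ⬝ᵥ c e : ℝ))) * V (spatial (pullback (A e) p))

/-- The coefficients of the derivative of `symbolAct`. -/
def symbolCoeff (c : E → Spacetime) (A : E → SL2) (j : Option (Fin 3) × Fin 4) (e : E) :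
    E →L[ℝ] ℂ :=
  match j.1 with
  | none => (-I) • (Complex.ofRealCLM ∘L
      ∑ μ, lorentz (A e)⁻¹ (basisVec μ) j.2 • fderiv ℝ (fun e => c e μ) e)
  | some i => Complex.ofRealCLM ∘L
      ∑ μ, lorentz (A e)⁻¹ (basisVec μ) j.2 •
        fderiv ℝ (fun e => lorentz (A e) (basisVec i.succ) μ) e

variable {c : E → Spacetime} {A : E → SL2}

theorem contDiff_mat_inv (hA : ∀ i j, ContDiff ℝ ∞ fun e => mat (A e) i j) (i j : Fin 2) :
    ContDiff ℝ ∞ fun e => mat (A e)⁻¹ i j := by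
  simp only [mat_inv]
  fin_cases i <;> fin_cases j
  · exact hA 1 1
  · exact (hA 0 1).neg
  · exact (hA 1 0).neg
  · exact hA 0 0

theorem contDiff_symbolCoeff (hc : ContDiff ℝ ∞ c) (hA : ∀ i j, ContDiff ℝ ∞ fun e => mat (A e) i j)
    (j : Option (Fin 3) × Fin 4) : ContDiff ℝ ∞ (symbolCoeff c A j) := by
  have hi : ∀ μ κ, ContDiff ℝ ∞ fun e => lorentz (A e)⁻¹ (basisVec μ) κ := fun μ κ =>
    contDiff_pi.1 (contDiff_lorentz (contDiff_mat_inv hA) contDiff_const) κ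
  have hl : ∀ (i : Fin 3) μ, ContDiff ℝ ∞ fun e => lorentz (A e) (basisVec i.succ) μ := fun i μ =>
    contDiff_pi.1 (contDiff_lorentz hA contDiff_const) μ
  have hcomp : ∀ {g : E → E →L[ℝ] ℝ}, ContDiff ℝ ∞ g →
      ContDiff ℝ ∞ fun e => Complex.ofRealCLM ∘L g e := fun hg => contDiff_const.clm_comp hg
  obtain ⟨j, κ⟩ := j
  cases j with
  | none => exact (hcomp (ContDiff.sum fun μ _ => (hi μ κ).smul
      ((contDiff_pi.1 hc μ).fderiv_right (m := ∞) (by simp)))).const_smul _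
  | some i => exact hcomp (ContDiff.sum fun μ _ => (hi μ κ).smul
      ((hl i μ).fderiv_right (m := ∞) (by simp)))

theorem sum_pullback_mul (A : SL2) (p : Covector) (x : Fin 4 → ℝ) :
    ∑ κ, (pullback A p κ : ℂ) * ((∑ μ, lorentz A⁻¹ (basisVec μ) κ * x μ : ℝ) : ℂ) =
      ((∑ μ, p μ * x μ : ℝ) : ℂ) := by
  have h : ∀ μ, p μ = ∑ κ, pullback A p κ * lorentz A⁻¹ (basisVec μ) κ := fun μ => by
    conv_lhs => rw [← pullback_inv_pullback A p]
    rfl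
  have h2 : ∑ κ, pullback A p κ * (∑ μ, lorentz A⁻¹ (basisVec μ) κ * x μ) = ∑ μ, p μ * x μ := by
    simp only [Finset.mul_sum]
    rw [Finset.sum_comm]
    refine Finset.sum_congr rfl fun μ _ => ?_
    rw [h μ, Finset.sum_mul]
    exact Finset.sum_congr rfl fun κ _ => by ring
  rw [← h2]
  push_cast
  rfl

theorem hasFDerivAt_symbolAct (hm : 0 < m) (hc : ContDiff ℝ ∞ c)
    (hA : ∀ i j, ContDiff ℝ ∞ fun e => mat (A e) i j) (V : 𝓢(Mom, ℂ)) {p : Covector}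
    (hp : OnShell m p) (e : E) : HasFDerivAt (fun e => symbolAct c A V e p)
      (∑ j, symbolAct c A (symbolOp m j V) e p • symbolCoeff c A j e) e := by
  have hq := hp.pullback hm (A e)
  have hcd : ∀ μ, HasFDerivAt (fun e => c e μ) (fderiv ℝ (fun e => c e μ) e) e := fun μ =>
    ((contDiff_pi.1 hc μ).differentiable (by simp)).differentiableAt.hasFDerivAt
  have hld : ∀ (i : Fin 3) μ, HasFDerivAt (fun e => lorentz (A e) (basisVec i.succ) μ)
      (fderiv ℝ (fun e => lorentz (A e) (basisVec i.succ) μ) e) e := fun i μ =>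
    ((contDiff_pi.1 (contDiff_lorentz hA contDiff_const) μ).differentiable
      (by simp)).differentiableAt.hasFDerivAt
  have h1 : HasFDerivAt (fun e => p ⬝ᵥ c e) (∑ μ, p μ • fderiv ℝ (fun e => c e μ) e) e := by
    simp only [dotProduct]
    exact HasFDerivAt.fun_sum fun μ _ => (hcd μ).const_mul (p μ)
  have h2 : HasFDerivAt (fun e => exp (-(I * (p ⬝ᵥ c e : ℝ)))) _ e :=
    ((Complex.ofRealCLM.hasFDerivAt.comp e h1).const_mul I).neg.cexp
  have h3 : HasFDerivAt (fun e => spatial (pullback (A e) p))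
      ((EuclideanSpace.equiv (Fin 3) ℝ).symm.toContinuousLinearMap ∘L
        ContinuousLinearMap.pi fun i : Fin 3 =>
          ∑ μ, p μ • fderiv ℝ (fun e => lorentz (A e) (basisVec i.succ) μ) e) e := by
    refine ((EuclideanSpace.equiv (Fin 3) ℝ).symm.toContinuousLinearMap.hasFDerivAt).comp e
      (f := fun e => fun i : Fin 3 => pullback (A e) p i.succ) (hasFDerivAt_pi.2 fun i => ?_)
    simp only [pullback, dotProduct]
    exact HasFDerivAt.fun_sum fun μ _ => (hld i μ).const_mul (p μ)
  have h4 : HasFDerivAt (fun e => V (spatial (pullback (A e) p))) _ e :=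
    (V.hasFDerivAt _).comp e h3
  refine (h2.mul h4).congr_fderiv ?_
  refine ContinuousLinearMap.ext fun w => ?_
  have hV : ∀ x : Mom, fderiv ℝ V (spatial (pullback (A e) p)) x =
      ∑ i : Fin 3, (x i : ℂ) * (∂_{(EuclideanSpace.single i 1 : Mom)} V)
        (spatial (pullback (A e) p)) := fun x => by
    have hx : x = ∑ i : Fin 3, x i • (EuclideanSpace.single i 1 : Mom) := by
      ext j; simp [Finset.sum_apply, Pi.single_apply]
    conv_lhs => rw [hx, map_sum]
    refine Finset.sum_congr rfl fun i _ => ?_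
    rw [map_smul, SchwartzMap.lineDerivOp_apply_eq_fderiv, Complex.real_smul]
  set G := exp (-(I * (p ⬝ᵥ c e : ℝ))) with hG
  have hs1 := sum_pullback_mul (A e) p fun μ => fderiv ℝ (fun e => c e μ) e w
  have hs2 : ∀ i : Fin 3, _ := fun i : Fin 3 => sum_pullback_mul (A e) p fun μ =>
    fderiv ℝ (fun e => lorentz (A e) (basisVec i.succ) μ) e w
  have hR : (∑ j, symbolAct c A (symbolOp m j V) e p • symbolCoeff c A j e) w =
      ∑ j, symbolAct c A (symbolOp m j V) e p * symbolCoeff c A j e w := by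
    simp
  rw [hR, Fintype.sum_prod_type, Fintype.sum_option]
  simp only [symbolAct, symbolOp, symbolCoeff, mulP_spatial hm _ _ hq, ← hG]
  have e1 : ∀ κ, ((-I) • (Complex.ofRealCLM ∘L
      ∑ μ, lorentz (A e)⁻¹ (basisVec μ) κ • fderiv ℝ (fun e => c e μ) e)) w =
      -I * ((∑ μ, lorentz (A e)⁻¹ (basisVec μ) κ * fderiv ℝ (fun e => c e μ) e w : ℝ) : ℂ) :=
    fun κ => by simp
  have e2 : ∀ (i : Fin 3) κ, (Complex.ofRealCLM ∘L
      ∑ μ, lorentz (A e)⁻¹ (basisVec μ) κ •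
        fderiv ℝ (fun e => lorentz (A e) (basisVec i.succ) μ) e) w =
      ((∑ μ, lorentz (A e)⁻¹ (basisVec μ) κ *
        fderiv ℝ (fun e => lorentz (A e) (basisVec i.succ) μ) e w : ℝ) : ℂ) := fun i κ => by simp
  simp only [e1, e2]
  have t1 : ∑ κ, G * ((pullback (A e) p κ : ℂ) * V (spatial (pullback (A e) p))) *
      (-I * ((∑ μ, lorentz (A e)⁻¹ (basisVec μ) κ *
        fderiv ℝ (fun e => c e μ) e w : ℝ) : ℂ)) =
      G * V (spatial (pullback (A e) p)) * (-I) *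
        ((∑ μ, p μ * fderiv ℝ (fun e => c e μ) e w : ℝ) : ℂ) := by
    rw [← hs1, Finset.mul_sum]
    exact Finset.sum_congr rfl fun κ _ => by ring
  have t2 : ∀ i : Fin 3, ∑ κ, G * ((pullback (A e) p κ : ℂ) *
      (∂_{(EuclideanSpace.single i 1 : Mom)} V) (spatial (pullback (A e) p))) *
      ((∑ μ, lorentz (A e)⁻¹ (basisVec μ) κ *
        fderiv ℝ (fun e => lorentz (A e) (basisVec i.succ) μ) e w : ℝ) : ℂ) =
      G * (((∑ μ, p μ * fderiv ℝ (fun e => lorentz (A e) (basisVec i.succ) μ) e w : ℝ) : ℂ) *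
        (∂_{(EuclideanSpace.single i 1 : Mom)} V) (spatial (pullback (A e) p))) := fun i => by
    rw [← hs2 i, Finset.sum_mul, Finset.mul_sum]
    exact Finset.sum_congr rfl fun κ _ => by ring
  rw [t1, Finset.sum_congr rfl fun i _ => t2 i, ← Finset.mul_sum]
  have hx : ∀ i : Fin 3, (((EuclideanSpace.equiv (Fin 3) ℝ).symm.toContinuousLinearMap ∘L
        ContinuousLinearMap.pi fun i : Fin 3 =>
          ∑ μ, p μ • fderiv ℝ (fun e => lorentz (A e) (basisVec i.succ) μ) e) w : Mom) i =
      ∑ μ, p μ * fderiv ℝ (fun e => lorentz (A e) (basisVec i.succ) μ) e w := fun i => by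
    simp
  have hV2 := hV (((EuclideanSpace.equiv (Fin 3) ℝ).symm.toContinuousLinearMap ∘L
        ContinuousLinearMap.pi fun i : Fin 3 =>
          ∑ μ, p μ • fderiv ℝ (fun e => lorentz (A e) (basisVec i.succ) μ) e) w)
  simp only [hx] at hV2
  rw [← hV2]
  simp
  ring

theorem symbolAct_bound (hm : 0 < m) (hA : ∀ i j, ContDiff ℝ ∞ fun e => mat (A e) i j)
    (V : 𝓢(Mom, ℂ)) (e₀ : E) : ∃ C, ∀ᶠ e in nhds e₀, ∀ p, OnShell m p →
      ‖symbolAct c A V e p‖ ≤ C * (p 0 ^ 2)⁻¹ := by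
  obtain ⟨C, hC0, hC⟩ := schwartz_bound hm V
  set B : E → ℝ := fun e => ∑ κ, |lorentz (A e)⁻¹ (basisVec 0) κ|
  have hB : Continuous B := continuous_finsetSum _ fun κ _ =>
    (contDiff_pi.1 (contDiff_lorentz (contDiff_mat_inv hA) contDiff_const) κ).continuous.abs
  refine ⟨C * (B e₀ + 1) ^ 2, (hB.continuousAt.eventually (gt_mem_nhds (lt_add_one _))).mono
    fun e he p hp => ?_⟩
  have hq := hp.pullback hm (A e)
  have hq0 := hq.pos hm
  have hp0 := hp.pos hm
  have hle : p 0 ≤ (B e₀ + 1) * pullback (A e) p 0 := by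
    have h1 : p 0 = ∑ κ, pullback (A e) p κ * lorentz (A e)⁻¹ (basisVec 0) κ := by
      conv_lhs => rw [← pullback_inv_pullback (A e) p]
      rfl
    calc p 0 ≤ ∑ κ, pullback (A e) p 0 * |lorentz (A e)⁻¹ (basisVec 0) κ| := by
          rw [h1]
          refine Finset.sum_le_sum fun κ _ => (le_abs_self _).trans ?_
          rw [abs_mul]
          exact mul_le_mul_of_nonneg_right (hq.abs_le hm κ) (abs_nonneg _)
      _ = B e * pullback (A e) p 0 := by rw [← Finset.mul_sum, mul_comm]
      _ ≤ _ := mul_le_mul_of_nonneg_right (le_of_lt he) hq0.le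
  have hB1 : 0 < B e₀ + 1 := by
    have : 0 ≤ B e₀ := Finset.sum_nonneg fun _ _ => abs_nonneg _
    linarith
  rw [symbolAct, norm_mul, show -(I * ((p ⬝ᵥ c e : ℝ) : ℂ)) =
    ((-(p ⬝ᵥ c e) : ℝ) : ℂ) * I by push_cast; ring, Complex.norm_exp_ofReal_mul_I, one_mul]
  refine (hC _ hq).trans ?_
  rw [mul_assoc]
  refine mul_le_mul_of_nonneg_left ?_ hC0
  rw [← div_eq_mul_inv, le_div_iff₀ (by positivity), inv_mul_le_iff₀ (by positivity)]
  calc p 0 ^ 2 ≤ ((B e₀ + 1) * pullback (A e) p 0) ^ 2 := pow_le_pow_left₀ hp0.le hle 2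
    _ = _ := by ring

theorem contDiff_minor (hA : ∀ i j, ContDiff ℝ ∞ fun e => mat (A e) i j)
    (I J : Finset (Fin 2)) : ContDiff ℝ ∞ fun e => minor (mat (A e)) I J := by
  by_cases hc : I.card = J.card
  · simp only [minor, hc, dif_pos, Matrix.det_apply']
    refine ContDiff.sum fun σ _ => contDiff_const.mul (contDiff_prod fun i _ => hA _ _)
  · simp only [minor, hc, dif_neg, not_false_eq_true]
    exact contDiff_const

theorem spinFock_single (A : SL2) (I : Finset (Fin 2)) : spinFock A (Pi.single I 1) =
    ∑ J, minor (mat A) J I • Pi.single J 1 := by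
  funext K
  simp [spinFock, Finset.sum_apply, Pi.single_apply]

end Symbols

namespace PreInduced

variable {m : ℝ} {H : Type*} [NormedAddCommGroup H] [InnerProductSpace ℂ H]
  {ρ : Poincare →* (H ≃ₗᵢ[ℂ] H)} {Φ : H →ₗ[ℂ] AEEqFun Covector Fock (massShell m)}
  (h : PreInduced m ρ Φ) (hm : 0 < m)
include h hm

theorem smooth_of_schwartz {Ψ : H} {V : 𝓢(Mom, ℂ)} {I : Finset (Fin 2)}
    (hΨ : ∀ᵐ p ∂(massShell m), Φ Ψ p = scalarSection (fun p => V (spatial p)) I p) :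
    Ψ ∈ smoothVectors ρ := by
  refine mem_smoothVectors_of_contDiff fun c A hc hA => ?_
  have hmeas : ∀ (W : 𝓢(Mom, ℂ)) e, Continuous (symbolAct c A W e) := fun W e => by
    unfold symbolAct
    have h1 : Continuous fun p : Covector => p ⬝ᵥ c e := by unfold dotProduct; fun_prop
    have h2 : Continuous fun p : Covector => spatial (pullback (A e) p) :=
      spatial.continuous.comp (pullbackL (A e)).continuous
    exact (Complex.continuous_exp.comp (continuous_const.mul
      (Complex.continuous_ofReal.comp h1)).neg).mul (W.continuous.comp h2)
  have hex : ∀ (J : Finset (Fin 2)) (W : 𝓢(Mom, ℂ)) (e : Spacetime × (Fin 3 → ℂ)), ∃ Ω : H,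
      ∀ᵐ p ∂(massShell m), Φ Ω p = scalarSection (symbolAct c A W e) J p := fun J W e => by
    obtain ⟨C, hC⟩ := symbolAct_bound (c := c) hm hA W e
    have hC1 := hC.self_of_nhds
    obtain ⟨Ω, hΩ, -⟩ := h.exists_scalarSection hm (hmeas W e).aestronglyMeasurable J
      (C := |C|) (abs_nonneg C) fun p hp => (hC1 p hp).trans
        (mul_le_mul_of_nonneg_right (le_abs_self C) (by positivity))
    exact ⟨Ω, hΩ⟩
  choose F hF using hex
  have hsm : ∀ J, ContDiff ℝ ∞ (F J V) := fun J =>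
    h.contDiff_vec hm (contDiff_symbolCoeff hc hA) hmeas
      (fun W p hp e => hasFDerivAt_symbolAct hm hc hA W hp e)
      (fun W e => symbolAct_bound hm hA W e) J (F J) (hF J) V
  have he : ∀ e, ρ ⟨c e, A e⟩ Ψ = ∑ J, minor (mat (A e)) J I • F J V e := fun e => by
    refine h.eq_of_ae ?_
    have h1 : ∀ᵐ p ∂(massShell m), Φ (∑ J, minor (mat (A e)) J I • F J V e) p =
        ∑ J, minor (mat (A e)) J I • Φ (F J V e) p := by
      simp only [map_sum, map_smul]
      have h2 : ∀ᵐ p ∂(massShell m), ∀ J,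
          (minor (mat (A e)) J I • Φ (F J V e) : AEEqFun Covector Fock (massShell m)) p =
            minor (mat (A e)) J I • Φ (F J V e) p :=
        ae_all_iff.2 fun j => AEEqFun.coeFn_smul _ _
      have h3 := AEEqFun.coeFn_finsetSum Finset.univ
        (fun J => (minor (mat (A e)) J I • Φ (F J V e) : AEEqFun Covector Fock (massShell m)))
      filter_upwards [h2, h3] with p h4 h5
      rw [h5, Finset.sum_apply]
      exact Finset.sum_congr rfl fun j _ => h4 j
    have h6 : ∀ᵐ p ∂(massShell m), ∀ J, Φ (F J V e) p = scalarSection (symbolAct c A V e) J p :=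
      ae_all_iff.2 fun J => hF J V e
    have h7 := (measurePreserving_pullback hm (A e)).quasiMeasurePreserving.ae hΨ
    filter_upwards [h1, h6, h7, h.poincare ⟨c e, A e⟩ Ψ] with p a1 a2 a3 a4
    rw [a4, a1, a3]
    simp only [a2, scalarSection, spinFock_smul, spinFock_single, symbolAct, Finset.smul_sum,
      smul_smul]
    exact Finset.sum_congr rfl fun J _ => by congr 1; ring
  simp only [he]
  exact ContDiff.sum fun J _ => (contDiff_minor hA J I).smul (hsm J)

theorem exists_schwartz_vec (V : Finset (Fin 2) → 𝓢(Mom, ℂ)) :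
    ∃ Ψ ∈ smoothVectors ρ, ∀ᵐ p ∂(massShell m), Φ Ψ p = fun I => V I (spatial p) := by
  have hex : ∀ I, ∃ Ω : H, ∀ᵐ p ∂(massShell m),
      Φ Ω p = scalarSection (fun p => V I (spatial p)) I p := fun I => by
    obtain ⟨C, hC0, hC⟩ := schwartz_bound hm (V I)
    obtain ⟨Ω, hΩ, -⟩ := h.exists_scalarSection hm
      ((V I).continuous.comp spatial.continuous).aestronglyMeasurable I hC0 hC
    exact ⟨Ω, hΩ⟩
  choose F hF using hex
  refine ⟨∑ I, F I, Submodule.sum_mem _ fun I _ => h.smooth_of_schwartz hm (hF I), ?_⟩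
  rw [map_sum]
  have h3 := AEEqFun.coeFn_finsetSum Finset.univ (fun I => Φ (F I))
  filter_upwards [h3, ae_all_iff.2 hF] with p h4 h5
  rw [h4, Finset.sum_apply]
  simp only [h5, scalarSection]
  funext I
  simp [Finset.sum_apply, Pi.single_apply]

end PreInduced

end SuperPoincare

namespace SuperPoincare
open Complex (I exp)
open MeasureTheory
open scoped SchwartzMap LineDeriv

/-! ### The Clifford action -/

section Clifford

variable {m : ℝ}

/-- The components `p(Γ_ℂ(τ^c, s_-))`. -/
def slashConj (p : Covector) (s : Spinor) (c : Fin 2) : ℂ := ∑ d, slashUp p c d * conj (s d)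

theorem clifford_eq (p : Covector) (s : Spinor) (w : Fock) : clifford p s w =
    I • (∑ a, s a • ext a w) + (2 : ℂ) • ∑ c, slashConj p s c • contr c w := by
  have : ∀ c, (∑ d, ∑ μ, (p μ : ℂ) * gammaUp μ c d * conj (s d)) = slashConj p s c :=
    fun c => by simp only [slashConj, slashUp, Finset.sum_mul]
  simp only [clifford, this]

theorem clifford_empty (p : Covector) (s : Spinor) (w : Fock) : clifford p s w ∅ =
    2 * (slashConj p s 0 * w {0} + slashConj p s 1 * w {1}) := by
  rw [clifford_eq]
  simp [Fin.sum_univ_two, ext, contr, koszul_zero, koszul_one]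
  ring

theorem clifford_zero (p : Covector) (s : Spinor) (w : Fock) : clifford p s w {0} =
    I * (s 0 * w ∅) - 2 * (slashConj p s 1 * w Finset.univ) := by
  rw [clifford_eq]
  simp [Fin.sum_univ_two, ext, contr, koszul_zero, koszul_one, insert_one_zero]
  ring

theorem clifford_one (p : Covector) (s : Spinor) (w : Fock) : clifford p s w {1} =
    I * (s 1 * w ∅) + 2 * (slashConj p s 0 * w Finset.univ) := by
  rw [clifford_eq]
  simp [Fin.sum_univ_two, ext, contr, koszul_zero, koszul_one, insert_zero_one]

theorem clifford_univ (p : Covector) (s : Spinor) (w : Fock) : clifford p s w Finset.univ =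
    I * (s 0 * w {1} - s 1 * w {0}) := by
  rw [clifford_eq]
  simp [Fin.sum_univ_two, ext, contr, koszul_zero, koszul_one, erase_univ_zero, erase_univ_one]
  ring

theorem clifford_ext_aux {v w : Fock} (h0 : v ∅ = w ∅) (h1 : v {0} = w {0}) (h2 : v {1} = w {1})
    (h3 : v Finset.univ = w Finset.univ) : v = w := by
  refine fock_ext h0 (fun a => ?_) h3
  fin_cases a
  · exact h1
  · exact h2

theorem slashConj_add (p : Covector) (s t : Spinor) (c : Fin 2) :
    slashConj p (s + t) c = slashConj p s c + slashConj p t c := by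
  simp [slashConj, mul_add, Finset.sum_add_distrib]

theorem slashConj_smul (p : Covector) (r : ℝ) (s : Spinor) (c : Fin 2) :
    slashConj p (r • s) c = r * slashConj p s c := by
  simp [slashConj, Fin.sum_univ_two]; ring

theorem clifford_add_left (p : Covector) (s t : Spinor) (w : Fock) :
    clifford p (s + t) w = clifford p s w + clifford p t w := by
  apply clifford_ext_aux <;> simp only [clifford_empty, clifford_zero, clifford_one, clifford_univ,
    Pi.add_apply, slashConj_add] <;> ring

theorem clifford_smul_left (p : Covector) (r : ℝ) (s : Spinor) (w : Fock) :
    clifford p (r • s) w = (r : ℂ) • clifford p s w := by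
  apply clifford_ext_aux <;> simp only [clifford_empty, clifford_zero, clifford_one, clifford_univ,
    Pi.smul_apply, slashConj_smul, smul_eq_mul, Complex.real_smul] <;> ring

/-- The Clifford action as a linear map on the fibre. -/
def cliffordL (p : Covector) (s : Spinor) : Fock →ₗ[ℂ] Fock where
  toFun := clifford p s
  map_add' v w := by
    apply clifford_ext_aux <;> simp only [clifford_empty, clifford_zero, clifford_one,
      clifford_univ, Pi.add_apply] <;> ring
  map_smul' c w := by
    apply clifford_ext_aux <;> simp only [clifford_empty, clifford_zero, clifford_one,
      clifford_univ, Pi.smul_apply, smul_eq_mul, RingHom.id_apply] <;> ring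

theorem cliffordL_apply (p : Covector) (s : Spinor) (w : Fock) :
    cliffordL p s w = clifford p s w := rfl

theorem clifford_smul (p : Covector) (s : Spinor) (c : ℂ) (w : Fock) :
    clifford p s (c • w) = c • clifford p s w := (cliffordL p s).map_smul c w

theorem conj_slashUp (p : Covector) (a b : Fin 2) : conj (slashUp p a b) = slashUp p b a := by
  fin_cases a <;> fin_cases b <;> simp [slashUp_00, slashUp_01, slashUp_10, slashUp_11, sub_eq_add_neg]

theorem sum_slashConj (p : Covector) (s t : Spinor) :
    s 0 * slashConj p t 0 + s 1 * slashConj p t 1 +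
      (t 0 * slashConj p s 0 + t 1 * slashConj p s 1) = (p ⬝ᵥ gamma s t : ℝ) := by
  have h : ∀ z : ℂ, ((2 * z.re : ℝ) : ℂ) = z + conj z := fun z => by
    rw [Complex.add_conj]
  rw [dotProduct_gamma, h]
  simp only [slashConj, Fin.sum_univ_two, map_add, map_mul, conj_slashUp, Complex.conj_conj]
  ring

theorem clifford_clifford_add (p : Covector) (s t : Spinor) (w : Fock) :
    clifford p s (clifford p t w) + clifford p t (clifford p s w) =
      (2 * I * (p ⬝ᵥ gamma s t : ℝ)) • w := by
  rw [← sum_slashConj]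
  apply clifford_ext_aux <;> simp only [clifford_empty, clifford_zero, clifford_one, clifford_univ,
    Pi.add_apply, Pi.smul_apply, smul_eq_mul] <;> ring

theorem slashConj_pullback (A : SL2) (p : Covector) (s : Spinor) (b : Fin 2) :
    slashConj (pullback A p) s b = ∑ c, mat A c b * slashConj p ((mat A).mulVec s) c := by
  simp only [slashConj, slashUp_pullback, Matrix.mulVec, dotProduct, Fin.sum_univ_two, map_add,
    map_mul]
  ring

theorem spinFock_clifford (A : SL2) (p : Covector) (s : Spinor) (w : Fock) :
    spinFock A (clifford (pullback A p) s w) =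
      clifford p ((mat A).mulVec s) (spinFock A w) := by
  have hd := mat_det A
  apply clifford_ext_aux
  · simp only [spinFock_empty, clifford_empty, spinFock_singleton, slashConj_pullback,
      Fin.sum_univ_two]
    ring
  · simp only [spinFock_empty, clifford_zero, clifford_one, spinFock_singleton, slashConj_pullback,
      spinFock_univ, Fin.sum_univ_two, Matrix.mulVec, dotProduct]
    linear_combination (-2 * slashConj p ((mat A).mulVec s) 1 *
      w Finset.univ) * hd
  · simp only [spinFock_empty, clifford_zero, clifford_one, spinFock_singleton, slashConj_pullback,
      spinFock_univ, Fin.sum_univ_two, Matrix.mulVec, dotProduct]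
    linear_combination (2 * slashConj p ((mat A).mulVec s) 0 *
      w Finset.univ) * hd
  · simp only [clifford_univ, spinFock_singleton, spinFock_univ, Fin.sum_univ_two, Matrix.mulVec,
      dotProduct]
    linear_combination (-I * (s 0 * w {1} - s 1 * w {0})) * hd

/-- Antisymmetry of the Clifford action up to the phase `-i`. -/
theorem fibreInner_clifford {p : Covector} (h : OnShell m p) (s : Spinor) (v w : Fock) :
    fibreInner m p (clifford p s v) w = -I * fibreInner m p v (clifford p s w) := by
  have hd := det_slashUp p
  have hsq : ((p 0 ^ 2 - p 1 ^ 2 - p 2 ^ 2 - p 3 ^ 2 : ℝ) : ℂ) = (m : ℂ) ^ 2 := by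
    rw [← Complex.ofReal_pow]
    congr 1
    linarith [h.sq]
  rw [hsq] at hd
  simp only [fibreInner, clifford_empty, clifford_zero, clifford_one, clifford_univ,
    Fin.sum_univ_two, map_add, map_sub, map_mul, slashConj, conj_slashUp, Complex.conj_conj,
    Complex.conj_I, map_ofNat]
  generalize slashUp p 0 0 = a at *
  generalize slashUp p 0 1 = b at *
  generalize slashUp p 1 0 = c at *
  generalize slashUp p 1 1 = d at *
  rw [← hd]
  have hI := Complex.I_sq
  ring_nf
  simp only [hI]
  ring

theorem norm_triv_clifford_sq (hm : 0 < m) {p : Covector} (h : OnShell m p) (s : Spinor)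
    (w : Fock) : ‖triv m p (clifford p s w)‖ ^ 2 = (p ⬝ᵥ gamma s s) * ‖triv m p w‖ ^ 2 := by
  have h2 := clifford_clifford_add p s s w
  have h3 : clifford p s (clifford p s w) = (I * (p ⬝ᵥ gamma s s : ℝ)) • w := by
    rw [← two_smul ℂ] at h2
    have := congrArg (fun v => (2 : ℂ)⁻¹ • v) h2
    simp only [smul_smul] at this
    rw [inv_mul_cancel₀ two_ne_zero, one_smul] at this
    rw [this]
    congr 1
    ring
  have h4 : (inner ℂ (triv m p (clifford p s w)) (triv m p (clifford p s w)) : ℂ) =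
      (p ⬝ᵥ gamma s s : ℝ) * inner ℂ (triv m p w) (triv m p w) := by
    rw [inner_triv hm h, fibreInner_clifford h, h3, ← inner_triv hm h, triv_smul,
      inner_smul_right]
    linear_combination (-((p ⬝ᵥ gamma s s : ℝ) : ℂ) * inner ℂ (triv m p w) (triv m p w)) *
      Complex.I_sq
  simp only [inner_self_eq_norm_sq_to_K] at h4
  change (‖triv m p (clifford p s w)‖ : ℂ) ^ 2 = _ * (‖triv m p w‖ : ℂ) ^ 2 at h4
  exact_mod_cast h4

theorem gamma_le (hm : 0 < m) {p : Covector} (h : OnShell m p) (s : Spinor) :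
    p ⬝ᵥ gamma s s ≤ p 0 * ∑ μ, |gamma s s μ| := by
  rw [Finset.mul_sum]
  refine Finset.sum_le_sum fun μ _ => (le_abs_self _).trans ?_
  rw [abs_mul]
  exact mul_le_mul_of_nonneg_right (h.abs_le hm μ) (abs_nonneg _)

end Clifford

/-! ### Density of the smooth vectors -/

theorem ae_eq_zero_of_schwartz {g : Mom → ℂ}
    (hi : ∀ V : 𝓢(Mom, ℂ), Integrable fun k => conj (V k) * g k)
    (hz : ∀ V : 𝓢(Mom, ℂ), ∫ k, conj (V k) * g k = 0) : ∀ᵐ k, g k = 0 := by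
  have hreal : ∀ φ : Mom → ℝ, ∀ (h1 : ContDiff ℝ ∞ φ) (h2 : HasCompactSupport φ),
      ∃ V : 𝓢(Mom, ℂ), ∀ k, V k = φ k := fun φ h1 h2 =>
    ⟨HasCompactSupport.toSchwartzMap (f := fun k => (φ k : ℂ))
      (h2.comp_left (g := Complex.ofReal) Complex.ofReal_zero)
      (Complex.ofRealCLM.contDiff.comp h1), fun k => rfl⟩
  refine ae_eq_zero_of_integral_contDiff_smul_eq_zero (fun x => ?_) fun φ h1 h2 => ?_
  · obtain ⟨V, hV⟩ := hreal (ContDiffBump.mk 1 2 one_pos one_lt_two : ContDiffBump x)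
      (ContDiffBump.contDiff _) (ContDiffBump.hasCompactSupport _)
    refine ⟨Metric.ball x 1, Metric.ball_mem_nhds x one_pos, ?_⟩
    refine ((hi V).integrableOn (s := Metric.ball x 1)).congr_fun (fun k hk => ?_)
      Metric.isOpen_ball.measurableSet
    simp only [hV]
    rw [ContDiffBump.one_of_mem_closedBall _ (Metric.ball_subset_closedBall hk)]
    simp
  · obtain ⟨V, hV⟩ := hreal φ h1 h2
    rw [← hz V]
    simp only [hV, Complex.conj_ofReal, Complex.real_smul]

namespace PreInduced

variable {m : ℝ} {H : Type*} [NormedAddCommGroup H] [InnerProductSpace ℂ H]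
  {ρ : Poincare →* (H ≃ₗᵢ[ℂ] H)} {Φ : H →ₗ[ℂ] AEEqFun Covector Fock (massShell m)}
  (h : PreInduced m ρ Φ) (hm : 0 < m)
include h hm

theorem eq_zero_of_inner_smooth {Ω : H} (hΩ : ∀ Ψ ∈ smoothVectors ρ, (inner ℂ Ψ Ω : ℂ) = 0) :
    Ω = 0 := by
  have key : ∀ I, ∀ᵐ p ∂(massShell m),
      (inner ℂ (triv m p (Pi.single I 1)) (triv m p (Φ Ω p)) : ℂ) = 0 := fun I => by
    rw [ae_massShell_iff hm]
    have hV : ∀ V : 𝓢(Mom, ℂ), Integrable (fun k : Mom => conj (V k) *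
        (((2 * energy m k)⁻¹ : ℝ) * inner ℂ (triv m (shellPt m k) (Pi.single I 1))
          (triv m (shellPt m k) (Φ Ω (shellPt m k))))) ∧ ∫ k : Mom, conj (V k) *
        (((2 * energy m k)⁻¹ : ℝ) * inner ℂ (triv m (shellPt m k) (Pi.single I 1))
          (triv m (shellPt m k) (Φ Ω (shellPt m k)))) = 0 := fun V => by
      obtain ⟨Ψ, hΨ, hΨV⟩ := h.exists_schwartz_vec hm (Pi.single I V)
      have h1 := h.integrable_inner hm Ψ Ω
      have h2 := h.inner_eq hm Ψ Ω
      rw [hΩ Ψ hΨ, integral_massShell hm] at h2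
      rw [integrable_massShell_iff hm] at h1
      rw [ae_massShell_iff hm] at hΨV
      have he : (fun k => (2 * energy m k)⁻¹ • (inner ℂ (triv m (shellPt m k) (Φ Ψ (shellPt m k)))
          (triv m (shellPt m k) (Φ Ω (shellPt m k))) : ℂ)) =ᵐ[volume] fun k => conj (V k) *
        (((2 * energy m k)⁻¹ : ℝ) * inner ℂ (triv m (shellPt m k) (Pi.single I 1))
          (triv m (shellPt m k) (Φ Ω (shellPt m k)))) := by
        filter_upwards [hΨV] with k hk
        have : (fun J => (Pi.single I V : Finset (Fin 2) → 𝓢(Mom, ℂ)) J (spatial (shellPt m k))) =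
            V k • (Pi.single I 1 : Fock) := by
          funext J
          rw [spatial_shellPt]
          rcases eq_or_ne J I with rfl | hJ
          · simp
          · simp [hJ]
        rw [hk, this, triv_smul, inner_smul_left, Complex.real_smul]
        ring
      exact ⟨h1.congr he, by rw [← integral_congr_ae he]; exact h2.symm⟩
    have := ae_eq_zero_of_schwartz (fun V => (hV V).1) (fun V => (hV V).2)
    filter_upwards [this] with k hk
    have hE : (((2 * energy m k)⁻¹ : ℝ) : ℂ) ≠ 0 := by
      have := energy_pos hm k
      exact_mod_cast (by positivity : (2 * energy m k)⁻¹ ≠ 0)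
    exact (mul_eq_zero.1 hk).resolve_left hE
  refine h.eq_of_ae ?_
  filter_upwards [ae_all_iff.2 key, coe_zero Φ] with p h1 h2
  rw [h2]
  have h3 : triv m p (Φ Ω p) = ∑ I, Φ Ω p I • triv m p (Pi.single I 1) := by
    have : Φ Ω p = ∑ I, Φ Ω p I • (Pi.single I 1 : Fock) := by
      funext J; simp [Finset.sum_apply, Pi.single_apply]
    conv_lhs => rw [this]
    have hl : ∀ w, triv m p w = (IsLinearMap.mk' (triv m p)
      ⟨triv_add p, triv_smul p⟩ : Fock →ₗ[ℂ] FibreE) w := fun w => rfl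
    simp only [hl, map_sum, map_smul]
  have h4 : (inner ℂ (triv m p (Φ Ω p)) (triv m p (Φ Ω p)) : ℂ) = 0 := by
    have h5 : (inner ℂ (triv m p (Φ Ω p)) (triv m p (Φ Ω p)) : ℂ) =
        inner ℂ (∑ I, Φ Ω p I • triv m p (Pi.single I 1)) (triv m p (Φ Ω p)) := by rw [← h3]
    rw [h5, sum_inner]
    refine Finset.sum_eq_zero fun I _ => ?_
    rw [inner_smul_left, h1 I, mul_zero]
  rw [inner_self_eq_zero] at h4
  rw [← trivInv_triv hm p (Φ Ω p), h4]
  simpa using trivInv_smul hm p 0 0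

theorem dense_smoothVectors [CompleteSpace H] : Dense (smoothVectors ρ : Set H) := by
  rw [Submodule.dense_iff_topologicalClosure_eq_top, Submodule.topologicalClosure_eq_top_iff,
    Submodule.eq_bot_iff]
  exact fun Ω hΩ => h.eq_zero_of_inner_smooth hm fun Ψ hΨ =>
    Submodule.inner_right_of_mem_orthogonal hΨ hΩ

theorem continuous_rep_of_dense [CompleteSpace H] (Ψ : H) :
    Continuous fun y : Spacetime × SL2 => ρ ⟨y.1, y.2⟩ Ψ := by
  rw [continuous_iff_continuousAt]
  intro y₀
  rw [Metric.continuousAt_iff']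
  intro ε hε
  obtain ⟨Ω, hΩ, hd⟩ := Metric.dense_iff.1 (h.dense_smoothVectors hm) Ψ (ε / 3) (by positivity)
  have hd' : dist Ω Ψ < ε / 3 := hΩ
  have hc := Metric.continuousAt_iff'.1 ((continuous_rep hd).continuousAt (x := y₀)) (ε / 3)
    (by positivity)
  filter_upwards [hc] with y hy
  calc dist (ρ ⟨y.1, y.2⟩ Ψ) (ρ ⟨y₀.1, y₀.2⟩ Ψ)
      ≤ dist (ρ ⟨y.1, y.2⟩ Ψ) (ρ ⟨y.1, y.2⟩ Ω) + dist (ρ ⟨y.1, y.2⟩ Ω) (ρ ⟨y₀.1, y₀.2⟩ Ω) +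
        dist (ρ ⟨y₀.1, y₀.2⟩ Ω) (ρ ⟨y₀.1, y₀.2⟩ Ψ) := dist_triangle4 _ _ _ _
    _ < ε / 3 + ε / 3 + ε / 3 := by
        rw [LinearIsometryEquiv.dist_map, LinearIsometryEquiv.dist_map, dist_comm Ψ Ω]
        gcongr
    _ = ε := by ring

/-- Derivatives in `H` may be computed pointwise on the mass shell. -/
theorem ae_eq_of_hasDerivAt {f : ℝ → H} {Ω : H} (hf : HasDerivAt f Ω 0)
    {g : ℝ → Covector → Fock} {g' : Covector → Fock}
    (hg : ∀ t, ∀ᵐ p ∂(massShell m), Φ (f t) p = g t p)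
    (hg' : ∀ᵐ p ∂(massShell m), HasDerivAt (fun t => g t p) (g' p) 0) :
    ∀ᵐ p ∂(massShell m), Φ Ω p = g' p := by
  have ht : Filter.Tendsto (fun n : ℕ => 1 / ((n : ℝ) + 1)) Filter.atTop (nhdsWithin 0 {0}ᶜ) := by
    refine tendsto_nhdsWithin_iff.2 ⟨tendsto_one_div_add_atTop_nhds_zero_nat, ?_⟩
    exact Filter.Eventually.of_forall fun n => by
      have : (1 / ((n : ℝ) + 1)) ≠ 0 := by positivity
      exact this
  have h1 := (hasDerivAt_iff_tendsto_slope_zero.1 hf).comp ht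
  refine h.ae_eq_of_tendsto hm h1 ?_
  have h2 : ∀ᵐ p ∂(massShell m), ∀ n : ℕ, Φ (f (0 + 1 / ((n : ℝ) + 1))) p =
      g (0 + 1 / ((n : ℝ) + 1)) p := ae_all_iff.2 fun n => hg _
  have h3 : ∀ᵐ p ∂(massShell m), ∀ n : ℕ, Φ (((1 / ((n : ℝ) + 1))⁻¹ : ℝ) •
      (f (0 + 1 / ((n : ℝ) + 1)) - f 0)) p = ((1 / ((n : ℝ) + 1))⁻¹ : ℝ) •
        (Φ (f (0 + 1 / ((n : ℝ) + 1))) p - Φ (f 0) p) := ae_all_iff.2 fun n => by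
    filter_upwards [coe_smul Φ (((1 / ((n : ℝ) + 1))⁻¹ : ℝ) : ℂ)
      (f (0 + 1 / ((n : ℝ) + 1)) - f 0), coe_sub Φ (f (0 + 1 / ((n : ℝ) + 1))) (f 0)] with p h4 h5
    rw [← h5]
    exact h4
  filter_upwards [h2, h3, hg', hg 0] with p h4 h5 h6 h7
  have h8 := (hasDerivAt_iff_tendsto_slope_zero.1 h6).comp ht
  refine h8.congr fun n => ?_
  simp only [Function.comp]
  rw [h5, h4, h7]

omit hm in
theorem ae_translate (v : Spacetime) (Ψ : H) : ∀ᵐ p ∂(massShell m),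
    Φ (ρ ⟨v, 1⟩ Ψ) p = exp (-(Complex.I * (p ⬝ᵥ v : ℝ))) • Φ Ψ p := by
  filter_upwards [h.poincare ⟨v, 1⟩ Ψ] with p hp
  rw [hp]
  simp only [pullback_one]
  congr 1
  funext I
  rcases finset_fin_two_cases I with rfl | rfl | rfl | rfl
  · rw [spinFock_empty]
  · rw [spinFock_singleton]; simp
  · rw [spinFock_singleton]; simp
  · rw [spinFock_univ]

theorem ae_translationDeriv {Ψ : H} (hΨ : Ψ ∈ smoothVectors ρ) (v : Spacetime) :
    ∀ᵐ p ∂(massShell m), Φ (translationDeriv ρ v Ψ) p =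
      (-(I * (p ⬝ᵥ v : ℝ))) • Φ Ψ p := by
  refine h.ae_eq_of_hasDerivAt hm (hasDerivAt_translate hΨ v)
    (fun t => h.ae_translate (t • v) Ψ) (Filter.Eventually.of_forall fun p => ?_)
  have h1 : HasDerivAt (fun t : ℝ => -(I * (p ⬝ᵥ (t • v) : ℝ)))
      (-(I * (p ⬝ᵥ v : ℝ))) 0 := by
    have h2 : HasDerivAt (fun t : ℝ => ((t * (p ⬝ᵥ v) : ℝ) : ℂ)) (((p ⬝ᵥ v : ℝ)) : ℂ) 0 := by
      have := ((hasDerivAt_id (0 : ℝ)).mul_const (p ⬝ᵥ v)).ofReal_comp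
      simpa using this
    simp only [dotProduct_smul, smul_eq_mul]
    exact (h2.const_mul I).neg
  have h3 := (h1.cexp).smul_const (Φ Ψ p)
  simpa using h3

end PreInduced

end SuperPoincare

namespace SuperPoincare
open Complex (I exp)
open MeasureTheory

/-! ### Charges on an induced representation of the Poincare group -/

variable {m : ℝ}

/-- The phase `exp(-iπ/4)`. -/
def phase : ℂ := exp (-(I * (Real.pi / 4 : ℝ)))

theorem exp_mul_phase : exp (I * (Real.pi / 4 : ℝ)) * phase = 1 := by
  rw [phase, ← Complex.exp_add, add_neg_cancel, Complex.exp_zero]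

theorem phase_sq : phase * phase = -I := by
  rw [phase, ← Complex.exp_add, ← Complex.exp_neg_pi_div_two_mul_I]
  congr 1
  push_cast
  ring

theorem conj_phase : conj phase = exp (I * (Real.pi / 4 : ℝ)) := by
  rw [phase, ← Complex.exp_conj]
  simp [map_ofNat]

theorem conj_phase_eq : conj phase = I * phase := by
  have h1 : conj phase * phase = 1 := by rw [conj_phase, exp_mul_phase]
  have h2 := phase_sq
  have h0 : phase ≠ 0 := Complex.exp_ne_zero _
  apply mul_right_cancel₀ h0
  rw [h1, mul_assoc, h2]
  simp

/-- The parity of `⋀ S_+^*`. -/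
def fockParity : Fock →ₗ[ℂ] Fock where
  toFun w := fun I => (-1) ^ I.card * w I
  map_add' v w := by funext I; simp [mul_add]
  map_smul' c w := by funext I; simp; ring

theorem fockParity_apply (w : Fock) (I : Finset (Fin 2)) :
    fockParity w I = (-1) ^ I.card * w I := rfl

theorem fockParity_fockParity (w : Fock) : fockParity (fockParity w) = w := by
  funext I
  rw [fockParity_apply, fockParity_apply, ← mul_assoc, ← mul_pow]
  simp

theorem clifford_fockParity (p : Covector) (s : Spinor) (w : Fock) :
    clifford p s (fockParity w) = -fockParity (clifford p s w) := by
  apply clifford_ext_aux <;> simp only [clifford_empty, clifford_zero, clifford_one, clifford_univ,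
    Pi.neg_apply, fockParity_apply, Finset.card_empty, Finset.card_singleton, Finset.card_univ,
    Fintype.card_fin] <;> ring

theorem spinFock_fockParity (A : SL2) (w : Fock) :
    spinFock A (fockParity w) = fockParity (spinFock A w) := by
  apply clifford_ext_aux <;> simp only [spinFock_empty, spinFock_singleton, spinFock_univ,
    fockParity_apply, Finset.card_empty, Finset.card_singleton, Finset.card_univ,
    Fintype.card_fin] <;> ring

theorem fibreNormSq_fockParity (p : Covector) (w : Fock) :
    fibreNormSq m p (fockParity w) = fibreNormSq m p w := by
  simp only [fibreNormSq, dotProduct_gamma, fockParity_apply]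
  simp [Fin.sum_univ_two]

theorem spinFock_mul (A B : SL2) (w : Fock) :
    spinFock (A * B) w = spinFock A (spinFock B w) := by
  apply clifford_ext_aux
  · simp only [spinFock_empty]
  · simp only [spinFock_singleton, mat_mul_apply]; ring
  · simp only [spinFock_singleton, mat_mul_apply]; ring
  · simp only [spinFock_univ]

theorem spinFock_one (w : Fock) : spinFock 1 w = w := by
  apply clifford_ext_aux
  · rw [spinFock_empty]
  · rw [spinFock_singleton]; simp
  · rw [spinFock_singleton]; simp
  · rw [spinFock_univ]

theorem continuous_slashConj (s : Spinor) (c : Fin 2) :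
    Continuous fun x : Covector × Fock => slashConj x.1 s c := by
  unfold slashConj slashUp
  fun_prop

theorem continuous_clifford (s : Spinor) :
    Continuous fun x : Covector × Fock => clifford x.1 s x.2 := by
  have h1 := continuous_slashConj s 0
  have h2 := continuous_slashConj s 1
  refine continuous_pi fun I => ?_
  rcases finset_fin_two_cases I with rfl | rfl | rfl | rfl
  · simp only [clifford_empty]; fun_prop
  · simp only [clifford_zero]; fun_prop
  · simp only [clifford_one]; fun_prop
  · simp only [clifford_univ]; fun_prop

namespace PreInduced

variable {H : Type*} [NormedAddCommGroup H] [InnerProductSpace ℂ H]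
  {ρ : Poincare →* (H ≃ₗᵢ[ℂ] H)} {Φ : H →ₗ[ℂ] AEEqFun Covector Fock (massShell m)}
  (h : PreInduced m ρ Φ) (hm : 0 < m)
include h hm

theorem exists_parity : ∃ P : H ≃ₗᵢ[ℂ] H, (∀ Ψ, P (P Ψ) = Ψ) ∧
    ∀ Ψ, ∀ᵐ p ∂(massShell m), Φ (P Ψ) p = fockParity (Φ Ψ p) := by
  obtain ⟨T, hT⟩ := h.exists_fibre_op hm (fun _ => fockParity)
    ((LinearMap.continuous_of_finiteDimensional fockParity).comp continuous_snd) 1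
    (fun p hp w => by
      rw [one_mul, ← pow_le_pow_iff_left₀ (norm_nonneg _) (norm_nonneg _) two_ne_zero,
        norm_triv_sq hm hp, norm_triv_sq hm hp, fibreNormSq_fockParity])
  have hTT : ∀ Ψ, T (T Ψ) = Ψ := fun Ψ => h.eq_of_ae (by
    filter_upwards [hT (T Ψ), hT Ψ] with p h1 h2
    rw [h1, h2, fockParity_fockParity])
  refine ⟨⟨LinearEquiv.ofInvolutive (T : H →ₗ[ℂ] H) hTT, fun Ψ => ?_⟩, hTT, hT⟩
  have h1 : ENNReal.ofReal (‖T Ψ‖ ^ 2) = ENNReal.ofReal (‖Ψ‖ ^ 2) := by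
    rw [h.norm_sq, h.norm_sq]
    refine lintegral_congr_ae ?_
    filter_upwards [hT Ψ] with p hp
    rw [hp, fibreNormSq_fockParity]
  rw [ENNReal.ofReal_eq_ofReal_iff (sq_nonneg _) (sq_nonneg _)] at h1
  exact (pow_left_inj₀ (norm_nonneg _) (norm_nonneg _) two_ne_zero).1 h1

theorem exists_charge_bounded (s : Spinor) : ∃ T : H →L[ℂ] H, ∀ Ψ, ∀ᵐ p ∂(massShell m),
    Φ (T Ψ) p = ((p 0)⁻¹ : ℂ) • clifford p s (Φ Ψ p) := by
  obtain ⟨T, hT⟩ := h.exists_fibre_op hm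
    (fun p => (((energy m (spatial p))⁻¹ : ℝ) : ℂ) • cliffordL p s)
    (by
      have h1 : Continuous fun x : Covector × Fock => (((energy m (spatial x.1))⁻¹ : ℝ) : ℂ) :=
        Complex.continuous_ofReal.comp (((continuous_energy hm).comp
          (spatial.continuous.comp continuous_fst)).inv₀ fun x => (energy_pos hm _).ne')
      exact h1.smul (continuous_clifford s))
    (√((∑ μ, |gamma s s μ|) / m)) (fun p hp w => by
      have h0 := hp.pos hm
      have hS : 0 ≤ ∑ μ, |gamma s s μ| := Finset.sum_nonneg fun _ _ => abs_nonneg _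
      rw [← pow_le_pow_iff_left₀ (norm_nonneg _) (by positivity) two_ne_zero]
      rw [LinearMap.smul_apply, cliffordL_apply, triv_smul, norm_smul, mul_pow, mul_pow,
        norm_triv_clifford_sq hm hp, Real.sq_sqrt (by positivity), ← hp, ← mul_assoc,
        Complex.norm_real, Real.norm_of_nonneg (inv_nonneg.2 h0.le)]
      refine mul_le_mul_of_nonneg_right ?_ (sq_nonneg _)
      calc (p 0)⁻¹ ^ 2 * (p ⬝ᵥ gamma s s) ≤ (p 0)⁻¹ ^ 2 * (p 0 * ∑ μ, |gamma s s μ|) :=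
            mul_le_mul_of_nonneg_left (gamma_le hm hp s) (sq_nonneg _)
        _ = (∑ μ, |gamma s s μ|) / p 0 := by field_simp
        _ ≤ _ := div_le_div_of_nonneg_left hS hm hp.le_zero)
  refine ⟨T, fun Ψ => ?_⟩
  filter_upwards [hT Ψ, ae_onShell hm] with p h1 h2
  rw [h1, LinearMap.smul_apply, cliffordL_apply, ← h2, Complex.ofReal_inv]

theorem exists_charge (s : Spinor) {Ψ : H} (hΨ : Ψ ∈ smoothVectors ρ) :
    ∃ Ω ∈ smoothVectors ρ, ∀ᵐ p ∂(massShell m), Φ Ω p = phase • clifford p s (Φ Ψ p) := by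
  choose T hT using h.exists_charge_bounded hm
  have hE : ∀ (s : Spinor) {Θ : H}, Θ ∈ smoothVectors ρ → ∀ᵐ p ∂(massShell m),
      Φ (T s (I • translationDeriv ρ (basisVec 0) Θ)) p = clifford p s (Φ Θ p) := by
    intro s Θ hΘ
    filter_upwards [hT s (I • translationDeriv ρ (basisVec 0) Θ),
      h.ae_translationDeriv hm hΘ (basisVec 0), ae_onShell hm,
      coe_smul Φ I (translationDeriv ρ (basisVec 0) Θ)] with p h1 h2 h3 h4
    have h0 : (p 0 : ℂ) ≠ 0 := by exact_mod_cast (h3.pos hm).ne'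
    rw [h1, h4, h2, smul_smul, clifford_smul, smul_smul]
    rw [show ((p 0 : ℂ))⁻¹ * (I * -(I * ((p ⬝ᵥ basisVec 0 : ℝ) : ℂ))) = 1 by
      rw [show p ⬝ᵥ basisVec 0 = p 0 by simp [basisVec]]
      field_simp
      simp, one_smul]
  have hbasis : ∀ s : Spinor, s = (s 0).re • (Pi.single 0 1 : Spinor) +
      (s 0).im • (Pi.single 0 I : Spinor) + (s 1).re • (Pi.single 1 1 : Spinor) +
      (s 1).im • (Pi.single 1 I : Spinor) := fun s => by
    funext a
    fin_cases a <;> simp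
  set L : Spinor → H →L[ℂ] H := fun s =>
    ((s 0).re : ℂ) • T (Pi.single 0 1) + ((s 0).im : ℂ) • T (Pi.single 0 I) +
      ((s 1).re : ℂ) • T (Pi.single 1 1) + ((s 1).im : ℂ) • T (Pi.single 1 I) with hL
  have hTL : ∀ s Θ, T s Θ = L s Θ := fun s Θ => by
    refine h.eq_of_ae ?_
    have e : Φ (L s Θ) = ((s 0).re : ℂ) • Φ (T (Pi.single 0 1) Θ) +
        ((s 0).im : ℂ) • Φ (T (Pi.single 0 I) Θ) +
        ((s 1).re : ℂ) • Φ (T (Pi.single 1 1) Θ) + ((s 1).im : ℂ) • Φ (T (Pi.single 1 I) Θ) := by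
      simp only [hL, add_apply, FunLike.coe_smul, Pi.smul_apply,
        map_add, map_smul]
    rw [e]
    filter_upwards [hT s Θ, hT (Pi.single 0 1) Θ, hT (Pi.single 0 I) Θ,
      hT (Pi.single 1 1) Θ, hT (Pi.single 1 I) Θ,
      AEEqFun.coeFn_add (((s 0).re : ℂ) • Φ (T (Pi.single 0 1) Θ) +
        ((s 0).im : ℂ) • Φ (T (Pi.single 0 I) Θ) +
        ((s 1).re : ℂ) • Φ (T (Pi.single 1 1) Θ)) (((s 1).im : ℂ) • Φ (T (Pi.single 1 I) Θ)),
      AEEqFun.coeFn_add (((s 0).re : ℂ) • Φ (T (Pi.single 0 1) Θ) +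
        ((s 0).im : ℂ) • Φ (T (Pi.single 0 I) Θ)) (((s 1).re : ℂ) • Φ (T (Pi.single 1 1) Θ)),
      AEEqFun.coeFn_add (((s 0).re : ℂ) • Φ (T (Pi.single 0 1) Θ))
        (((s 0).im : ℂ) • Φ (T (Pi.single 0 I) Θ)),
      AEEqFun.coeFn_smul ((s 0).re : ℂ) (Φ (T (Pi.single 0 1) Θ)),
      AEEqFun.coeFn_smul ((s 0).im : ℂ) (Φ (T (Pi.single 0 I) Θ)),
      AEEqFun.coeFn_smul ((s 1).re : ℂ) (Φ (T (Pi.single 1 1) Θ)),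
      AEEqFun.coeFn_smul ((s 1).im : ℂ) (Φ (T (Pi.single 1 I) Θ))]
      with p a0 a1 a2 a3 a4 b1 b2 b3 c1 c2 c3 c4
    rw [b1, Pi.add_apply, b2, Pi.add_apply, b3, Pi.add_apply, c1, c2, c3, c4, Pi.smul_apply,
      Pi.smul_apply, Pi.smul_apply, Pi.smul_apply, a1, a2, a3, a4, a0]
    conv_lhs => rw [hbasis s]
    simp only [clifford_add_left, clifford_smul_left, smul_add, smul_smul, mul_comm]
  refine ⟨phase • T s (I • translationDeriv ρ (basisVec 0) Ψ), ?_, ?_⟩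
  · refine mem_smoothVectors_of_contDiff fun c A hc hA => ?_
    have he : ∀ e, ρ ⟨c e, A e⟩ (phase • T s (I • translationDeriv ρ (basisVec 0) Ψ)) =
        phase • L ((mat (A e)).mulVec s)
          (I • translationDeriv ρ (basisVec 0) (ρ ⟨c e, A e⟩ Ψ)) := fun e => by
      rw [← hTL, map_smul]
      congr 1
      refine h.eq_of_ae ?_
      have q := (measurePreserving_pullback hm (A e)).quasiMeasurePreserving.ae (hE s hΨ)
      filter_upwards [h.poincare ⟨c e, A e⟩ (T s (I • translationDeriv ρ (basisVec 0) Ψ)),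
        h.poincare ⟨c e, A e⟩ Ψ, q, hE ((mat (A e)).mulVec s) (rep_smooth_mem hΨ ⟨c e, A e⟩)]
        with p a1 a2 a3 a4
      rw [a1, a4, a2, a3, spinFock_clifford, clifford_smul]
    simp only [he]
    have hv := contDiff_rep_translationDeriv hΨ hc hA (v := fun _ => basisVec 0) contDiff_const
    have hmv : ∀ a, ContDiff ℝ ∞ fun e => (mat (A e)).mulVec s a := fun a => by
      simp only [Matrix.mulVec, dotProduct]
      exact ContDiff.sum fun i _ => (hA a i).mul contDiff_const
    have hr : ∀ {f : (Spacetime × (Fin 3 → ℂ)) → ℂ}, ContDiff ℝ ∞ f →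
        ContDiff ℝ ∞ fun e => ((f e).re : ℂ) := fun hf =>
      (Complex.ofRealCLM.contDiff.comp (Complex.reCLM.contDiff.comp hf))
    have hi : ∀ {f : (Spacetime × (Fin 3 → ℂ)) → ℂ}, ContDiff ℝ ∞ f →
        ContDiff ℝ ∞ fun e => ((f e).im : ℂ) := fun hf =>
      (Complex.ofRealCLM.contDiff.comp (Complex.imCLM.contDiff.comp hf))
    have hT' : ∀ s, ContDiff ℝ ∞ fun e =>
        T s (I • translationDeriv ρ (basisVec 0) (ρ ⟨c e, A e⟩ Ψ)) := fun s =>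
      ((T s).restrictScalars ℝ).contDiff.comp (hv.const_smul I)
    refine ContDiff.const_smul phase ?_
    exact ((((hr (hmv 0)).smul (hT' _)).add ((hi (hmv 0)).smul (hT' _))).add
      ((hr (hmv 1)).smul (hT' _))).add ((hi (hmv 1)).smul (hT' _))
  · filter_upwards [coe_smul Φ phase (T s (I • translationDeriv ρ (basisVec 0) Ψ)),
      hE s hΨ] with p h1 h2
    rw [h1, h2]

/-- An induced representation of the Poincare group extends to the super Poincare group. -/
theorem exists_superUnitaryRep [CompleteSpace H] : ∃ R : SuperUnitaryRep H, IsInduced m R Φ := by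
  obtain ⟨P, hPP, hP⟩ := h.exists_parity hm
  have hex : ∀ (s : Spinor) (Ψ : smoothVectors ρ), ∃ Ω : smoothVectors ρ,
      ∀ᵐ p ∂(massShell m), Φ (Ω : H) p = phase • clifford p s (Φ (Ψ : H) p) := fun s Ψ => by
    obtain ⟨Ω, h1, h2⟩ := h.exists_charge hm s Ψ.2
    exact ⟨⟨Ω, h1⟩, h2⟩
  choose C hC using hex
  have hLin : ∀ s, ∃ L : smoothVectors ρ →ₗ[ℂ] smoothVectors ρ, ∀ Ψ, L Ψ = C s Ψ := fun s =>
    ⟨{ toFun := C s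
       map_add' := fun Ψ Ω => Subtype.ext (h.eq_of_ae (by
        filter_upwards [hC s (Ψ + Ω), hC s Ψ, hC s Ω, coe_add Φ (Ψ : H) (Ω : H),
          coe_add Φ (C s Ψ : H) (C s Ω : H)] with p a1 a2 a3 a4 a5
        rw [a1, Submodule.coe_add, Submodule.coe_add, a4, a5, a2, a3, ← smul_add]
        congr 1
        exact (cliffordL p s).map_add _ _))
       map_smul' := fun c Ψ => Subtype.ext (h.eq_of_ae (by
        filter_upwards [hC s (c • Ψ), hC s Ψ, coe_smul Φ c (Ψ : H), coe_smul Φ c (C s Ψ : H)]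
          with p a1 a2 a3 a4
        rw [RingHom.id_apply, a1, Submodule.coe_smul, Submodule.coe_smul, a3, a4, a2,
          clifford_smul, smul_comm])) }, fun Ψ => rfl⟩
  choose L hL using hLin
  have hLC : ∀ s (Ψ : smoothVectors ρ), ∀ᵐ p ∂(massShell m),
      Φ (L s Ψ : H) p = phase • clifford p s (Φ (Ψ : H) p) := fun s Ψ => by
    rw [hL]; exact hC s Ψ
  refine ⟨{ parity := P, parity_parity := hPP, ρ := ρ,
            continuous_ρ := h.continuous_rep_of_dense hm,
            even_ρ := ?_,
            charge := { toFun := L, map_add' := ?_, map_smul' := ?_ },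
            odd_charge := ?_, symm_charge := ?_, anticomm_charge := ?_,
            equivariant_charge := ?_ }, ?_⟩
  · intro g Ψ
    refine h.eq_of_ae ?_
    have q := (measurePreserving_pullback hm g.lin).quasiMeasurePreserving.ae (hP Ψ)
    filter_upwards [h.poincare g (P Ψ), h.poincare g Ψ, hP (ρ g Ψ), q] with p a1 a2 a3 a4
    rw [a1, a3, a2, a4, spinFock_fockParity, map_smul]
  · intro s t
    refine LinearMap.ext fun Ψ => Subtype.ext (h.eq_of_ae ?_)
    filter_upwards [hLC (s + t) Ψ, hLC s Ψ, hLC t Ψ, coe_add Φ (L s Ψ : H) (L t Ψ : H)]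
      with p a1 a2 a3 a4
    rw [a1, LinearMap.add_apply, Submodule.coe_add, a4, a2, a3, clifford_add_left, smul_add]
  · intro r s
    refine LinearMap.ext fun Ψ => Subtype.ext (h.eq_of_ae ?_)
    have e : ((((RingHom.id ℝ) r • L s) Ψ : smoothVectors ρ) : H) = (r : ℂ) • (L s Ψ : H) := rfl
    rw [e]
    filter_upwards [hLC (r • s) Ψ, hLC s Ψ, coe_smul Φ (r : ℂ) (L s Ψ : H)] with p a1 a2 a3
    rw [a1, a3, a2, clifford_smul_left, smul_comm]
  · intro s Ψ Ω hΩ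
    refine h.eq_of_ae ?_
    have e : ∀ᵐ p ∂(massShell m), Φ (-P (L s Ψ : H)) p = -Φ (P (L s Ψ : H)) p := by
      rw [map_neg]; exact AEEqFun.coeFn_neg _
    change ∀ᵐ p ∂(massShell m), Φ (L s Ω : H) p = Φ (-P (L s Ψ : H)) p
    filter_upwards [hLC s Ω, hLC s Ψ, e, hP (L s Ψ : H), hP (Ψ : H)] with p a1 a2 a3 a4 a5
    rw [a1, a3, a4, a2, hΩ, a5, clifford_fockParity, map_smul, smul_neg]
  · intro s Ψ Ω
    change (inner ℂ (L s Ψ : H) (Ω : H) : ℂ) = inner ℂ (Ψ : H) (L s Ω : H)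
    rw [h.inner_eq hm, h.inner_eq hm]
    refine integral_congr_ae ?_
    filter_upwards [hLC s Ψ, hLC s Ω, ae_onShell hm] with p a1 a2 a3
    rw [a1, a2, triv_smul, triv_smul, inner_smul_left, inner_smul_right, inner_triv hm a3,
      inner_triv hm a3, fibreInner_clifford a3, conj_phase_eq]
    linear_combination (-phase * fibreInner m p (Φ (Ψ : H) p) (clifford p s (Φ (Ω : H) p))) *
      Complex.I_sq
  · intro s t Ψ
    refine h.eq_of_ae ?_
    change ∀ᵐ p ∂(massShell m), Φ ((L s (L t Ψ) : H) + L t (L s Ψ)) p =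
      Φ (-Complex.I • translationDeriv ρ (bracket s t) (Ψ : H)) p
    filter_upwards [hLC s (L t Ψ), hLC t Ψ, hLC t (L s Ψ), hLC s Ψ,
      coe_add Φ (L s (L t Ψ) : H) (L t (L s Ψ)), h.ae_translationDeriv hm Ψ.2 (bracket s t),
      coe_smul Φ (-Complex.I) (translationDeriv ρ (bracket s t) (Ψ : H))]
      with p a1 a2 a3 a4 a5 a6 a7
    rw [a5, a1, a2, a3, a4, a7, a6, clifford_smul, clifford_smul, ← smul_add, ← smul_add,
      clifford_clifford_add, smul_smul, smul_smul, smul_smul]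
    congr 1
    rw [bracket, dotProduct_smul, smul_eq_mul]
    push_cast
    linear_combination (2 * Complex.I * ((p ⬝ᵥ gamma s t : ℝ) : ℂ)) * phase_sq
  · intro g s Ψ Ω hΩ
    refine h.eq_of_ae ?_
    change ∀ᵐ p ∂(massShell m), Φ (L ((mat g.lin).mulVec s) Ω : H) p = Φ (ρ g (L s Ψ : H)) p
    have q := (measurePreserving_pullback hm g.lin).quasiMeasurePreserving.ae (hLC s Ψ)
    filter_upwards [hLC ((mat g.lin).mulVec s) Ω, h.poincare g (L s Ψ : H), q,
      h.poincare g (Ψ : H)] with p a1 a2 a3 a4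
    rw [a1, a2, a3, hΩ, a4, spinFock_smul, spinFock_clifford, clifford_smul, smul_comm]
  · refine ⟨h.norm_sq, h.surj, fun Ψ => ?_, h.poincare, fun s Ψ => ?_⟩
    · filter_upwards [hP Ψ] with p hp I
      rw [hp]; rfl
    · filter_upwards [hLC s Ψ] with p hp
      change _ • Φ (L s Ψ : H) p = _
      rw [hp, smul_smul, exp_mul_phase, one_smul]

end PreInduced

/-! ### The model on the square-integrable functions -/

section Model

/-- The action of the Poincare group in the trivialization. -/
def modelAct (m : ℝ) (g : Poincare) (f : Covector → FibreE) (p : Covector) : FibreE :=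
  triv m p (exp (-(I * (p ⬝ᵥ g.trans : ℝ))) •
    spinFock g.lin (trivInv m (pullback g.lin p) (f (pullback g.lin p))))

theorem norm_modelAct (hm : 0 < m) (g : Poincare) (f : Covector → FibreE) {p : Covector}
    (hp : OnShell m p) : ‖modelAct m g f p‖ = ‖f (pullback g.lin p)‖ := by
  rw [← pow_left_inj₀ (norm_nonneg _) (norm_nonneg _) two_ne_zero, modelAct, triv_smul, norm_smul,
    show -(I * ((p ⬝ᵥ g.trans : ℝ) : ℂ)) = ((-(p ⬝ᵥ g.trans) : ℝ) : ℂ) * I by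
      push_cast; ring, Complex.norm_exp_ofReal_mul_I, one_mul, norm_triv_sq hm hp,
    fibreNormSq_spinFock, ← norm_triv_sq hm (hp.pullback hm _), triv_trivInv hm]

theorem continuous_spinFock (A : SL2) : Continuous (spinFock A) := by
  unfold spinFock; fun_prop

theorem aestronglyMeasurable_modelAct (hm : 0 < m) (g : Poincare) {f : Covector → FibreE}
    (hf : AEStronglyMeasurable f (massShell m)) :
    AEStronglyMeasurable (modelAct m g f) (massShell m) := by
  have h1 := aestronglyMeasurable_trivInv hm hf
  have h2 := h1.comp_quasiMeasurePreserving
    (measurePreserving_pullback hm g.lin).quasiMeasurePreserving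
  have h3 := (continuous_spinFock g.lin).comp_aestronglyMeasurable h2
  have h4 : Continuous fun p : Covector => exp (-(I * (p ⬝ᵥ g.trans : ℝ))) := by
    unfold dotProduct; fun_prop
  exact aestronglyMeasurable_triv hm (h4.aestronglyMeasurable.smul h3)

theorem eLpNorm_modelAct (hm : 0 < m) (g : Poincare) {f : Covector → FibreE}
    (hf : AEStronglyMeasurable f (massShell m)) :
    eLpNorm (modelAct m g f) 2 (massShell m) = eLpNorm f 2 (massShell m) := by
  rw [← eLpNorm_comp_measurePreserving hf (measurePreserving_pullback hm g.lin)]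
  refine eLpNorm_congr_norm_ae ?_
  filter_upwards [ae_onShell hm] with p hp using norm_modelAct hm g f hp

theorem modelAct_congr (hm : 0 < m) (g : Poincare) {f f' : Covector → FibreE}
    (hf : ∀ᵐ p ∂(massShell m), f p = f' p) :
    ∀ᵐ p ∂(massShell m), modelAct m g f p = modelAct m g f' p := by
  filter_upwards [(measurePreserving_pullback hm g.lin).quasiMeasurePreserving.ae hf] with p hp
  rw [modelAct, hp, modelAct]

theorem modelAct_mul (hm : 0 < m) (g g' : Poincare) (f : Covector → FibreE) (p : Covector) :
    modelAct m (g * g') f p = modelAct m g (modelAct m g' f) p := by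
  simp only [modelAct]
  rw [trivInv_triv hm, spinFock_smul, smul_smul, ← Complex.exp_add, ← spinFock_mul]
  change triv m p (exp (-(I * ((p ⬝ᵥ (g.trans + lorentz g.lin g'.trans) : ℝ) : ℂ))) •
    spinFock (g.lin * g'.lin) (trivInv m (pullback (g.lin * g'.lin) p)
      (f (pullback (g.lin * g'.lin) p)))) = _
  rw [pullback_mul, dotProduct_add, pullback_dotProduct]
  congr 3
  push_cast
  ring

theorem modelAct_one (hm : 0 < m) (f : Covector → FibreE) (p : Covector) :
    modelAct m 1 f p = f p := by
  change triv m p (exp (-(I * ((p ⬝ᵥ (0 : Spacetime) : ℝ) : ℂ))) •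
    spinFock 1 (trivInv m (pullback 1 p) (f (pullback 1 p)))) = _
  rw [pullback_one, spinFock_one, dotProduct_zero]
  simp [triv_trivInv hm]

theorem modelAct_add (hm : 0 < m) (g : Poincare) (f f' : Covector → FibreE) (p : Covector) :
    modelAct m g (f + f') p = modelAct m g f p + modelAct m g f' p := by
  simp only [modelAct, Pi.add_apply, trivInv_add hm, spinFock_add, smul_add, triv_add]

theorem modelAct_smul (hm : 0 < m) (g : Poincare) (c : ℂ) (f : Covector → FibreE) (p : Covector) :
    modelAct m g (c • f) p = c • modelAct m g f p := by
  simp only [modelAct, Pi.smul_apply, trivInv_smul hm, spinFock_smul]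
  rw [smul_comm, triv_smul]

/-- The Hilbert space of the model. -/
abbrev Model (m : ℝ) : Type := Lp FibreE 2 (massShell m)

theorem memLp_modelAct (hm : 0 < m) (g : Poincare) (f : Model m) :
    MemLp (modelAct m g f) 2 (massShell m) :=
  ⟨aestronglyMeasurable_modelAct hm g (Lp.aestronglyMeasurable f), by
    rw [eLpNorm_modelAct hm g (Lp.aestronglyMeasurable f)]; exact Lp.eLpNorm_lt_top f⟩

/-- The action of an element of the Poincare group on the model. -/
def modelIsometry (hm : 0 < m) (g : Poincare) : Model m →ₗᵢ[ℂ] Model m where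
  toFun f := (memLp_modelAct hm g f).toLp _
  map_add' f f' := by
    rw [← MemLp.toLp_add]
    refine MemLp.toLp_congr _ _ ?_
    filter_upwards [modelAct_congr hm g (Lp.coeFn_add f f')] with p hp
    rw [hp, modelAct_add hm]; rfl
  map_smul' c f := by
    rw [RingHom.id_apply, ← MemLp.toLp_const_smul]
    refine MemLp.toLp_congr _ _ ?_
    filter_upwards [modelAct_congr hm g (Lp.coeFn_smul c f)] with p hp
    rw [hp, modelAct_smul hm]; rfl
  norm_map' f := by
    change ‖(memLp_modelAct hm g f).toLp _‖ = _
    rw [Lp.norm_toLp, eLpNorm_modelAct hm g (Lp.aestronglyMeasurable f)]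
    rfl

theorem coe_modelIsometry (hm : 0 < m) (g : Poincare) (f : Model m) :
    ∀ᵐ p ∂(massShell m), modelIsometry hm g f p = modelAct m g f p :=
  (memLp_modelAct hm g f).coeFn_toLp

theorem modelIsometry_mul (hm : 0 < m) (g g' : Poincare) (f : Model m) :
    modelIsometry hm (g * g') f = modelIsometry hm g (modelIsometry hm g' f) := by
  refine Lp.ext ?_
  filter_upwards [coe_modelIsometry hm (g * g') f,
    coe_modelIsometry hm g (modelIsometry hm g' f),
    modelAct_congr hm g (coe_modelIsometry hm g' f)] with p h1 h2 h3
  rw [h1, h2, h3, modelAct_mul hm]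

theorem modelIsometry_one (hm : 0 < m) (f : Model m) : modelIsometry hm 1 f = f := by
  refine Lp.ext ?_
  filter_upwards [coe_modelIsometry hm 1 f] with p h1
  rw [h1, modelAct_one hm]

theorem surjective_modelIsometry (hm : 0 < m) (g : Poincare) :
    Function.Surjective (modelIsometry hm g) := fun f =>
  ⟨modelIsometry hm g⁻¹ f, by rw [← modelIsometry_mul, mul_inv_cancel, modelIsometry_one]⟩

/-- The unitary action of an element of the Poincare group on the model. -/
def modelEquiv (hm : 0 < m) (g : Poincare) : Model m ≃ₗᵢ[ℂ] Model m :=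
  LinearIsometryEquiv.ofSurjective (modelIsometry hm g) (surjective_modelIsometry hm g)

theorem modelEquiv_apply (hm : 0 < m) (g : Poincare) (f : Model m) :
    modelEquiv hm g f = modelIsometry hm g f := by
  exact congrFun (LinearIsometryEquiv.coe_ofSurjective (modelIsometry hm g)
    (surjective_modelIsometry hm g)) f

/-- The induced representation of the Poincare group on the model. -/
def modelRep (hm : 0 < m) : Poincare →* (Model m ≃ₗᵢ[ℂ] Model m) where
  toFun := modelEquiv hm
  map_one' := LinearIsometryEquiv.ext fun f => by
    rw [modelEquiv_apply, modelIsometry_one, LinearIsometryEquiv.coe_one, id]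
  map_mul' g g' := LinearIsometryEquiv.ext fun f => by
    rw [LinearIsometryEquiv.coe_mul, Function.comp_apply, modelEquiv_apply, modelEquiv_apply,
      modelEquiv_apply, modelIsometry_mul]

theorem modelRep_apply (hm : 0 < m) (g : Poincare) (f : Model m) :
    modelRep hm g f = modelIsometry hm g f :=
  modelEquiv_apply hm g f

/-- The sections of the model. -/
def modelSection (hm : 0 < m) : Model m →ₗ[ℂ] AEEqFun Covector Fock (massShell m) where
  toFun f := AEEqFun.mk (fun p => trivInv m p (f p))
    (aestronglyMeasurable_trivInv hm (Lp.aestronglyMeasurable f))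
  map_add' f f' := by
    rw [AEEqFun.mk_add_mk, AEEqFun.mk_eq_mk]
    filter_upwards [Lp.coeFn_add f f'] with p hp
    rw [hp, Pi.add_apply, trivInv_add hm]; rfl
  map_smul' c f := by
    refine AEEqFun.ext ?_
    rw [RingHom.id_apply]
    filter_upwards [AEEqFun.coeFn_mk (fun p => trivInv m p ((c • f : Model m) p))
        (aestronglyMeasurable_trivInv hm (Lp.aestronglyMeasurable (c • f))),
      AEEqFun.coeFn_mk (fun p => trivInv m p (f p))
        (aestronglyMeasurable_trivInv hm (Lp.aestronglyMeasurable f)),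
      AEEqFun.coeFn_smul c (AEEqFun.mk (fun p => trivInv m p (f p))
        (aestronglyMeasurable_trivInv hm (Lp.aestronglyMeasurable f))), Lp.coeFn_smul c f]
      with p h1 h2 h3 hp
    rw [h1, h3, Pi.smul_apply, h2, hp, Pi.smul_apply, trivInv_smul hm]

theorem coe_modelSection (hm : 0 < m) (f : Model m) :
    ∀ᵐ p ∂(massShell m), modelSection hm f p = trivInv m p (f p) :=
  AEEqFun.coeFn_mk _ _

theorem preInduced_model (hm : 0 < m) : PreInduced m (modelRep hm) (modelSection hm) where
  norm_sq f := by
    have h1 : ENNReal.ofReal (‖f‖ ^ 2) = eLpNorm f 2 (massShell m) ^ 2 := by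
      rw [Lp.norm_def, ENNReal.ofReal_pow ENNReal.toReal_nonneg,
        ENNReal.ofReal_toReal (Lp.eLpNorm_ne_top f)]
    rw [h1, lintegral_fibreNormSq hm, eLpNorm_two_sq]
    refine lintegral_congr_ae ?_
    filter_upwards [coe_modelSection hm f] with p hp
    rw [hp, triv_trivInv hm]
  surj w hw := by
    rw [lintegral_fibreNormSq hm, ← eLpNorm_two_sq] at hw
    have hM : MemLp (fun p => triv m p (w p)) 2 (massShell m) :=
      ⟨aestronglyMeasurable_triv hm w.aestronglyMeasurable, by
        by_contra hne
        rw [not_lt, top_le_iff] at hne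
        rw [hne] at hw
        simp at hw⟩
    refine ⟨hM.toLp _, AEEqFun.ext ?_⟩
    filter_upwards [coe_modelSection hm (hM.toLp _), hM.coeFn_toLp] with p h1 h2
    rw [h1, h2, trivInv_triv hm]
  poincare g f := by
    have q := (measurePreserving_pullback hm g.lin).quasiMeasurePreserving.ae (coe_modelSection hm f)
    filter_upwards [coe_modelSection hm (modelRep hm g f), coe_modelIsometry hm g f, q]
      with p h1 h2 h3
    rw [h1, modelRep_apply, h2, modelAct, trivInv_triv hm, h3]

/-- The unitary representation of mass `m` and superspin `0` exists. -/
theorem exists_isInduced (hm : 0 < m) :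
    ∃ (H : Type) (_ : NormedAddCommGroup H) (_ : InnerProductSpace ℂ H) (_ : CompleteSpace H)
      (R : SuperUnitaryRep H) (Φ : H →ₗ[ℂ] AEEqFun Covector Fock (massShell m)),
      IsInduced m R Φ := by
  obtain ⟨R, hR⟩ := (preInduced_model hm).exists_superUnitaryRep hm
  exact ⟨Model m, inferInstance, inferInstance, inferInstance, R, modelSection hm, hR⟩

end Model

end SuperPoincare

namespace SuperPoincare
open Complex (I exp)
open MeasureTheory

/-! ### Fourier integrals of smooth vectors -/

variable {m : ℝ}

theorem mass_sq_mul_le_gamma {p : Covector} (h : OnShell m p) (χ : Spinor) :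
    m ^ 2 * (‖χ 0‖ ^ 2 + ‖χ 1‖ ^ 2) ≤ p 0 * (p ⬝ᵥ gamma χ χ) := by
  have e : p 0 * (p ⬝ᵥ gamma χ χ) = m ^ 2 * (‖χ 0‖ ^ 2 + ‖χ 1‖ ^ 2) +
      (‖slashUp p 0 0 * χ 0 + slashUp p 1 0 * χ 1‖ ^ 2 +
        ‖slashUp p 0 1 * χ 0 + slashUp p 1 1 * χ 1‖ ^ 2) := by
    have hs := h.sq
    rw [dotProduct_gamma]
    simp only [Fin.sum_univ_two, ← Complex.normSq_eq_norm_sq, Complex.normSq_apply, slashUp_00,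
      slashUp_01, slashUp_10, slashUp_11, Complex.add_re, Complex.mul_re, Complex.add_im,
      Complex.mul_im, Complex.sub_re, Complex.sub_im, Complex.ofReal_re, Complex.ofReal_im,
      Complex.I_re, Complex.I_im, Complex.conj_re, Complex.conj_im]
    linear_combination ((χ 0).re ^ 2 + (χ 0).im ^ 2 + (χ 1).re ^ 2 + (χ 1).im ^ 2) * hs
  rw [e]
  linarith [sq_nonneg ‖slashUp p 0 0 * χ 0 + slashUp p 1 0 * χ 1‖,
    sq_nonneg ‖slashUp p 0 1 * χ 0 + slashUp p 1 1 * χ 1‖]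

/-- A constant with `‖w‖ ≤ fockConst m * p 0 * ‖triv m p w‖` on the mass shell. -/
def fockConst (m : ℝ) : ℝ := √((m ^ 2)⁻¹ + (m ^ 3)⁻¹ + (m ^ 4)⁻¹)

theorem norm_fock_le (hm : 0 < m) {p : Covector} (h : OnShell m p) (w : Fock) :
    ‖w‖ ≤ fockConst m * p 0 * ‖triv m p w‖ := by
  have h0 := h.pos hm
  have hl := h.le_zero
  have hC : 0 ≤ fockConst m := Real.sqrt_nonneg _
  have hg := h.gamma_nonneg hm (fun a => w {a})
  have hχ := mass_sq_mul_le_gamma h (fun a => w {a})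
  set G := p ⬝ᵥ gamma (fun a => w {a}) (fun a => w {a})
  have hN : ‖triv m p w‖ ^ 2 = ‖w ∅‖ ^ 2 + G + 4 * m ^ 2 * ‖w Finset.univ‖ ^ 2 :=
    norm_triv_sq hm h w
  rw [pi_norm_le_iff_of_nonneg (by positivity)]
  have key : ∀ I, ∃ c, 0 ≤ c ∧ c ≤ (m ^ 2)⁻¹ + (m ^ 3)⁻¹ + (m ^ 4)⁻¹ ∧
      ‖w I‖ ^ 2 ≤ c * p 0 ^ 2 * ‖triv m p w‖ ^ 2 := by
    have hs : ∀ a, ‖w {a}‖ ^ 2 ≤ (m ^ 3)⁻¹ * p 0 ^ 2 * ‖triv m p w‖ ^ 2 := by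
      intro a
      have h1 : m ^ 2 * ‖w {a}‖ ^ 2 ≤ p 0 * ‖triv m p w‖ ^ 2 := by
        refine le_trans ?_ (hχ.trans (mul_le_mul_of_nonneg_left ?_ h0.le))
        · refine mul_le_mul_of_nonneg_left ?_ (sq_nonneg m)
          fin_cases a
          · exact le_add_of_nonneg_right (sq_nonneg _)
          · exact le_add_of_nonneg_left (sq_nonneg _)
        · rw [hN]
          have : 0 ≤ 4 * m ^ 2 * ‖w Finset.univ‖ ^ 2 := by positivity
          linarith [sq_nonneg ‖w ∅‖]
      have h2 : m ^ 3 * ‖w {a}‖ ^ 2 ≤ p 0 ^ 2 * ‖triv m p w‖ ^ 2 := by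
        calc m ^ 3 * ‖w {a}‖ ^ 2 = m * (m ^ 2 * ‖w {a}‖ ^ 2) := by ring
          _ ≤ p 0 * (p 0 * ‖triv m p w‖ ^ 2) := by gcongr
          _ = _ := by ring
      rw [mul_assoc, inv_mul_eq_div, le_div_iff₀ (by positivity)]
      linarith
    have e1 : (0 : ℝ) ≤ (m ^ 2)⁻¹ := by positivity
    have e2 : (0 : ℝ) ≤ (m ^ 3)⁻¹ := by positivity
    have e3 : (0 : ℝ) ≤ (m ^ 4)⁻¹ := by positivity
    have hsq : m ^ 2 ≤ p 0 ^ 2 := by gcongr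
    intro I
    rcases finset_fin_two_cases I with rfl | rfl | rfl | rfl
    · refine ⟨(m ^ 2)⁻¹, e1, by linarith, ?_⟩
      rw [mul_assoc, inv_mul_eq_div, le_div_iff₀ (by positivity)]
      have : ‖w ∅‖ ^ 2 ≤ ‖triv m p w‖ ^ 2 := by
        rw [hN]
        have : 0 ≤ 4 * m ^ 2 * ‖w Finset.univ‖ ^ 2 := by positivity
        linarith
      calc ‖w ∅‖ ^ 2 * m ^ 2 ≤ ‖triv m p w‖ ^ 2 * p 0 ^ 2 := by gcongr
        _ = _ := by ring
    · exact ⟨_, e2, by linarith, hs 0⟩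
    · exact ⟨_, e2, by linarith, hs 1⟩
    · refine ⟨(m ^ 4)⁻¹, e3, by linarith, ?_⟩
      rw [mul_assoc, inv_mul_eq_div, le_div_iff₀ (by positivity)]
      have : m ^ 2 * ‖w Finset.univ‖ ^ 2 ≤ ‖triv m p w‖ ^ 2 := by
        rw [hN]
        have : 0 ≤ m ^ 2 * ‖w Finset.univ‖ ^ 2 := by positivity
        linarith [sq_nonneg ‖w ∅‖]
      calc ‖w Finset.univ‖ ^ 2 * m ^ 4 = m ^ 2 * (m ^ 2 * ‖w Finset.univ‖ ^ 2) := by ring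
        _ ≤ p 0 ^ 2 * ‖triv m p w‖ ^ 2 := by gcongr
  intro I
  obtain ⟨c, hc, hc', hI⟩ := key I
  rw [← pow_le_pow_iff_left₀ (norm_nonneg _) (by positivity) two_ne_zero, mul_pow, mul_pow,
    fockConst, Real.sq_sqrt (hc.trans hc')]
  exact hI.trans (by gcongr)

section Moments

variable {H : Type*} [NormedAddCommGroup H] [InnerProductSpace ℂ H]
  {ρ : Poincare →* (H ≃ₗᵢ[ℂ] H)} {Φ : H →ₗ[ℂ] AEEqFun Covector Fock (massShell m)}

/-- The energy and momentum operators on smooth vectors. -/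
def momOp (ρ : Poincare →* (H ≃ₗᵢ[ℂ] H)) (μ : Fin 4) (Ψ : H) : H :=
  I • translationDeriv ρ (basisVec μ) Ψ

theorem momOp_mem {Ψ : H} (hΨ : Ψ ∈ smoothVectors ρ) (μ : Fin 4) : momOp ρ μ Ψ ∈ smoothVectors ρ :=
  Submodule.smul_mem _ _ (translationDeriv_mem hΨ _)

/-- The Fourier integral at `x` of the section `p ↦ p_0⁻ⁿ (Φ Ψ)(p)`. -/
def moment (Φ : H →ₗ[ℂ] AEEqFun Covector Fock (massShell m)) (n : ℕ) (x : Spacetime) (Ψ : H) :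
    Fock :=
  ∫ p, exp (I * (p ⬝ᵥ x : ℝ)) • ((p 0 : ℂ) ^ n)⁻¹ • Φ Ψ p ∂(massShell m)

theorem moment_congr {Ψ Ω : H} (n : ℕ) (x : Spacetime) {c : ℂ}
    (he : ∀ᵐ p ∂(massShell m), Φ Ψ p = c • Φ Ω p) : moment Φ n x Ψ = c • moment Φ n x Ω := by
  rw [moment, moment, ← integral_smul]
  refine integral_congr_ae ?_
  filter_upwards [he] with p hp
  rw [hp, smul_comm _ c, smul_comm _ c]

theorem norm_expI (r : ℝ) : ‖exp (I * (r : ℂ))‖ = 1 := by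
  rw [mul_comm, Complex.norm_exp_ofReal_mul_I]

theorem integrable_expI_smul {x : Spacetime} {g : Covector → Fock}
    (hg : Integrable g (massShell m)) :
    Integrable (fun p => exp (I * (p ⬝ᵥ x : ℝ)) • g p) (massShell m) := by
  refine hg.bdd_smul 1 ?_ (Filter.Eventually.of_forall fun p => (norm_expI _).le)
  refine Continuous.aestronglyMeasurable ?_
  unfold dotProduct
  fun_prop

namespace PreInduced

variable (h : PreInduced m ρ Φ) (hm : 0 < m)
include h

theorem moment_eq (n : ℕ) (x : Spacetime) (Ψ : H) : moment Φ n x Ψ =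
    ∫ p, ((p 0 : ℂ) ^ n)⁻¹ • Φ (ρ ⟨-x, 1⟩ Ψ) p ∂(massShell m) := by
  refine integral_congr_ae ?_
  filter_upwards [h.ae_translate (-x) Ψ] with p hp
  rw [hp, smul_comm, dotProduct_neg]
  push_cast
  rw [mul_neg, neg_neg]

include hm

theorem ae_momOp {Ψ : H} (hΨ : Ψ ∈ smoothVectors ρ) (μ : Fin 4) : ∀ᵐ p ∂(massShell m),
    Φ (momOp ρ μ Ψ) p = (p μ : ℂ) • Φ Ψ p := by
  filter_upwards [h.ae_translationDeriv hm hΨ (basisVec μ),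
    coe_smul Φ I (translationDeriv ρ (basisVec μ) Ψ)] with p h1 h2
  rw [momOp, h2, h1, smul_smul, show p ⬝ᵥ basisVec μ = p μ by simp [basisVec]]
  congr 1
  linear_combination (-(p μ : ℂ)) * Complex.I_sq

theorem exists_moment (n : ℕ) : ∃ L : H →L[ℂ] Fock, ∀ Ψ,
    Integrable (fun p => ((p 0 : ℂ) ^ (n + 3))⁻¹ • Φ Ψ p) (massShell m) ∧
      L Ψ = ∫ p, ((p 0 : ℂ) ^ (n + 3))⁻¹ • Φ Ψ p ∂(massShell m) := by
  have hC : 0 ≤ fockConst m := Real.sqrt_nonneg _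
  have key := h.integral_norm_fibre_le hm
    (fun p => ((((energy m (spatial p)) ^ (n + 3))⁻¹ : ℝ) : ℂ) • (LinearMap.id : Fock →ₗ[ℂ] Fock))
    (by
      have h1 : Continuous fun x : Covector × Fock =>
          ((((energy m (spatial x.1)) ^ (n + 3))⁻¹ : ℝ) : ℂ) :=
        Complex.continuous_ofReal.comp ((((continuous_energy hm).comp
          (spatial.continuous.comp continuous_fst)).pow _).inv₀
            fun x => (pow_pos (energy_pos hm _) _).ne')
      exact h1.smul continuous_snd)
    (fockConst m * (m ^ n)⁻¹) (fun p hp w => by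
      have h0 := hp.pos hm
      rw [LinearMap.smul_apply, LinearMap.id_apply, norm_smul, Complex.norm_real, ← hp,
        Real.norm_of_nonneg (by positivity)]
      calc (p 0 ^ (n + 3))⁻¹ * ‖w‖ ≤ (p 0 ^ (n + 3))⁻¹ * (fockConst m * p 0 * ‖triv m p w‖) := by
            gcongr; exact norm_fock_le hm hp w
        _ = fockConst m * (p 0 ^ n)⁻¹ * (p 0 ^ 2)⁻¹ * ‖triv m p w‖ := by
            field_simp
            ring
        _ ≤ fockConst m * (m ^ n)⁻¹ * (p 0 ^ 2)⁻¹ * ‖triv m p w‖ := by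
            gcongr; exact hp.le_zero)
  have hae : ∀ Ψ, (fun p => ((((energy m (spatial p)) ^ (n + 3))⁻¹ : ℝ) : ℂ) • Φ Ψ p)
      =ᵐ[massShell m] fun p => ((p 0 : ℂ) ^ (n + 3))⁻¹ • Φ Ψ p := fun Ψ => by
    filter_upwards [ae_onShell hm] with p hp
    rw [← hp]; push_cast; rfl
  have hI : ∀ Ψ, Integrable (fun p => ((p 0 : ℂ) ^ (n + 3))⁻¹ • Φ Ψ p) (massShell m) := fun Ψ =>
    (integrable_congr (hae Ψ)).1 (key Ψ).1
  refine ⟨LinearMap.mkContinuous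
    { toFun := fun Ψ => ∫ p, ((p 0 : ℂ) ^ (n + 3))⁻¹ • Φ Ψ p ∂(massShell m)
      map_add' := fun Ψ Ω => by
        rw [← integral_add (hI Ψ) (hI Ω)]
        refine integral_congr_ae ?_
        filter_upwards [coe_add Φ Ψ Ω] with p hp
        rw [hp, smul_add]
      map_smul' := fun c Ψ => by
        rw [RingHom.id_apply, ← integral_smul]
        refine integral_congr_ae ?_
        filter_upwards [coe_smul Φ c Ψ] with p hp
        rw [hp, smul_comm] } (shellConst m * (fockConst m * (m ^ n)⁻¹)) fun Ψ => ?_,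
    fun Ψ => ⟨hI Ψ, rfl⟩⟩
  refine (norm_integral_le_integral_norm _).trans ((le_of_eq ?_).trans (key Ψ).2)
  refine integral_congr_ae ?_
  filter_upwards [hae Ψ] with p hp
  rw [← hp]; rfl

theorem integrable_moment {Ψ : H} (hΨ : Ψ ∈ smoothVectors ρ) (n : ℕ) :
    Integrable (fun p => ((p 0 : ℂ) ^ n)⁻¹ • Φ Ψ p) (massShell m) := by
  have step : ∀ n, (∀ Ψ ∈ smoothVectors ρ,
      Integrable (fun p => ((p 0 : ℂ) ^ (n + 1))⁻¹ • Φ Ψ p) (massShell m)) →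
      ∀ Ψ ∈ smoothVectors ρ, Integrable (fun p => ((p 0 : ℂ) ^ n)⁻¹ • Φ Ψ p) (massShell m) := by
    intro n hn Ψ hΨ
    refine (hn _ (momOp_mem hΨ 0)).congr ?_
    filter_upwards [h.ae_momOp hm hΨ 0, ae_onShell hm] with p h1 h2
    have h0 : (p 0 : ℂ) ≠ 0 := by exact_mod_cast (h2.pos hm).ne'
    rw [h1, smul_smul]
    congr 1
    field_simp
    ring
  obtain ⟨L, hL⟩ := h.exists_moment hm n
  exact step n (step (n + 1) (step (n + 2) fun Ψ _ => (hL Ψ).1)) Ψ hΨ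

theorem integrable_section {Ψ : H} (hΨ : Ψ ∈ smoothVectors ρ) : Integrable (Φ Ψ) (massShell m) := by
  simpa using h.integrable_moment hm hΨ 0

theorem moment_succ {Ψ : H} (hΨ : Ψ ∈ smoothVectors ρ) (n : ℕ) (x : Spacetime) :
    moment Φ (n + 1) x (momOp ρ 0 Ψ) = moment Φ n x Ψ := by
  refine integral_congr_ae ?_
  filter_upwards [h.ae_momOp hm hΨ 0, ae_onShell hm] with p h1 h2
  have h0 : (p 0 : ℂ) ≠ 0 := by exact_mod_cast (h2.pos hm).ne'
  rw [h1, smul_smul ((p 0 : ℂ) ^ (n + 1))⁻¹]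
  congr 2
  field_simp
  ring

/-- Smoothness and derivatives of the Fourier integrals. -/
theorem contDiff_moment_and {Ψ : H} (hΨ : Ψ ∈ smoothVectors ρ) (n : ℕ) :
    ContDiff ℝ ∞ (fun x => moment Φ n x Ψ) ∧ ∀ μ x,
      partialX μ (fun x => moment Φ n x Ψ) x = I • moment Φ n x (momOp ρ μ Ψ) := by
  have aux : ∀ n, ∀ Ψ ∈ smoothVectors ρ, ContDiff ℝ ∞ (fun x => moment Φ (n + 3) x Ψ) ∧ ∀ μ x,
      partialX μ (fun x => moment Φ (n + 3) x Ψ) x =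
        I • moment Φ (n + 3) x (momOp ρ μ Ψ) := by
    intro n Ψ hΨ
    obtain ⟨L, hL⟩ := h.exists_moment hm n
    have e : ∀ Ψ, (fun x => moment Φ (n + 3) x Ψ) = fun x => L (ρ ⟨-x, 1⟩ Ψ) := fun Ψ =>
      funext fun x => by rw [h.moment_eq, (hL _).2]
    have hd : ContDiff ℝ ∞ fun x : Spacetime => ρ ⟨-x, 1⟩ Ψ :=
      (contDiff_translate hΨ).comp contDiff_neg
    have hc : ContDiff ℝ ∞ (fun x => L (ρ ⟨-x, 1⟩ Ψ)) := (L.restrictScalars ℝ).contDiff.comp hd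
    refine ⟨e Ψ ▸ hc, fun μ x => ?_⟩
    rw [congrFun (e (momOp ρ μ Ψ)) x, e Ψ, partialX]
    have h1 : HasFDerivAt (fun x : Spacetime => ρ ⟨-x, 1⟩ Ψ)
        ((fderiv ℝ (fun x : Spacetime => ρ ⟨x, 1⟩ Ψ) (-x)).comp
          (-ContinuousLinearMap.id ℝ Spacetime)) x :=
      HasFDerivAt.comp x (((contDiff_translate hΨ).differentiable (by simp)) (-x)).hasFDerivAt
        (hasFDerivAt_id x).neg
    have h2 := ((L.restrictScalars ℝ).hasFDerivAt.comp x h1).fderiv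
    have h3 := congrArg (fun l => l (basisVec μ)) h2
    refine h3.trans ?_
    change L (fderiv ℝ (fun x : Spacetime => ρ ⟨x, 1⟩ Ψ) (-x) (-basisVec μ)) = _
    rw [map_neg, fderiv_translate hΨ, momOp, map_smul, map_smul, smul_smul, Complex.I_mul_I,
      neg_one_smul, map_neg]
  have step : ∀ n, (∀ Ψ ∈ smoothVectors ρ, ContDiff ℝ ∞ (fun x => moment Φ (n + 1) x Ψ) ∧ ∀ μ x,
      partialX μ (fun x => moment Φ (n + 1) x Ψ) x =
        I • moment Φ (n + 1) x (momOp ρ μ Ψ)) →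
      ∀ Ψ ∈ smoothVectors ρ, ContDiff ℝ ∞ (fun x => moment Φ n x Ψ) ∧ ∀ μ x,
      partialX μ (fun x => moment Φ n x Ψ) x = I • moment Φ n x (momOp ρ μ Ψ) := by
    intro n hn Ψ hΨ
    have e : (fun x => moment Φ n x Ψ) = fun x => moment Φ (n + 1) x (momOp ρ 0 Ψ) :=
      funext fun x => (h.moment_succ hm hΨ n x).symm
    rw [e]
    refine ⟨(hn _ (momOp_mem hΨ 0)).1, fun μ x => ?_⟩
    rw [(hn _ (momOp_mem hΨ 0)).2, ← h.moment_succ hm (momOp_mem hΨ μ)]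
    congr 1
    refine integral_congr_ae ?_
    filter_upwards [h.ae_momOp hm (momOp_mem hΨ 0) μ, h.ae_momOp hm (momOp_mem hΨ μ) 0,
      h.ae_momOp hm hΨ 0, h.ae_momOp hm hΨ μ] with p h1 h2 h3 h4
    rw [h1, h2, h3, h4, smul_comm (p μ : ℂ)]
  exact step n (step (n + 1) (step (n + 2) (aux n))) Ψ hΨ

end PreInduced

end Moments

end SuperPoincare

namespace SuperPoincare
open Complex (I exp)
open MeasureTheory

/-! ### Boosts and the decay of Fourier integrals -/

variable {m : ℝ}

/-- The boost of rapidity `t` along the `j`-th spatial axis. -/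
def boost (j : Fin 3) (t : ℝ) : SL2 :=
  ⟨(Real.cosh (t / 2) : ℂ) • 1 + (Real.sinh (t / 2) : ℂ) • toHerm (basisVec j.succ), by
    have h : ((Real.cosh (t / 2) : ℝ) : ℂ) ^ 2 = ((Real.sinh (t / 2) : ℝ) : ℂ) ^ 2 + 1 := by
      exact_mod_cast Real.cosh_sq (t / 2)
    generalize Real.cosh (t / 2) = c at h ⊢
    generalize Real.sinh (t / 2) = s at h ⊢
    rw [Matrix.det_fin_two]
    fin_cases j <;> simp [toHerm, basisVec]
    · linear_combination h
    · linear_combination h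
    · linear_combination h + (s : ℂ) ^ 2 * Complex.I_sq⟩

theorem mat_boost (j : Fin 3) (t : ℝ) : mat (boost j t) =
    (Real.cosh (t / 2) : ℂ) • 1 + (Real.sinh (t / 2) : ℂ) • toHerm (basisVec j.succ) := rfl

theorem boost_zero (j : Fin 3) : boost j 0 = 1 := by
  apply Subtype.ext
  change mat (boost j 0) = 1
  rw [mat_boost]
  simp

theorem contDiff_boost (j : Fin 3) (a b : Fin 2) : ContDiff ℝ ∞ fun t => mat (boost j t) a b := by
  have hc : ContDiff ℝ ∞ fun t : ℝ => ((Real.cosh (t / 2) : ℝ) : ℂ) :=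
    Complex.ofRealCLM.contDiff.comp (Real.contDiff_cosh.comp (contDiff_id.div_const 2))
  have hs : ContDiff ℝ ∞ fun t : ℝ => ((Real.sinh (t / 2) : ℝ) : ℂ) :=
    Complex.ofRealCLM.contDiff.comp (Real.contDiff_sinh.comp (contDiff_id.div_const 2))
  simp only [mat_boost, Matrix.add_apply, Matrix.smul_apply, smul_eq_mul]
  exact (hc.mul contDiff_const).add (hs.mul contDiff_const)

theorem lorentz_boost (j : Fin 3) (t : ℝ) (x : Spacetime) : lorentz (boost j t) x =
    x + (Real.cosh t - 1) • (x 0 • basisVec 0 + x j.succ • basisVec j.succ) +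
      Real.sinh t • (x j.succ • basisVec 0 + x 0 • basisVec j.succ) := by
  have h1 : Real.cosh t = Real.cosh (t / 2) ^ 2 + Real.sinh (t / 2) ^ 2 := by
    rw [← Real.cosh_two_mul]; ring_nf
  have h2 : Real.sinh t = 2 * Real.sinh (t / 2) * Real.cosh (t / 2) := by
    rw [← Real.sinh_two_mul]; ring_nf
  have h3 : Real.cosh (t / 2) ^ 2 = Real.sinh (t / 2) ^ 2 + 1 := Real.cosh_sq (t / 2)
  rw [h1, h2, lorentz]
  change ofHerm (mat (boost j t) * toHerm x * (mat (boost j t)).conjTranspose) = _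
  rw [mat_boost]
  generalize Real.cosh (t / 2) = c at h3 ⊢
  generalize Real.sinh (t / 2) = s at h3 ⊢
  clear h1 h2
  funext i
  fin_cases j <;> fin_cases i <;>
    simp [ofHerm, toHerm, basisVec, Matrix.mul_apply, Fin.sum_univ_two, Matrix.one_apply] <;>
    first
      | ring1
      | linear_combination x 1 * h3
      | linear_combination x 2 * h3
      | linear_combination x 3 * h3

theorem lorentz_boost_inv (j : Fin 3) (t : ℝ) : lorentz (boost j t)⁻¹ (basisVec 0) =
    Real.cosh t • basisVec 0 - Real.sinh t • basisVec j.succ := by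
  have h := Real.cosh_sq t
  have e : lorentz (boost j t) (Real.cosh t • basisVec 0 - Real.sinh t • basisVec j.succ) =
      basisVec 0 := by
    rw [lorentz_boost]
    funext i
    fin_cases j <;> fin_cases i <;> simp [basisVec] <;> nlinarith [h]
  rw [← e, lorentz_inv_lorentz, e]


theorem hasDerivAt_lorentz_boost (j : Fin 3) (x : Spacetime) :
    HasDerivAt (fun t => lorentz (boost j t) x)
      (x j.succ • basisVec 0 + x 0 • basisVec j.succ) 0 := by
  simp only [lorentz_boost]
  have h1 : HasDerivAt (fun t => Real.cosh t - 1) 0 0 := by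
    simpa using (Real.hasDerivAt_cosh 0).sub_const 1
  have h2 : HasDerivAt Real.sinh 1 0 := by simpa using Real.hasDerivAt_sinh 0
  have := ((h1.smul_const (x 0 • basisVec 0 + x j.succ • basisVec j.succ)).const_add x).add
    (h2.smul_const (x j.succ • basisVec 0 + x 0 • basisVec j.succ))
  exact this.congr_deriv (by simp)

/-- The energy of a boosted covector. -/
def boostEnergy (j : Fin 3) (p : Covector) (t : ℝ) : ℝ := Real.cosh t * p 0 - Real.sinh t * p j.succ

theorem pullback_boost_inv_zero (j : Fin 3) (t : ℝ) (p : Covector) :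
    pullback (boost j t)⁻¹ p 0 = boostEnergy j p t := by
  rw [pullback, lorentz_boost_inv, dotProduct_sub, dotProduct_smul, dotProduct_smul]
  simp [basisVec, boostEnergy]

theorem boostEnergy_zero (j : Fin 3) (p : Covector) : boostEnergy j p 0 = p 0 := by
  simp [boostEnergy]

theorem hasDerivAt_boostEnergy (j : Fin 3) (p : Covector) (t : ℝ) :
    HasDerivAt (boostEnergy j p) (Real.sinh t * p 0 - Real.cosh t * p j.succ) t :=
  ((Real.hasDerivAt_cosh t).mul_const _).sub ((Real.hasDerivAt_sinh t).mul_const _)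

theorem abs_deriv_boostEnergy_le (hm : 0 < m) (j : Fin 3) {p : Covector} (hp : OnShell m p) (t : ℝ) :
    |Real.sinh t * p 0 - Real.cosh t * p j.succ| ≤ boostEnergy j p t := by
  have h1 := abs_le.1 (hp.abs_le hm j.succ)
  have e1 : 0 < Real.cosh t - Real.sinh t := by rw [Real.cosh_sub_sinh]; exact Real.exp_pos _
  have e2 : 0 < Real.cosh t + Real.sinh t := by rw [Real.cosh_add_sinh]; exact Real.exp_pos _
  rw [abs_le, boostEnergy]
  constructor <;> nlinarith

theorem le_boostEnergy (hm : 0 < m) (j : Fin 3) {p : Covector} (hp : OnShell m p) {t : ℝ}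
    (ht : |t| ≤ 1) : Real.exp (-1) * p 0 ≤ boostEnergy j p t := by
  have h1 := abs_le.1 (hp.abs_le hm j.succ)
  have ht' := abs_le.1 ht
  have e1 : Real.exp (-1) ≤ Real.cosh t - Real.sinh t := by
    rw [Real.cosh_sub_sinh]; exact Real.exp_le_exp.2 (by linarith)
  have e2 : Real.exp (-1) ≤ Real.cosh t + Real.sinh t := by
    rw [Real.cosh_add_sinh]; exact Real.exp_le_exp.2 (by linarith)
  rw [boostEnergy]
  nlinarith

theorem hasDerivAt_integral_boostEnergy (hm : 0 < m) (j : Fin 3) (N : ℕ) {w : Covector → Fock}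
    (hw : Integrable (fun p => ((p 0 : ℂ) ^ N)⁻¹ • w p) (massShell m))
    (hw' : AEStronglyMeasurable w (massShell m)) :
    HasDerivAt (fun t => ∫ p, (((boostEnergy j p t : ℝ) : ℂ) ^ N)⁻¹ • w p ∂(massShell m))
      (∫ p, ((N : ℂ) * p j.succ * ((p 0 : ℂ) ^ (N + 1))⁻¹) • w p ∂(massShell m)) 0 := by
  have hmeas : ∀ t, AEStronglyMeasurable
      (fun p => (((boostEnergy j p t : ℝ) : ℂ) ^ N)⁻¹ • w p) (massShell m) := fun t => by
    have h1 : Measurable fun p : Covector => (((boostEnergy j p t : ℝ) : ℂ) ^ N)⁻¹ := by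
      unfold boostEnergy
      fun_prop
    exact h1.aestronglyMeasurable.smul hw'
  have key := hasDerivAt_integral_of_dominated_loc_of_deriv_le (μ := massShell m) (𝕜 := ℝ)
    (F := fun t p => (((boostEnergy j p t : ℝ) : ℂ) ^ N)⁻¹ • w p)
    (F' := fun t p => (-((N : ℂ) * ((boostEnergy j p t : ℝ) : ℂ) ^ (N - 1) *
      ((Real.sinh t * p 0 - Real.cosh t * p j.succ : ℝ) : ℂ)) /
        (((boostEnergy j p t : ℝ) : ℂ) ^ N) ^ 2) • w p)
    (x₀ := 0) (s := Metric.ball 0 1)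
    (bound := fun p => N * Real.exp 1 ^ N * ‖((p 0 : ℂ) ^ N)⁻¹ • w p‖)
    (Metric.ball_mem_nhds 0 one_pos) (Filter.Eventually.of_forall hmeas) ?_ ?_ ?_ ?_ ?_
  · refine key.2.congr_deriv (integral_congr_ae ?_)
    filter_upwards [ae_onShell hm] with p hp
    have h0 : (p 0 : ℂ) ≠ 0 := by exact_mod_cast (hp.pos hm).ne'
    congr 1
    rw [boostEnergy_zero]
    rcases N with _ | N
    · simp
    · simp only [Real.sinh_zero, Real.cosh_zero, zero_mul, one_mul, zero_sub, Nat.add_sub_cancel]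
      push_cast
      field_simp
      ring
  · simpa only [boostEnergy_zero] using hw
  · have h1 : Measurable fun p : Covector => (-((N : ℂ) * ((boostEnergy j p 0 : ℝ) : ℂ) ^ (N - 1) *
      ((Real.sinh 0 * p 0 - Real.cosh 0 * p j.succ : ℝ) : ℂ)) /
        (((boostEnergy j p 0 : ℝ) : ℂ) ^ N) ^ 2) := by
      unfold boostEnergy
      fun_prop
    exact h1.aestronglyMeasurable.smul hw'
  · filter_upwards [ae_onShell hm] with p hp t ht
    have h0 := hp.pos hm
    have hq := le_boostEnergy hm j hp (t := t) (by simpa using (mem_ball_zero_iff.1 ht).le)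
    have hd := abs_deriv_boostEnergy_le hm j hp t
    have hq0 : 0 < boostEnergy j p t := lt_of_lt_of_le (by positivity) hq
    rw [norm_smul, norm_smul, ← mul_assoc]
    refine mul_le_mul_of_nonneg_right ?_ (norm_nonneg _)
    rw [norm_div, norm_neg, norm_mul, norm_mul, norm_pow, norm_pow, norm_pow, norm_inv, norm_pow,
      Complex.norm_real, Complex.norm_real, Complex.norm_real, Complex.norm_natCast,
      Real.norm_of_nonneg hq0.le, Real.norm_of_nonneg h0.le, Real.norm_eq_abs]
    rcases N with _ | N
    · simp
    · rw [Nat.add_sub_cancel]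
      calc ((N + 1 : ℕ) : ℝ) * boostEnergy j p t ^ N * |Real.sinh t * p 0 - Real.cosh t * p j.succ| /
            (boostEnergy j p t ^ (N + 1)) ^ 2
          ≤ ((N + 1 : ℕ) : ℝ) * boostEnergy j p t ^ N * boostEnergy j p t /
            (boostEnergy j p t ^ (N + 1)) ^ 2 := by gcongr
        _ = ((N + 1 : ℕ) : ℝ) * (boostEnergy j p t ^ (N + 1))⁻¹ := by
            field_simp
            ring
        _ ≤ ((N + 1 : ℕ) : ℝ) * ((Real.exp (-1) * p 0) ^ (N + 1))⁻¹ := by gcongr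
        _ = _ := by
            rw [mul_pow, mul_inv, ← inv_pow, ← Real.exp_neg, neg_neg, mul_assoc]
  · exact hw.norm.const_mul _
  · filter_upwards [ae_onShell hm] with p hp t ht
    have hq := le_boostEnergy hm j hp (t := t) (by simpa using (mem_ball_zero_iff.1 ht).le)
    have hq0 : 0 < boostEnergy j p t := lt_of_lt_of_le (mul_pos (Real.exp_pos _) (hp.pos hm)) hq
    have h1 := ((hasDerivAt_boostEnergy j p t).ofReal_comp.pow N).inv
      (pow_ne_zero N (Complex.ofReal_ne_zero.2 hq0.ne'))
    exact h1.smul_const (w p)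

/-- The operator norm bound for the generator of the boosts in the spin representation. -/
theorem spinFock_boost_deriv (j : Fin 3) : ∃ S : Fock →ₗ[ℂ] Fock, ∀ (v : ℝ → Fock) (v' : Fock),
    HasDerivAt v v' 0 → HasDerivAt (fun t => spinFock (boost j t) (v t)) (S (v 0) + v') 0 := by
  have hd : ∀ I J, HasDerivAt (fun t => minor (mat (boost j t)) I J)
      (deriv (fun t => minor (mat (boost j t)) I J) 0) 0 := fun I J =>
    (((contDiff_minor (contDiff_boost j) I J).differentiable (by simp)) 0).hasDerivAt
  refine ⟨{ toFun := fun w I => ∑ J, deriv (fun t => minor (mat (boost j t)) I J) 0 * w J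
            map_add' := fun v w => by
              funext I; simp [mul_add, Finset.sum_add_distrib]
            map_smul' := fun c w => by
              funext I; simp only [Pi.smul_apply, smul_eq_mul, RingHom.id_apply, Finset.mul_sum]
              exact Finset.sum_congr rfl fun J _ => by ring }, fun v v' hv => ?_⟩
  rw [hasDerivAt_pi] at hv ⊢
  intro I
  have h1 := HasDerivAt.fun_sum (u := Finset.univ) fun J _ => (hd I J).mul (hv J)
  refine h1.congr_deriv ?_
  have h2 : ∑ J, minor (mat (boost j 0)) I J * v' J = v' I := by
    rw [boost_zero]; exact congrFun (spinFock_one v') I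
  rw [Finset.sum_add_distrib, h2]
  rfl

namespace PreInduced

variable {H : Type*} [NormedAddCommGroup H] [InnerProductSpace ℂ H]
  {ρ : Poincare →* (H ≃ₗᵢ[ℂ] H)} {Φ : H →ₗ[ℂ] AEEqFun Covector Fock (massShell m)}

theorem hasDerivAt_boost_translate {Ψ K : H} (hΨ : Ψ ∈ smoothVectors ρ) {j : Fin 3}
    (hK : HasDerivAt (fun t => ρ ⟨0, boost j t⟩ Ψ) K 0) (x : Spacetime) :
    HasDerivAt (fun t => ρ ⟨0, boost j t⟩ (ρ ⟨-x, 1⟩ Ψ)) (ρ ⟨-x, 1⟩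
      (translationDeriv ρ (-(x j.succ • basisVec 0 + x 0 • basisVec j.succ)) Ψ + K)) 0 := by
  set c' : Spacetime := -(x j.succ • basisVec 0 + x 0 • basisVec j.succ) with hc'
  have hF : ContDiff ℝ ∞ fun y : Spacetime × ℝ => ρ ⟨y.1, boost j y.2⟩ Ψ :=
    contDiff_rep hΨ contDiff_fst fun a b => (contDiff_boost j a b).comp contDiff_snd
  have hF' := ((hF.differentiable (by simp)) ((0 : Spacetime), (0 : ℝ))).hasFDerivAt
  set F' := fderiv ℝ (fun y : Spacetime × ℝ => ρ ⟨y.1, boost j y.2⟩ Ψ) ((0 : Spacetime), (0 : ℝ))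
  have h1 : F' (0, 1) = K := by
    have hg : HasDerivAt (fun t : ℝ => ((0 : Spacetime), t)) ((0 : Spacetime), (1 : ℝ)) 0 :=
      (hasDerivAt_const _ _).prodMk (hasDerivAt_id _)
    exact (HasFDerivAt.comp_hasDerivAt (0 : ℝ) hF' hg).unique hK
  have h2 : F' (c', 0) = translationDeriv ρ c' Ψ := by
    have hg : HasDerivAt (fun t : ℝ => (t • c', (0 : ℝ))) (c', (0 : ℝ)) 0 := by
      have := ((hasDerivAt_id (0 : ℝ)).smul_const c').prodMk (hasDerivAt_const (0 : ℝ) (0 : ℝ))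
      simpa using this
    have h3 := HasFDerivAt.comp_hasDerivAt_of_eq (0 : ℝ) hF' hg (by rw [zero_smul])
    refine h3.unique ?_
    have h4 := hasDerivAt_translate hΨ c'
    simpa only [Function.comp_def, boost_zero] using h4
  have hg : HasDerivAt (fun t : ℝ => (x - lorentz (boost j t) x, t)) (c', (1 : ℝ)) 0 :=
    ((hasDerivAt_lorentz_boost j x).const_sub x).prodMk (hasDerivAt_id _)
  have h5 := HasFDerivAt.comp_hasDerivAt_of_eq (0 : ℝ) hF' hg
    (by rw [boost_zero, lorentz_one, sub_self])
  have h6 : F' (c', 1) = translationDeriv ρ c' Ψ + K := by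
    rw [← h1, ← h2, ← map_add, Prod.mk_add_mk, add_zero, zero_add]
  rw [h6] at h5
  have h7 := ((ρ ⟨-x, 1⟩).toContinuousLinearEquiv.toContinuousLinearMap.restrictScalars
    ℝ).hasFDerivAt.comp_hasDerivAt (0 : ℝ) h5
  refine h7.congr_of_eventuallyEq (Filter.Eventually.of_forall fun t => ?_)
  change ρ ⟨0, boost j t⟩ (ρ ⟨-x, 1⟩ Ψ) = ρ ⟨-x, 1⟩ (ρ ⟨x - lorentz (boost j t) x, boost j t⟩ Ψ)
  rw [rep_rep, rep_rep, Poincare.mk_mul_mk, Poincare.mk_mul_mk, mul_one, one_mul, lorentz_one,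
    ← lorentzL_apply, map_neg, lorentzL_apply]
  congr 2
  abel_nf

variable (h : PreInduced m ρ Φ) (hm : 0 < m)
include h hm

/-- The commutator of the boosts with the Fourier integrals. -/
theorem exists_boost_identity {Ψ : H} (hΨ : Ψ ∈ smoothVectors ρ) (j : Fin 3) :
    ∃ K ∈ smoothVectors ρ, ∃ S : Fock →ₗ[ℂ] Fock, ∀ (n : ℕ) (x : Spacetime),
      (I * (x j.succ : ℂ)) • moment Φ (n + 3) x Ψ =
        S (moment Φ (n + 4) x Ψ) + ((n + 4 : ℕ) : ℂ) • moment Φ (n + 5) x (momOp ρ j.succ Ψ) -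
        moment Φ (n + 4) x K -
        (I * (x 0 : ℂ)) • moment Φ (n + 4) x (momOp ρ j.succ Ψ) := by
  obtain ⟨K, hKs, hK⟩ := hasDerivAt_rep_mem hΨ (contDiff_boost j)
  obtain ⟨S, hS⟩ := spinFock_boost_deriv j
  refine ⟨K, hKs, S, fun n x => ?_⟩
  obtain ⟨L, hL⟩ := h.exists_moment hm (n + 1)
  set Ω := ρ ⟨-x, 1⟩ Ψ with hΩ
  have hΩs : Ω ∈ smoothVectors ρ := rep_smooth_mem hΨ _
  have hJ := hasDerivAt_integral_boostEnergy hm j (n + 1 + 3) (hL Ω).1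
    (Φ Ω).aestronglyMeasurable
  have hLJ : ∀ t, L (ρ ⟨0, boost j t⟩ Ω) = spinFock (boost j t)
      (∫ p, (((boostEnergy j p t : ℝ) : ℂ) ^ (n + 1 + 3))⁻¹ • Φ Ω p ∂(massShell m)) := by
    intro t
    have mp := measurePreserving_pullback hm (boost j t)
    have e1 : ∀ᵐ p ∂(massShell m), ((p 0 : ℂ) ^ (n + 1 + 3))⁻¹ • Φ (ρ ⟨0, boost j t⟩ Ω) p =
        (fun q : Covector => (((boostEnergy j q t : ℝ) : ℂ) ^ (n + 1 + 3))⁻¹ •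
          spinFock (boost j t) (Φ Ω q)) (pullback (boost j t) p) := by
      filter_upwards [h.poincare ⟨0, boost j t⟩ Ω] with p hp
      rw [hp, dotProduct_zero]
      simp only [← pullback_boost_inv_zero, pullback_inv_pullback]
      simp
    have e2 := MeasurePreserving.integral_comp (g := fun q : Covector =>
      (((boostEnergy j q t : ℝ) : ℂ) ^ (n + 1 + 3))⁻¹ • spinFock (boost j t) (Φ Ω q)) mp
      (pullbackEquiv (boost j t)).measurableEmbedding
    have e3 : Integrable (fun q : Covector => (((boostEnergy j q t : ℝ) : ℂ) ^ (n + 1 + 3))⁻¹ •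
        Φ Ω q) (massShell m) := by
      have mp' := measurePreserving_pullback hm (boost j t)⁻¹
      have i1 := (mp'.integrable_comp_emb (pullbackEquiv (boost j t)⁻¹).measurableEmbedding).2
        ((hL (ρ ⟨0, boost j t⟩ Ω)).1)
      have i2 := (LinearMap.toContinuousLinearMap (spinFockL (boost j t)⁻¹)).integrable_comp i1
      refine i2.congr ?_
      filter_upwards [mp'.quasiMeasurePreserving.ae (h.poincare ⟨0, boost j t⟩ Ω)] with p hp
      change spinFock (boost j t)⁻¹ (((pullback (boost j t)⁻¹ p 0 : ℂ) ^ (n + 1 + 3))⁻¹ •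
        Φ (ρ ⟨0, boost j t⟩ Ω) (pullback (boost j t)⁻¹ p)) = _
      rw [hp, dotProduct_zero, pullback_pullback_inv, pullback_boost_inv_zero, spinFock_smul,
        spinFock_smul, ← spinFock_mul, inv_mul_cancel, spinFock_one]
      simp
    rw [(hL _).2, integral_congr_ae e1, e2]
    have e4 := (LinearMap.toContinuousLinearMap (spinFockL (boost j t))).integral_comp_comm e3
    refine Eq.trans ?_ e4
    refine integral_congr_ae (Filter.Eventually.of_forall fun q => ?_)
    exact (spinFock_smul _ _ _).symm
  have hA := (L.restrictScalars ℝ).hasFDerivAt.comp_hasDerivAt (0 : ℝ)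
    (hasDerivAt_boost_translate hΨ hK x)
  have hB := hS _ _ hJ
  have hAB := hA.unique (hB.congr_of_eventuallyEq (Filter.Eventually.of_forall fun t => hLJ t))
  have eL : ∀ Θ, L (ρ ⟨-x, 1⟩ Θ) = moment Φ (n + 4) x Θ := fun Θ => by
    rw [(hL _).2, h.moment_eq]
  have e0 : ∫ p, (((boostEnergy j p 0 : ℝ) : ℂ) ^ (n + 1 + 3))⁻¹ • Φ Ω p ∂(massShell m) =
      moment Φ (n + 4) x Ψ := by
    rw [h.moment_eq]; simp only [boostEnergy_zero]; rfl
  have e1 : ∫ p, (((n + 1 + 3 : ℕ) : ℂ) * p j.succ * ((p 0 : ℂ) ^ (n + 1 + 3 + 1))⁻¹) • Φ Ω p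
      ∂(massShell m) = ((n + 4 : ℕ) : ℂ) • moment Φ (n + 5) x (momOp ρ j.succ Ψ) := by
    rw [moment, ← integral_smul]
    refine integral_congr_ae ?_
    filter_upwards [h.ae_translate (-x) Ψ, h.ae_momOp hm hΨ j.succ] with p h1 h2
    rw [hΩ, h1, h2, dotProduct_neg, Complex.ofReal_neg, mul_neg, neg_neg, smul_smul, smul_smul,
      smul_smul, smul_smul]
    congr 1
    ring
  rw [e0, e1] at hAB
  have e2 : (L.restrictScalars ℝ) (ρ ⟨-x, 1⟩ (translationDeriv ρ
      (-(x j.succ • basisVec 0 + x 0 • basisVec j.succ)) Ψ + K)) =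
      (I * (x j.succ : ℂ)) • moment Φ (n + 3) x Ψ +
        (I * (x 0 : ℂ)) • moment Φ (n + 4) x (momOp ρ j.succ Ψ) +
        moment Φ (n + 4) x K := by
    have t1 : translationDeriv ρ (-(x j.succ • basisVec 0 + x 0 • basisVec j.succ)) Ψ =
        (I * (x j.succ : ℂ)) • momOp ρ 0 Ψ + (I * (x 0 : ℂ)) • momOp ρ j.succ Ψ := by
      rw [translationDeriv_eq hΨ, momOp, momOp, translationDeriv_eq hΨ, translationDeriv_eq hΨ,
        map_neg, map_add, map_smul, map_smul, smul_smul, smul_smul, mul_right_comm,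
        mul_right_comm _ (x 0 : ℂ), Complex.I_mul_I, neg_one_mul, neg_one_mul, neg_smul, neg_smul,
        neg_add]
      rfl
    change L (ρ ⟨-x, 1⟩ _) = _
    rw [t1, map_add, map_add, map_add, map_add, map_smul, map_smul, map_smul, map_smul, eL, eL, eL,
      h.moment_succ hm hΨ (n + 3)]
  rw [e2] at hAB
  rw [sub_sub, eq_sub_iff_add_eq, ← hAB]
  abel

end PreInduced

end SuperPoincare

namespace SuperPoincare
open Complex (I exp)
open MeasureTheory

/-! ### Rapidly decreasing functions -/

section Rapid

variable {F G : Type} [NormedAddCommGroup F] [NormedSpace ℝ F] [NormedAddCommGroup G]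
  [NormedSpace ℝ G]

/-- Smooth functions which, together with all their derivatives, decrease rapidly in space, locally
uniformly in time. -/
structure RapidFn (f : Spacetime → F) : Prop where
  smooth : ContDiff ℝ ∞ f
  bound : ∀ (k n : ℕ) (r : ℝ), ∃ C : ℝ, ∀ x : Spacetime, |x 0| ≤ r →
    ‖x‖ ^ k * ‖iteratedFDeriv ℝ n f x‖ ≤ C

theorem RapidFn.clm (L : F →L[ℝ] G) {f : Spacetime → F} (hf : RapidFn f) :
    RapidFn fun x => L (f x) where
  smooth := L.contDiff.comp hf.smooth
  bound k n r := by
    obtain ⟨C, hC⟩ := hf.bound k n r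
    refine ⟨‖L‖ * C, fun x hx => ?_⟩
    have h1 := L.norm_iteratedFDeriv_comp_left (n := n) (N := ∞) (x := x) hf.smooth.contDiffAt
      (by exact_mod_cast le_top)
    calc ‖x‖ ^ k * ‖iteratedFDeriv ℝ n (fun x => L (f x)) x‖
        ≤ ‖x‖ ^ k * (‖L‖ * ‖iteratedFDeriv ℝ n f x‖) := by gcongr; exact h1
      _ = ‖L‖ * (‖x‖ ^ k * ‖iteratedFDeriv ℝ n f x‖) := by ring
      _ ≤ _ := by gcongr; exact hC x hx

theorem RapidFn.linear [FiniteDimensional ℝ F] (L : F →ₗ[ℝ] G) {f : Spacetime → F}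
    (hf : RapidFn f) : RapidFn fun x => L (f x) :=
  hf.clm (LinearMap.toContinuousLinearMap L)

theorem RapidFn.add {f g : Spacetime → F} (hf : RapidFn f) (hg : RapidFn g) :
    RapidFn fun x => f x + g x where
  smooth := hf.smooth.add hg.smooth
  bound k n r := by
    obtain ⟨C, hC⟩ := hf.bound k n r
    obtain ⟨C', hC'⟩ := hg.bound k n r
    refine ⟨C + C', fun x hx => ?_⟩
    have e : iteratedFDeriv ℝ n (fun x => f x + g x) x =
        iteratedFDeriv ℝ n f x + iteratedFDeriv ℝ n g x :=
      iteratedFDeriv_add_apply ((hf.smooth.of_le (by exact_mod_cast le_top)).contDiffAt)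
        ((hg.smooth.of_le (by exact_mod_cast le_top)).contDiffAt)
    rw [e]
    calc _ ≤ ‖x‖ ^ k * (‖iteratedFDeriv ℝ n f x‖ + ‖iteratedFDeriv ℝ n g x‖) := by
          gcongr; exact norm_add_le _ _
      _ = ‖x‖ ^ k * ‖iteratedFDeriv ℝ n f x‖ + ‖x‖ ^ k * ‖iteratedFDeriv ℝ n g x‖ := mul_add _ _ _
      _ ≤ _ := add_le_add (hC x hx) (hC' x hx)

theorem RapidFn.zero : RapidFn fun _ : Spacetime => (0 : F) where
  smooth := contDiff_const
  bound k n r := ⟨0, fun x _ => by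
    rw [iteratedFDeriv_fun_zero]; simp⟩

theorem RapidFn.sum {ι : Type*} (s : Finset ι) {f : ι → Spacetime → F}
    (hf : ∀ i ∈ s, RapidFn (f i)) : RapidFn fun x => ∑ i ∈ s, f i x := by
  classical
  induction s using Finset.induction_on with
  | empty => simpa using RapidFn.zero
  | insert a s ha ih =>
    simp only [Finset.sum_insert ha]
    exact (hf a (Finset.mem_insert_self _ _)).add
      (ih fun i hi => hf i (Finset.mem_insert_of_mem hi))

theorem RapidFn.partialX {f : Spacetime → F} (hf : RapidFn f) (μ : Fin 4) :
    RapidFn (partialX μ f) := by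
  have h1 : RapidFn (fderiv ℝ f) :=
    ⟨hf.smooth.fderiv_right (m := ∞) (by simp), fun k n r => by
      simpa only [norm_iteratedFDeriv_fderiv] using hf.bound k (n + 1) r⟩
  exact h1.clm (ContinuousLinearMap.apply ℝ F (basisVec μ))

theorem RapidFn.mul_left {f : Spacetime → ℂ} (hf : RapidFn f) (c : ℂ) : RapidFn fun x => c * f x :=
  hf.clm (ContinuousLinearMap.mul ℝ ℂ c)

theorem RapidFn.neg {f : Spacetime → F} (hf : RapidFn f) : RapidFn fun x => -f x :=
  hf.clm (-ContinuousLinearMap.id ℝ F)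

theorem RapidFn.sub {f g : Spacetime → F} (hf : RapidFn f) (hg : RapidFn g) :
    RapidFn fun x => f x - g x := by
  simpa only [sub_eq_add_neg] using hf.add hg.neg

theorem RapidFn.pi {ι : Type} [Fintype ι] [DecidableEq ι] {f : Spacetime → ι → ℂ}
    (hf : ∀ i, RapidFn fun x => f x i) : RapidFn f := by
  have h1 := RapidFn.sum Finset.univ fun i _ =>
    (hf i).clm (ContinuousLinearMap.single ℝ (fun _ : ι => ℂ) i)
  have e : f = fun x => ∑ i, ContinuousLinearMap.single ℝ (fun _ : ι => ℂ) i (f x i) := by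
    funext x i
    simp [Finset.sum_apply, Pi.single_apply]
  rw [e]
  exact h1

theorem RapidFn.apply {ι : Type} [Fintype ι] {f : Spacetime → ι → ℂ} (hf : RapidFn f) (i : ι) :
    RapidFn fun x => f x i :=
  hf.clm (ContinuousLinearMap.proj i)

/-- A class of smooth decreasing functions which is stable under differentiation consists of
rapidly decreasing ones. -/
theorem RapidFn.of_closed {P : (Spacetime → F) → Prop} (hs : ∀ f, P f → ContDiff ℝ ∞ f)
    (hp : ∀ f, P f → ∀ μ, P (SuperPoincare.partialX μ f))
    (hd : ∀ f, P f → ∀ (k : ℕ) (r : ℝ), ∃ C, ∀ x : Spacetime, |x 0| ≤ r → ‖x‖ ^ k * ‖f x‖ ≤ C)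
    {f : Spacetime → F} (hf : P f) : RapidFn f := by
  refine ⟨hs f hf, fun k n r => ?_⟩
  suffices key : ∀ n, ∀ f, P f → ∃ C, ∀ x : Spacetime, |x 0| ≤ r →
      ‖x‖ ^ k * ‖iteratedFDeriv ℝ n f x‖ ≤ C from key n f hf
  intro n
  induction n with
  | zero => intro f hf; simpa only [norm_iteratedFDeriv_zero] using hd f hf k r
  | succ n ih =>
    intro f hf
    choose C hC using fun μ => ih _ (hp f hf μ)
    set L : Fin 4 → F →L[ℝ] (Spacetime →L[ℝ] F) := fun μ =>
      ContinuousLinearMap.smulRightL ℝ Spacetime F (ContinuousLinearMap.proj μ) with hL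
    have e : fderiv ℝ f = fun x => ∑ μ, L μ (SuperPoincare.partialX μ f x) := by
      funext x
      refine ContinuousLinearMap.ext fun v => ?_
      conv_lhs => rw [← sum_smul_basisVec v, map_sum]
      rw [sum_apply]
      refine Finset.sum_congr rfl fun μ _ => ?_
      rw [map_smul]
      rfl
    refine ⟨∑ μ, ‖L μ‖ * C μ, fun x hx => ?_⟩
    have hsm : ∀ μ, ContDiff ℝ ∞ fun x => L μ (SuperPoincare.partialX μ f x) := fun μ =>
      (L μ).contDiff.comp (hs _ (hp f hf μ))
    rw [← norm_iteratedFDeriv_fderiv, e, iteratedFDeriv_fun_sum_apply fun μ _ =>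
      ((hsm μ).of_le (by exact_mod_cast le_top)).contDiffAt]
    refine (mul_le_mul_of_nonneg_left (norm_sum_le _ _) (by positivity)).trans ?_
    rw [Finset.mul_sum]
    refine Finset.sum_le_sum fun μ _ => ?_
    have h1 := (L μ).norm_iteratedFDeriv_comp_left (n := n) (N := ∞) (x := x)
      (hs _ (hp f hf μ)).contDiffAt (by exact_mod_cast le_top)
    calc _ ≤ ‖x‖ ^ k * (‖L μ‖ * ‖iteratedFDeriv ℝ n (SuperPoincare.partialX μ f) x‖) := by
          gcongr; exact h1
      _ = ‖L μ‖ * (‖x‖ ^ k * ‖iteratedFDeriv ℝ n (SuperPoincare.partialX μ f) x‖) := by ring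
      _ ≤ _ := by gcongr; exact hC μ x hx

theorem RapidFn.dslash {φ : Spacetime → ℂ} (hφ : RapidFn φ) (a b : Fin 2) :
    RapidFn (dslash a b φ) :=
  RapidFn.sum _ fun μ _ => (hφ.partialX μ).mul_left _

theorem RapidFn.box {φ : Spacetime → ℂ} (hφ : RapidFn φ) : RapidFn (box φ) :=
  ((((hφ.partialX 0).partialX 0).sub ((hφ.partialX 1).partialX 1)).sub
    ((hφ.partialX 2).partialX 2)).sub ((hφ.partialX 3).partialX 3)

theorem RapidFn.chiralLift {c : Spacetime → Fock} (hc : RapidFn c) : RapidFn (chiralLift c) := by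
  refine RapidFn.pi fun I => ?_
  simp only [SuperPoincare.chiralLift]
  split_ifs
  all_goals first
    | exact hc.apply _
    | exact ((hc.apply _).dslash _ _).sub ((hc.apply _).dslash _ _)
    | exact ((hc.apply _).dslash _ _).neg
    | exact (hc.apply _).box.neg
    | exact RapidFn.zero

theorem RapidFn.fieldOp {f : Superfield} (hf : RapidFn f) (M : Fock2 →ₗ[ℂ] Fock2)
    (N : Fin 4 → Fock2 →ₗ[ℂ] Fock2) : RapidFn (fieldOp M N f) :=
  (hf.linear (M.restrictScalars ℝ)).add
    (RapidFn.sum _ fun μ _ => (hf.partialX μ).linear ((N μ).restrictScalars ℝ))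

theorem RapidFn.const_smul {f : Superfield} (hf : RapidFn f) (c : ℂ) : RapidFn (c • f) :=
  hf.linear ((c • (LinearMap.id : Fock2 →ₗ[ℂ] Fock2)).restrictScalars ℝ)

theorem RapidFn.realify {f : Superfield} (hf : RapidFn f) (m : ℝ) : RapidFn (realify m f) := by
  have h1 : RapidFn (D 0 (D 1 f)) := by
    rw [D_eq_fieldOp, D_eq_fieldOp]
    exact (hf.fieldOp _ _).fieldOp _ _
  have h2 : RapidFn (DSq f) := by
    rw [DSq_eq hf.smooth]
    exact h1.const_smul _
  have h3 : RapidFn (conjS (DSq f)) := h2.linear conjL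
  exact hf.sub (h3.const_smul _)

end Rapid

/-! ### Decay of the Fourier integrals -/

namespace PreInduced

variable {m : ℝ} {H : Type*} [NormedAddCommGroup H] [InnerProductSpace ℂ H]
  {ρ : Poincare →* (H ≃ₗᵢ[ℂ] H)} {Φ : H →ₗ[ℂ] AEEqFun Covector Fock (massShell m)}
  (h : PreInduced m ρ Φ) (hm : 0 < m)
include h hm

theorem moment_bound (n : ℕ) (Ψ : H) : ∃ C, ∀ x, ‖moment Φ (n + 3) x Ψ‖ ≤ C := by
  obtain ⟨L, hL⟩ := h.exists_moment hm n
  refine ⟨‖L‖ * ‖Ψ‖, fun x => ?_⟩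
  rw [h.moment_eq, ← (hL _).2]
  refine (L.le_opNorm _).trans (le_of_eq ?_)
  rw [LinearIsometryEquiv.norm_map]

theorem moment_decay_axis (j : Fin 3) (r : ℝ) (k : ℕ) : ∀ (n : ℕ), ∀ Ψ ∈ smoothVectors ρ,
    ∃ C, ∀ x : Spacetime, |x 0| ≤ r → |x j.succ| ^ k * ‖moment Φ (n + 3) x Ψ‖ ≤ C := by
  induction k with
  | zero =>
    intro n Ψ _
    obtain ⟨C, hC⟩ := h.moment_bound hm n Ψ
    exact ⟨C, fun x _ => by simpa using hC x⟩
  | succ k ih =>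
    intro n Ψ hΨ
    obtain ⟨K, hK, S, hS⟩ := h.exists_boost_identity hm hΨ j
    obtain ⟨C1, h1⟩ := ih (n + 1) Ψ hΨ
    obtain ⟨C2, h2⟩ := ih (n + 2) _ (momOp_mem hΨ j.succ)
    obtain ⟨C3, h3⟩ := ih (n + 1) K hK
    obtain ⟨C4, h4⟩ := ih (n + 1) _ (momOp_mem hΨ j.succ)
    set S' := LinearMap.toContinuousLinearMap S
    refine ⟨‖S'‖ * C1 + ((n + 4 : ℕ) : ℝ) * C2 + C3 + r * C4, fun x hx => ?_⟩
    specialize h1 x hx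
    specialize h2 x hx
    specialize h3 x hx
    specialize h4 x hx
    have hr : 0 ≤ r := (abs_nonneg _).trans hx
    have e : |x j.succ| ^ (k + 1) * ‖moment Φ (n + 3) x Ψ‖ =
        |x j.succ| ^ k * ‖(I * (x j.succ : ℂ)) • moment Φ (n + 3) x Ψ‖ := by
      rw [norm_smul, norm_mul, Complex.norm_I, one_mul, Complex.norm_real, Real.norm_eq_abs]
      ring
    rw [e, hS]
    set a := |x j.succ| ^ k
    have ha : 0 ≤ a := by positivity
    have b1 : ‖S (moment Φ (n + 4) x Ψ)‖ ≤ ‖S'‖ * ‖moment Φ (n + 4) x Ψ‖ := S'.le_opNorm _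
    have b2 : ‖((n + 4 : ℕ) : ℂ) • moment Φ (n + 5) x (momOp ρ j.succ Ψ)‖ =
        ((n + 4 : ℕ) : ℝ) * ‖moment Φ (n + 5) x (momOp ρ j.succ Ψ)‖ := by
      rw [norm_smul, Complex.norm_natCast]
    have b4 : ‖(I * (x 0 : ℂ)) • moment Φ (n + 4) x (momOp ρ j.succ Ψ)‖ =
        |x 0| * ‖moment Φ (n + 4) x (momOp ρ j.succ Ψ)‖ := by
      rw [norm_smul, norm_mul, Complex.norm_I, one_mul, Complex.norm_real, Real.norm_eq_abs]
    have c2 : a * (((n + 4 : ℕ) : ℝ) * ‖moment Φ (n + 5) x (momOp ρ j.succ Ψ)‖) ≤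
        ((n + 4 : ℕ) : ℝ) * C2 := by
      rw [mul_left_comm]; gcongr
    have c4 : a * (|x 0| * ‖moment Φ (n + 4) x (momOp ρ j.succ Ψ)‖) ≤ r * C4 := by
      rw [mul_left_comm]; gcongr
    have c1 : a * ‖S (moment Φ (n + 4) x Ψ)‖ ≤ ‖S'‖ * C1 := by
      calc _ ≤ a * (‖S'‖ * ‖moment Φ (n + 4) x Ψ‖) := by gcongr
        _ = ‖S'‖ * (a * ‖moment Φ (n + 4) x Ψ‖) := by ring
        _ ≤ _ := by gcongr
    calc _ ≤ a * (‖S (moment Φ (n + 4) x Ψ)‖ +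
          ((n + 4 : ℕ) : ℝ) * ‖moment Φ (n + 5) x (momOp ρ j.succ Ψ)‖ + ‖moment Φ (n + 4) x K‖ +
          |x 0| * ‖moment Φ (n + 4) x (momOp ρ j.succ Ψ)‖) := by
            gcongr
            refine (norm_sub_le _ _).trans (add_le_add ?_ b4.le)
            refine (norm_sub_le _ _).trans (add_le_add ?_ le_rfl)
            exact (norm_add_le _ _).trans (add_le_add le_rfl b2.le)
      _ ≤ _ := by
        rw [mul_add, mul_add, mul_add]
        exact add_le_add (add_le_add (add_le_add c1 c2) h3) c4

theorem moment_decay {Ψ : H} (hΨ : Ψ ∈ smoothVectors ρ) (n k : ℕ) (r : ℝ) :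
    ∃ C, ∀ x : Spacetime, |x 0| ≤ r → ‖x‖ ^ k * ‖moment Φ n x Ψ‖ ≤ C := by
  set Θ := momOp ρ 0 (momOp ρ 0 (momOp ρ 0 Ψ))
  have h1 := momOp_mem hΨ 0
  have h2 := momOp_mem h1 0
  have e : ∀ x, moment Φ n x Ψ = moment Φ (n + 3) x Θ := fun x => by
    rw [h.moment_succ hm h2 (n + 2), h.moment_succ hm h1 (n + 1), h.moment_succ hm hΨ n]
  choose C hC using fun j => h.moment_decay_axis hm j r k n Θ (momOp_mem h2 0)
  obtain ⟨C0, hC0⟩ := h.moment_bound hm n Θ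
  refine ⟨|r| ^ k * C0 + ∑ j, C j, fun x hx => ?_⟩
  rw [e]
  have hb : ‖x‖ ^ k ≤ |x 0| ^ k + ∑ j : Fin 3, |x j.succ| ^ k := by
    obtain ⟨i, hi⟩ : ∃ i, ‖x‖ = |x i| := by
      obtain ⟨i, -, hi⟩ := Finset.exists_mem_eq_sup' Finset.univ_nonempty (fun i => ‖x i‖₊)
      refine ⟨i, ?_⟩
      rw [Pi.norm_def, ← Finset.sup'_eq_sup Finset.univ_nonempty, hi]
      rfl
    rw [hi]
    have hn : ∀ j : Fin 3, 0 ≤ |x j.succ| ^ k := fun j => by positivity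
    refine Fin.cases ?_ (fun j => ?_) i
    · exact le_add_of_nonneg_right (Finset.sum_nonneg fun j _ => hn j)
    · exact (Finset.single_le_sum (fun j _ => hn j) (Finset.mem_univ j)).trans
        (le_add_of_nonneg_left (by positivity))
  calc _ ≤ (|x 0| ^ k + ∑ j : Fin 3, |x j.succ| ^ k) * ‖moment Φ (n + 3) x Θ‖ := by gcongr
    _ = |x 0| ^ k * ‖moment Φ (n + 3) x Θ‖ +
        ∑ j : Fin 3, |x j.succ| ^ k * ‖moment Φ (n + 3) x Θ‖ := by rw [add_mul, Finset.sum_mul]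
    _ ≤ _ := by
      refine add_le_add ?_ (Finset.sum_le_sum fun j _ => hC j x hx)
      have : |x 0| ≤ |r| := hx.trans (le_abs_self r)
      exact mul_le_mul (by gcongr) (hC0 x) (norm_nonneg _) (by positivity)

theorem rapidFn_moment {Ψ : H} (hΨ : Ψ ∈ smoothVectors ρ) (n : ℕ) :
    RapidFn fun x => moment Φ n x Ψ := by
  refine RapidFn.of_closed (P := fun f => ∃ Ψ ∈ smoothVectors ρ, f = fun x => moment Φ n x Ψ)
    ?_ ?_ ?_ ⟨Ψ, hΨ, rfl⟩
  · rintro _ ⟨Ψ, hΨ, rfl⟩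
    exact (h.contDiff_moment_and hm hΨ n).1
  · rintro _ ⟨Ψ, hΨ, rfl⟩ μ
    refine ⟨I • momOp ρ μ Ψ, Submodule.smul_mem _ _ (momOp_mem hΨ μ), funext fun x => ?_⟩
    rw [(h.contDiff_moment_and hm hΨ n).2, moment_congr n x (coe_smul Φ I _)]
  · rintro _ ⟨Ψ, hΨ, rfl⟩ k r
    exact h.moment_decay hm hΨ n k r

end PreInduced

end SuperPoincare

namespace SuperPoincare
open Complex (I exp)
open MeasureTheory

/-! ### The super Fourier transform -/

variable {m : ℝ}

/-- The odd Fourier transform of `⋀ S_+^*` (with the phases of the super Fourier transform). -/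
def hodge : Fock →ₗ[ℂ] Fock where
  toFun w := fun I => if I = ∅ then w Finset.univ else
    if I = Finset.univ then w ∅ else -Complex.I * w I
  map_add' v w := by funext I; simp only [Pi.add_apply]; split_ifs <;> ring
  map_smul' c w := by
    funext I; simp only [Pi.smul_apply, smul_eq_mul, RingHom.id_apply]; split_ifs <;> ring

theorem hodge_empty (w : Fock) : hodge w ∅ = w Finset.univ := by simp [hodge]

theorem hodge_singleton (w : Fock) (a : Fin 2) : hodge w {a} = -I * w {a} := by
  have h1 : ({a} : Finset (Fin 2)) ≠ Finset.univ := by revert a; decide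
  simp [hodge, h1]

theorem hodge_univ (w : Fock) : hodge w Finset.univ = w ∅ := by
  simp [hodge, univ_ne_empty']

theorem spinFock_hodge (A : SL2) (w : Fock) : spinFock A (hodge w) = hodge (spinFock A w) := by
  refine fock_ext ?_ (fun a => ?_) ?_
  · rw [spinFock_empty, hodge_empty, hodge_empty, spinFock_univ]
  · rw [spinFock_singleton, hodge_singleton, hodge_singleton, hodge_singleton, spinFock_singleton]
    ring
  · rw [spinFock_univ, hodge_univ, hodge_univ, spinFock_empty]

theorem spinFock2_empty (A : SL2) (w : Fock2) (I : Finset (Fin 2)) :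
    spinFock2 A w (I, ∅) = spinFock A (fun K => w (K, ∅)) I := by
  rw [spinFock2_apply, Finset.sum_eq_single ∅]
  · rw [minor_empty]; simp
  · intro L _ hL
    rw [minor_of_card_ne]
    · simp
    · simpa using (Finset.card_ne_zero.2 (Finset.nonempty_iff_ne_empty.2 hL)).symm
  · simp

theorem dslash_congr_apply {c : Spacetime → Fock} (hc : ContDiff ℝ ∞ c) (a b : Fin 2)
    (x : Spacetime) (I : Finset (Fin 2)) :
    dslash a b (fun y => c y I) x = ∑ μ, gammaLow μ a b * partialX μ c x I := by
  simp only [dslash, partialX_apply (ContDiff.differentiableAt_top hc x)]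

section SuperAct

variable {f : Superfield}

theorem IsChiral.act (hf : IsChiral f) (g : Poincare) : IsChiral (act g f) :=
  ⟨hf.smooth.act g, fun b => by
    rw [DBar_act hf.smooth]; simp [hf.dbar, act_zero]⟩

theorem IsChiral.parityS (hf : IsChiral f) : IsChiral (parityS f) :=
  ⟨hf.smooth.parityS, fun b => by
    rw [DBar_parityS hf.smooth, hf.dbar]
    funext x
    simp [parityS_apply]⟩

theorem IsChiral.superAct (hf : IsChiral f) (s : Spinor) : IsChiral (superAct s f) :=
  ⟨hf.smooth.superAct s, fun b => by
    rw [DBar_superAct hf.smooth, hf.dbar, superAct_zero, neg_zero]⟩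

theorem realify_act (hf : IsChiral f) (g : Poincare) :
    realify m (act g f) = act g (realify m f) := by
  rw [realify, realify, DSq_act hf.smooth, conjS_act, sub_eq_add_neg, sub_eq_add_neg,
    act_add, ← neg_smul, ← neg_smul, act_smul]

theorem realify_parityS (hf : IsChiral f) :
    realify m (parityS f) = parityS (realify m f) := by
  rw [realify, realify, DSq_parityS hf.smooth, conjS_parityS]
  funext x I
  simp only [Pi.sub_apply, Pi.smul_apply, smul_eq_mul, SuperPoincare.parityS]
  ring

theorem superAct_add {g : Superfield} (hf : IsSuperfunction f) (hg : IsSuperfunction g)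
    (s : Spinor) : superAct s (f + g) = superAct s f + superAct s g := by
  simp only [superAct_eq, Q_add hf hg, QBar_add hf hg, smul_add]
  abel

theorem realify_superAct (hf : IsChiral f) (s : Spinor) :
    realify m (superAct s f) = superAct s (realify m f) := by
  have h1 : IsSuperfunction (conjS (DSq f)) := hf.smooth.DSq.conjS
  rw [realify, realify, DSq_superAct hf.smooth, conjS_superAct hf.smooth.DSq, sub_eq_add_neg,
    sub_eq_add_neg, ← neg_smul, ← neg_smul, superAct_add hf.smooth (h1.smul _), superAct_smul h1]

theorem realify_add {g : Superfield} (hf : IsSuperfunction f) (hg : IsSuperfunction g) :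
    realify m (f + g) = realify m f + realify m g := by
  rw [realify, DSq_add hf hg, conjS_add, smul_add, realify, realify]
  abel

theorem realify_smul (hf : IsSuperfunction f) (r : ℝ) :
    realify m ((r : ℂ) • f) = (r : ℂ) • realify m f := by
  rw [realify, DSq_smul hf, conjS_smul, Complex.conj_ofReal, realify, smul_sub, smul_comm]

theorem IsChiral.QBar_apply (hf : IsChiral f) (b : Fin 2) (x : Spacetime) (I : Finset (Fin 2)) :
    QBar b f x (I, ∅) = 2 * ∑ a, if a ∈ I then
      koszul a I * dslash a b (fun y => f y (I.erase a, ∅)) x else 0 := by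
  have h := congrFun (congrFun (hf.dbar b) x) (I, ∅)
  rw [DBar_apply hf.smooth, Pi.zero_apply, Pi.zero_apply] at h
  simp only [QBar, Pi.add_apply, Finset.sum_apply, partialThetaBar, mulTheta,
    gammaPartial_apply hf.smooth]
  linear_combination h

theorem Q_apply_empty (f : Superfield) (a : Fin 2) (x : Spacetime) (I : Finset (Fin 2)) :
    Q a f x (I, ∅) = if a ∈ I then 0 else koszul a I * f x (insert a I, ∅) := by
  simp [Q, partialTheta, mulThetaBar]

theorem superAct_apply (s : Spinor) (x : Spacetime)
    (I : Finset (Fin 2)) : superAct s f x (I, ∅) =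
      s 1 * Q 0 f x (I, ∅) + conj (s 1) * QBar 0 f x (I, ∅) - s 0 * Q 1 f x (I, ∅) -
        conj (s 0) * QBar 1 f x (I, ∅) := by
  rw [superAct_eq]
  simp only [Pi.add_apply, Pi.smul_apply, smul_eq_mul, map_neg]
  ring

end SuperAct

theorem slashConj_eq_sum (p : Covector) (s : Spinor) (c : Fin 2) :
    slashConj p s c = ∑ μ, (p μ : ℂ) * ∑ d, gammaUp μ c d * conj (s d) := by
  simp only [slashConj, slashUp, Finset.sum_mul, Finset.mul_sum]
  rw [Finset.sum_comm]
  exact Finset.sum_congr rfl fun μ _ => Finset.sum_congr rfl fun d _ => by ring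

/-- The coefficients of the Clifford action, which is an affine function of the momentum. -/
def cliffordCoeff (s : Spinor) : Option (Fin 4) → Fock →ₗ[ℂ] Fock
  | none => cliffordL 0 s
  | some μ => cliffordL (basisVec μ) s - cliffordL 0 s

theorem clifford_eq_sum (p : Covector) (s : Spinor) (w : Fock) : clifford p s w =
    cliffordCoeff s none w + ∑ μ, (p μ : ℂ) • cliffordCoeff s (some μ) w := by
  apply clifford_ext_aux <;>
  simp [cliffordCoeff, cliffordL_apply, clifford_empty, clifford_zero, clifford_one,
    clifford_univ, slashConj_eq_sum, Fin.sum_univ_four, basisVec, Pi.single_apply] <;> ring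

theorem chiralLift_add {c c' : Spacetime → Fock} (hc : ContDiff ℝ ∞ c) (hc' : ContDiff ℝ ∞ c') :
    chiralLift (fun x => c x + c' x) = chiralLift c + chiralLift c' :=
  (isChiral_chiralLift (hc.add hc')).ext
    ((isChiral_chiralLift hc).add (isChiral_chiralLift hc')) fun x I => by
      rw [Pi.add_apply, Pi.add_apply, chiralLift_empty, chiralLift_empty, chiralLift_empty]; rfl

theorem chiralLift_smul {c : Spacetime → Fock} (hc : ContDiff ℝ ∞ c) (a : ℂ) :
    chiralLift (fun x => a • c x) = a • chiralLift c :=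
  (isChiral_chiralLift (hc.const_smul a)).ext
    ((isChiral_chiralLift hc).smul a) fun x I => by
      rw [Pi.smul_apply, Pi.smul_apply, chiralLift_empty, chiralLift_empty]; rfl

namespace PreInduced

variable {H : Type*} [NormedAddCommGroup H] [InnerProductSpace ℂ H]
  {ρ : Poincare →* (H ≃ₗᵢ[ℂ] H)} {Φ : H →ₗ[ℂ] AEEqFun Covector Fock (massShell m)}

/-- The coefficients of the chiral superfunction defined by a smooth vector. -/
def fourierField (Φ : H →ₗ[ℂ] AEEqFun Covector Fock (massShell m)) (Ψ : H) (x : Spacetime) : Fock :=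
  hodge (moment Φ 0 x Ψ)

/-- The super Fourier transform of a smooth vector. -/
def superFourier (Φ : H →ₗ[ℂ] AEEqFun Covector Fock (massShell m)) (Ψ : H) : Superfield :=
  realify m (chiralLift (fourierField Φ Ψ))

variable (h : PreInduced m ρ Φ) (hm : 0 < m)
include h hm

theorem contDiff_fourierField {Ψ : H} (hΨ : Ψ ∈ smoothVectors ρ) :
    ContDiff ℝ ∞ (fourierField Φ Ψ) :=
  contDiff_linear_comp (hodge.restrictScalars ℝ) (h.contDiff_moment_and hm hΨ 0).1

theorem partialX_fourierField {Ψ : H} (hΨ : Ψ ∈ smoothVectors ρ) (μ : Fin 4) (x : Spacetime) :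
    partialX μ (fourierField Φ Ψ) x = I • fourierField Φ (momOp ρ μ Ψ) x := by
  have h1 := h.contDiff_moment_and hm hΨ 0
  have h2 := partialX_linear (hodge.restrictScalars ℝ) (ContDiff.differentiableAt_top h1.1 x) μ
  refine h2.trans ?_
  rw [h1.2]
  exact map_smul hodge _ _

theorem isChiral_fourier {Ψ : H} (hΨ : Ψ ∈ smoothVectors ρ) :
    IsChiral (chiralLift (fourierField Φ Ψ)) :=
  isChiral_chiralLift (h.contDiff_fourierField hm hΨ)

theorem moment_add {Ψ Ω : H} (hΨ : Ψ ∈ smoothVectors ρ) (hΩ : Ω ∈ smoothVectors ρ) (n : ℕ)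
    (x : Spacetime) : moment Φ n x (Ψ + Ω) = moment Φ n x Ψ + moment Φ n x Ω := by
  rw [moment, moment, moment, ← integral_add (integrable_expI_smul (h.integrable_moment hm hΨ n))
    (integrable_expI_smul (h.integrable_moment hm hΩ n))]
  refine integral_congr_ae ?_
  filter_upwards [coe_add Φ Ψ Ω] with p hp
  rw [hp, smul_add, smul_add]

theorem box_fourierField {Ψ : H} (hΨ : Ψ ∈ smoothVectors ρ) (I : Finset (Fin 2)) (x : Spacetime) :
    box (fun y => fourierField Φ Ψ y I) x = -(m : ℂ) ^ 2 * fourierField Φ Ψ x I := by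
  have hd : ∀ {Θ : H}, Θ ∈ smoothVectors ρ → ∀ μ, partialX μ (fun y => fourierField Φ Θ y I) =
      fun y => Complex.I * fourierField Φ (momOp ρ μ Θ) y I := fun hΘ μ => funext fun y => by
    rw [← partialX_apply (ContDiff.differentiableAt_top (h.contDiff_fourierField hm hΘ) y),
      h.partialX_fourierField hm hΘ]
    rfl
  have hdd : ∀ μ, partialX μ (partialX μ (fun y => fourierField Φ Ψ y I)) x =
      -fourierField Φ (momOp ρ μ (momOp ρ μ Ψ)) x I := fun μ => by
    rw [hd hΨ, partialX_const_smul _ (((contDiff_pi.1 (h.contDiff_fourierField hm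
      (momOp_mem hΨ μ))) I).differentiable (by simp) x), hd (momOp_mem hΨ μ), ← mul_assoc,
      Complex.I_mul_I, neg_one_mul]
  rw [box, Pi.sub_apply, Pi.sub_apply, Pi.sub_apply, hdd, hdd, hdd, hdd]
  have hs := fun μ => momOp_mem (momOp_mem hΨ μ) μ
  have key : moment Φ 0 x (momOp ρ 0 (momOp ρ 0 Ψ)) = moment Φ 0 x (((m : ℂ) ^ 2) • Ψ +
      momOp ρ 1 (momOp ρ 1 Ψ) + momOp ρ 2 (momOp ρ 2 Ψ) + momOp ρ 3 (momOp ρ 3 Ψ)) := by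
    refine integral_congr_ae ?_
    have hp := fun μ => h.ae_momOp hm (momOp_mem hΨ μ) μ
    have hq := fun μ => h.ae_momOp hm hΨ μ
    filter_upwards [hp 0, hp 1, hp 2, hp 3, hq 0, hq 1, hq 2, hq 3, ae_onShell hm,
      coe_smul Φ ((m : ℂ) ^ 2) Ψ, coe_add Φ (((m : ℂ) ^ 2) • Ψ) (momOp ρ 1 (momOp ρ 1 Ψ)),
      coe_add Φ (((m : ℂ) ^ 2) • Ψ + momOp ρ 1 (momOp ρ 1 Ψ)) (momOp ρ 2 (momOp ρ 2 Ψ)),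
      coe_add Φ (((m : ℂ) ^ 2) • Ψ + momOp ρ 1 (momOp ρ 1 Ψ) + momOp ρ 2 (momOp ρ 2 Ψ))
        (momOp ρ 3 (momOp ρ 3 Ψ))] with p a0 a1 a2 a3 b0 b1 b2 b3 hs c0 c1 c2 c3
    rw [c3, c2, c1, c0, a0, a1, a2, a3, b0, b1, b2, b3]
    have e : (p 0 : ℂ) ^ 2 = (m : ℂ) ^ 2 + (p 1 : ℂ) ^ 2 + (p 2 : ℂ) ^ 2 + (p 3 : ℂ) ^ 2 := by
      exact_mod_cast hs.sq
    simp only [smul_smul, ← add_smul]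
    congr 3
    linear_combination e
  have hm2 : ((m : ℂ) ^ 2) • Ψ ∈ smoothVectors ρ := Submodule.smul_mem _ _ hΨ
  have e : ∀ Θ, fourierField Φ Θ x I = hodge (moment Φ 0 x Θ) I := fun Θ => rfl
  simp only [e]
  rw [key, h.moment_add hm (Submodule.add_mem _ (Submodule.add_mem _ hm2 (hs 1)) (hs 2)) (hs 3),
    h.moment_add hm (Submodule.add_mem _ hm2 (hs 1)) (hs 2), h.moment_add hm hm2 (hs 1),
    moment_congr 0 x (coe_smul Φ ((m : ℂ) ^ 2) Ψ)]
  simp only [map_add, map_smul, Pi.add_apply, Pi.smul_apply, smul_eq_mul]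
  ring

theorem superFourier_mem {Ψ : H} (hΨ : Ψ ∈ smoothVectors ρ) :
    superFourier Φ Ψ ∈ solutions m ∧ RapidlyDecreasing (superFourier Φ Ψ) := by
  constructor
  · refine (h.isChiral_fourier hm hΨ).realify_mem_solutions hm.ne' fun I x => ?_
    simp only [chiralLift_empty]
    exact h.box_fourierField hm hΨ I x
  · have h1 : RapidFn (fourierField Φ Ψ) :=
      (h.rapidFn_moment hm hΨ 0).linear (hodge.restrictScalars ℝ)
    exact (h1.chiralLift.realify m).bound

theorem superFourier_add {Ψ Ω : H} (hΨ : Ψ ∈ smoothVectors ρ) (hΩ : Ω ∈ smoothVectors ρ) :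
    superFourier Φ (Ψ + Ω) = superFourier Φ Ψ + superFourier Φ Ω := by
  have e : fourierField Φ (Ψ + Ω) = fun x => fourierField Φ Ψ x + fourierField Φ Ω x :=
    funext fun x => by simp only [fourierField, h.moment_add hm hΨ hΩ, map_add]
  rw [superFourier, e, chiralLift_add (h.contDiff_fourierField hm hΨ)
    (h.contDiff_fourierField hm hΩ), realify_add (h.isChiral_fourier hm hΨ).smooth
    (h.isChiral_fourier hm hΩ).smooth]
  rfl

theorem superFourier_smul {Ψ : H} (hΨ : Ψ ∈ smoothVectors ρ) (r : ℝ) :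
    superFourier Φ ((r : ℂ) • Ψ) = (r : ℂ) • superFourier Φ Ψ := by
  have e : fourierField Φ ((r : ℂ) • Ψ) = fun x => (r : ℂ) • fourierField Φ Ψ x :=
    funext fun x => by simp only [fourierField, moment_congr 0 x (coe_smul Φ _ Ψ), map_smul]
  rw [superFourier, e, chiralLift_smul (h.contDiff_fourierField hm hΨ),
    realify_smul (h.isChiral_fourier hm hΨ).smooth]
  rfl

theorem superFourier_rep {Ψ : H} (hΨ : Ψ ∈ smoothVectors ρ) (g : Poincare) :
    superFourier Φ (ρ g Ψ) = act g (superFourier Φ Ψ) := by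
  rw [superFourier, superFourier, ← realify_act (h.isChiral_fourier hm hΨ)]
  congr 1
  refine (h.isChiral_fourier hm (rep_smooth_mem hΨ g)).ext ((h.isChiral_fourier hm hΨ).act g)
    fun x I => ?_
  rw [chiralLift_empty, act, spinFock2_empty]
  simp only [chiralLift_empty]
  change hodge _ I = spinFock g.lin (hodge (moment Φ 0 (lorentz g.lin⁻¹ (x - g.trans)) Ψ)) I
  rw [spinFock_hodge]
  set g' : Covector → Fock := fun q => exp (Complex.I *
    (q ⬝ᵥ lorentz g.lin⁻¹ (x - g.trans) : ℝ)) • ((q 0 : ℂ) ^ 0)⁻¹ • Φ Ψ q with hg'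
  have e1 : ∀ᵐ p ∂(massShell m), exp (Complex.I * (p ⬝ᵥ x : ℝ)) • ((p 0 : ℂ) ^ 0)⁻¹ •
      Φ (ρ g Ψ) p = spinFock g.lin (g' (pullback g.lin p)) := by
    filter_upwards [h.poincare g Ψ] with p hp
    rw [hp, hg']
    beta_reduce
    rw [pullback_dotProduct, lorentz_lorentz_inv, dotProduct_sub, spinFock_smul, pow_zero,
      pow_zero, inv_one, one_smul, one_smul, smul_smul, ← Complex.exp_add]
    congr 2
    push_cast
    ring
  have e2 : moment Φ 0 x (ρ g Ψ) =
      spinFock g.lin (moment Φ 0 (lorentz g.lin⁻¹ (x - g.trans)) Ψ) := by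
    have e3 : ∫ p, spinFock g.lin (g' (pullback g.lin p)) ∂(massShell m) =
        ∫ q, spinFock g.lin (g' q) ∂(massShell m) :=
      MeasurePreserving.integral_comp (g := fun q => spinFock g.lin (g' q))
        (measurePreserving_pullback hm g.lin) (pullbackEquiv g.lin).measurableEmbedding
    refine (integral_congr_ae e1).trans (e3.trans ?_)
    exact (LinearMap.toContinuousLinearMap (spinFockL g.lin)).integral_comp_comm
      (integrable_expI_smul (h.integrable_moment hm hΨ 0))
  rw [← e2]

theorem superFourier_parity {Ψ Ω : H} (hΨ : Ψ ∈ smoothVectors ρ) (hΩ : Ω ∈ smoothVectors ρ)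
    (hp : ∀ᵐ p ∂(massShell m), Φ Ω p = fockParity (Φ Ψ p)) :
    superFourier Φ Ω = parityS (superFourier Φ Ψ) := by
  rw [superFourier, superFourier, ← realify_parityS (h.isChiral_fourier hm hΨ)]
  congr 1
  refine (h.isChiral_fourier hm hΩ).ext (h.isChiral_fourier hm hΨ).parityS fun x I => ?_
  have e : moment Φ 0 x Ω = fockParity (moment Φ 0 x Ψ) := by
    refine Eq.trans ?_ ((LinearMap.toContinuousLinearMap fockParity).integral_comp_comm
      (integrable_expI_smul (h.integrable_moment hm hΨ 0)))
    refine integral_congr_ae ?_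
    filter_upwards [hp] with p hp
    rw [hp]
    simp only [← map_smul]
    rfl
  rw [chiralLift_empty, SuperPoincare.parityS, chiralLift_empty, fourierField, e, fourierField]
  rcases finset_fin_two_cases I with rfl | rfl | rfl | rfl
  · simp [hodge_empty, fockParity_apply]
  · simp [hodge_singleton, fockParity_apply]
  · simp [hodge_singleton, fockParity_apply]
  · simp [hodge_univ, fockParity_apply]

theorem moment_clifford {Ψ Ω : H} (hΨ : Ψ ∈ smoothVectors ρ) (s : Spinor)
    (hp : ∀ᵐ p ∂(massShell m), Φ Ω p = clifford p s (Φ Ψ p)) (x : Spacetime) :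
    moment Φ 0 x Ω = cliffordCoeff s none (moment Φ 0 x Ψ) +
      ∑ μ, cliffordCoeff s (some μ) (moment Φ 0 x (momOp ρ μ Ψ)) := by
  have hi : ∀ o {Θ : H}, Θ ∈ smoothVectors ρ → _ := fun o Θ hΘ =>
    (LinearMap.toContinuousLinearMap (cliffordCoeff s o)).integrable_comp
      (integrable_expI_smul (x := x) (h.integrable_moment hm hΘ 0))
  have hc : ∀ o {Θ : H}, Θ ∈ smoothVectors ρ → _ := fun o Θ hΘ =>
    (LinearMap.toContinuousLinearMap (cliffordCoeff s o)).integral_comp_comm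
      (integrable_expI_smul (x := x) (h.integrable_moment hm hΘ 0))
  have e : ∀ o {Θ : H}, Θ ∈ smoothVectors ρ → cliffordCoeff s o (moment Φ 0 x Θ) =
    ∫ p, LinearMap.toContinuousLinearMap (cliffordCoeff s o) (exp (I *
      (p ⬝ᵥ x : ℝ)) • ((p 0 : ℂ) ^ 0)⁻¹ • Φ Θ p) ∂(massShell m) := fun o Θ hΘ => (hc o hΘ).symm
  rw [e none hΨ, Finset.sum_congr rfl fun μ _ => e (some μ) (momOp_mem hΨ μ),
    ← integral_finsetSum _ fun μ _ => hi (some μ) (momOp_mem hΨ μ),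
    ← integral_add (hi none hΨ) (integrable_finsetSum _ fun μ _ => hi (some μ) (momOp_mem hΨ μ))]
  refine integral_congr_ae ?_
  have hq := fun μ => h.ae_momOp hm hΨ μ
  filter_upwards [hp, hq 0, hq 1, hq 2, hq 3] with p h1 b0 b1 b2 b3
  rw [h1, clifford_eq_sum]
  simp only [LinearMap.coe_toContinuousLinearMap', map_smul, Fin.sum_univ_four, b0, b1, b2, b3,
    smul_add]

theorem superFourier_charge {Ψ Ω : H} (hΨ : Ψ ∈ smoothVectors ρ) (hΩ : Ω ∈ smoothVectors ρ)
    (s : Spinor) (hp : ∀ᵐ p ∂(massShell m), Φ Ω p = clifford p s (Φ Ψ p)) :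
    superFourier Φ Ω = superAct s (superFourier Φ Ψ) := by
  have hc := h.isChiral_fourier hm hΨ
  rw [superFourier, superFourier, ← realify_superAct hc]
  congr 1
  refine (h.isChiral_fourier hm hΩ).ext (hc.superAct s) fun x I => ?_
  have hd : ∀ a b I, dslash a b (fun y => fourierField Φ Ψ y I) x =
      ∑ μ, gammaLow μ a b * (Complex.I * hodge (moment Φ 0 x (momOp ρ μ Ψ)) I) := fun a b I => by
    rw [dslash_congr_apply (h.contDiff_fourierField hm hΨ)]
    simp only [h.partialX_fourierField hm hΨ]
    rfl
  rw [superAct_apply]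
  simp only [hc.QBar_apply, Q_apply_empty, chiralLift_empty, hd]
  rw [fourierField, h.moment_clifford hm hΨ s hp x, fourierField]
  generalize moment Φ 0 x Ψ = G
  obtain ⟨G', hG'⟩ : ∃ G' : Fin 4 → Fock, ∀ μ, moment Φ 0 x (momOp ρ μ Ψ) = G' μ :=
    ⟨_, fun _ => rfl⟩
  simp only [hG']
  have e1 : (0 : Fin 2) ∉ ({1} : Finset (Fin 2)) := by decide
  have e2 : (1 : Fin 2) ∉ ({0} : Finset (Fin 2)) := by decide
  have I2 := Complex.I_sq
  rcases finset_fin_two_cases I with rfl | rfl | rfl | rfl <;>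
    simp [hodge_empty, hodge_singleton, hodge_univ, cliffordCoeff, cliffordL_apply, clifford_empty,
      clifford_zero, clifford_one, clifford_univ, slashConj_eq_sum, Fin.sum_univ_four, basisVec,
      Pi.single_apply, koszul_zero, koszul_one, erase_univ_zero, erase_univ_one, insert_zero_one,
      insert_one_zero, gammaLow, gammaUp, eps, Fin.sum_univ_two]
  · ring
  · linear_combination (-(s 0) * G ∅) * I2
  · linear_combination (-(s 1) * G ∅) * I2
  · linear_combination (2 * conj (s 0) * (G' 0 {0} + G' 1 {0} + G' 2 {1} + Complex.I * G' 3 {1}) +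
      2 * conj (s 1) * (G' 0 {1} - G' 1 {1} + G' 2 {0} - Complex.I * G' 3 {0})) * I2

theorem isFourierTransform_superFourier {Ψ : H} (hΨ : Ψ ∈ smoothVectors ρ) :
    IsFourierTransform m (Φ Ψ) (superFourier Φ Ψ) := by
  have hc := h.isChiral_fourier hm hΨ
  have hi := h.integrable_section hm hΨ
  have e : ∀ x I, moment Φ 0 x Ψ I =
      ∫ p, exp (Complex.I * (p ⬝ᵥ x : ℝ)) * Φ Ψ p I ∂(massShell m) := fun x I => by
    have h1 := (ContinuousLinearMap.proj (R := ℂ) (φ := fun _ : Finset (Fin 2) => ℂ)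
      I).integral_comp_comm (integrable_expI_smul (x := x) hi)
    refine Eq.trans ?_ h1.symm
    simp [moment]
  refine ⟨hi, chiralLift (fourierField Φ Ψ), hc.smooth, hc.dbar 0, hc.dbar 1, fun x => ?_,
    fun x a => ?_, fun x => ?_, rfl⟩
  · rw [chiralLift_empty, fourierField, hodge_empty, e]
  · rw [chiralLift_empty, fourierField, hodge_singleton, e]
  · rw [chiralLift_empty, fourierField, hodge_univ, e]

end PreInduced

end SuperPoincare

namespace SuperPoincare
open Complex (I exp)
open MeasureTheory
open scoped SchwartzMap FourierTransform

/-! ### Positive-frequency fields -/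

variable {m : ℝ}

theorem ae_eq_zero_of_fourier {g : Mom → ℂ} (hg : Integrable g)
    (hz : ∀ ξ : Mom, ∫ k, exp (I * (inner ℝ k ξ : ℝ)) * g k = 0) :
    ∀ᵐ k, g k = 0 := by
  have hinv : ∀ w, 𝓕⁻ g w = 0 := fun w => by
    rw [Real.fourierInv_eq', ← hz ((2 * Real.pi) • w)]
    refine integral_congr_ae (.of_forall fun k => ?_)
    simp only [real_inner_smul_right, smul_eq_mul]
    rw [mul_comm I]
  have key : ∀ V : 𝓢(Mom, ℂ), ∫ k, conj (V k) * g k = 0 := fun V => by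
    let W : 𝓢(Mom, ℂ) := 𝓕⁻ V
    have h1 := VectorFourier.integral_sesq_fourierIntegral_eq_neg_flip (innerSL ℂ)
      (L := innerₗ Mom) Real.continuous_fourierChar continuous_inner
      (W.integrable (μ := volume)) hg
    have h2 : 𝓕 W = V := FourierTransform.fourier_fourierInv_eq V
    have h3 : ∀ k, VectorFourier.fourierIntegral Real.fourierChar volume (innerₗ Mom) W k =
        V k := fun k => congrArg (fun U : 𝓢(Mom, ℂ) => U k) h2
    have h4 : ∀ k, VectorFourier.fourierIntegral Real.fourierChar volume
        (-(innerₗ Mom).flip) g k = 0 := fun k => by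
      rw [flip_innerₗ]; exact hinv k
    simp only [h3, h4, map_zero, integral_zero, innerSL_apply_apply, RCLike.inner_apply'] at h1
    exact h1
  exact ae_eq_zero_of_schwartz (fun V => hg.bdd_mul (c := ‖V.toBoundedContinuousFunction‖)
    (Complex.continuous_conj.comp V.continuous).aestronglyMeasurable
    (.of_forall fun k => by
      rw [RCLike.norm_conj]; exact V.toBoundedContinuousFunction.norm_coe_le_norm k)) key

/-- The field whose Fourier transform is `u` times the measure of the mass shell. -/
def posFn (m : ℝ) (u : Covector → ℂ) (x : Spacetime) : ℂ :=
  ∫ p, exp (I * (p ⬝ᵥ x : ℝ)) * u p ∂(massShell m)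

theorem shellPt_dotProduct (k : Mom) (x : Spacetime) :
    shellPt m k ⬝ᵥ x = energy m k * x 0 + inner ℝ k (spatial x) := by
  simp [dotProduct, Fin.sum_univ_succ, shellPt, PiLp.inner_apply, spatial_apply]
  ring

theorem posFn_eq (hm : 0 < m) (u : Covector → ℂ) (x : Spacetime) : posFn m u x =
    ∫ k : Mom, exp (I * (inner ℝ k (spatial x) : ℝ)) *
      (exp (I * (energy m k * x 0 : ℝ)) *
        ((2 * energy m k)⁻¹ * u (shellPt m k))) := by
  rw [posFn, integral_massShell hm]
  refine integral_congr_ae (.of_forall fun k => ?_)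
  simp only [shellPt_dotProduct, Complex.real_smul, Complex.ofReal_add, mul_add, Complex.exp_add]
  push_cast
  ring

theorem energy_neg (k : Mom) : energy m (-k) = energy m k := by simp [energy]

theorem conj_posFn_eq (hm : 0 < m) (u : Covector → ℂ) (x : Spacetime) : conj (posFn m u x) =
    ∫ k : Mom, exp (I * (inner ℝ k (spatial x) : ℝ)) *
      (exp (-(I * (energy m k * x 0 : ℝ))) *
        ((2 * energy m k)⁻¹ * conj (u (shellPt m (-k))))) := by
  rw [posFn_eq hm, ← integral_conj, ← integral_neg_eq_self]
  refine integral_congr_ae (.of_forall fun k => ?_)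
  simp only [map_mul, ← Complex.exp_conj, inner_neg_left, energy_neg, Complex.conj_I,
    Complex.conj_ofReal, Complex.ofReal_neg, map_neg, neg_mul, mul_neg, neg_neg]

theorem norm_exp_neg_I (r : ℝ) : ‖exp (-(I * (r : ℂ)))‖ = 1 := by
  rw [show -(I * (r : ℂ)) = I * ((-r : ℝ) : ℂ) by push_cast; ring, norm_expI]

theorem eq_zero_of_frequencies {e : ℝ} (he : 0 < e) {a b : ℂ}
    (h : ∀ n : ℕ, exp (I * (e * (1 / (n + 1)) : ℝ)) * a +
      exp (-(I * (e * (1 / (n + 1)) : ℝ))) * b = 0) (h0 : a + b = 0) :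
    a = 0 ∧ b = 0 := by
  obtain ⟨n, hn⟩ := exists_nat_one_div_lt (div_pos Real.pi_pos he)
  have hs : 0 < Real.sin (e * (1 / (n + 1))) := Real.sin_pos_of_pos_of_lt_pi (by positivity) (by
    rw [lt_div_iff₀ he] at hn; linarith)
  have h1 := h n
  rw [← neg_mul, mul_comm I, mul_comm (-I), mul_neg, ← neg_mul,
    ← Complex.ofReal_neg, Complex.exp_mul_I, Complex.exp_mul_I, ← Complex.ofReal_cos,
    ← Complex.ofReal_cos, ← Complex.ofReal_sin, ← Complex.ofReal_sin, Real.cos_neg,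
    Real.sin_neg] at h1
  have hb : b = -a := by linear_combination h0
  have : (2 * I * (Real.sin (e * (1 / (n + 1))) : ℂ)) * a = 0 := by
    rw [hb] at h1; push_cast at h1 ⊢; linear_combination h1
  have ha : a = 0 := by
    refine (mul_eq_zero.1 this).resolve_left ?_
    exact mul_ne_zero (mul_ne_zero two_ne_zero Complex.I_ne_zero)
      (Complex.ofReal_ne_zero.2 hs.ne')
  exact ⟨ha, by rw [hb, ha, neg_zero]⟩

theorem ae_eq_zero_of_posFn_add_conj (hm : 0 < m) {u v : Covector → ℂ}
    (hu : Integrable u (massShell m)) (hv : Integrable v (massShell m))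
    (hz : ∀ x, posFn m u x + conj (posFn m v x) = 0) :
    (∀ᵐ p ∂(massShell m), u p = 0) ∧ ∀ᵐ p ∂(massShell m), v p = 0 := by
  rw [integrable_massShell_iff hm] at hu hv
  set a : Mom → ℂ := fun k => (2 * energy m k)⁻¹ * u (shellPt m k)
  set b : Mom → ℂ := fun k => (2 * energy m k)⁻¹ * conj (v (shellPt m (-k)))
  have ha : Integrable a := hu.congr (.of_forall fun k => by simp [a])
  have hb : Integrable b := by
    refine (Complex.conjCLE.toContinuousLinearMap.integrable_comp hv.comp_neg).congr (.of_forall fun k => ?_)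
    simp [b, energy_neg, map_ofNat]
  have hexp : ∀ (t : ℝ), Continuous fun k : Mom =>
      exp (I * (energy m k * t : ℝ)) := fun t => by
    have := continuous_energy hm
    fun_prop
  have hexp' : ∀ (t : ℝ), Continuous fun k : Mom =>
      exp (-(I * (energy m k * t : ℝ))) := fun t => by
    have := continuous_energy hm
    fun_prop
  have key : ∀ t : ℝ, ∀ᵐ k : Mom, exp (I * (energy m k * t : ℝ)) * a k +
      exp (-(I * (energy m k * t : ℝ))) * b k = 0 := fun t => by
    have i1 : Integrable fun k : Mom => exp (I * (energy m k * t : ℝ)) * a k :=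
      ha.bdd_mul (c := 1) (hexp t).aestronglyMeasurable
        (.of_forall fun k => (norm_expI _).le)
    have i2 : Integrable fun k : Mom => exp (-(I * (energy m k * t : ℝ))) * b k :=
      hb.bdd_mul (c := 1) (hexp' t).aestronglyMeasurable
        (.of_forall fun k => (norm_exp_neg_I _).le)
    refine ae_eq_zero_of_fourier (i1.add i2) fun ξ => ?_
    have hc : Continuous fun k : Mom => exp (I * (inner ℝ k ξ : ℝ)) := by fun_prop
    have hx : spatial (Fin.cons t ξ.ofLp) = ξ := by ext i; simp [spatial_apply]
    have := hz (Fin.cons t ξ.ofLp)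
    rw [posFn_eq hm, conj_posFn_eq hm, hx] at this
    simp only [Fin.cons_zero] at this
    rw [← this, ← integral_add]
    · simp only [a, b, mul_add]
    · exact i1.bdd_mul (c := 1) hc.aestronglyMeasurable (.of_forall fun k => (norm_expI _).le)
    · exact i2.bdd_mul (c := 1) hc.aestronglyMeasurable (.of_forall fun k => (norm_expI _).le)
  have hall : ∀ᵐ k : Mom, a k = 0 ∧ b k = 0 := by
    filter_upwards [ae_all_iff.2 fun n : ℕ => key (1 / (n + 1)), key 0] with k h1 h0
    exact eq_zero_of_frequencies (energy_pos hm k) h1 (by simpa using h0)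
  have hne : ∀ k : Mom, ((2 * energy m k : ℝ) : ℂ)⁻¹ ≠ 0 := fun k =>
    inv_ne_zero (Complex.ofReal_ne_zero.2 (mul_pos two_pos (energy_pos hm k)).ne')
  constructor <;> rw [ae_massShell_iff hm]
  · filter_upwards [hall] with k hk
    refine (mul_eq_zero.1 hk.1).resolve_left ?_
    simpa using hne k
  · have := (Measure.measurePreserving_neg (volume : Measure Mom)).quasiMeasurePreserving.ae hall
    filter_upwards [this] with k hk
    have h1 := hk.2
    simp only [b, neg_neg] at h1
    have := (mul_eq_zero.1 h1).resolve_left (by simpa using hne (-k))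
    simpa using this

/-- Fields with integrable Fourier transform supported on the mass shell. -/
def IsPosFn (m : ℝ) (F : Spacetime → ℂ) : Prop :=
  ∃ u, Integrable u (massShell m) ∧ F = posFn m u

theorem integrable_expI_mul {x : Spacetime} {u : Covector → ℂ} (hu : Integrable u (massShell m)) :
    Integrable (fun p => exp (I * (p ⬝ᵥ x : ℝ)) * u p) (massShell m) :=
  hu.bdd_mul (c := 1) (by fun_prop) (.of_forall fun p => (norm_expI _).le)

theorem IsPosFn.const_mul {F : Spacetime → ℂ} (hF : IsPosFn m F) (c : ℂ) :
    IsPosFn m fun x => c * F x := by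
  obtain ⟨u, hu, rfl⟩ := hF
  refine ⟨fun p => c * u p, hu.const_mul c, funext fun x => ?_⟩
  rw [posFn, posFn, ← integral_const_mul]
  exact integral_congr_ae (.of_forall fun p => by ring)

theorem IsPosFn.add {F G : Spacetime → ℂ} (hF : IsPosFn m F) (hG : IsPosFn m G) :
    IsPosFn m fun x => F x + G x := by
  obtain ⟨u, hu, rfl⟩ := hF
  obtain ⟨v, hv, rfl⟩ := hG
  refine ⟨fun p => u p + v p, hu.add hv, funext fun x => ?_⟩
  simp only [posFn, mul_add]
  exact (integral_add (integrable_expI_mul hu) (integrable_expI_mul hv)).symm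

theorem IsPosFn.sub {F G : Spacetime → ℂ} (hF : IsPosFn m F) (hG : IsPosFn m G) :
    IsPosFn m fun x => F x - G x := by
  simpa [sub_eq_add_neg] using hF.add (hG.const_mul (-1))

theorem IsPosFn.sum {ι : Type*} {s : Finset ι} (hs : s.Nonempty) {F : ι → Spacetime → ℂ}
    (hF : ∀ i ∈ s, IsPosFn m (F i)) : IsPosFn m fun x => ∑ i ∈ s, F i x := by
  have := Finset.sum_induction_nonempty F (IsPosFn m) (fun _ _ h1 h2 => h1.add h2) hs hF
  simpa [← Finset.sum_apply] using this

theorem IsPosFn.eq_zero (hm : 0 < m) {F G : Spacetime → ℂ} (hF : IsPosFn m F) (hG : IsPosFn m G)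
    (hz : ∀ x, F x + conj (G x) = 0) : (∀ x, F x = 0) ∧ ∀ x, G x = 0 := by
  obtain ⟨u, hu, rfl⟩ := hF
  obtain ⟨v, hv, rfl⟩ := hG
  obtain ⟨h1, h2⟩ := ae_eq_zero_of_posFn_add_conj hm hu hv hz
  exact ⟨fun x => integral_eq_zero_of_ae (h1.mono fun p hp => by simp [hp]),
    fun x => integral_eq_zero_of_ae (h2.mono fun p hp => by simp [hp])⟩

namespace PreInduced

variable {H : Type*} [NormedAddCommGroup H] [InnerProductSpace ℂ H]
  {ρ : Poincare →* (H ≃ₗᵢ[ℂ] H)} {Φ : H →ₗ[ℂ] AEEqFun Covector Fock (massShell m)}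
  (h : PreInduced m ρ Φ) (hm : 0 < m)
include h hm

theorem integrable_apply {Ψ : H} (hΨ : Ψ ∈ smoothVectors ρ) (I : Finset (Fin 2)) :
    Integrable (fun p => Φ Ψ p I) (massShell m) :=
  (ContinuousLinearMap.proj (R := ℂ) (φ := fun _ : Finset (Fin 2) => ℂ) I).integrable_comp
    (h.integrable_section hm hΨ)

theorem moment_apply {Ψ : H} (hΨ : Ψ ∈ smoothVectors ρ) (x : Spacetime) (I : Finset (Fin 2)) :
    moment Φ 0 x Ψ I = posFn m (fun p => Φ Ψ p I) x := by
  have hi := integrable_expI_smul (x := x) (h.integrable_section hm hΨ)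
  have := (ContinuousLinearMap.proj (R := ℂ)
    (φ := fun _ : Finset (Fin 2) => ℂ) I).integral_comp_comm hi
  simp only [moment, pow_zero, inv_one, one_smul]
  exact this.symm

theorem isPosFn_fourierField {Ψ : H} (hΨ : Ψ ∈ smoothVectors ρ) (I : Finset (Fin 2)) :
    IsPosFn m fun x => fourierField Φ Ψ x I := by
  have hp : ∀ J, IsPosFn m fun x => moment Φ 0 x Ψ J := fun J =>
    ⟨_, h.integrable_apply hm hΨ J, funext fun x => h.moment_apply hm hΨ x J⟩
  by_cases h1 : I = ∅
  · subst h1; simpa only [fourierField, hodge_empty] using hp Finset.univ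
  by_cases h2 : I = Finset.univ
  · subst h2; simpa only [fourierField, hodge_univ] using hp ∅
  · have : ∀ w, hodge w I = -Complex.I * w I := fun w => by simp [hodge, h1, h2]
    simpa only [fourierField, this] using (hp I).const_mul (-Complex.I)

theorem dslash_fourierField {Ψ : H} (hΨ : Ψ ∈ smoothVectors ρ) (a b : Fin 2)
    (I : Finset (Fin 2)) : IsPosFn m (dslash a b fun x => fourierField Φ Ψ x I) := by
  have : (dslash a b fun x => fourierField Φ Ψ x I) = fun x => ∑ μ,
      gammaLow μ a b * Complex.I * fourierField Φ (momOp ρ μ Ψ) x I := funext fun x => by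
    rw [dslash_congr_apply (h.contDiff_fourierField hm hΨ)]
    simp only [h.partialX_fourierField hm hΨ, Pi.smul_apply, smul_eq_mul, mul_assoc]
  rw [this]
  exact .sum Finset.univ_nonempty fun μ _ =>
    (h.isPosFn_fourierField hm (momOp_mem hΨ μ) I).const_mul _

theorem eq_zero_of_superFourier_eq_zero {Ψ : H} (hΨ : Ψ ∈ smoothVectors ρ)
    (hz : superFourier Φ Ψ = 0) : Ψ = 0 := by
  have hc := h.isChiral_fourier hm hΨ
  have hl : ∀ x I, chiralLift (fourierField Φ Ψ) x (I, ∅) = fourierField Φ Ψ x I := fun x I =>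
    chiralLift_empty _ x I
  have hmc : (m : ℂ) ≠ 0 := Complex.ofReal_ne_zero.2 hm.ne'
  have h0 : ∀ x I, superFourier Φ Ψ x I = 0 := fun x I => by rw [hz]; rfl
  have e0 : ∀ x, fourierField Φ Ψ x ∅ + conj ((m : ℂ)⁻¹ / 2 * fourierField Φ Ψ x Finset.univ)
      = 0 := fun x => by
    have := h0 x (∅, ∅)
    rw [superFourier, hc.realify_empty, hl, hl] at this
    simpa [map_ofNat] using this
  have e1 : ∀ b x, fourierField Φ Ψ x {b} + conj ((m : ℂ)⁻¹ *
      (dslash 0 b (fun y => fourierField Φ Ψ y {1}) x -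
        dslash 1 b (fun y => fourierField Φ Ψ y {0}) x)) = 0 := fun b x => by
    have := h0 x ({b}, ∅)
    rw [superFourier, hc.realify_singleton] at this
    simp only [hl] at this
    simpa using this
  have z0 := IsPosFn.eq_zero hm (h.isPosFn_fourierField hm hΨ ∅)
    ((h.isPosFn_fourierField hm hΨ Finset.univ).const_mul _) e0
  have z1 := fun b => (IsPosFn.eq_zero hm (h.isPosFn_fourierField hm hΨ {b})
    (((h.dslash_fourierField hm hΨ 0 b {1}).sub
      (h.dslash_fourierField hm hΨ 1 b {0})).const_mul _) (e1 b)).1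
  have hae : ∀ I, (∀ x, posFn m (fun p => Φ Ψ p I) x = 0) →
      ∀ᵐ p ∂(massShell m), Φ Ψ p I = 0 := fun I hI =>
    (ae_eq_zero_of_posFn_add_conj hm (h.integrable_apply hm hΨ I)
      (integrable_zero Covector ℂ (massShell m)) fun x => by rw [hI]; simp [posFn]).1
  have k1 := hae Finset.univ fun x => by
    rw [← h.moment_apply hm hΨ, ← z0.1 x, fourierField, hodge_empty]
  have k2 := hae ∅ fun x => by
    rw [← h.moment_apply hm hΨ, ← hodge_univ (moment Φ 0 x Ψ)]
    exact (mul_eq_zero.1 (z0.2 x)).resolve_left (by simp [hmc])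
  have k3 : ∀ b, ∀ᵐ p ∂(massShell m), Φ Ψ p {b} = 0 := fun b => hae {b} fun x => by
    rw [← h.moment_apply hm hΨ]
    have := z1 b x
    rw [fourierField, hodge_singleton] at this
    exact (mul_eq_zero.1 this).resolve_left (by simp)
  refine h.eq_of_ae ?_
  filter_upwards [k1, k2, k3 0, k3 1, coe_zero Φ] with p p1 p2 p3 p4 p5
  rw [p5]
  exact clifford_ext_aux p2 p3 p4 p1

end PreInduced

end SuperPoincare

namespace SuperPoincare
open Complex (I exp)
open MeasureTheory
open scoped SchwartzMap FourierTransform LineDeriv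

/-! ### Rapidly decreasing solutions of the Klein-Gordon equation -/

variable {m : ℝ}

/-- The embedding of space into spacetime. -/
def space : Mom →L[ℝ] Spacetime :=
  LinearMap.toContinuousLinearMap
    { toFun := fun ξ => Fin.cons 0 ξ.ofLp
      map_add' := fun ξ η => by ext i; refine Fin.cases ?_ (fun j => ?_) i <;> simp
      map_smul' := fun c ξ => by ext i; refine Fin.cases ?_ (fun j => ?_) i <;> simp }

theorem space_zero (ξ : Mom) : space ξ 0 = 0 := rfl

theorem spatial_space (t : ℝ) (ξ : Mom) : spatial (t • basisVec 0 + space ξ) = ξ := by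
  ext i
  simp [spatial_apply, basisVec, space]

theorem time_space (t : ℝ) (ξ : Mom) : (t • basisVec 0 + space ξ) 0 = t := by
  simp [space_zero, basisVec]

theorem eq_time_space (x : Spacetime) : x = x 0 • basisVec 0 + space (spatial x) := by
  ext i
  refine Fin.cases ?_ (fun j => ?_) i <;> simp [basisVec, space, spatial_apply]

theorem space_single (j : Fin 3) : space (EuclideanSpace.single j 1) = basisVec j.succ := by
  ext i
  refine Fin.cases ?_ (fun k => ?_) i <;>
    simp [space, basisVec, Pi.single_apply, eq_comm]

theorem norm_le_space (t : ℝ) (ξ : Mom) :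
    ‖ξ‖ ≤ ‖(spatial : Covector →L[ℝ] Mom)‖ * ‖t • basisVec 0 + space ξ‖ := by
  conv_lhs => rw [← spatial_space t ξ]
  exact spatial.le_opNorm _

namespace RapidFn

variable {ψ : Spacetime → ℂ} (hψ : RapidFn ψ)
include hψ

/-- The restriction of a rapidly decreasing function to the space at the time `t`. -/
def slice (t : ℝ) : 𝓢(Mom, ℂ) where
  toFun ξ := ψ (t • basisVec 0 + space ξ)
  smooth' := hψ.smooth.comp (contDiff_const.add space.contDiff)
  decay' k n := by
    obtain ⟨C, hC⟩ := hψ.bound k n |t|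
    refine ⟨‖(spatial : Covector →L[ℝ] Mom)‖ ^ k * (‖space‖ ^ n * C), fun ξ => ?_⟩
    have h1 : iteratedFDeriv ℝ n (fun ξ => ψ (t • basisVec 0 + space ξ)) ξ =
        (iteratedFDeriv ℝ n ψ (t • basisVec 0 + space ξ)).compContinuousLinearMap
          fun _ => space := by
      have hs : ContDiff ℝ ∞ fun y => ψ (t • basisVec 0 + y) :=
        hψ.smooth.comp (contDiff_const.add contDiff_id)
      rw [← iteratedFDeriv_comp_add_left]
      exact space.iteratedFDeriv_comp_right hs ξ (i := n) (by exact_mod_cast le_top)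
    have h2 := (iteratedFDeriv ℝ n ψ
      (t • basisVec 0 + space ξ)).norm_compContinuousLinearMap_le fun _ => space
    rw [← h1, Finset.prod_const, Finset.card_univ, Fintype.card_fin] at h2
    have h3 := hC (t • basisVec 0 + space ξ) (by rw [time_space])
    have h4 := pow_le_pow_left₀ (norm_nonneg _) (norm_le_space t ξ) k
    calc _ ≤ (‖(spatial : Covector →L[ℝ] Mom)‖ * ‖t • basisVec 0 + space ξ‖) ^ k *
          (‖iteratedFDeriv ℝ n ψ (t • basisVec 0 + space ξ)‖ * ‖space‖ ^ n) := by gcongr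
      _ = ‖(spatial : Covector →L[ℝ] Mom)‖ ^ k * (‖space‖ ^ n *
          (‖t • basisVec 0 + space ξ‖ ^ k *
            ‖iteratedFDeriv ℝ n ψ (t • basisVec 0 + space ξ)‖)) := by rw [mul_pow]; ring
      _ ≤ _ := by gcongr

theorem slice_apply (t : ℝ) (ξ : Mom) : hψ.slice t ξ = ψ (t • basisVec 0 + space ξ) := rfl

theorem slice_partialX (t : ℝ) (j : Fin 3) :
    (hψ.partialX j.succ).slice t = ∂_{EuclideanSpace.single j (1 : ℝ)} (hψ.slice t) := by
  ext ξ
  have h1 : HasFDerivAt (fun ξ => ψ (t • basisVec 0 + space ξ))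
      ((fderiv ℝ ψ (t • basisVec 0 + space ξ)).comp space) ξ :=
    ((hψ.smooth.differentiable (by simp)) _).hasFDerivAt.comp ξ
      (space.hasFDerivAt.const_add _)
  rw [slice_apply, SchwartzMap.lineDerivOp_apply_eq_fderiv]
  have h2 : fderiv ℝ (hψ.slice t) ξ = _ := h1.fderiv
  rw [h2, ContinuousLinearMap.comp_apply, space_single]
  rfl

theorem fourier_partialX (t : ℝ) (j : Fin 3) (w : Mom) :
    𝓕 ((hψ.partialX j.succ).slice t) w = 2 * Real.pi * I * w j * 𝓕 (hψ.slice t) w := by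
  rw [hψ.slice_partialX, SchwartzMap.fourier_lineDerivOp_eq]
  have : (inner ℝ · (EuclideanSpace.single j (1 : ℝ)) : Mom → ℝ).HasTemperateGrowth :=
    ((innerSL ℝ).flip _).hasTemperateGrowth
  rw [smul_apply, SchwartzMap.smulLeftCLM_apply_apply this]
  simp [mul_assoc, EuclideanSpace.inner_single_right]

theorem hasDerivAt_fourier (w : Mom) (t : ℝ) :
    HasDerivAt (fun t => 𝓕 (hψ.slice t) w) (𝓕 ((hψ.partialX 0).slice t) w) t := by
  obtain ⟨C₀, h₀⟩ := (hψ.partialX 0).bound 0 0 (|t| + 1)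
  obtain ⟨C₄, h₄⟩ := (hψ.partialX 0).bound 4 0 (|t| + 1)
  simp only [norm_iteratedFDeriv_zero, pow_zero, one_mul] at h₀ h₄
  set N := ‖(spatial : Covector →L[ℝ] Mom)‖
  simp only [SchwartzMap.fourier_coe, Real.fourier_eq']
  refine (hasDerivAt_integral_of_dominated_loc_of_deriv_le (μ := volume)
    (F := fun s ξ => exp (↑(-2 * Real.pi * inner ℝ ξ w) * I) • hψ.slice s ξ)
    (F' := fun s ξ => exp (↑(-2 * Real.pi * inner ℝ ξ w) * I) •
      (hψ.partialX 0).slice s ξ) (s := Metric.ball t 1)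
    (bound := fun ξ : Mom => 2 ^ 3 * (C₀ + N ^ 4 * C₄) * (1 + ‖ξ‖) ^ (-(4 : ℝ)))
    (Metric.ball_mem_nhds t one_pos) (.of_forall fun s => ?_) ?_ ?_ ?_ ?_ ?_).2
  · exact ((Complex.continuous_exp.comp (by fun_prop)).smul
      (hψ.slice s).continuous).aestronglyMeasurable
  · refine ((hψ.slice t).integrable (μ := volume)).bdd_mul (c := 1)
      (Continuous.aestronglyMeasurable (by fun_prop)) (.of_forall fun ξ => ?_)
    rw [Complex.norm_exp_ofReal_mul_I]
  · exact ((Complex.continuous_exp.comp (by fun_prop)).smul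
      ((hψ.partialX 0).slice t).continuous).aestronglyMeasurable
  · refine .of_forall fun ξ s hs => ?_
    rw [norm_smul, Complex.norm_exp_ofReal_mul_I, one_mul, slice_apply]
    have hs' : |(s • basisVec 0 + space ξ) 0| ≤ |t| + 1 := by
      rw [time_space]
      rw [Metric.mem_ball, Real.dist_eq] at hs
      have := abs_sub_abs_le_abs_sub s t
      linarith
    rw [Real.rpow_neg (by positivity), ← div_eq_mul_inv, le_div_iff₀ (by positivity)]
    have e0 := h₀ _ hs'
    have e4 := h₄ _ hs'
    have e1 : (1 + ‖ξ‖) ^ 4 ≤ 2 ^ 3 * (1 ^ 4 + ‖ξ‖ ^ 4) := add_pow_le zero_le_one (norm_nonneg _) 4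
    have e2 := pow_le_pow_left₀ (norm_nonneg _) (norm_le_space s ξ) 4
    set F := ‖SuperPoincare.partialX 0 ψ (s • basisVec 0 + space ξ)‖
    have hF : 0 ≤ F := norm_nonneg _
    have hN : 0 ≤ N ^ 4 := by positivity
    calc F * (1 + ‖ξ‖) ^ (4 : ℝ) = F * (1 + ‖ξ‖) ^ 4 := by norm_cast
      _ ≤ F * (2 ^ 3 * (1 ^ 4 + (N * ‖s • basisVec 0 + space ξ‖) ^ 4)) := by
        gcongr; exact e1.trans (by gcongr)
      _ = 2 ^ 3 * (F + N ^ 4 * (‖s • basisVec 0 + space ξ‖ ^ 4 * F)) := by ring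
      _ ≤ _ := by gcongr
  · refine (integrable_one_add_norm ?_).const_mul _
    simp
    norm_num
  · refine .of_forall fun ξ s _ => HasDerivAt.const_mul _ ?_
    have h1 : HasDerivAt (fun s : ℝ => s • basisVec 0 + space ξ) (basisVec 0) s := by
      simpa using ((hasDerivAt_id s).smul_const (basisVec 0)).add_const (space ξ)
    exact ((hψ.smooth.differentiable (by simp)) _).hasFDerivAt.comp_hasDerivAt s h1

end RapidFn

theorem frequency_split {y y' : ℝ → ℂ} {e : ℝ} (h : ∀ t, HasDerivAt y (y' t) t)
    (h' : ∀ t, HasDerivAt y' (-(e : ℂ) ^ 2 * y t) t) (t : ℝ) :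
    2 * e * y t = exp (I * (e * t : ℝ)) * (e * y 0 - I * y' 0) +
      exp (-(I * (e * t : ℝ))) * (e * y 0 + I * y' 0) := by
  have key : ∀ c : ℂ, c ^ 2 = -1 → exp (-(c * (e * t : ℝ))) * (e * y t - c * y' t) =
      e * y 0 - c * y' 0 := fun c hc => by
    have hd : ∀ t, HasDerivAt (fun t : ℝ => exp (-(c * (e * t : ℝ))) *
        (e * y t - c * y' t)) 0 t := fun t => by
      have h1 : HasDerivAt (fun t : ℝ => -(c * ((e * t : ℝ) : ℂ))) (-(c * e)) t := by
        have := (((hasDerivAt_id t).const_mul e).ofReal_comp.const_mul c).neg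
        rw [mul_one] at this
        exact this
      convert! h1.cexp.mul (((h t).const_mul (e : ℂ)).sub ((h' t).const_mul c)) using 1
      simp only [Pi.sub_apply]
      linear_combination -exp (-(c * ((e * t : ℝ) : ℂ))) * e * y' t * hc
    have := is_const_of_deriv_eq_zero (fun t => (hd t).differentiableAt)
      (fun t => (hd t).deriv) t 0
    simpa using this
  have k1 := key I Complex.I_sq
  have k2 := key (-I) (by simp)
  rw [← k1, show e * y 0 + I * y' 0 = e * y 0 - -I * y' 0 by ring, ← k2,
    ← mul_assoc, ← mul_assoc, ← Complex.exp_add, ← Complex.exp_add]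
  simp only [neg_mul, neg_neg, add_neg_cancel, neg_add_cancel, Complex.exp_zero]
  ring

theorem fourier_kleinGordon {ψ : Spacetime → ℂ} (hψ : RapidFn ψ)
    (hb : ∀ x, box ψ x = -(m : ℂ) ^ 2 * ψ x) (t : ℝ) (w : Mom) :
    𝓕 (((hψ.partialX 0).partialX 0).slice t) w =
      -(energy m ((2 * Real.pi) • w) : ℂ) ^ 2 * 𝓕 (hψ.slice t) w := by
  have h1 : ((hψ.partialX 0).partialX 0).slice t = ((hψ.partialX 1).partialX 1).slice t +
      ((hψ.partialX 2).partialX 2).slice t + ((hψ.partialX 3).partialX 3).slice t +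
      (-(m : ℂ) ^ 2) • hψ.slice t := by
    ext ξ
    have := hb (t • basisVec 0 + space ξ)
    simp only [box, Pi.sub_apply] at this
    simp only [add_apply, smul_apply, RapidFn.slice_apply, smul_eq_mul]
    linear_combination this
  have h2 : ∀ j : Fin 3, 𝓕 (((hψ.partialX j.succ).partialX j.succ).slice t) w =
      -(2 * Real.pi * w j) ^ 2 * 𝓕 (hψ.slice t) w := fun j => by
    rw [(hψ.partialX j.succ).fourier_partialX, hψ.fourier_partialX]
    linear_combination (2 * Real.pi * w j) ^ 2 * 𝓕 (hψ.slice t) w * Complex.I_sq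
  have e0 := h2 0
  have e1 := h2 1
  have e2 := h2 2
  simp only [Fin.succ_zero_eq_one, Fin.succ_one_eq_two, show (2 : Fin 3).succ = 3 from rfl]
    at e0 e1 e2
  rw [h1, FourierTransform.fourier_add, FourierTransform.fourier_add,
    FourierTransform.fourier_add, FourierTransform.fourier_smul]
  simp only [add_apply, smul_apply, smul_eq_mul]
  have he := congrArg Complex.ofReal (energy_sq m ((2 * Real.pi) • w))
  simp only [Complex.ofReal_pow, Fin.sum_univ_three, PiLp.smul_apply, smul_eq_mul] at he
  rw [e0, e1, e2, he]
  push_cast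
  ring

theorem integrable_schwartz (hm : 0 < m) (V : 𝓢(Mom, ℂ)) :
    Integrable (fun p => V (spatial p)) (massShell m) := by
  rw [integrable_massShell_iff hm]
  simp only [spatial_shellPt, Complex.real_smul]
  refine (V.integrable (μ := volume)).bdd_mul (c := (2 * m)⁻¹) ?_ ?_
  · exact (Complex.continuous_ofReal.comp <| Continuous.inv₀ ((continuous_energy hm).const_mul 2)
      fun k => (mul_pos two_pos (energy_pos hm k)).ne').aestronglyMeasurable
  · refine .of_forall fun k => ?_
    have := le_energy m k
    rw [Complex.norm_real, norm_inv, Real.norm_of_nonneg (by linarith)]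
    gcongr

/-- The Schwartz function `k ↦ (2π)⁻³ 𝓕 S (k / 2π)`. -/
def hat (S : 𝓢(Mom, ℂ)) : 𝓢(Mom, ℂ) :=
  (((2 * (Real.pi : ℂ)) ^ 3)⁻¹) • SchwartzMap.compCLMOfContinuousLinearEquiv ℂ
    (ContinuousLinearEquiv.smulLeft (R₁ := ℝ) (M₁ := Mom)
      (Units.mk0 (2 * Real.pi)⁻¹ (by positivity))) (𝓕 S)

theorem hat_apply (S : 𝓢(Mom, ℂ)) (k : Mom) :
    hat S k = ((2 * (Real.pi : ℂ)) ^ 3)⁻¹ * 𝓕 S ((2 * Real.pi)⁻¹ • k) := rfl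

theorem fourier_inversion (S : 𝓢(Mom, ℂ)) (ξ : Mom) :
    S ξ = ∫ k, exp (I * (inner ℝ k ξ : ℝ)) * hat S k := by
  have h1 : 𝓕⁻ (𝓕 S) = S := FourierTransform.fourierInv_fourier_eq S
  have h2 := congrArg (fun U : 𝓢(Mom, ℂ) => U ξ) h1
  simp only [SchwartzMap.fourierInv_coe, Real.fourierInv_eq'] at h2
  rw [← h2]
  have h3 := Measure.integral_comp_smul (volume : Measure Mom) (fun k =>
    exp (I * (inner ℝ k ξ : ℝ)) * hat S k) (2 * Real.pi)
  rw [finrank_euclideanSpace_fin, abs_of_nonneg (by positivity), eq_inv_smul_iff₀ (by positivity),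
    ← integral_smul] at h3
  rw [← h3]
  refine integral_congr_ae (.of_forall fun w => ?_)
  have hpi : (2 * (Real.pi : ℂ)) ≠ 0 := by simp [Real.pi_ne_zero]
  simp only [hat_apply, smul_smul, inv_mul_cancel₀ (show (2 * Real.pi : ℝ) ≠ 0 by positivity),
    one_smul, real_inner_smul_left, Complex.real_smul, smul_eq_mul]
  push_cast
  field_simp

/-- The Schwartz function `k ↦ conj (V (-k))`. -/
def conjNeg (V : 𝓢(Mom, ℂ)) : 𝓢(Mom, ℂ) :=
  SchwartzMap.postcompCLM (Complex.conjCLE : ℂ →L[ℝ] ℂ)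
    (SchwartzMap.compCLMOfContinuousLinearEquiv ℝ (ContinuousLinearEquiv.neg ℝ) V)

theorem conjNeg_apply (V : 𝓢(Mom, ℂ)) (k : Mom) : conjNeg V k = conj (V (-k)) := rfl

theorem exists_posFn (hm : 0 < m) {ψ : Spacetime → ℂ} (hψ : RapidFn ψ)
    (hb : ∀ x, box ψ x = -(m : ℂ) ^ 2 * ψ x) : ∃ A B : 𝓢(Mom, ℂ), ∀ x,
      ψ x = posFn m (fun p => A (spatial p)) x + conj (posFn m (fun p => B (spatial p)) x) := by
  set S₀ := hat (hψ.slice 0)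
  set S₁ := hat ((hψ.partialX 0).slice 0)
  let A := mulP m 0 S₀ - I • S₁
  let B := mulP m 0 S₀ + I • S₁
  have hA : ∀ k, A k = energy m k * S₀ k - I * S₁ k := fun k => by
    simp [A, mulP_apply hm, shellPt]
  have hB : ∀ k, B k = energy m k * S₀ k + I * S₁ k := fun k => by
    simp [B, mulP_apply hm, shellPt]
  have hs : ∀ t k, 2 * energy m k * hat (hψ.slice t) k =
      exp (I * (energy m k * t : ℝ)) * A k +
        exp (-(I * (energy m k * t : ℝ))) * B k := fun t k => by
    have := frequency_split (e := energy m k)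
      (fun t => hψ.hasDerivAt_fourier ((2 * Real.pi)⁻¹ • k) t) (fun t => by
        have h1 := (hψ.partialX 0).hasDerivAt_fourier ((2 * Real.pi)⁻¹ • k) t
        rwa [fourier_kleinGordon hψ hb, smul_smul, mul_inv_cancel₀ (by positivity),
          one_smul] at h1) t
    rw [hA, hB]
    simp only [S₀, S₁, hat_apply]
    linear_combination ((2 * (Real.pi : ℂ)) ^ 3)⁻¹ * this
  have hi : ∀ (V : 𝓢(Mom, ℂ)), Integrable fun k => ((2 * energy m k)⁻¹ : ℝ) * V k := fun V => by
    have := (integrable_massShell_iff hm).1 (integrable_schwartz hm V)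
    simpa only [spatial_shellPt, Complex.real_smul] using this
  have hc := continuous_energy hm
  refine ⟨A, conjNeg B, fun x => ?_⟩
  rw [posFn_eq hm, conj_posFn_eq hm, ← integral_add]
  · conv_lhs => rw [eq_time_space x, ← hψ.slice_apply, fourier_inversion]
    refine integral_congr_ae (.of_forall fun k => ?_)
    have he : (energy m k : ℂ) ≠ 0 := Complex.ofReal_ne_zero.2 (energy_pos hm k).ne'
    have := hs (x 0) k
    simp only [spatial_shellPt, conjNeg_apply, neg_neg, Complex.conj_conj]
    rw [← mul_add]
    congr 1
    generalize exp (I * (energy m k * x 0 : ℝ)) = E at this ⊢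
    generalize exp (-(I * (energy m k * x 0 : ℝ))) = E' at this ⊢
    push_cast
    field_simp
    linear_combination this
  · simp only [spatial_shellPt]
    refine ((hi A).bdd_mul (c := 1) (Continuous.aestronglyMeasurable (by fun_prop))
      (.of_forall fun k => (norm_expI _).le)).bdd_mul (c := 1)
      (Continuous.aestronglyMeasurable (by fun_prop)) (.of_forall fun k => (norm_expI _).le)
  · simp only [spatial_shellPt, conjNeg_apply, neg_neg, Complex.conj_conj]
    refine ((hi B).bdd_mul (c := 1) (Continuous.aestronglyMeasurable (by fun_prop))
      (.of_forall fun k => (norm_exp_neg_I _).le)).bdd_mul (c := 1)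
      (Continuous.aestronglyMeasurable (by fun_prop)) (.of_forall fun k => (norm_expI _).le)

end SuperPoincare

namespace SuperPoincare
open Complex (I exp)
open MeasureTheory
open scoped SchwartzMap

/-! ### Surjectivity of the super Fourier transform -/

variable {m : ℝ}

theorem box_singleton {f : Superfield} (hf : f ∈ solutions m) (b : Fin 2) (x : Spacetime) :
    box (fun y => f y ({b}, ∅)) x = -(m : ℂ) ^ 2 * f x ({b}, ∅) := by
  obtain ⟨hc, -, h1, -⟩ := mem_solutions_iff.1 hf
  have hs' : ∀ c a b, ContDiff ℝ ∞ (dslash a b fun y => f y ({c}, ∅)) := fun c a b =>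
    contDiff_dslash (hc.smooth.component _) a b
  have hmul : ∀ b, (fun y => (m : ℂ) * conj (f y ({b}, ∅))) = fun y =>
      dslash 0 b (fun y => f y ({1}, ∅)) y + -1 * dslash 1 b (fun y => f y ({0}, ∅)) y := fun b =>
    funext fun y => by rw [h1]; ring
  have hd : ∀ a b c, (m : ℂ) * conj (dslash c a (fun y => f y ({b}, ∅)) x) =
      dslash a c (dslash 0 b fun y => f y ({1}, ∅)) x -
        dslash a c (dslash 1 b fun y => f y ({0}, ∅)) x := fun a b c => by
    have := congrArg (fun φ => dslash a c φ x) (hmul b)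
    have hs : ContDiff ℝ ∞ fun y => conj (f y ({b}, ∅)) :=
      Complex.conjCLE.contDiff.comp (hc.smooth.component _)
    rw [dslash_const_mul hs,
      dslash_add (hs' _ _ _) (contDiff_const.mul (hs' _ _ _)),
      dslash_const_mul (hs' _ _ _), dslash_conj] at this
    rw [this]; ring
  have hsq : ∀ b, (m : ℂ) ^ 2 * f x ({b}, ∅) =
      m * conj (dslash 0 b (fun y => f y ({1}, ∅)) x) -
        m * conj (dslash 1 b (fun y => f y ({0}, ∅)) x) := fun b => by
    have := congrArg (fun z => (m : ℂ) * conj z) (h1 x b)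
    simp only [map_mul, Complex.conj_conj, Complex.conj_ofReal, map_sub] at this
    linear_combination this
  have hcomm := fun c a b a' b' => dslash_comm (hc.smooth.component ({c}, ∅)) a b a' b' x
  fin_cases b
  · have := hsq 0
    rw [hd, hd] at this
    simp only [Fin.zero_eta]
    rw [box_eq_dslash (hc.smooth.component _)]
    linear_combination this + hcomm 1 0 0 0 1 + hcomm 0 0 1 1 0
  · have := hsq 1
    rw [hd, hd] at this
    simp only [Fin.mk_one]
    rw [box_eq_dslash (hc.smooth.component _)]
    linear_combination this + hcomm 1 0 0 1 1 + hcomm 0 1 1 1 0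

namespace PreInduced

variable {H : Type*} [NormedAddCommGroup H] [InnerProductSpace ℂ H]
  {ρ : Poincare →* (H ≃ₗᵢ[ℂ] H)} {Φ : H →ₗ[ℂ] AEEqFun Covector Fock (massShell m)}
  (h : PreInduced m ρ Φ) (hm : 0 < m)
include h hm

theorem exists_fourierField (V : Finset (Fin 2) → 𝓢(Mom, ℂ)) : ∃ Ψ ∈ smoothVectors ρ,
    (∀ x, fourierField Φ Ψ x ∅ = posFn m (fun p => V Finset.univ (spatial p)) x) ∧
    (∀ x b, fourierField Φ Ψ x {b} = -Complex.I * posFn m (fun p => V {b} (spatial p)) x) ∧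
    ∀ x, fourierField Φ Ψ x Finset.univ = posFn m (fun p => V ∅ (spatial p)) x := by
  obtain ⟨Ψ, hΨ, he⟩ := h.exists_schwartz_vec hm V
  have key : ∀ x I, moment Φ 0 x Ψ I = posFn m (fun p => V I (spatial p)) x := fun x I => by
    rw [h.moment_apply hm hΨ]
    refine integral_congr_ae ?_
    filter_upwards [he] with p hp
    rw [hp]
  exact ⟨Ψ, hΨ, fun x => by rw [fourierField, hodge_empty, key],
    fun x b => by rw [fourierField, hodge_singleton, key],
    fun x => by rw [fourierField, hodge_univ, key]⟩

theorem exists_superFourier_eq {f : Superfield} (hf : f ∈ solutions m)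
    (hr : RapidlyDecreasing f) : ∃ Ψ ∈ smoothVectors ρ, superFourier Φ Ψ = f := by
  have hmc : (m : ℂ) ≠ 0 := Complex.ofReal_ne_zero.2 hm.ne'
  have hrf : RapidFn f := ⟨hf.1, hr⟩
  obtain ⟨hc, hu, hd, hb⟩ := mem_solutions_iff.1 hf
  obtain ⟨A, B, hAB⟩ := exists_posFn hm (hrf.apply (∅, ∅)) fun x => by
    have := hb x
    rw [hu] at this
    simp only [map_mul, Complex.conj_conj, Complex.conj_ofReal, map_ofNat] at this
    linear_combination this / 2
  choose A' B' hAB' using fun b : Fin 2 =>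
    exists_posFn hm (hrf.apply ({b}, ∅)) (box_singleton hf b)
  let comp (V W : 𝓢(Mom, ℂ)) (U : Fin 2 → 𝓢(Mom, ℂ)) (I : Finset (Fin 2)) : 𝓢(Mom, ℂ) :=
    if I = ∅ then V else if I = Finset.univ then W else if I = {0} then U 0 else U 1
  have hcomp : ∀ V W U, comp V W U ∅ = V ∧ comp V W U Finset.univ = W ∧
      ∀ b, comp V W U {b} = U b := fun V W U =>
    ⟨if_pos rfl, by simp [comp, univ_ne_empty'], fun b => by
      fin_cases b <;> simp [comp, univ_ne_zero'.symm, univ_ne_one'.symm]⟩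
  have hposc : ∀ (c : ℂ) (V : 𝓢(Mom, ℂ)) x, posFn m (fun p => (c • V) (spatial p)) x =
      c * posFn m (fun p => V (spatial p)) x := fun c V x => by
    rw [posFn, posFn, ← integral_const_mul]
    exact integral_congr_ae (.of_forall fun p => by simp only [smul_apply, smul_eq_mul]; ring)
  obtain ⟨Ψ, hΨ, p0, p1, p2⟩ := h.exists_fourierField hm
    (comp ((2 * m : ℂ) • B) A fun b => Complex.I • A' b)
  obtain ⟨Ω, hΩ, -, q1, -⟩ := h.exists_fourierField hm (comp 0 0 fun b => Complex.I • B' b)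
  have hneg : ∀ z : ℂ, -Complex.I * (Complex.I * z) = z := fun z => by
    linear_combination -z * Complex.I_sq
  simp only [(hcomp _ _ _).1, (hcomp _ _ _).2.1, (hcomp _ _ _).2.2, hposc, hneg] at p0 p1 p2 q1
  have hF : ∀ x b, f x ({b}, ∅) = fourierField Φ Ψ x {b} + conj (fourierField Φ Ω x {b}) :=
    fun x b => by rw [p1, q1]; exact hAB' b x
  have sP := fun b => contDiff_pi.1 (h.contDiff_fourierField hm hΨ) {b}
  have sN := fun b => contDiff_pi.1 (h.contDiff_fourierField hm hΩ) {b}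
  have hdf : ∀ a b c x, dslash a b (fun y => f y ({c}, ∅)) x =
      dslash a b (fun y => fourierField Φ Ψ y {c}) x +
        conj (dslash b a (fun y => fourierField Φ Ω y {c}) x) := fun a b c x => by
    have hs : ContDiff ℝ ∞ fun y => conj (fourierField Φ Ω y {c}) :=
      Complex.conjCLE.contDiff.comp (sN c)
    rw [← dslash_conj, ← dslash_add (sP c) hs]
    simp only [hF]
  have hN : ∀ b x, fourierField Φ Ω x {b} = (m : ℂ)⁻¹ *
      (dslash 0 b (fun y => fourierField Φ Ψ y {1}) x -
        dslash 1 b (fun y => fourierField Φ Ψ y {0}) x) := fun b x => by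
    have := (IsPosFn.eq_zero hm (((h.isPosFn_fourierField hm hΩ {b}).const_mul m).sub
      ((h.dslash_fourierField hm hΨ 0 b {1}).sub (h.dslash_fourierField hm hΨ 1 b {0})))
      (((h.isPosFn_fourierField hm hΨ {b}).const_mul m).sub
      ((h.dslash_fourierField hm hΩ b 0 {1}).sub (h.dslash_fourierField hm hΩ b 1 {0})))
      fun x => by
        have := hd x b
        rw [hF, hdf, hdf] at this
        simp only [map_add, map_sub, map_mul, Complex.conj_conj, Complex.conj_ofReal] at this ⊢
        linear_combination this).1 x
    rw [← sub_eq_zero.1 this, inv_mul_cancel_left₀ hmc]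
  have hl := fun x I => chiralLift_empty (fourierField Φ Ψ) x I
  have hch := h.isChiral_fourier hm hΨ
  refine ⟨Ψ, hΨ, solutions_ext (h.superFourier_mem hm hΨ).1 hf (fun x => ?_) fun x b => ?_⟩
  · rw [superFourier, hch.realify_empty, hl, hl, p0, p2, hAB]
    simp only [map_mul, Complex.conj_ofReal, map_ofNat]
    field_simp
  · rw [superFourier, hch.realify_singleton, hF, hN]
    simp only [hl, map_mul, map_inv₀, Complex.conj_ofReal]

end PreInduced

end SuperPoincare

namespace SuperPoincare
open Complex (I exp)
open MeasureTheory

/-! ### Irreducibility -/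

variable {m : ℝ}

theorem eq_top_of_ext_contr {N : Submodule ℂ Fock} (he : ∀ a, ∀ v ∈ N, ext a v ∈ N)
    (hc : ∀ a, ∀ v ∈ N, contr a v ∈ N) {w : Fock} (hw : w ∈ N) (h0 : w ≠ 0) : N = ⊤ := by
  have hu0 : (Finset.univ : Finset (Fin 2)) = {0, 1} := by decide
  have vac : (Pi.single ∅ 1 : Fock) ∈ N := by
    have scale : ∀ c : ℂ, c ≠ 0 → (c • Pi.single ∅ 1 : Fock) ∈ N → (Pi.single ∅ 1 : Fock) ∈ N :=
      fun c hc h => (N.smul_mem_iff hc).1 h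
    by_cases h1 : w Finset.univ = 0
    · by_cases h2 : w {0} = 0
      · by_cases h3 : w {1} = 0
        · refine scale (w ∅) (fun h4 => h0 (clifford_ext_aux h4 h2 h3 h1)) ?_
          convert! hw using 1
          apply clifford_ext_aux <;> simp [h1, h2, h3, univ_ne_empty']
        · refine scale (w {1}) h3 ?_
          convert! hc 1 w hw using 1
          rw [hu0, Finset.pair_comm] at h1
          apply clifford_ext_aux <;> simp +decide [contr, koszul, h1]
      · refine scale (w {0}) h2 ?_
        convert! hc 0 w hw using 1
        rw [hu0] at h1
        apply clifford_ext_aux <;> simp +decide [contr, koszul, h1]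
    · refine scale (w Finset.univ) h1 ?_
      convert! hc 1 _ (hc 0 w hw) using 1
      rw [hu0]
      apply clifford_ext_aux <;> simp +decide [contr, koszul]
  have one : ∀ a, (Pi.single {a} 1 : Fock) ∈ N := fun a => by
    convert! he a _ vac using 1
    fin_cases a <;> apply clifford_ext_aux <;> simp +decide [ext, koszul, hu0, Finset.filter_singleton]
  have two : (Pi.single Finset.univ 1 : Fock) ∈ N := by
    convert! he 0 _ (one 1) using 1
    apply clifford_ext_aux <;> simp +decide [ext, koszul, hu0]
  refine (Submodule.eq_top_iff').2 fun v => ?_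
  have : v = v ∅ • Pi.single ∅ 1 + v {0} • Pi.single {0} 1 + v {1} • Pi.single {1} 1 +
      v Finset.univ • Pi.single Finset.univ 1 := by
    apply clifford_ext_aux <;> simp +decide [hu0]
  rw [this]
  exact N.add_mem (N.add_mem (N.add_mem (N.smul_mem _ vac) (N.smul_mem _ (one 0)))
    (N.smul_mem _ (one 1))) (N.smul_mem _ two)

/-- A real basis of the spinors. -/
def realSpinor (i : Fin 2 × Bool) : Spinor := Pi.single i.1 (if i.2 then I else 1)

theorem eq_top_of_clifford (hm : 0 < m) {p : Covector} (hp : OnShell m p) {N : Submodule ℂ Fock}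
    (hN : ∀ i, ∀ v ∈ N, clifford p (realSpinor i) v ∈ N) {w : Fock} (hw : w ∈ N) (h0 : w ≠ 0) :
    N = ⊤ := by
  have h1 : ∀ a v, clifford p (realSpinor (a, false)) v = Complex.I • ext a v +
      (2 : ℂ) • (slashUp p 0 a • contr 0 v + slashUp p 1 a • contr 1 v) := fun a v => by
    rw [clifford_eq]
    fin_cases a <;> simp [realSpinor, slashConj]
  have h2 : ∀ a v, clifford p (realSpinor (a, true)) v = -ext a v -
      (2 * Complex.I) • (slashUp p 0 a • contr 0 v + slashUp p 1 a • contr 1 v) := fun a v => by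
    rw [clifford_eq]
    fin_cases a <;> funext I <;> simp [realSpinor, slashConj] <;>
      ring_nf <;> simp only [Complex.I_sq] <;> ring
  have he : ∀ a, ∀ v ∈ N, ext a v ∈ N := fun a v hv => by
    have : ext a v = (-Complex.I / 2) • clifford p (realSpinor (a, false)) v -
        (1 / 2 : ℂ) • clifford p (realSpinor (a, true)) v := by
      rw [h1, h2]
      funext I
      simp only [Pi.smul_apply, Pi.add_apply, Pi.sub_apply, Pi.neg_apply, smul_eq_mul]
      linear_combination ext a v I / 2 * Complex.I_sq
    rw [this]
    exact N.sub_mem (N.smul_mem _ (hN _ v hv)) (N.smul_mem _ (hN _ v hv))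
  have hk : ∀ a, ∀ v ∈ N, slashUp p 0 a • contr 0 v + slashUp p 1 a • contr 1 v ∈ N :=
    fun a v hv => by
      refine (N.smul_mem_iff (two_ne_zero (α := ℂ))).1 ?_
      rw [← add_sub_cancel_left (Complex.I • ext a v) ((2 : ℂ) • _), ← h1]
      exact N.sub_mem (hN _ v hv) (N.smul_mem _ (he a v hv))
  have hd := det_slashUp p
  have hne : ((p 0 ^ 2 - p 1 ^ 2 - p 2 ^ 2 - p 3 ^ 2 : ℝ) : ℂ) ≠ 0 := by
    rw [hp.sq, Complex.ofReal_ne_zero]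
    ring_nf
    positivity
  refine eq_top_of_ext_contr he (fun c v hv => ?_) hw h0
  have h0 := hk 0 v hv
  have h1 := hk 1 v hv
  refine (N.smul_mem_iff hne).1 ?_
  rw [← hd]
  fin_cases c
  · convert! N.sub_mem (N.smul_mem (slashUp p 1 1) h0) (N.smul_mem (slashUp p 1 0) h1) using 1
    simp only [Fin.zero_eta]
    module
  · convert! N.sub_mem (N.smul_mem (slashUp p 0 0) h1) (N.smul_mem (slashUp p 0 1) h0) using 1
    simp only [Fin.mk_one]
    module

theorem null_or_null_of_translates {A B : Set LightCone} (hA : MeasurableSet A)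
    (hB : MeasurableSet B) (h : ∀ t c, ∀ᵐ y : LightCone,
      y ∉ A ∨ (y.1 + t, y.2 + Real.exp y.1 • c) ∉ B) :
    (∀ᵐ y, y ∉ A) ∨ ∀ᵐ y, y ∉ B := by
  have hF : Measurable fun z : LightCone × LightCone =>
      (⟨z.2.1 + z.1.1, z.2.2 + Real.exp z.2.1 • z.1.2⟩ : LightCone) := by fun_prop
  have h1 : ∀ᵐ y : LightCone, ∀ᵐ τ : LightCone,
      y ∉ A ∨ (y.1 + τ.1, y.2 + Real.exp y.1 • τ.2) ∉ B := by
    refine (Measure.ae_ae_comm ?_).1 (.of_forall fun τ : LightCone => h τ.1 τ.2)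
    exact (measurable_snd hA).compl.union (hF hB).compl
  by_cases hn : ∀ᵐ y, y ∉ A
  · exact .inl hn
  refine .inr ?_
  obtain ⟨y, hy, hy'⟩ := ((Filter.not_eventually.1 hn).and_eventually h1).exists
  have h2 : ∀ᵐ τ : LightCone, (y.1 + τ.1, y.2 + Real.exp y.1 • τ.2) ∉ B :=
    hy'.mono fun τ hτ => hτ.resolve_left hy
  have q2 : Measure.QuasiMeasurePreserving
      (fun z : Fin 2 → ℝ => (Real.exp y.1)⁻¹ • (z - y.2)) :=
    (Measure.quasiMeasurePreserving_smul volume (inv_ne_zero (Real.exp_pos y.1).ne')).comp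
      (measurePreserving_sub_right volume y.2).quasiMeasurePreserving
  have q : Measure.QuasiMeasurePreserving (fun z : LightCone =>
      (⟨z.1 - y.1, (Real.exp y.1)⁻¹ • (z.2 - y.2)⟩ : LightCone)) := by
    have q1 := (measurePreserving_sub_right volume y.1).quasiMeasurePreserving
    refine ⟨by fun_prop, ?_⟩
    have := Measure.map_prod_map (volume : Measure ℝ) (volume : Measure (Fin 2 → ℝ))
      q1.measurable q2.measurable
    exact this.symm.absolutelyContinuous.trans (q1.absolutelyContinuous.prod q2.absolutelyContinuous)
  filter_upwards [q.ae h2] with z hz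
  simpa [smul_smul, (Real.exp_pos y.1).ne'] using hz

namespace PreInduced

variable {H : Type*} [NormedAddCommGroup H] [InnerProductSpace ℂ H]
  {ρ : Poincare →* (H ≃ₗᵢ[ℂ] H)} {Φ : H →ₗ[ℂ] AEEqFun Covector Fock (massShell m)}
  (h : PreInduced m ρ Φ) (hm : 0 < m)
include h hm

theorem ae_inner_eq_zero {K : Submodule ℂ H} (hK : ∀ g, ∀ Ψ ∈ K, ρ g Ψ ∈ K) {Ψ Ω : H}
    (hΨ : Ψ ∈ K) (hΩ : Ω ∈ Kᗮ) :
    ∀ᵐ p ∂(massShell m), fibreInner m p (Φ Ψ p) (Φ Ω p) = 0 := by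
  have := (ae_eq_zero_of_posFn_add_conj hm (h.integrable_inner hm Ψ Ω)
    (integrable_zero Covector ℂ (massShell m)) fun x => by
      have h1 := (K.mem_orthogonal Ω).1 hΩ _ (hK ⟨x, 1⟩ Ψ hΨ)
      rw [h.inner_eq hm] at h1
      rw [show posFn m 0 x = 0 by simp [posFn], map_zero, add_zero, ← h1, posFn]
      refine integral_congr_ae ?_
      filter_upwards [h.ae_translate x Ψ] with p hp
      rw [hp, triv_smul, inner_smul_left, ← Complex.exp_conj]
      simp).1
  filter_upwards [this, ae_onShell hm] with p h1 h2
  rw [← inner_triv hm h2, h1]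

theorem ae_eq_zero_or (hΦ : ∀ g Ψ, ∀ᵐ p ∂(massShell m), Φ (ρ g Ψ) p = 0 →
    Φ Ψ (pullback g.lin p) = 0) {Ψ Ω : H}
    (hd : ∀ g, ∀ᵐ p ∂(massShell m), Φ Ψ p = 0 ∨ Φ (ρ g Ω) p = 0) : Ψ = 0 ∨ Ω = 0 := by
  have hmeas : ∀ Ψ, MeasurableSet {y : LightCone | Φ Ψ (lightCone m y) ≠ 0} := fun Ψ =>
    (((Φ Ψ).stronglyMeasurable.measurable.comp continuous_lightCone.measurable)
      (measurableSet_singleton 0)).compl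
  have key := null_or_null_of_translates (hmeas Ψ) (hmeas Ω) fun t c => by
    have := (hd ⟨0, borel t c⟩).and (hΦ ⟨0, borel t c⟩ Ω)
    rw [ae_massShell_iff_lightCone hm] at this
    filter_upwards [this] with y hy
    rw [pullback_borel hm] at hy
    simpa using hy.1.imp_right hy.2
  have hz : ∀ Ψ, (∀ᵐ y : LightCone, y ∉ {y : LightCone | Φ Ψ (lightCone m y) ≠ 0}) → Ψ = 0 :=
    fun Ψ hΨ => h.eq_of_ae (by
      have h1 : ∀ᵐ p ∂(massShell m), Φ Ψ p = 0 := by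
        rw [ae_massShell_iff_lightCone hm]
        exact hΨ.mono fun y hy => by simpa using hy
      filter_upwards [h1, coe_zero Φ] with p h1 h2
      rw [h1, h2])
  exact key.imp (hz Ψ) (hz Ω)

end PreInduced

theorem starProjection_comm {H : Type*} [NormedAddCommGroup H] [InnerProductSpace ℂ H]
    {ρ : Poincare →* (H ≃ₗᵢ[ℂ] H)} {K : Submodule ℂ H} [K.HasOrthogonalProjection]
    (hK : ∀ g, ∀ Ψ ∈ K, ρ g Ψ ∈ K) (g : Poincare) (Ψ : H) :
    K.starProjection (ρ g Ψ) = ρ g (K.starProjection Ψ) := by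
  refine Submodule.eq_starProjection_of_mem_of_inner_eq_zero
    (hK g _ (K.starProjection_apply_mem Ψ)) fun w hw => ?_
  rw [← map_sub, ← (ρ g⁻¹).inner_map_map, ← Function.comp_apply (f := ρ g⁻¹),
    ← LinearIsometryEquiv.coe_mul, ← map_mul, inv_mul_cancel, map_one]
  exact K.starProjection_inner_eq_zero Ψ _ (hK _ w hw)

theorem starProjection_mem_smoothVectors {H : Type*} [NormedAddCommGroup H]
    [InnerProductSpace ℂ H] {ρ : Poincare →* (H ≃ₗᵢ[ℂ] H)} {K : Submodule ℂ H}
    [K.HasOrthogonalProjection] (hK : ∀ g, ∀ Ψ ∈ K, ρ g Ψ ∈ K) {Ψ : H}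
    (hΨ : Ψ ∈ smoothVectors ρ) : K.starProjection Ψ ∈ smoothVectors ρ := by
  have hs : ContDiff ℝ ∞ fun y : Spacetime × (Fin 3 → ℂ) => ρ ⟨y.1, slChart y.2⟩ Ψ := hΨ
  have := (K.starProjection.restrictScalars ℝ).contDiff.comp hs
  simp only [Function.comp_def, ContinuousLinearMap.coe_restrictScalars',
    starProjection_comm hK] at this
  exact this

namespace IsInduced

variable {H : Type*} [NormedAddCommGroup H] [InnerProductSpace ℂ H] {R : SuperUnitaryRep H}
  {Φ : H →ₗ[ℂ] AEEqFun Covector Fock (massShell m)} (h : IsInduced m R Φ) (hm : 0 < m)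
include h

theorem ae_charge (s : Spinor) (Ψ : smoothVectors R.ρ) : ∀ᵐ p ∂(massShell m),
    Φ (exp (I * (Real.pi / 4 : ℝ)) • (R.charge s Ψ : H)) p =
      clifford p s (Φ Ψ p) := by
  filter_upwards [h.charge s Ψ, PreInduced.coe_smul Φ
    (exp (I * (Real.pi / 4 : ℝ))) (R.charge s Ψ : H)] with p h1 h2
  rw [h2, h1]

theorem exists_clifford_word {K : Submodule ℂ H}
    (hK : ∀ s, ∀ Ψ : smoothVectors R.ρ, (Ψ : H) ∈ K → (R.charge s Ψ : H) ∈ K)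
    {Ψ : smoothVectors R.ρ} (hΨ : (Ψ : H) ∈ K) (l : List (Fin 2 × Bool)) :
    ∃ Ω : smoothVectors R.ρ, (Ω : H) ∈ K ∧ ∀ᵐ p ∂(massShell m),
      Φ Ω p = l.foldr (fun i v => clifford p (realSpinor i) v) (Φ Ψ p) := by
  induction l with
  | nil => exact ⟨Ψ, hΨ, .of_forall fun p => rfl⟩
  | cons i l ih =>
    obtain ⟨Ω, hΩ, he⟩ := ih
    refine ⟨exp (I * (Real.pi / 4 : ℝ)) • R.charge (realSpinor i) Ω,
      K.smul_mem _ (hK _ Ω hΩ), ?_⟩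
    filter_upwards [h.ae_charge (realSpinor i) Ω, he] with p h1 h2
    rw [List.foldr_cons, ← h2, ← h1]
    rfl

include hm

theorem ae_eq_zero_or_of_mem_orthogonal {K : Submodule ℂ H} (hρ : ∀ g, ∀ Ψ ∈ K, R.ρ g Ψ ∈ K)
    (hK : ∀ s, ∀ Ψ : smoothVectors R.ρ, (Ψ : H) ∈ K → (R.charge s Ψ : H) ∈ K)
    {Ψ : smoothVectors R.ρ} (hΨ : (Ψ : H) ∈ K) {Ω : H} (hΩ : Ω ∈ Kᗮ) :
    ∀ᵐ p ∂(massShell m), Φ (Ψ : H) p = 0 ∨ Φ Ω p = 0 := by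
  have hw : ∀ᵐ p ∂(massShell m), ∀ l : List (Fin 2 × Bool), fibreInner m p
      (l.foldr (fun i v => clifford p (realSpinor i) v) (Φ (Ψ : H) p)) (Φ Ω p) = 0 :=
    ae_all_iff.2 fun l => by
      obtain ⟨Θ, hΘ, he⟩ := h.exists_clifford_word hK hΨ l
      filter_upwards [he, h.preInduced.ae_inner_eq_zero hm hρ hΘ hΩ] with p h1 h2
      rw [← h1, h2]
  filter_upwards [hw, ae_onShell hm] with p hp hs
  by_cases h0 : Φ (Ψ : H) p = 0
  · exact .inl h0
  refine .inr ?_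
  simp only [← inner_triv hm hs] at hp
  let N : Submodule ℂ Fock := Submodule.span ℂ (Set.range fun l : List (Fin 2 × Bool) =>
    l.foldr (fun i v => clifford p (realSpinor i) v) (Φ (Ψ : H) p))
  have hN : N = ⊤ := by
    refine eq_top_of_clifford hm hs (N := N) (fun i v hv => ?_)
      (Submodule.subset_span ⟨[], rfl⟩) h0
    have : N ≤ N.comap (cliffordL p (realSpinor i)) := by
      refine Submodule.span_le.2 ?_
      rintro _ ⟨l, rfl⟩
      exact Submodule.subset_span ⟨i :: l, rfl⟩
    exact this hv
  have key : ∀ v ∈ N, (inner ℂ (triv m p v) (triv m p (Φ Ω p)) : ℂ) = 0 := fun v hv => by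
    induction hv using Submodule.span_induction with
    | mem v hv => obtain ⟨l, rfl⟩ := hv; exact hp l
    | zero => rw [← zero_smul ℂ (0 : Fock), triv_smul, zero_smul, inner_zero_left]
    | add v w _ _ h1 h2 => rw [triv_add, inner_add_left, h1, h2, add_zero]
    | smul c v _ h1 => rw [triv_smul, inner_smul_left, h1, mul_zero]
  have := inner_self_eq_zero.1 (key (Φ Ω p) (hN ▸ Submodule.mem_top))
  rw [← trivInv_triv hm p (Φ Ω p), this, ← triv_trivInv hm p 0, trivInv_triv hm,
    ← zero_smul ℂ (0 : FibreE), trivInv_smul hm, zero_smul]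

theorem isIrreducible [CompleteSpace H] : R.IsIrreducible := by
  have hp := h.preInduced
  constructor
  · obtain ⟨V, hV⟩ : ∃ V : SchwartzMap Mom ℂ, V ≠ 0 := by
      by_contra! hV
      obtain ⟨k, hk⟩ := (ae_eq_zero_of_schwartz (g := fun _ => 1) (fun V => by simp [hV V])
        fun V => by simp [hV V]).exists
      exact one_ne_zero hk
    obtain ⟨Ψ, -, he⟩ := hp.exists_schwartz_vec hm fun _ => V
    refine ⟨Ψ, 0, fun h0 => hV ?_⟩
    have h1 : ∀ᵐ p ∂(massShell m), V (spatial p) = 0 := by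
      rw [h0] at he
      filter_upwards [he, PreInduced.coe_zero Φ] with p h1 h2
      rw [h2] at h1
      exact (congrFun h1 ∅).symm
    rw [ae_massShell_iff hm] at h1
    simp only [spatial_shellPt] at h1
    ext k
    exact congrFun (V.continuous.ae_eq_iff_eq volume continuous_const |>.1 h1) k
  · intro K hcl _ hρ hK
    have := hcl.completeSpace_coe
    by_cases hex : ∃ Ψ ∈ smoothVectors R.ρ, K.starProjection Ψ ≠ 0
    · obtain ⟨Ψ, hΨ, hne⟩ := hex
      refine .inr ((Submodule.orthogonal_eq_bot_iff).1 ((Submodule.eq_bot_iff _).2 fun Ω hΩ => ?_))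
      have hΨ' := starProjection_mem_smoothVectors hρ hΨ
      refine (hp.ae_eq_zero_or hm (fun g Ω => ?_) fun g => ?_).resolve_left hne
      · filter_upwards [h.poincare g Ω] with p h1 h2
        rw [h1] at h2
        have h3 := (smul_eq_zero.1 h2).resolve_left (Complex.exp_ne_zero _)
        rw [← spinFock_one (Φ Ω _), ← inv_mul_cancel g.lin, spinFock_mul, h3]
        funext I
        simp [spinFock]
      · refine h.ae_eq_zero_or_of_mem_orthogonal hm hρ hK (Ψ := ⟨_, hΨ'⟩)
          (K.starProjection_apply_mem Ψ) ?_
        rw [Submodule.mem_orthogonal]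
        intro w hw
        rw [← (R.ρ g⁻¹).inner_map_map, ← Function.comp_apply (f := R.ρ g⁻¹) (x := Ω),
          ← LinearIsometryEquiv.coe_mul, ← map_mul, inv_mul_cancel, map_one]
        exact (K.mem_orthogonal Ω).1 hΩ _ (hρ _ w hw)
    · push Not at hex
      refine .inl ((Submodule.eq_bot_iff _).2 fun Ψ hΨ => ?_)
      rw [← Submodule.starProjection_eq_self_iff.2 hΨ]
      exact congrFun (Continuous.ext_on (hp.dense_smoothVectors hm) K.starProjection.continuous
        continuous_const hex) Ψ

/-- The super Fourier transform as a real-linear map on the smooth vectors. -/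
def superFourierMap : smoothVectors R.ρ →ₗ[ℝ] Superfield where
  toFun Ψ := PreInduced.superFourier Φ (Ψ : H)
  map_add' Ψ Ω := h.preInduced.superFourier_add hm Ψ.2 Ω.2
  map_smul' r Ψ := by
    have := h.preInduced.superFourier_smul hm Ψ.2 r
    simp only [Complex.coe_smul] at this
    exact this

end IsInduced

end SuperPoincare

end

theorem theorem8 (m : ℝ) (hm : 0 < m) :
    -- The solution space is a graded real subspace, invariant under the super Poincare group.
    ((0 : SuperPoincare.Superfield) ∈ SuperPoincare.solutions m ∧
      (∀ f ∈ SuperPoincare.solutions m, ∀ h ∈ SuperPoincare.solutions m,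
        f + h ∈ SuperPoincare.solutions m) ∧
      (∀ r : ℝ, ∀ f ∈ SuperPoincare.solutions m, r • f ∈ SuperPoincare.solutions m) ∧
      (∀ f ∈ SuperPoincare.solutions m, SuperPoincare.parityS f ∈ SuperPoincare.solutions m) ∧
      (∀ g, ∀ f ∈ SuperPoincare.solutions m,
        SuperPoincare.act g f ∈ SuperPoincare.solutions m) ∧
      (∀ s, ∀ f ∈ SuperPoincare.solutions m,
        SuperPoincare.superAct s f ∈ SuperPoincare.solutions m)) ∧
    -- In components it is the space of solutions of the Klein-Gordon and Dirac equations.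
    Set.BijOn SuperPoincare.components (SuperPoincare.solutions m)
      (SuperPoincare.componentSolutions m) ∧
    -- The unitary representation of mass `m` and superspin `0` exists.
    (∃ (H : Type) (_ : NormedAddCommGroup H) (_ : InnerProductSpace ℂ H) (_ : CompleteSpace H)
      (R : SuperPoincare.SuperUnitaryRep H)
      (Φ : H →ₗ[ℂ] MeasureTheory.AEEqFun SuperPoincare.Covector SuperPoincare.Fock
        (SuperPoincare.massShell m)),
      SuperPoincare.IsInduced m R Φ) ∧
    -- It is irreducible, and its smooth vectors are realized by the rapidly decreasing solutions.
    ∀ (H : Type*) [NormedAddCommGroup H] [InnerProductSpace ℂ H] [CompleteSpace H]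
      (R : SuperPoincare.SuperUnitaryRep H)
      (Φ : H →ₗ[ℂ] MeasureTheory.AEEqFun SuperPoincare.Covector SuperPoincare.Fock
        (SuperPoincare.massShell m)),
      SuperPoincare.IsInduced m R Φ →
      R.IsIrreducible ∧
      ∃ T : SuperPoincare.smoothVectors R.ρ →ₗ[ℝ] SuperPoincare.Superfield,
        Function.Injective T ∧
        Set.range T =
          {f | f ∈ SuperPoincare.solutions m ∧ SuperPoincare.RapidlyDecreasing f} ∧
        (∀ Ψ Ω : SuperPoincare.smoothVectors R.ρ, (Ω : H) = R.parity Ψ →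
          T Ω = SuperPoincare.parityS (T Ψ)) ∧
        (∀ (g : SuperPoincare.Poincare) (Ψ Ω : SuperPoincare.smoothVectors R.ρ),
          (Ω : H) = R.ρ g Ψ → T Ω = SuperPoincare.act g (T Ψ)) ∧
        (∀ (s : SuperPoincare.Spinor) (Ψ : SuperPoincare.smoothVectors R.ρ),
          T (Complex.exp (Complex.I * (Real.pi / 4 : ℝ)) • R.charge s Ψ) =
            SuperPoincare.superAct s (T Ψ)) ∧
        (∀ Ψ : SuperPoincare.smoothVectors R.ρ,
          SuperPoincare.IsFourierTransform m (Φ (Ψ : H)) (T Ψ)) := by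
  refine ⟨⟨SuperPoincare.solutions_zero m,
    fun _ hf _ hk => SuperPoincare.solutions_add hf hk,
    fun r _ hf => SuperPoincare.solutions_smul r hf,
    fun _ hf => SuperPoincare.solutions_parityS hf,
    fun g _ hf => SuperPoincare.solutions_act g hf,
    fun s _ hf => SuperPoincare.solutions_superAct s hf⟩,
    SuperPoincare.bijOn_components m, SuperPoincare.exists_isInduced hm,
    fun H _ _ _ R Φ h => ⟨h.isIrreducible hm, h.superFourierMap hm, ?_, ?_, ?_, ?_, ?_, ?_⟩⟩
  · refine (injective_iff_map_eq_zero _).2 fun Ψ hΨ => ?_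
    exact Subtype.ext (h.preInduced.eq_zero_of_superFourier_eq_zero hm Ψ.2 hΨ)
  · refine Set.Subset.antisymm ?_ ?_
    · rintro _ ⟨Ψ, rfl⟩
      exact h.preInduced.superFourier_mem hm Ψ.2
    · rintro f ⟨hf, hr⟩
      obtain ⟨Ψ, hΨ, rfl⟩ := h.preInduced.exists_superFourier_eq hm hf hr
      exact ⟨⟨Ψ, hΨ⟩, rfl⟩
  · intro Ψ Ω hΩ
    refine h.preInduced.superFourier_parity hm Ψ.2 Ω.2 ?_
    rw [hΩ]
    exact (h.parity Ψ).mono fun p hp => funext hp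
  · intro g Ψ Ω hΩ
    exact (congrArg _ hΩ).trans (h.preInduced.superFourier_rep hm Ψ.2 g)
  · intro s Ψ
    exact h.preInduced.superFourier_charge hm Ψ.2 (Subtype.prop _) s (h.ae_charge s Ψ)
  · intro Ψ
    exact h.preInduced.isFourierTransform_superFourier hm Ψ.2
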